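/- **Setting.** Fix a countably infinite set $\mathcal C$ of constants, which act as standard names (distinct constants denote distinct elements). A DL-Lite$_{\mathcal A}$ TBox $T$ is a finite set of assertions $B_1\sqsubseteq B_2$, $B_1\sqsubseteq\neg B_2$, $(\mathsf{funct}\,R)$, where $B::=N\mid\exists R$ and $R::=P\mid P^-$; an ABox $A$ is a finite set of facts $N(c)$, $P(c,c')$, and $\mathrm{adom}(A)$ is the set of constants occurring in it. EQL queries are $Q::=[q]\mid\neg Q\mid Q_1\wedge Q_2\mid\exists x.Q$, where $q$ is a union of conjunctive queries (UCQ) evaluated under certain answers over $(T,A)$ and $x$ ranges over $\mathrm{adom}(A)$. A knowledge and action base (KAB) $\mathcal K=(T,A_0,\Gamma,\Pi)$ consists of a TBox $T$, a $T$-consistent ABox $A_0$, a finite set $\Gamma$ of actions, each with parameters and finitely many effects $[q^+]\wedge Q^-\rightsquigarrow E$ ($q^+$ a UCQ, $Q^-$ an EQL query, $E$ a finite set of facts over constants, variables and service calls $f(\vec x)$), and a finite set $\Pi$ of rules $Q\mapsto\alpha$ with $\alpha\in\Gamma$ whose free variables are the parameters of $\alpha$. A finite set $\mathcal C_0\subset\mathcal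 C$ contains all constants that occur in $\mathcal K$. Under the standard semantics a state is a pair $(A,m)$ of an ABox and a partial map $m$ from service calls $f(\vec c)$ to $\mathcal C$; the initial state is $(A_0,\emptyset)$. If $\sigma$ is an answer over $(T,A)$ to the condition of a rule for $\alpha$, let $E_{\alpha\sigma}$ be the set of facts obtained by instantiating the effects of $\alpha\sigma$ with all answers to their queries over $(T,A)$; for each assignment $\theta$ of constants to the service calls in $E_{\alpha\sigma}$ that agrees with $m$, the pair $(A',m')=(E_{\alpha\sigma}\theta,\,m\cup\theta)$ results from executing $\alpha\sigma$ in $(A,m)$, and it is a successor of $(A,m)$ provided that $A'$ is $T$-consistent (otherwise it is rejected). This generates the transition system $\Upsilon_{\mathcal K}$. $\mathcal K$ is *run-bounded* if for some $b\in\mathbb N$ every (finite or infinite) run of $\Upsilon_{\mathcal K}$ from the initial state satisfies $|\bigcup_{s}\mathrm{adom}(\mathrm{abox}(s))|<b$, $s$ ranging over the states of the run. The logic $\mu\mathcal L_A^{\mathrm{EQL}}$ is $\Phi::=Q\mid\neg\Phi\mid\Phi_1\wedge\Phi_2\mid\exists x.\Phi\mid\langle-\rangle\Phi\mid Z\mid\mu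 Z.\Phi$, where $Q$ is an EQL query with constants in $\mathcal C_0$ answered in the current state, $\exists x$ ranges over the active domain of the current state, and $Z$ occurs only positively in $\Phi$ in $\mu Z.\Phi$ (least fixpoint). Given a state $(A,m)$ and $\alpha\sigma$ as above, an *equality commitment* is a partition of the set of the constants in $\mathcal C_0$, $\mathrm{adom}(A)$, $m$'s image and $E_{\alpha\sigma}$ together with the service calls in $m$'s domain and in $E_{\alpha\sigma}$, such that each cell contains at most one constant and each call in the domain of $m$ lies in the cell of its value. An assignment $\theta$ *respects* it if two calls receive the same value iff they share a cell, and a call receives a constant $d$ of the partitioned set iff it lies in the cell of $d$. A *pruning* of $\Upsilon_{\mathcal K}$ is a transition system generated in the same way from $(A_0,\emptyset)$ when, for each state, each $\alpha\sigma$ and each equality commitment respected by some $\theta$ agreeing with $m$, exactly one pair resulting from such a $\theta$ is kept. A *history-preserving bisimulation* between transition systems $\Upsilon_1,\Upsilon_2$ is a set of triples $(s_1,h,s_2)$, where $h$ is a partial bijection of $\mathcal C$ that is the identity on $\mathcal C_0$ and induces an isomorphism of the ABoxes of $s_1$ and $s_2$, such that each move of $s_1$ (resp. $s_2$) is matched by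 a move of $s_2$ (resp. $s_1$) leading to a related triple with some $h'\supseteq h$; $\Upsilon_1$ and $\Upsilon_2$ are *history-preserving bisimilar* if such a relation contains a triple $(s_{01},h_0,s_{02})$ of the initial states. **Theorem 1.** Verification of $\mu\mathcal L_A^{\mathrm{EQL}}$ properties over run-bounded KABs under the standard semantics is decidable, and can be reduced to finite-state model checking of the propositional $\mu$-calculus. Precisely, there are partial computable functions $\mathit{dec}$ and $\mathit{red}$ such that for every finite $\mathcal C_0$ and every run-bounded KAB $\mathcal K$ with constants in $\mathcal C_0$: 1. for every closed $\Phi$ with constants in $\mathcal C_0$, $\mathit{dec}(\mathcal C_0,\mathcal K,\Phi)$ is defined and says whether $\Upsilon_{\mathcal K}\models\Phi$; 2. every pruning of $\Upsilon_{\mathcal K}$ has finitely many states, is history-preserving bisimilar to $\Upsilon_{\mathcal K}$, and satisfies the same closed formulae $\Phi$ with constants in $\mathcal C_0$; 3. there is a pruning $\Theta$, with a numbering of its states that makes it a finite frame $F$, such that for every closed $\Phi$ with constants in $\mathcal C_0$, $\mathit{red}(\mathcal C_0,\mathcal K,\Phi)$ is defined and consists of $F$, a labelling $L$ of its states with propositions,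 each proposition expressing the truth of a closed EQL query in the ABox of the state, and a closed propositional $\mu$-calculus formula $\varphi$, for which $\Phi$ holds in a state of $\Theta$ iff $\varphi$ holds in the corresponding state of $(F,L)$; in particular $\Upsilon_{\mathcal K}\models\Phi$ iff $(F,L)\models\varphi$. -/

import Mathlib

namespace KABV

/-! ## DL-Lite_A knowledge bases

Individual constants (values), variables, concept names, role names and service names are all
natural numbers; in particular the set of constants is countably infinite. -/

/-- Roles `P` and inverse roles `P⁻`. -/
inductive Role where
  | name (P : ℕ)
  | inv (P : ℕ)

/-- Basic concepts `N` and `∃R`. -/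
inductive Basic where
  | name (N : ℕ)
  | some (R : Role)

/-- TBox assertions `B₁ ⊑ B₂`, `B₁ ⊑ ¬B₂` and `(funct R)`. -/
inductive TAssertion where
  | pos (B₁ B₂ : Basic)
  | neg (B₁ B₂ : Basic)
  | funct (R : Role)

abbrev TBox := List TAssertion

/-- Concept and role atoms `N(t)`, `P(t,t')` over terms of type `τ`. -/
inductive Fact (τ : Type) where
  | conc (N : ℕ) (t : τ)
  | role (P : ℕ) (t t' : τ)
  deriving DecidableEq

namespace Fact

def map {τ υ : Type} (f : τ → υ) : Fact τ → Fact υ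
  | conc N t => conc N (f t)
  | role P t t' => role P (f t) (f t')

def terms {τ : Type} : Fact τ → List τ
  | conc _ t => [t]
  | role _ t t' => [t, t']

end Fact

/-- ABoxes: finite sets of membership assertions about constants. -/
abbrev ABox := Finset (Fact ℕ)

/-- The active domain of an ABox: the constants appearing in it. -/
def adom (A : ABox) : Set ℕ := {c | ∃ F ∈ A, c ∈ F.terms}

/-- First-order interpretations. Constants act as standard names, so distinct constants denote
distinct elements of the domain. -/
structure Interp where
  Dom : Type
  ind : ℕ → Dom
  ind_injective : Function.Injective ind
  conc : ℕ → Dom → Prop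
  role : ℕ → Dom → Dom → Prop

namespace Interp

def roleExt (I : Interp) : Role → I.Dom → I.Dom → Prop
  | .name P, x, y => I.role P x y
  | .inv P, x, y => I.role P y x

def basicExt (I : Interp) : Basic → I.Dom → Prop
  | .name N, x => I.conc N x
  | .some R, x => ∃ y, I.roleExt R x y

def SatT (I : Interp) : TAssertion → Prop
  | .pos B₁ B₂ => ∀ x, I.basicExt B₁ x → I.basicExt B₂ x
  | .neg B₁ B₂ => ∀ x, I.basicExt B₁ x → ¬ I.basicExt B₂ x
  | .funct R => ∀ x y z, I.roleExt R x y → I.roleExt R x z → y = z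

def SatFact (I : Interp) : Fact I.Dom → Prop
  | .conc N x => I.conc N x
  | .role P x y => I.role P x y

/-- `I` is a model of the knowledge base `(T, A)`. -/
def IsModel (I : Interp) (T : TBox) (A : ABox) : Prop :=
  (∀ a ∈ T, I.SatT a) ∧ ∀ F ∈ A, I.SatFact (F.map I.ind)

end Interp

/-- `A` is `T`-consistent. -/
def Consistent (T : TBox) (A : ABox) : Prop := ∃ I : Interp, I.IsModel T A

/-! ## Queries -/

/-- Terms of queries: variables and constants. -/
inductive QTerm where
  | var (x : ℕ)
  | const (c : ℕ)

namespace QTerm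

def vars : QTerm → List ℕ
  | var x => [x]
  | const _ => []

def consts : QTerm → List ℕ
  | var _ => []
  | const c => [c]

def eval (I : Interp) (g : ℕ → I.Dom) : QTerm → I.Dom
  | var x => g x
  | const c => I.ind c

end QTerm

/-- A conjunctive query `∃ y₁ … yₖ. a₁ ∧ … ∧ aₗ`; the empty conjunction is `true`. -/
structure CQ where
  exVars : List ℕ
  atoms : List (Fact QTerm)

namespace CQ

def fv (q : CQ) : Finset ℕ :=
  (q.atoms.flatMap fun a => a.terms.flatMap QTerm.vars).toFinset \ q.exVars.toFinset

def consts (q : CQ) : List ℕ := q.atoms.flatMap fun a => a.terms.flatMap QTerm.consts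

/-- Truth in an interpretation, under an assignment to the variables. -/
def Sat (I : Interp) (g : ℕ → I.Dom) (q : CQ) : Prop :=
  ∃ g' : ℕ → I.Dom, (∀ x, x ∉ q.exVars → g' x = g x) ∧
    ∀ a ∈ q.atoms, I.SatFact (a.map (QTerm.eval I g'))

end CQ

/-- Unions (disjunctions) of conjunctive queries. -/
structure UCQ where
  disjuncts : List CQ

namespace UCQ

def fv (q : UCQ) : Finset ℕ := (q.disjuncts.flatMap fun d => d.fv.sort (· ≤ ·)).toFinset

def consts (q : UCQ) : List ℕ := q.disjuncts.flatMap CQ.consts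

/-- The instance of `q` under `v` is true in every model of `(T, A)`. -/
def Certain (T : TBox) (A : ABox) (v : ℕ → ℕ) (q : UCQ) : Prop :=
  ∀ I : Interp, I.IsModel T A → ∃ d ∈ q.disjuncts, d.Sat I (fun x => I.ind (v x))

end UCQ

/-- EQL queries `[q] ∣ ¬Q ∣ Q₁ ∧ Q₂ ∣ ∃x.Q` over unions of conjunctive queries. -/
inductive ECQ where
  | cert (q : UCQ)
  | neg (Q : ECQ)
  | and (Q₁ Q₂ : ECQ)
  | ex (x : ℕ) (Q : ECQ)

namespace ECQ

def fv : ECQ → Finset ℕ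
  | cert q => q.fv
  | neg Q => Q.fv
  | and Q₁ Q₂ => Q₁.fv ∪ Q₂.fv
  | ex x Q => Q.fv.erase x

def consts : ECQ → List ℕ
  | cert q => q.consts
  | neg Q => Q.consts
  | and Q₁ Q₂ => Q₁.consts ++ Q₂.consts
  | ex _ Q => Q.consts

/-- The instance `Qv` is answered `true` over `(T, A)`: the certain answers of the atoms are
composed through the connectives, and existential variables range over the active domain. The
answers to an open `Q` are the `v` of this kind that map its free variables into `adom A`. -/
def Holds (T : TBox) (A : ABox) (v : ℕ → ℕ) : ECQ → Prop
  | cert q => q.Certain T A v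
  | neg Q => ¬ Holds T A v Q
  | and Q₁ Q₂ => Holds T A v Q₁ ∧ Holds T A v Q₂
  | ex x Q => ∃ d ∈ adom A, Holds T A (Function.update v x d) Q

end ECQ

/-! ## Knowledge and action bases -/

/-- Service calls `f(v₁,…,vₙ)` with constants as arguments. -/
structure SCall where
  fn : ℕ
  args : List ℕ
  deriving DecidableEq

/-- Ground terms: constants and service calls. -/
inductive GTerm where
  | val (c : ℕ)
  | call (t : SCall)
  deriving DecidableEq

/-- Terms of effects: variables, constants, Skolem terms `f(x₁,…,xₙ)`. -/
inductive ETerm where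
  | var (x : ℕ)
  | const (c : ℕ)
  | skolem (f : ℕ) (xs : List ℕ)

namespace ETerm

def vars : ETerm → List ℕ
  | var x => [x]
  | const _ => []
  | skolem _ xs => xs

def consts : ETerm → List ℕ
  | var _ => []
  | const c => [c]
  | skolem _ _ => []

def ground (v : ℕ → ℕ) : ETerm → GTerm
  | var x => .val (v x)
  | const c => .val c
  | skolem f xs => .call ⟨f, xs.map v⟩

end ETerm

/-- The value of a ground term when service calls are answered by `θ`. -/
def GTerm.eval (θ : SCall → ℕ) : GTerm → ℕ
  | .val c => c
  | .call t => θ t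

/-- An effect `[q⁺] ∧ Q⁻ ⇝ E`. -/
structure Effect where
  qpos : UCQ
  qneg : ECQ
  facts : List (Fact ETerm)

structure Action where
  params : List ℕ
  effects : List Effect

/-- A condition/action rule `Q ↦ α`. -/
structure Rule where
  cond : ECQ
  act : Action

/-- A knowledge and action base `(T, A₀, Γ, Π)`. -/
structure KAB where
  tbox : TBox
  abox : List (Fact ℕ)
  actions : List Action
  process : List Rule

/-- Syntactic conditions on effects of an action with the given parameters. -/
structure Effect.WellFormed (C₀ : List ℕ) (params : List ℕ) (e : Effect) : Prop where
  neg_vars : e.qneg.fv ⊆ e.qpos.fv ∪ params.toFinset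
  fact_vars : ∀ E ∈ e.facts, ∀ t ∈ E.terms, ∀ x ∈ t.vars, x ∈ e.qpos.fv ∪ params.toFinset
  pos_consts : ∀ c ∈ e.qpos.consts, c ∈ C₀
  neg_consts : ∀ c ∈ e.qneg.consts, c ∈ C₀
  fact_consts : ∀ E ∈ e.facts, ∀ t ∈ E.terms, ∀ c ∈ t.consts, c ∈ C₀

/-- `K` is a knowledge and action base with a `T`-consistent initial ABox whose constants all
belong to the finite set `C₀` of distinguished constants. -/
structure KAB.WellFormed (C₀ : List ℕ) (K : KAB) : Prop where
  consistent : Consistent K.tbox K.abox.toFinset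
  abox_consts : ∀ F ∈ K.abox, ∀ c ∈ F.terms, c ∈ C₀
  params_nodup : ∀ α ∈ K.actions, α.params.Nodup
  effects : ∀ α ∈ K.actions, ∀ e ∈ α.effects, e.WellFormed C₀ α.params
  rule_action : ∀ r ∈ K.process, r.act ∈ K.actions
  rule_vars : ∀ r ∈ K.process, r.cond.fv = r.act.params.toFinset
  rule_consts : ∀ r ∈ K.process, ∀ c ∈ r.cond.consts, c ∈ C₀

/-! ## Execution -/

/-- Service call maps: partial functions from service calls to constants. -/
abbrev SMap := SCall → Option ℕ

/-- States: an ABox together with the results of the service calls issued so far. -/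
structure KState where
  abox : ABox
  smap : SMap

/-- The variable assignment `v` maps the parameters to the actual parameters `σ`. -/
def Assigns (params σ : List ℕ) (v : ℕ → ℕ) : Prop := ∀ pc ∈ params.zip σ, v pc.1 = pc.2

namespace KAB

/-- `σ` is a legal tuple of actual parameters for `α` in a state with ABox `A`. -/
def Legal (K : KAB) (A : ABox) (α : Action) (σ : List ℕ) : Prop :=
  σ.length = α.params.length ∧ (∀ c ∈ σ, c ∈ adom A) ∧
    ∃ r ∈ K.process, r.act = α ∧ ∃ v, Assigns α.params σ v ∧ r.cond.Holds K.tbox A v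

/-- `DO(T, A, ασ)`: the facts, possibly with service calls, produced by the effects of `ασ`. -/
def doFacts (K : KAB) (A : ABox) (α : Action) (σ : List ℕ) : Set (Fact GTerm) :=
  {F | ∃ e ∈ α.effects, ∃ v : ℕ → ℕ, Assigns α.params σ v ∧
    (∀ x ∈ e.qpos.fv, x ∉ α.params → v x ∈ adom A) ∧
    e.qpos.Certain K.tbox A v ∧ e.qneg.Holds K.tbox A v ∧
    ∃ E ∈ e.facts, F = E.map (ETerm.ground v)}

/-- The ground terms occurring in `DO(T, A, ασ)`. -/
def doTerms (K : KAB) (A : ABox) (α : Action) (σ : List ℕ) : Set GTerm :=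
  {t | ∃ F ∈ K.doFacts A α σ, t ∈ F.terms}

/-- The service calls occurring in `DO(T, A, ασ)`. -/
def doCalls (K : KAB) (A : ABox) (α : Action) (σ : List ℕ) : Set SCall :=
  {t | GTerm.call t ∈ K.doTerms A α σ}

/-- `s'` results from executing `ασ` in `s`, when the service calls are answered by `θ`, of which
only the restriction to the calls issued by `ασ` matters. -/
structure ExecVia (K : KAB) (s : KState) (α : Action) (σ : List ℕ) (θ : SCall → ℕ)
    (s' : KState) : Prop where
  legal : K.Legal s.abox α σ
  agree : ∀ t ∈ K.doCalls s.abox α σ, ∀ d, s.smap t = some d → θ t = d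
  abox_eq : (s'.abox : Set (Fact ℕ)) = Fact.map (GTerm.eval θ) '' K.doFacts s.abox α σ
  smap_call : ∀ t ∈ K.doCalls s.abox α σ, s'.smap t = some (θ t)
  smap_old : ∀ t, t ∉ K.doCalls s.abox α σ → s'.smap t = s.smap t

/-- The relation `EXEC`. -/
def Exec (K : KAB) (s : KState) (α : Action) (σ : List ℕ) (s' : KState) : Prop :=
  ∃ θ, K.ExecVia s α σ θ s'

def initState (K : KAB) : KState := ⟨K.abox.toFinset, fun _ => none⟩

/-- One step along `ex` by some action, inconsistent successors being rejected. -/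
def StepBy (K : KAB) (ex : KState → Action → List ℕ → KState → Prop) (s s' : KState) : Prop :=
  ∃ α ∈ K.actions, ∃ σ, ex s α σ s' ∧ Consistent K.tbox s'.abox

/-- The states generated from the initial state along `ex`. -/
inductive Reach (K : KAB) (ex : KState → Action → List ℕ → KState → Prop) : KState → Prop where
  | init : Reach K ex K.initState
  | step {s s' : KState} : Reach K ex s → K.StepBy ex s s' → Reach K ex s'

end KAB

/-! ## Transition systems -/

structure TS where
  tbox : TBox
  State : Type
  init : State
  abox : State → ABox
  Step : State → State → Prop

/-- The transition system generated from the initial state of `K` along `ex`. -/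
def KAB.generated (K : KAB) (ex : KState → Action → List ℕ → KState → Prop) : TS where
  tbox := K.tbox
  State := {s : KState // K.Reach ex s}
  init := ⟨K.initState, .init⟩
  abox s := s.1.abox
  Step s s' := K.StepBy ex s.1 s'.1

/-- The transition system of `K` under the standard semantics. -/
def KAB.standardTS (K : KAB) : TS := K.generated K.Exec

/-- The first `N ≤ ∞` entries of `τ` form a run (a path from the initial state). -/
def TS.IsRun (Υ : TS) (N : ℕ∞) (τ : ℕ → Υ.State) : Prop :=
  τ 0 = Υ.init ∧ ∀ i : ℕ, ((i + 1 : ℕ) : ℕ∞) < N → Υ.Step (τ i) (τ (i + 1))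

/-- A single bound `b` works for the number of values occurring along any finite or infinite
run. -/
def TS.RunBounded (Υ : TS) : Prop :=
  ∃ b : ℕ, ∀ (N : ℕ∞) (τ : ℕ → Υ.State), Υ.IsRun N τ →
    (⋃ i : ℕ, ⋃ _ : (i : ℕ∞) < N, adom (Υ.abox (τ i))).encard < b

/-! ## The first-order μ-calculus over EQL queries -/

inductive MuForm where
  | query (Q : ECQ)
  | neg (Φ : MuForm)
  | and (Φ Ψ : MuForm)
  | ex (x : ℕ) (Φ : MuForm)
  | dia (Φ : MuForm)
  | pvar (Z : ℕ)
  | mu (Z : ℕ) (Φ : MuForm)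

namespace MuForm

/-- Free individual variables. -/
def fv : MuForm → Finset ℕ
  | query Q => Q.fv
  | neg Φ => Φ.fv
  | and Φ Ψ => Φ.fv ∪ Ψ.fv
  | ex x Φ => Φ.fv.erase x
  | dia Φ => Φ.fv
  | pvar _ => ∅
  | mu _ Φ => Φ.fv

/-- Free predicate variables. -/
def fpv : MuForm → Finset ℕ
  | query _ => ∅
  | neg Φ => Φ.fpv
  | and Φ Ψ => Φ.fpv ∪ Ψ.fpv
  | ex _ Φ => Φ.fpv
  | dia Φ => Φ.fpv
  | pvar Z => {Z}
  | mu Z Φ => Φ.fpv.erase Z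

def consts : MuForm → List ℕ
  | query Q => Q.consts
  | neg Φ => Φ.consts
  | and Φ Ψ => Φ.consts ++ Ψ.consts
  | ex _ Φ => Φ.consts
  | dia Φ => Φ.consts
  | pvar _ => []
  | mu _ Φ => Φ.consts

/-- Every free occurrence of `Z` is under an even number of negations if `b = true`, and under
an odd number if `b = false`. -/
def Polarity (Z : ℕ) : Bool → MuForm → Prop
  | _, query _ => True
  | b, neg Φ => Polarity Z (!b) Φ
  | b, and Φ Ψ => Polarity Z b Φ ∧ Polarity Z b Ψ
  | b, ex _ Φ => Polarity Z b Φ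
  | b, dia Φ => Polarity Z b Φ
  | b, pvar Y => Y = Z → b = true
  | b, mu Y Φ => Y = Z ∨ Polarity Z b Φ

/-- In each subformula `μZ.Φ` the variable `Z` occurs only positively in `Φ`. -/
def SynMonotone : MuForm → Prop
  | query _ => True
  | neg Φ => Φ.SynMonotone
  | and Φ Ψ => Φ.SynMonotone ∧ Ψ.SynMonotone
  | ex _ Φ => Φ.SynMonotone
  | dia Φ => Φ.SynMonotone
  | pvar _ => True
  | mu Z Φ => Polarity Z true Φ ∧ Φ.SynMonotone

/-- Closed formulae, whose constants are distinguished. -/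
structure IsSentence (C₀ : List ℕ) (Φ : MuForm) : Prop where
  closed : Φ.fv = ∅
  pclosed : Φ.fpv = ∅
  monotone : Φ.SynMonotone
  consts_mem : ∀ c ∈ Φ.consts, c ∈ C₀

/-- The extension of a formula; `μZ.Φ` is the least (pre-)fixpoint. -/
def ext (Υ : TS) : MuForm → (ℕ → ℕ) → (ℕ → Set Υ.State) → Set Υ.State
  | query Q, v, _ => {s | Q.Holds Υ.tbox (Υ.abox s) v}
  | neg Φ, v, V => (ext Υ Φ v V)ᶜ
  | and Φ Ψ, v, V => ext Υ Φ v V ∩ ext Υ Ψ v V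
  | ex x Φ, v, V => {s | ∃ d ∈ adom (Υ.abox s), s ∈ ext Υ Φ (Function.update v x d) V}
  | dia Φ, v, V => {s | ∃ s', Υ.Step s s' ∧ s' ∈ ext Υ Φ v V}
  | pvar Z, _, V => V Z
  | mu Z Φ, v, V => ⋂₀ {S | ext Υ Φ v (Function.update V Z S) ⊆ S}

end MuForm

/-- A closed formula holds in a state (its extension does not depend on the valuations). -/
def TS.HoldsAt (Υ : TS) (s : Υ.State) (Φ : MuForm) : Prop :=
  s ∈ Φ.ext Υ (fun _ => 0) (fun _ => ∅)

/-- `Υ ⊨ Φ` for closed `Φ`. -/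
def TS.Models (Υ : TS) (Φ : MuForm) : Prop := Υ.HoldsAt Υ.init Φ

/-! ## History-preserving bisimulation -/

/-- `A₁ ≡ₕ A₂` for a partial bijection `h` of the constants that is the identity on `C₀`. -/
structure ABoxIso (C₀ : List ℕ) (h : ℕ ≃. ℕ) (A₁ A₂ : ABox) : Prop where
  fix : ∀ c ∈ C₀, h c = some c
  dom : ∀ c ∈ adom A₁, (h c).isSome
  ran : ∀ c ∈ adom A₂, (h.symm c).isSome
  conc_iff : ∀ N c d, h c = some d → (.conc N c ∈ A₁ ↔ .conc N d ∈ A₂)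
  role_iff : ∀ P c d c' d', h c = some d → h c' = some d' →
    (.role P c c' ∈ A₁ ↔ .role P d d' ∈ A₂)

structure IsHPBisimulation (C₀ : List ℕ) (Υ₁ Υ₂ : TS)
    (B : Υ₁.State → (ℕ ≃. ℕ) → Υ₂.State → Prop) : Prop where
  iso : ∀ s₁ h s₂, B s₁ h s₂ → ABoxIso C₀ h (Υ₁.abox s₁) (Υ₂.abox s₂)
  forth : ∀ s₁ h s₂, B s₁ h s₂ → ∀ s₁', Υ₁.Step s₁ s₁' →
    ∃ s₂', Υ₂.Step s₂ s₂' ∧ ∃ h', h ≤ h' ∧ B s₁' h' s₂'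
  back : ∀ s₁ h s₂, B s₁ h s₂ → ∀ s₂', Υ₂.Step s₂ s₂' →
    ∃ s₁', Υ₁.Step s₁ s₁' ∧ ∃ h', h ≤ h' ∧ B s₁' h' s₂'

/-- `Υ₁ ≈ Υ₂`. -/
def HPBisimilar (C₀ : List ℕ) (Υ₁ Υ₂ : TS) : Prop :=
  ∃ B, IsHPBisimulation C₀ Υ₁ Υ₂ B ∧ ∃ h₀, B Υ₁.init h₀ Υ₂.init

/-! ## Equality commitments and pruning -/

/-- The constants and service calls on which an equality commitment for `ασ` in `s` is built. -/
def KAB.commitBase (C₀ : List ℕ) (K : KAB) (s : KState) (α : Action) (σ : List ℕ) : Set GTerm :=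
  {e | ∃ c ∈ C₀, e = .val c} ∪ {e | ∃ c ∈ adom s.abox, e = .val c} ∪
    {e | ∃ t d, s.smap t = some d ∧ (e = .call t ∨ e = .val d)} ∪ K.doTerms s.abox α σ

/-- A partition of `S` (given by its equivalence relation), each cell of which contains at most
one constant. -/
structure EqCommitment (S : Set GTerm) where
  cells : Setoid S
  val_unique : ∀ (x y : S) (c d : ℕ), x.1 = .val c → y.1 = .val d → cells x y → c = d

/-- `[t] = [m(t)]` for all calls `t` in the domain of `m`. -/
def EqCommitment.Agrees {S : Set GTerm} (H : EqCommitment S) (m : SMap) : Prop :=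
  ∀ (x y : S) (t : SCall) (d : ℕ), m t = some d → x.1 = .call t → y.1 = .val d → H.cells x y

/-- The answers `θ` to the calls in `D` realise exactly the equalities of `H`. -/
structure EqCommitment.Respected {S : Set GTerm} (H : EqCommitment S) (D : Set SCall)
    (θ : SCall → ℕ) : Prop where
  calls : ∀ (x y : S) (t u : SCall), t ∈ D → u ∈ D → x.1 = .call t → y.1 = .call u →
    (θ t = θ u ↔ H.cells x y)
  vals : ∀ (x y : S) (t : SCall) (d : ℕ), t ∈ D → x.1 = .call t → y.1 = .val d →
    (θ t = d ↔ H.cells x y)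

/-- `s'` is a successor of `s` under `ασ` that realises the equality commitment `H`. -/
def KAB.Realises (C₀ : List ℕ) (K : KAB) (s : KState) (α : Action) (σ : List ℕ)
    (H : EqCommitment (K.commitBase C₀ s α σ)) (s' : KState) : Prop :=
  ∃ θ, K.ExecVia s α σ θ s' ∧ H.Respected (K.doCalls s.abox α σ) θ

/-- `pe` is a pruned version of `EXEC`: among the successors of a state under an action with
parameters that realise the same equality commitment, it keeps exactly one. -/
structure KAB.IsPExec (C₀ : List ℕ) (K : KAB)
    (pe : KState → Action → List ℕ → KState → Prop) : Prop where
  sub : ∀ s α σ s', pe s α σ s' → K.Exec s α σ s'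
  unique : ∀ s α σ (H : EqCommitment (K.commitBase C₀ s α σ)), H.Agrees s.smap →
    (∃ s', K.Realises C₀ s α σ H s') → ∃! s', pe s α σ s' ∧ K.Realises C₀ s α σ H s'

/-! ## Finite-state model checking for the propositional μ-calculus -/

inductive PropMu where
  | atom (p : ℕ)
  | neg (φ : PropMu)
  | and (φ ψ : PropMu)
  | dia (φ : PropMu)
  | pvar (Z : ℕ)
  | mu (Z : ℕ) (φ : PropMu)

/-- A finite Kripke frame with states `0, …, last` and initial state `0`. -/
structure FinFrame where
  last : ℕ
  edges : List (ℕ × ℕ)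

abbrev FinFrame.State (F : FinFrame) : Type := Fin (F.last + 1)

def FinFrame.Step (F : FinFrame) (i j : F.State) : Prop := (i.val, j.val) ∈ F.edges

namespace PropMu

def fpv : PropMu → Finset ℕ
  | atom _ => ∅
  | neg φ => φ.fpv
  | and φ ψ => φ.fpv ∪ ψ.fpv
  | dia φ => φ.fpv
  | pvar Z => {Z}
  | mu Z φ => φ.fpv.erase Z

def Polarity (Z : ℕ) : Bool → PropMu → Prop
  | _, atom _ => True
  | b, neg φ => Polarity Z (!b) φ
  | b, and φ ψ => Polarity Z b φ ∧ Polarity Z b ψ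
  | b, dia φ => Polarity Z b φ
  | b, pvar Y => Y = Z → b = true
  | b, mu Y φ => Y = Z ∨ Polarity Z b φ

def SynMonotone : PropMu → Prop
  | atom _ => True
  | neg φ => φ.SynMonotone
  | and φ ψ => φ.SynMonotone ∧ ψ.SynMonotone
  | dia φ => φ.SynMonotone
  | pvar _ => True
  | mu Z φ => Polarity Z true φ ∧ φ.SynMonotone

def IsSentence (φ : PropMu) : Prop := φ.fpv = ∅ ∧ φ.SynMonotone

/-- The extension of a formula; the pair `(i, p)` in the labelling `L` says that proposition `p`
is true in state `i`. -/
def ext (F : FinFrame) (L : List (ℕ × ℕ)) : PropMu → (ℕ → Set F.State) → Set F.State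
  | atom p, _ => {i | (i.val, p) ∈ L}
  | neg φ, V => (ext F L φ V)ᶜ
  | and φ ψ, V => ext F L φ V ∩ ext F L ψ V
  | dia φ, V => {i | ∃ j, F.Step i j ∧ j ∈ ext F L φ V}
  | pvar Z, V => V Z
  | mu Z φ, V => ⋂₀ {S | ext F L φ (Function.update V Z S) ⊆ S}

end PropMu

/-- A closed propositional formula holds in state `i` of the Kripke structure `(F, L)`. -/
def FinFrame.HoldsAt (F : FinFrame) (L : List (ℕ × ℕ)) (i : F.State) (φ : PropMu) : Prop :=
  i ∈ φ.ext F L (fun _ => ∅)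

/-! ## Gödel numbers of the syntactic objects

Constructors are numbered, and tuples and lists of numbers are coded in the usual way. -/

/-- The code of a list of objects that are coded by `f`. -/
def codeList {α : Type} (f : α → ℕ) (l : List α) : ℕ := Encodable.encode (l.map f)

def codePair (p : ℕ × ℕ) : ℕ := Nat.pair p.1 p.2

def Role.code : Role → ℕ
  | .name P => Nat.pair 0 P
  | .inv P => Nat.pair 1 P

def Basic.code : Basic → ℕ
  | .name N => Nat.pair 0 N
  | .some R => Nat.pair 1 R.code

def TAssertion.code : TAssertion → ℕ
  | .pos B₁ B₂ => Nat.pair 0 (Nat.pair B₁.code B₂.code)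
  | .neg B₁ B₂ => Nat.pair 1 (Nat.pair B₁.code B₂.code)
  | .funct R => Nat.pair 2 R.code

def Fact.code {τ : Type} (f : τ → ℕ) : Fact τ → ℕ
  | .conc N t => Nat.pair 0 (Nat.pair N (f t))
  | .role P t t' => Nat.pair 1 (Nat.pair P (Nat.pair (f t) (f t')))

def QTerm.code : QTerm → ℕ
  | .var x => Nat.pair 0 x
  | .const c => Nat.pair 1 c

def CQ.code (q : CQ) : ℕ :=
  Nat.pair (codeList id q.exVars) (codeList (Fact.code QTerm.code) q.atoms)

def UCQ.code (q : UCQ) : ℕ := codeList CQ.code q.disjuncts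

def ECQ.code : ECQ → ℕ
  | .cert q => Nat.pair 0 q.code
  | .neg Q => Nat.pair 1 Q.code
  | .and Q₁ Q₂ => Nat.pair 2 (Nat.pair Q₁.code Q₂.code)
  | .ex x Q => Nat.pair 3 (Nat.pair x Q.code)

def ETerm.code : ETerm → ℕ
  | .var x => Nat.pair 0 x
  | .const c => Nat.pair 1 c
  | .skolem f xs => Nat.pair 2 (Nat.pair f (codeList id xs))

def Effect.code (e : Effect) : ℕ :=
  Nat.pair e.qpos.code (Nat.pair e.qneg.code (codeList (Fact.code ETerm.code) e.facts))

def Action.code (α : Action) : ℕ :=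
  Nat.pair (codeList id α.params) (codeList Effect.code α.effects)

def Rule.code (r : Rule) : ℕ := Nat.pair r.cond.code r.act.code

def KAB.code (K : KAB) : ℕ :=
  Nat.pair (codeList TAssertion.code K.tbox)
    (Nat.pair (codeList (Fact.code id) K.abox)
      (Nat.pair (codeList Action.code K.actions) (codeList Rule.code K.process)))

def MuForm.code : MuForm → ℕ
  | .query Q => Nat.pair 0 Q.code
  | .neg Φ => Nat.pair 1 Φ.code
  | .and Φ Ψ => Nat.pair 2 (Nat.pair Φ.code Ψ.code)
  | .ex x Φ => Nat.pair 3 (Nat.pair x Φ.code)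
  | .dia Φ => Nat.pair 4 Φ.code
  | .pvar Z => Nat.pair 5 Z
  | .mu Z Φ => Nat.pair 6 (Nat.pair Z Φ.code)

def PropMu.code : PropMu → ℕ
  | .atom p => Nat.pair 0 p
  | .neg φ => Nat.pair 1 φ.code
  | .and φ ψ => Nat.pair 2 (Nat.pair φ.code ψ.code)
  | .dia φ => Nat.pair 3 φ.code
  | .pvar Z => Nat.pair 4 Z
  | .mu Z φ => Nat.pair 5 (Nat.pair Z φ.code)

/-- The code of an instance of the verification problem. -/
def codeVerification (C₀ : List ℕ) (K : KAB) (Φ : MuForm) : ℕ :=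
  Nat.pair (codeList id C₀) (Nat.pair K.code Φ.code)

/-- The code of an instance of finite-state propositional model checking. -/
def codeModelChecking (F : FinFrame) (L : List (ℕ × ℕ)) (φ : PropMu) : ℕ :=
  Nat.pair (Nat.pair F.last (codeList codePair F.edges))
    (Nat.pair (codeList codePair L) φ.code)

end KABV

open KABV

/-! Constants outside `C₀` carry no meaning of their own: a permutation of the constants that fixes
`C₀` preserves certain answers (`UCQ.certain_permA`), EQL queries (`ECQ.holds_permA`) and executions
(`KAB.ExecVia.perm`). Call a constant known in a state if it lies in `C₀` or is a recorded answer.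
In a generated state the active domain and the arguments of recorded calls are known. Two executions
of one action that respect the same equality commitment have the same equality pattern on the
constants of the base and the calls issued. By `exists_perm_comp` their successors therefore differ
by a permutation that fixes everything known before (`KAB.ExecVia.exists_perm`). So "equal up to a
permutation, remembered on the known constants" is a history-preserving bisimulation between a
pruning and the full system (`KAB.IsPExec.hpBisimilar`). The same relation, indexed by the pairs of
constants currently held by variables, preserves the μ-calculus (`KAB.IsPExec.compat_ext`); the
fixpoint case is `compat_lfp`.

A pruning branches finitely, since a finite base has finitely many commitments. Along a run with at
most `b` constants there are, up to renaming, only finitely many states, so run-boundedness bounds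
the length of all repetition-free runs uniformly (`KAB.exists_length_lt_of_runBounded`). Every state
is reached by such a run, hence the pruning is finite (`KAB.IsPExec.finite_state`); no compactness
argument is needed.

For effectiveness one pruning is made explicit: a fresh class of calls is answered by a number above
all constants of the base plus the code of its least call (`KAB.canonExec`). Consistency and certain
answers are read off the canonical model of a DL-Lite knowledge base, a forest whose anonymous
elements are words over roles. The subtree below an anonymous element depends only on the last
letter of its word, so query matches can be moved to bounded depth (`Skeleton.match_iff`) and become
decidable.

Algorithms are not programmed. Each notion is shown semidecidable, syntax-directed evaluators are
given as inductive definitions on codes (`Semi.derivable`), and negative information is represented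
by a second truth value. "This finite list is a correct presentation of the canonical pruning" is
then semidecidable (`Semi.correct`), and an unbounded search finds such a list whenever the pruning
is finite, without knowing a bound. Over this finite presentation quantifiers are expanded to
disjunctions over its constants (`MuForm.ext_toProp`), instances of queries become propositions, and
propositional model checking is settled by enumerating all sets of states (`extRule_iff`). -/

namespace KABV

/-! ## Primitive recursive functions and semidecidable predicates -/

section Semidecidable

variable {α β γ δ : Type} [Primcodable α] [Primcodable β] [Primcodable γ] [Primcodable δ]

/-- `Primrec`, as a property known to `fun_prop`. -/
@[fun_prop]
def PRec (f : α → β) : Prop := Primrec f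

namespace PRec

@[fun_prop]
theorem id : PRec (fun a : α => a) := Primrec.id

@[fun_prop]
theorem const (b : β) : PRec (fun _ : α => b) := Primrec.const b

@[fun_prop]
theorem comp {f : β → γ} {g : α → β} (hf : PRec f) (hg : PRec g) : PRec (fun a => f (g a)) :=
  Primrec.comp hf hg

@[fun_prop]
theorem pair {f : α → β} {g : α → γ} (hf : PRec f) (hg : PRec g) : PRec (fun a => (f a, g a)) :=
  Primrec.pair hf hg

@[fun_prop]
theorem fst {f : α → β × γ} (hf : PRec f) : PRec (fun a => (f a).1) := Primrec.fst.comp hf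

@[fun_prop]
theorem snd {f : α → β × γ} (hf : PRec f) : PRec (fun a => (f a).2) := Primrec.snd.comp hf

@[fun_prop]
theorem natPair {f g : α → ℕ} (hf : PRec f) (hg : PRec g) : PRec (fun a => Nat.pair (f a) (g a)) :=
  Primrec₂.natPair.comp hf hg

@[fun_prop]
theorem add {f g : α → ℕ} (hf : PRec f) (hg : PRec g) : PRec (fun a => f a + g a) :=
  Primrec.nat_add.comp hf hg

@[fun_prop]
theorem encode {f : α → β} (hf : PRec f) : PRec (fun a => Encodable.encode (f a)) :=
  Primrec.encode.comp hf

@[fun_prop]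
theorem cons {f : α → β} {g : α → List β} (hf : PRec f) (hg : PRec g) :
    PRec (fun a => f a :: g a) :=
  Primrec.list_cons.comp hf hg

@[fun_prop]
theorem append {f : α → List β} {g : α → List β} (hf : PRec f) (hg : PRec g) :
    PRec (fun a => f a ++ g a) :=
  Primrec.list_append.comp hf hg

@[fun_prop]
theorem length {f : α → List β} (hf : PRec f) : PRec (fun a => (f a).length) :=
  Primrec.list_length.comp hf

@[fun_prop]
theorem range {f : α → ℕ} (hf : PRec f) : PRec (fun a => List.range (f a)) :=
  Primrec.list_range.comp hf

@[fun_prop]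
theorem getD {f : α → List β} {g : α → ℕ} (d : β) (hf : PRec f) (hg : PRec g) :
    PRec (fun a => (f a).getD (g a) d) :=
  (Primrec.list_getD d).comp hf hg

@[fun_prop]
theorem some {f : α → β} (hf : PRec f) : PRec (fun a => Option.some (f a)) :=
  Primrec.option_some.comp hf

@[fun_prop]
theorem inl {f : α → β} (hf : PRec f) : PRec (fun a => (Sum.inl (f a) : β ⊕ γ)) :=
  Primrec.sumInl.comp hf

@[fun_prop]
theorem inr {f : α → γ} (hf : PRec f) : PRec (fun a => (Sum.inr (f a) : β ⊕ γ)) :=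
  Primrec.sumInr.comp hf

@[fun_prop]
theorem map {f : α → List β} {g : α → β → γ} (hf : PRec f)
    (hg : PRec (fun p : α × β => g p.1 p.2)) : PRec (fun a => (f a).map (g a)) :=
  Primrec.list_map hf hg

@[fun_prop]
theorem flatMap {f : α → List β} {g : α → β → List γ} (hf : PRec f)
    (hg : PRec (fun p : α × β => g p.1 p.2)) : PRec (fun a => (f a).flatMap (g a)) :=
  Primrec.list_flatMap hf hg

theorem foldr {f : α → List β} {g : α → γ} {h : α → β → γ → γ} (hf : PRec f) (hg : PRec g)
    (hh : PRec (fun p : α × β × γ => h p.1 p.2.1 p.2.2)) :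
    PRec (fun a => (f a).foldr (h a) (g a)) :=
  Primrec.list_foldr (h := fun a p => h a p.1 p.2) hf hg hh

theorem ite {c : α → Prop} [DecidablePred c] {f g : α → β} (hc : PrimrecPred c) (hf : PRec f)
    (hg : PRec g) : PRec (fun a => if c a then f a else g a) :=
  Primrec.ite hc hf hg

@[fun_prop]
theorem ite_eq [DecidableEq γ] {u v : α → γ} {f g : α → β} (hu : PRec u) (hv : PRec v)
    (hf : PRec f) (hg : PRec g) : PRec (fun a => if u a = v a then f a else g a) :=
  Primrec.ite (PrimrecRel.comp Primrec.eq hu hv) hf hg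

theorem sumCases {o : α → β ⊕ γ} {f : α → β → δ} {g : α → γ → δ} (ho : PRec o)
    (hf : PRec (fun p : α × β => f p.1 p.2)) (hg : PRec (fun p : α × γ => g p.1 p.2)) :
    PRec (fun a => Sum.elim (f a) (g a) (o a)) :=
  (Primrec.sumCasesOn ho (Primrec₂.mk hf) (Primrec₂.mk hg)).of_eq fun a => by cases o a <;> rfl

@[fun_prop]
theorem bnot {f : α → Bool} (hf : PRec f) : PRec (fun a => !(f a)) := Primrec.not.comp hf

@[fun_prop]
theorem band {f g : α → Bool} (hf : PRec f) (hg : PRec g) : PRec (fun a => f a && g a) :=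
  Primrec.and.comp hf hg

theorem natRec {f : α → ℕ} {g : α → β} {h : α → ℕ → β → β} (hf : PRec f) (hg : PRec g)
    (hh : PRec (fun p : α × ℕ × β => h p.1 p.2.1 p.2.2)) :
    PRec (fun a => Nat.rec (motive := fun _ => β) (g a) (h a) (f a)) :=
  Primrec.nat_rec' (h := fun a p => h a p.1 p.2) hf hg hh

end PRec

/-- Semidecidable predicates, as projections of primitive recursive ones. -/
def Semi (p : α → Prop) : Prop :=
  ∃ q : α → ℕ → Prop, PrimrecPred (fun x : α × ℕ => q x.1 x.2) ∧ ∀ a, p a ↔ ∃ n, q a n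

namespace Semi

theorem of_iff {p q : α → Prop} (hp : Semi p) (h : ∀ a, q a ↔ p a) : Semi q := by
  obtain ⟨r, hr, hpr⟩ := hp
  exact ⟨r, hr, fun a => (h a).trans (hpr a)⟩

theorem of_primrecPred {p : α → Prop} (hp : PrimrecPred p) : Semi p :=
  ⟨fun a _ => p a, hp.comp Primrec.fst, fun a => by simp⟩

theorem comp {p : β → Prop} {f : α → β} (hp : Semi p) (hf : PRec f) : Semi (fun a => p (f a)) := by
  obtain ⟨r, hr, hpr⟩ := hp
  exact ⟨fun a n => r (f a) n,
    hr.comp (f := fun x : α × ℕ => (f x.1, x.2)) ((hf.comp Primrec.fst).pair Primrec.snd),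
    fun a => hpr _⟩

theorem const (p : Prop) : Semi (fun _ : α => p) := by
  classical exact of_primrecPred ⟨fun _ => inferInstance, Primrec.const _⟩

theorem eq {f g : α → β} (hf : PRec f) (hg : PRec g) : Semi (fun a => f a = g a) :=
  of_primrecPred (PrimrecRel.comp Primrec.eq hf hg)

theorem ne {f g : α → β} (hf : PRec f) (hg : PRec g) : Semi (fun a => f a ≠ g a) :=
  of_primrecPred (PrimrecRel.comp Primrec.eq hf hg).not

theorem lt {f g : α → ℕ} (hf : PRec f) (hg : PRec g) : Semi (fun a => f a < g a) :=
  of_primrecPred (PrimrecRel.comp Primrec.nat_lt hf hg)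

theorem le {f g : α → ℕ} (hf : PRec f) (hg : PRec g) : Semi (fun a => f a ≤ g a) :=
  of_primrecPred (PrimrecRel.comp Primrec.nat_le hf hg)

theorem primrecPred_mem {f : α → β} {g : α → List β} (hf : PRec f) (hg : PRec g) :
    PrimrecPred (fun a => f a ∈ g a) :=
  (PrimrecRel.comp (PrimrecRel.exists_mem_list (R := fun x y : β => x = y) Primrec.eq) hg hf).of_eq
    fun a => by simp

theorem mem {f : α → β} {g : α → List β} (hf : PRec f) (hg : PRec g) :
    Semi (fun a => f a ∈ g a) :=
  of_primrecPred (primrecPred_mem hf hg)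

theorem not_mem {f : α → β} {g : α → List β} (hf : PRec f) (hg : PRec g) :
    Semi (fun a => f a ∉ g a) :=
  of_primrecPred (primrecPred_mem hf hg).not

theorem exNat {p : α → ℕ → Prop} (hp : Semi (fun x : α × ℕ => p x.1 x.2)) :
    Semi (fun a => ∃ n, p a n) := by
  obtain ⟨r, hr, hpr⟩ := hp
  refine ⟨fun a n => r (a, n.unpair.1) n.unpair.2,
    hr.comp (f := fun x : α × ℕ => ((x.1, x.2.unpair.1), x.2.unpair.2))
      ((Primrec.fst.pair (Primrec.fst.comp (Primrec.unpair.comp Primrec.snd))).pair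
        (Primrec.snd.comp (Primrec.unpair.comp Primrec.snd))), fun a => ?_⟩
  constructor
  · rintro ⟨n, hn⟩
    obtain ⟨k, hk⟩ := (hpr (a, n)).1 hn
    exact ⟨Nat.pair n k, by simpa using hk⟩
  · rintro ⟨n, hn⟩
    exact ⟨n.unpair.1, (hpr (a, n.unpair.1)).2 ⟨_, hn⟩⟩

theorem and {p q : α → Prop} (hp : Semi p) (hq : Semi q) : Semi (fun a => p a ∧ q a) := by
  obtain ⟨r, hr, hpr⟩ := hp
  obtain ⟨t, ht, hqt⟩ := hq
  refine of_iff (exNat (p := fun a n => ∃ k, r a n ∧ t a k) (exNat (of_primrecPred ?_)))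
    (fun a => ?_)
  · exact (hr.comp (f := fun x : (α × ℕ) × ℕ => x.1) Primrec.fst).and
      (ht.comp (f := fun x : (α × ℕ) × ℕ => (x.1.1, x.2))
        ((Primrec.fst.comp Primrec.fst).pair Primrec.snd))
  · rw [hpr, hqt]
    constructor
    · rintro ⟨⟨n, h⟩, k, h'⟩; exact ⟨n, k, h, h'⟩
    · rintro ⟨n, k, h, h'⟩; exact ⟨⟨n, h⟩, k, h'⟩

theorem or {p q : α → Prop} (hp : Semi p) (hq : Semi q) : Semi (fun a => p a ∨ q a) := by
  obtain ⟨r, hr, hpr⟩ := hp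
  obtain ⟨t, ht, hqt⟩ := hq
  refine ⟨fun a n => r a n ∨ t a n, hr.or ht, fun a => ?_⟩
  exact (or_congr (hpr a) (hqt a)).trans exists_or.symm

theorem ex {p : α → β → Prop} (hp : Semi (fun x : α × β => p x.1 x.2)) :
    Semi (fun a => ∃ b, p a b) := by
  obtain ⟨r, hr, hpr⟩ := hp
  have key : Semi (fun x : α × ℕ => ∃ k, ∃ b, Encodable.decode (α := β) x.2 = some b ∧
      r (x.1, b) k) := by
    refine exNat (of_primrecPred ?_)
    obtain ⟨hd, hr⟩ := hr
    classical
    have h1 : Primrec (fun x : (α × ℕ) × ℕ => (Option.casesOn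
        (motive := fun _ => Bool) (Encodable.decode (α := β) x.1.2) false
          (fun b => decide (r (x.1.1, b) x.2)))) := by
      refine Primrec.option_casesOn (Primrec.decode.comp (Primrec.snd.comp Primrec.fst))
        (Primrec.const _) ?_
      refine Primrec.of_eq (hr.comp (g := fun x : ((α × ℕ) × ℕ) × β => ((x.1.1.1, x.2), x.1.2))
        (Primrec.pair (Primrec.pair (Primrec.fst.comp (Primrec.fst.comp Primrec.fst)) Primrec.snd)
        (Primrec.snd.comp Primrec.fst))) (fun x => by simp)
    refine ⟨Classical.decPred _, h1.of_eq fun x => ?_⟩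
    cases h : Encodable.decode (α := β) x.1.2 <;> simp [h]
  refine (exNat (p := fun a n => ∃ k, ∃ b, Encodable.decode (α := β) n = some b ∧
      r (a, b) k) key).of_iff fun a => ?_
  constructor
  · rintro ⟨b, hb⟩
    obtain ⟨k, hk⟩ := (hpr (a, b)).1 hb
    exact ⟨Encodable.encode b, k, b, by simp, hk⟩
  · rintro ⟨_, k, b, _, hk⟩
    exact ⟨b, (hpr (a, b)).2 ⟨k, hk⟩⟩

theorem bex {p : α → β → Prop} {f : α → List β} (hp : Semi (fun x : α × β => p x.1 x.2))
    (hf : PRec f) : Semi (fun a => ∃ b ∈ f a, p a b) :=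
  ex ((mem (by fun_prop) (by fun_prop)).and hp)

theorem bexLt {p : α → ℕ → Prop} {f : α → ℕ} (hp : Semi (fun x : α × ℕ => p x.1 x.2))
    (hf : PRec f) : Semi (fun a => ∃ b < f a, p a b) :=
  ex ((lt (by fun_prop) (by fun_prop)).and hp)

/-- A list has finitely many members, so their individual search stages have a common bound `N`;
what remains is a bounded quantification, which is primitive recursive. -/
theorem ball {p : α → β → Prop} {f : α → List β} (hp : Semi (fun x : α × β => p x.1 x.2))
    (hf : PRec f) : Semi (fun a => ∀ b ∈ f a, p a b) := by
  obtain ⟨r, hr, hpr⟩ := hp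
  refine ⟨fun a N => ∀ b ∈ f a, ∃ n < N, r (a, b) n, ?_, fun a => ?_⟩
  · have h1 : PrimrecRel (fun (n : ℕ) (x : β × α) => r (x.2, x.1) n) :=
      hr.comp (f := fun x : ℕ × β × α => ((x.2.2, x.2.1), x.1))
        (((Primrec.snd.comp Primrec.snd).pair (Primrec.fst.comp Primrec.snd)).pair Primrec.fst)
    have h2 := PrimrecRel.exists_mem_list h1
    have h3 : PrimrecRel (fun (b : β) (x : α × ℕ) => ∃ n < x.2, r (x.1, b) n) :=
      (PrimrecRel.comp h2 (f := fun y : β × α × ℕ => List.range y.2.2)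
        (g := fun y : β × α × ℕ => (y.1, y.2.1))
        (Primrec.list_range.comp (Primrec.snd.comp Primrec.snd))
        (Primrec.fst.pair (Primrec.fst.comp Primrec.snd))).of_eq fun x => by simp
    exact PrimrecRel.comp (PrimrecRel.forall_mem_list h3) (f := fun y : α × ℕ => f y.1)
      (g := fun y : α × ℕ => y) (hf.comp Primrec.fst) Primrec.id
  · constructor
    · intro h
      choose! n hn using fun b hb => (hpr (a, b)).1 (h b hb)
      obtain ⟨N, hN⟩ : ∃ N, ∀ b ∈ f a, n b < N := by
        refine ⟨((f a).map n).sum + 1, fun b hb => Nat.lt_succ_of_le ?_⟩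
        exact List.le_sum_of_mem (List.mem_map_of_mem hb)
      exact ⟨N, fun b hb => ⟨n b, hN b hb, hn b hb⟩⟩
    · rintro ⟨N, h⟩ b hb
      obtain ⟨n, -, hn⟩ := h b hb
      exact (hpr (a, b)).2 ⟨n, hn⟩

theorem ballLt {p : α → ℕ → Prop} {f : α → ℕ} (hp : Semi (fun x : α × ℕ => p x.1 x.2))
    (hf : PRec f) : Semi (fun a => ∀ b < f a, p a b) :=
  (ball hp (f := fun a => List.range (f a)) (by fun_prop)).of_iff fun a => by simp

/-- A semidecidable relation is uniformised by a partial recursive function. -/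
theorem exists_partrec {p : α → β → Prop} (hp : Semi (fun x : α × β => p x.1 x.2)) :
    ∃ f : α →. β, Partrec f ∧ (∀ a b, b ∈ f a → p a b) ∧ ∀ a b, p a b → (f a).Dom := by
  obtain ⟨r, ⟨hd, hr⟩, hpr⟩ := hp
  classical
  -- One number codes both the candidate and the stage at which it is tested, so a single unbounded
  -- search suffices.
  let g : α → ℕ → Option β := fun a n => (Encodable.decode (α := β) n.unpair.1).bind fun b =>
    if r (a, b) n.unpair.2 then some b else none
  have hg : Primrec₂ g := by
    refine Primrec.option_bind (f := fun x : α × ℕ => Encodable.decode (α := β) x.2.unpair.1)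
      (Primrec.decode.comp (Primrec.fst.comp (Primrec.unpair.comp Primrec.snd))) ?_
    refine Primrec.ite ?_ (Primrec.option_some.comp Primrec.snd) (Primrec.const _)
    refine PrimrecPred.comp (p := fun x : (α × β) × ℕ => r x.1 x.2) ⟨hd, hr⟩
      (f := fun y : (α × ℕ) × β => ((y.1.1, y.2), y.1.2.unpair.2)) ?_
    exact ((Primrec.fst.comp Primrec.fst).pair Primrec.snd).pair
      (Primrec.snd.comp (Primrec.unpair.comp (Primrec.snd.comp Primrec.fst)))
  refine ⟨fun a => Nat.rfindOpt (g a), Partrec.rfindOpt hg.to_comp, fun a b hb => ?_,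
    fun a b hb => ?_⟩
  · obtain ⟨n, hn⟩ := Nat.rfindOpt_spec hb
    obtain ⟨b', -, h⟩ := Option.bind_eq_some_iff.1 hn
    split_ifs at h with h'
    obtain rfl := Option.some.inj h
    exact (hpr (a, b')).2 ⟨_, h'⟩
  · obtain ⟨k, hk⟩ := (hpr (a, b)).1 hb
    refine Nat.rfindOpt_dom.2 ⟨Nat.pair (Encodable.encode b) k, b, ?_⟩
    simp only [g, Nat.unpair_pair, Encodable.encodek, Option.bind_some, Option.mem_def]
    rw [if_pos hk]

end Semi

/-! ### Inductive definitions -/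

/-- The least predicate closed under the rules `R`, whose premises form a list. -/
inductive Derivable {β : Type} (R : List β → β → Prop) : β → Prop where
  | intro (P : List β) (x : β) : R P x → (∀ y ∈ P, Derivable R y) → Derivable R x

/-- A derivation tree is flattened to a finite list, in which ranks that drop from conclusions to
premises exclude circular justification. This replaces an inductive definition by the existence of
one finite object that can be checked locally. -/
theorem derivable_iff_ranked {β : Type} {R : List β → β → Prop} {x : β} :
    Derivable R x ↔ ∃ L : List (ℕ × β), (∃ p ∈ L, p.2 = x) ∧
      ∀ p ∈ L, ∃ P : List β, R P p.2 ∧ ∀ y ∈ P, ∃ q ∈ L, q.1 < p.1 ∧ q.2 = y := by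
  constructor
  · intro h
    induction h with
    | intro P x hR _ ih =>
      have key : ∃ L : List (ℕ × β), (∀ y ∈ P, ∃ p ∈ L, p.2 = y) ∧
          ∀ p ∈ L, ∃ P : List β, R P p.2 ∧ ∀ y ∈ P, ∃ q ∈ L, q.1 < p.1 ∧ q.2 = y := by
        clear hR
        induction P with
        | nil => exact ⟨[], by simp, by simp⟩
        | cons y P ih' =>
          obtain ⟨L₁, h₁, h₁'⟩ := ih y (by simp)
          obtain ⟨L₂, h₂, h₂'⟩ := ih' (fun z hz => by simp_all) fun z hz =>
            ih z (List.mem_cons_of_mem _ hz)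
          refine ⟨L₁ ++ L₂, ?_, ?_⟩
          · intro z hz
            rcases List.mem_cons.1 hz with rfl | hz
            · obtain ⟨p, hp, e⟩ := h₁
              exact ⟨p, List.mem_append_left _ hp, e⟩
            · obtain ⟨p, hp, e⟩ := h₂ z hz
              exact ⟨p, List.mem_append_right _ hp, e⟩
          · intro p hp
            rcases List.mem_append.1 hp with hp | hp
            · obtain ⟨Q, hQ, h⟩ := h₁' p hp
              refine ⟨Q, hQ, fun z hz => ?_⟩
              obtain ⟨q, hq, e⟩ := h z hz
              exact ⟨q, List.mem_append_left _ hq, e⟩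
            · obtain ⟨Q, hQ, h⟩ := h₂' p hp
              refine ⟨Q, hQ, fun z hz => ?_⟩
              obtain ⟨q, hq, e⟩ := h z hz
              exact ⟨q, List.mem_append_right _ hq, e⟩
      obtain ⟨L, hL, hL'⟩ := key
      -- The sum of all ranks in use, plus one, exceeds each of them, so every premise is ranked
      -- below the new conclusion.
      refine ⟨((L.map Prod.fst).sum + 1, x) :: L, ⟨_, List.mem_cons_self, rfl⟩, ?_⟩
      intro p hp
      rcases List.mem_cons.1 hp with rfl | hp
      · refine ⟨P, hR, fun y hy => ?_⟩
        obtain ⟨q, hq, e⟩ := hL y hy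
        exact ⟨q, List.mem_cons_of_mem _ hq,
          Nat.lt_succ_of_le (List.le_sum_of_mem (List.mem_map_of_mem hq)), e⟩
      · obtain ⟨Q, hQ, h⟩ := hL' p hp
        refine ⟨Q, hQ, fun z hz => ?_⟩
        obtain ⟨q, hq, e⟩ := h z hz
        exact ⟨q, List.mem_cons_of_mem _ hq, e⟩
  · rintro ⟨L, ⟨p, hp, rfl⟩, hL⟩
    obtain ⟨n, hn⟩ : ∃ n, p.1 = n := ⟨_, rfl⟩
    induction n using Nat.strong_induction_on generalizing p with
    | _ n ih =>
      obtain ⟨P, hR, hP⟩ := hL p hp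
      refine .intro P _ hR fun y hy => ?_
      obtain ⟨q, hq, hlt, rfl⟩ := hP y hy
      exact ih q.1 (hn ▸ hlt) q hq rfl

/-- Evaluation of queries, translation of formulae and computation of extensions are all specified
by rules on codes and handled by this lemma, which avoids course-of-values recursion on codes. -/
theorem Semi.derivable {R : α → List β → β → Prop} {f : α → β}
    (hR : Semi (fun x : α × List β × β => R x.1 x.2.1 x.2.2)) (hf : PRec f) :
    Semi (fun a => Derivable (R a) (f a)) := by
  refine Semi.of_iff ?_ fun a => derivable_iff_ranked
  refine .ex (.and (.bex (.eq (by fun_prop) (by fun_prop)) (by fun_prop)) (.ball (.ex (.and ?_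
    (.ball (.bex (.and (.lt (by fun_prop) (by fun_prop)) (.eq (by fun_prop) (by fun_prop)))
      (by fun_prop)) (by fun_prop)))) (by fun_prop)))
  exact hR.comp (f := fun x : ((α × List (ℕ × β)) × ℕ × β) × List β => (x.1.1.1, x.2, x.1.2.2))
    (by fun_prop)

end Semidecidable

/-! ### Tuples and updates of lists -/

section Lists

variable {β : Type}

/-- All lists of length `n` over `U`. -/
def tuples (U : List β) (n : ℕ) : List (List β) :=
  Nat.rec [[]] (fun _ L => U.flatMap fun u => L.map fun l => u :: l) n

theorem mem_tuples {U : List β} {n : ℕ} {l : List β} :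
    l ∈ tuples U n ↔ l.length = n ∧ ∀ x ∈ l, x ∈ U := by
  induction n generalizing l with
  | zero => simp [tuples]; rintro rfl; simp
  | succ n ih =>
    change l ∈ U.flatMap (fun u => (tuples U n).map fun l => u :: l) ↔ _
    simp only [List.mem_flatMap, List.mem_map, ih]
    constructor
    · rintro ⟨u, hu, l, ⟨h1, h2⟩, rfl⟩
      simp [h1, hu]; exact h2
    · rintro ⟨h1, h2⟩
      cases l with
      | nil => simp at h1
      | cons u l => exact ⟨u, h2 _ (by simp), l, ⟨by simpa using h1, fun x hx =>
        h2 _ (by simp [hx])⟩,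
          rfl⟩

/-- The list `l` with entry `x` set to `d`; entries beyond the end of a list are `dflt`. -/
def updList (dflt : β) (l : List β) (x : ℕ) (d : β) : List β :=
  (List.range (l.length + x + 1)).map fun y => if y = x then d else l.getD y dflt

theorem getD_updList (dflt : β) (l : List β) (x : ℕ) (d : β) :
    (fun y => (updList dflt l x d).getD y dflt) =
      Function.update (fun y => l.getD y dflt) x d := by
  funext y
  by_cases hy : y < l.length + x + 1
  · simp [updList, List.getD_eq_getElem?_getD, hy, Function.update_apply]
  · have : y ≠ x := by omega
    have h2 : l.length ≤ y := by omega
    simp [updList, List.getD_eq_getElem?_getD, hy, this, h2]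

variable {α : Type} [Primcodable α] [Primcodable β]

@[fun_prop]
theorem PRec.tuples {U : α → List β} {n : α → ℕ} (hU : PRec U) (hn : PRec n) :
    PRec (fun a => tuples (U a) (n a)) := by
  refine PRec.natRec (g := fun _ => [[]]) hn (.const _)
    (h := fun a _ L => (U a).flatMap fun u => L.map fun l => u :: l) ?_
  fun_prop

@[fun_prop]
theorem PRec.updList {dflt : β} {l : α → List β} {x : α → ℕ} {d : α → β} (hl : PRec l)
    (hx : PRec x) (hd : PRec d) : PRec (fun a => updList dflt (l a) (x a) (d a)) := by
  unfold KABV.updList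
  fun_prop

end Lists

end KABV
namespace KABV

/-! ## Canonical models of DL-Lite knowledge bases -/

def Role.flip : Role → Role
  | .name P => .inv P
  | .inv P => .name P

@[simp]
theorem Role.flip_flip (R : Role) : R.flip.flip = R := by cases R <;> rfl

theorem Interp.roleExt_flip (I : Interp) (R : Role) (x y : I.Dom) :
    I.roleExt R.flip x y ↔ I.roleExt R y x := by cases R <;> rfl

/-- Membership of role facts in an ABox. -/
def ARole (A : Set (Fact ℕ)) : Role → ℕ → ℕ → Prop
  | .name P, c, d => .role P c d ∈ A
  | .inv P, c, d => .role P d c ∈ A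

theorem aRole_flip (A : Set (Fact ℕ)) (R : Role) (c d : ℕ) :
    ARole A R.flip c d ↔ ARole A R d c := by cases R <;> rfl

/-- The basic concepts explicitly asserted of a constant. -/
def ABasic (A : Set (Fact ℕ)) : Basic → ℕ → Prop
  | .name N, c => .conc N c ∈ A
  | .some R, c => ∃ d, ARole A R c d

/-- Subsumption by the positive inclusions of a TBox. -/
def Sub (T : TBox) : Basic → Basic → Prop :=
  Relation.ReflTransGen fun B B' => TAssertion.pos B B' ∈ T

/-- The words over roles, last letter first, that name the anonymous individuals below `c`. -/
def Alive (T : TBox) (A : Set (Fact ℕ)) (c : ℕ) : List Role → Prop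
  | [] => True
  | [R] => (∃ B, ABasic A B c ∧ Sub T B (.some R)) ∧ ¬ ABasic A (.some R) c
  | S :: R :: w => Alive T A c (R :: w) ∧ Sub T (.some R.flip) (.some S) ∧ S ≠ R.flip

/-- The basic concepts of an element of the canonical model. -/
def HasB (T : TBox) (A : Set (Fact ℕ)) : ℕ × List Role → Basic → Prop
  | (c, []), B => ∃ B₀, ABasic A B₀ c ∧ Sub T B₀ B
  | (c, R :: w), B => Alive T A c (R :: w) ∧ Sub T (.some R.flip) B

/-- The role successors in the canonical model. -/
def CanRole (T : TBox) (A : Set (Fact ℕ)) (R : Role) (x y : ℕ × List Role) : Prop :=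
  (x.2 = [] ∧ y.2 = [] ∧ ARole A R x.1 y.1) ∨
  (y = (x.1, R :: x.2) ∧ Alive T A y.1 y.2) ∨
  (x = (y.1, R.flip :: y.2) ∧ Alive T A x.1 x.2)

/-- The domain contains all words. Those that are not alive belong to no concept and to no role, so
they do no harm and no subtype is needed. -/
def canModel (T : TBox) (A : Set (Fact ℕ)) : Interp where
  Dom := ℕ × List Role
  ind c := (c, [])
  ind_injective _ _ h := congrArg Prod.fst h
  conc N x := HasB T A x (.name N)
  role P x y := CanRole T A (.name P) x y

variable {T : TBox} {A : Set (Fact ℕ)}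

theorem canRole_flip (R : Role) (x y : ℕ × List Role) :
    CanRole T A R.flip x y ↔ CanRole T A R y x := by
  unfold CanRole
  rw [aRole_flip, Role.flip_flip]
  tauto

theorem canModel_roleExt (R : Role) (x y : ℕ × List Role) :
    (canModel T A).roleExt R x y ↔ CanRole T A R x y := by
  cases R with
  | name P => rfl
  | inv P => exact (canRole_flip (.name P) x y).symm

theorem Alive.tail {c : ℕ} {R : Role} {w : List Role} (h : Alive T A c (R :: w)) :
    Alive T A c w := by
  cases w with
  | nil => trivial
  | cons S w => exact h.1

theorem HasB.sub {x : ℕ × List Role} {B B' : Basic} (h : HasB T A x B) (h' : Sub T B B') :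
    HasB T A x B' := by
  obtain ⟨c, _ | ⟨R, w⟩⟩ := x
  · obtain ⟨B₀, h1, h2⟩ := h
    exact ⟨B₀, h1, h2.trans h'⟩
  · exact ⟨h.1, h.2.trans h'⟩

theorem HasB.of_alive {c : ℕ} {R : Role} {w : List Role} (h : Alive T A c (R :: w)) :
    HasB T A (c, w) (.some R) := by
  cases w with
  | nil => exact h.1
  | cons S w => exact ⟨h.1, h.2.1⟩

/-- The two exclusions in `Alive` cost no witnesses. If the last letter is `R.flip`, the parent is
an `R`-successor; if a constant has an `R`-successor in the ABox, that one serves; in all other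
cases the child with the added letter `R` is alive. -/
theorem hasB_some_iff (R : Role) (x : ℕ × List Role) :
    HasB T A x (.some R) ↔ ∃ y, CanRole T A R x y := by
  obtain ⟨c, w⟩ := x
  constructor
  · intro h
    by_cases hup : ∃ v, w = R.flip :: v
    · obtain ⟨v, rfl⟩ := hup
      exact ⟨(c, v), .inr (.inr ⟨rfl, h.1⟩)⟩
    · cases w with
      | nil =>
        by_cases hA : ABasic A (.some R) c
        · obtain ⟨d, hd⟩ := hA
          exact ⟨(d, []), .inl ⟨rfl, rfl, hd⟩⟩
        · exact ⟨(c, [R]), .inr (.inl ⟨rfl, h, hA⟩)⟩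
      | cons S v =>
        refine ⟨(c, R :: S :: v), .inr (.inl ⟨rfl, h.1, h.2, ?_⟩)⟩
        rintro rfl
        exact hup ⟨v, by simp⟩
  · rintro ⟨y, ⟨h1, h2, h3⟩ | ⟨rfl, h⟩ | ⟨h1, h2⟩⟩
    · obtain rfl : w = [] := h1
      exact ⟨.some R, ⟨_, h3⟩, .refl⟩
    · exact .of_alive h
    · obtain ⟨rfl, rfl⟩ := Prod.mk.inj h1
      refine ⟨h2, ?_⟩
      rw [Role.flip_flip]
      exact .refl

theorem canModel_basicExt (B : Basic) (x : ℕ × List Role) :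
    (canModel T A).basicExt B x ↔ HasB T A x B := by
  cases B with
  | name N => rfl
  | some R =>
    rw [hasB_some_iff]
    exact exists_congr fun y => canModel_roleExt R x y

/-- The functionality assertions hold in the ABox itself. -/
def AFunct (T : TBox) (A : Set (Fact ℕ)) : Prop :=
  ∀ R, TAssertion.funct R ∈ T → ∀ c d d', ARole A R c d → ARole A R c d' → d = d'

/-- The negative inclusions hold in the canonical model. -/
def NoClash (T : TBox) (A : Set (Fact ℕ)) : Prop :=
  ∀ B B', TAssertion.neg B B' ∈ T → ∀ x, HasB T A x B → ¬ HasB T A x B'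

/-- An anonymous `R`-child exists only where neither the ABox nor the parent supplies an
`R`-successor, and it is unique because its word is determined. Two different successors would thus
have to come from the ABox. -/
theorem canRole_functional (hA : AFunct T A) {R : Role} (hR : TAssertion.funct R ∈ T)
    {x y z : ℕ × List Role} (hy : CanRole T A R x y) (hz : CanRole T A R x z) : y = z := by
  obtain ⟨c, w⟩ := x
  obtain ⟨cy, wy⟩ := y
  obtain ⟨cz, wz⟩ := z
  simp only [CanRole, Prod.mk.injEq] at hy hz
  rcases hy with ⟨rfl, rfl, hy⟩ | ⟨⟨rfl, rfl⟩, hy⟩ | ⟨⟨rfl, rfl⟩, hy⟩ <;>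
  rcases hz with ⟨h, rfl, hz⟩ | ⟨⟨rfl, rfl⟩, hz⟩ | ⟨⟨h, h'⟩, hz⟩
  · rw [hA R hR _ _ _ hy hz]
  · exact absurd ⟨_, hy⟩ hz.2
  · simp at h'
  · subst h
    exact absurd ⟨_, hz⟩ hy.2
  · rfl
  · subst h'
    exact absurd (by simp) hy.2.2
  · simp at h
  · exact absurd (by simp) hz.2.2
  · simp_all

theorem canModel_isModel {A : ABox} (hA : AFunct T A) (hn : NoClash T A) :
    (canModel T A).IsModel T A := by
  refine ⟨fun a ha => ?_, fun F hF => ?_⟩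
  · cases a with
    | pos B B' =>
      intro x hx
      exact (canModel_basicExt B' x).2 (((canModel_basicExt B x).1 hx).sub (.single ha))
    | neg B B' =>
      intro x hx hx'
      exact hn B B' ha x ((canModel_basicExt B x).1 hx) ((canModel_basicExt B' x).1 hx')
    | funct R =>
      intro x y z hy hz
      exact canRole_functional hA ha ((canModel_roleExt R x y).1 hy) ((canModel_roleExt R x z).1 hz)
  · cases F with
    | conc N c => exact ⟨.name N, hF, .refl⟩
    | role P c d => exact .inl ⟨rfl, rfl, hF⟩

section Hom

variable {A : ABox} {I : Interp}

/-- The homomorphism from the canonical model to a model. -/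
noncomputable def canHom (I : Interp) (c : ℕ) : List Role → I.Dom
  | [] => I.ind c
  | R :: w => Classical.epsilon (h := ⟨I.ind c⟩) fun y => I.roleExt R (canHom I c w) y

theorem Interp.IsModel.basicExt_of_sub (hI : I.IsModel T A) {B B' : Basic} (h : Sub T B B')
    {x : I.Dom} (hx : I.basicExt B x) : I.basicExt B' x := by
  induction h with
  | refl => exact hx
  | tail _ h ih => exact hI.1 _ h x ih

theorem Interp.IsModel.roleExt_of_aRole (hI : I.IsModel T A) {R : Role} {c d : ℕ}
    (h : ARole A R c d) : I.roleExt R (I.ind c) (I.ind d) := by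
  cases R <;> exact hI.2 _ h

theorem Interp.IsModel.basicExt_of_aBasic (hI : I.IsModel T A) {B : Basic} {c : ℕ}
    (h : ABasic A B c) : I.basicExt B (I.ind c) := by
  cases B with
  | name N => exact hI.2 _ h
  | some R => exact h.elim fun d hd => ⟨_, hI.roleExt_of_aRole hd⟩

/-- Induction on the word: the parent satisfies `∃R` in the model, so the choice in `canHom` selects
a genuine `R`-successor, which satisfies `∃R⁻` and everything above it. -/
theorem Interp.IsModel.canHom_basicExt (hI : I.IsModel T A) (c : ℕ) (w : List Role) (B : Basic)
    (h : HasB T A (c, w) B) : I.basicExt B (canHom I c w) := by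
  induction w generalizing B with
  | nil =>
    obtain ⟨B₀, h1, h2⟩ := h
    exact hI.basicExt_of_sub h2 (hI.basicExt_of_aBasic h1)
  | cons R w ih =>
    obtain ⟨y, hy⟩ := ih _ (HasB.of_alive h.1)
    have : I.roleExt R (canHom I c w) (canHom I c (R :: w)) :=
      Classical.epsilon_spec (p := fun y => I.roleExt R (canHom I c w) y) ⟨y, hy⟩
    exact hI.basicExt_of_sub h.2 ⟨_, (I.roleExt_flip _ _ _).2 this⟩

theorem Interp.IsModel.canHom_alive (hI : I.IsModel T A) {c : ℕ} {R : Role} {w : List Role}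
    (h : Alive T A c (R :: w)) : I.roleExt R (canHom I c w) (canHom I c (R :: w)) := by
  obtain ⟨y, hy⟩ := hI.canHom_basicExt c w _ (HasB.of_alive h)
  exact Classical.epsilon_spec (p := fun y => I.roleExt R (canHom I c w) y) ⟨y, hy⟩

theorem Interp.IsModel.canHom_canRole (hI : I.IsModel T A) {R : Role} {x y : ℕ × List Role}
    (h : CanRole T A R x y) : I.roleExt R (canHom I x.1 x.2) (canHom I y.1 y.2) := by
  obtain ⟨c, w⟩ := x
  obtain ⟨d, v⟩ := y
  simp only [CanRole, Prod.mk.injEq] at h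
  rcases h with ⟨rfl, rfl, h⟩ | ⟨⟨rfl, rfl⟩, h⟩ | ⟨⟨rfl, rfl⟩, h⟩
  · exact hI.roleExt_of_aRole h
  · exact hI.canHom_alive h
  · have := hI.canHom_alive h
    rwa [Interp.roleExt_flip] at this

/-- Clashes in the canonical model are carried by `canHom` into any model, and a violation of
functionality in the ABox contradicts standard names. Conversely the canonical model itself is then
a model. Functionality needs no check beyond the ABox because of `canRole_functional`. -/
theorem consistent_iff : Consistent T A ↔ AFunct T A ∧ NoClash T A := by
  constructor
  · rintro ⟨I, hI⟩
    refine ⟨fun R hR c d d' h h' => ?_, fun B B' hB x hx hx' => ?_⟩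
    · exact I.ind_injective (hI.1 _ hR _ _ _ (hI.roleExt_of_aRole h) (hI.roleExt_of_aRole h'))
    · exact hI.1 _ hB _ (hI.canHom_basicExt _ _ _ hx) (hI.canHom_basicExt _ _ _ hx')
  · rintro ⟨h1, h2⟩
    exact ⟨_, canModel_isModel h1 h2⟩

/-- The canonical model is a model with a homomorphism to every other one that respects the
constants, and homomorphisms preserve unions of conjunctive queries. -/
theorem certain_iff_canModel (hc : Consistent T A) (v : ℕ → ℕ) (q : UCQ) :
    q.Certain T A v ↔
      ∃ d ∈ q.disjuncts, d.Sat (canModel T A) (fun x => ((v x, []) : ℕ × List Role)) := by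
  constructor
  · intro h
    exact h _ (canModel_isModel (consistent_iff.1 hc).1 (consistent_iff.1 hc).2)
  · rintro ⟨d, hd, g, hg, hsat⟩ I hI
    refine ⟨d, hd, fun x => canHom I (g x).1 (g x).2, fun x hx => ?_, fun a ha => ?_⟩
    · change canHom I (g x).1 (g x).2 = I.ind (v x)
      rw [hg x hx]
      rfl
    · have he : ∀ t : QTerm, QTerm.eval I (fun x => canHom I (g x).1 (g x).2) t =
          canHom I (QTerm.eval (canModel T A) g t).1 (QTerm.eval (canModel T A) g t).2 := by
        intro t
        cases t <;> rfl
      have := hsat a ha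
      cases a with
      | conc N t =>
        change I.basicExt (.name N) _
        rw [he]
        exact hI.canHom_basicExt _ _ _ this
      | role P t t' =>
        change I.roleExt (.name P) _ _
        rw [he, he]
        exact hI.canHom_canRole this

end Hom

/-! ### Matches of bounded depth -/

/-- Every alive word has the last letter of a word of `W`. -/
def Covers (T : TBox) (A : Set (Fact ℕ)) (W : List (ℕ × List Role)) : Prop :=
  (∀ x ∈ W, Alive T A x.1 x.2) ∧
    ∀ c R w, Alive T A c (R :: w) → ∃ x ∈ W, x.2.head? = some R

/-- The possible continuations of a nonempty alive word depend only on its last letter. This makes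
it possible to transplant subtrees in `shrink` and to describe the anonymous part by one word per
role. -/
theorem alive_cons_cons_iff_of_head {c d : ℕ} {R S : Role} {w v : List Role}
    (h : Alive T A c (R :: w)) (h' : Alive T A d (R :: v)) :
    Alive T A c (S :: R :: w) ↔ Alive T A d (S :: R :: v) := by
  simp [Alive, h, h']

open Classical in
/-- Move the clusters of anonymous individuals of `X` close to the constants. -/
noncomputable def shrink (X : Finset (ℕ × List Role)) (rep : Role → ℕ × List Role) (c : ℕ) :
    List Role → ℕ × List Role
  | [] => (c, [])
  | R :: w => if (c, w) ∈ X then ((shrink X rep c w).1, R :: (shrink X rep c w).2) else rep R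

section Shrink

variable {X : Finset (ℕ × List Role)} {rep : Role → ℕ × List Role}

/-- The relocation keeps aliveness and the last letter, hence by `alive_cons_cons_iff_of_head` also
the possible continuations. Constants stay where they are. -/
theorem shrink_spec (hrep : ∀ c R w, Alive T A c (R :: w) →
      Alive T A (rep R).1 (rep R).2 ∧ (rep R).2.head? = some R) (c : ℕ) (w : List Role)
    (h : Alive T A c w) :
    Alive T A (shrink X rep c w).1 (shrink X rep c w).2 ∧
      (shrink X rep c w).2.head? = w.head? ∧ (w = [] → (shrink X rep c w).1 = c) := by
  induction w with
  | nil => exact ⟨trivial, rfl, fun _ => rfl⟩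
  | cons R w ih =>
    simp only [shrink]
    split_ifs with hX
    · obtain ⟨h1, h2, h3⟩ := ih h.tail
      refine ⟨?_, rfl, by simp⟩
      cases w with
      | nil =>
        have h3 := h3 rfl
        simp only [List.head?_nil, List.head?_eq_none_iff] at h2
        rw [h2, h3]
        exact h
      | cons S w =>
        obtain ⟨v, hv⟩ : ∃ v, (shrink X rep c (S :: w)).2 = S :: v := by
          revert h2
          cases (shrink X rep c (S :: w)).2 <;> simp
        rw [hv] at h1 ⊢
        exact (alive_cons_cons_iff_of_head h.tail h1).1 h
    · obtain ⟨h1, h2⟩ := hrep c R w h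
      exact ⟨h1, h2, by simp⟩

theorem shrink_hasB (hrep : ∀ c R w, Alive T A c (R :: w) →
      Alive T A (rep R).1 (rep R).2 ∧ (rep R).2.head? = some R) {x : ℕ × List Role} {B : Basic}
    (h : HasB T A x B) : HasB T A (shrink X rep x.1 x.2) B := by
  obtain ⟨c, w⟩ := x
  cases w with
  | nil => exact h
  | cons R w =>
    obtain ⟨h1, h2, -⟩ := shrink_spec (X := X) hrep c (R :: w) h.1
    simp only
    generalize shrink X rep c (R :: w) = y at h1 h2 ⊢
    obtain ⟨d, v⟩ := y
    cases v with
    | nil => simp at h2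
    | cons S v =>
      simp only [List.head?_cons, Option.some.injEq] at h2
      subst h2
      exact ⟨h1, h.2⟩

theorem shrink_canRole (hrep : ∀ c R w, Alive T A c (R :: w) →
      Alive T A (rep R).1 (rep R).2 ∧ (rep R).2.head? = some R) {x y : ℕ × List Role} {R : Role}
    (hx : x ∈ X) (hy : y ∈ X) (h : CanRole T A R x y) :
    CanRole T A R (shrink X rep x.1 x.2) (shrink X rep y.1 y.2) := by
  have key : ∀ (R : Role) (x : ℕ × List Role), x ∈ X → Alive T A x.1 (R :: x.2) →
      CanRole T A R (shrink X rep x.1 x.2) (shrink X rep x.1 (R :: x.2)) := by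
    intro R x hx h
    refine .inr (.inl ⟨?_, (shrink_spec hrep _ _ h).1⟩)
    simp [shrink, hx]
  obtain ⟨c, w⟩ := x
  obtain ⟨d, v⟩ := y
  simp only [CanRole, Prod.mk.injEq] at h
  rcases h with ⟨rfl, rfl, h⟩ | ⟨⟨rfl, rfl⟩, h⟩ | ⟨⟨rfl, rfl⟩, h⟩
  · exact .inl ⟨rfl, rfl, h⟩
  · exact key R (d, w) hx h
  · have := key R.flip (c, v) hy h
    exact (canRole_flip _ _ _).1 this

/-- Starting from a representative of length at most `k`, or from a constant, the image grows by one
letter only when the parent lies in `X`. Each growth is charged to a different, shorter element of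
`X`. -/
theorem length_shrink (k : ℕ) (c : ℕ) (w : List Role)
    (hk : ∀ c R w, Alive T A c (R :: w) → (rep R).2.length ≤ k) (h : Alive T A c w) :
    (shrink X rep c w).2.length ≤ k + (X.filter fun x => x.2.length < w.length).card := by
  induction w with
  | nil => simp [shrink]
  | cons R w ih =>
    simp only [shrink]
    split_ifs with hX
    · have : (X.filter fun x => x.2.length < w.length).card <
          (X.filter fun x => x.2.length < (R :: w).length).card := by
        -- The parent `(c, w)` is the element that is newly counted.
        refine Finset.card_lt_card (Finset.ssubset_iff_of_subset ?_ |>.2 ⟨(c, w), ?_, ?_⟩)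
        · intro x
          simp only [Finset.mem_filter, List.length_cons]
          exact fun h => ⟨h.1, h.2.trans (Nat.lt_succ_self _)⟩
        · simp [hX]
        · simp
      have := ih h.tail
      simp only [List.length_cons] at *
      omega
    · exact (hk c R w h).trans (Nat.le_add_right _ _)

end Shrink

end KABV
namespace KABV

/-! ## Decidability over DL-Lite knowledge bases -/

section Decidable

variable {α β γ : Type} [Primcodable α] [Primcodable β] [Primcodable γ]

/-- Decidable predicates: both the predicate and its complement are semidecidable. -/
def Deci (p : α → Prop) : Prop := Semi p ∧ Semi (fun a => ¬ p a)

namespace Deci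

theorem of_iff {p q : α → Prop} (hp : Deci p) (h : ∀ a, q a ↔ p a) : Deci q :=
  ⟨hp.1.of_iff h, hp.2.of_iff fun a => not_congr (h a)⟩

theorem const (p : Prop) : Deci (fun _ : α => p) := ⟨.const p, .const _⟩

theorem eq {f g : α → β} (hf : PRec f) (hg : PRec g) : Deci (fun a => f a = g a) :=
  ⟨.eq hf hg, .ne hf hg⟩

theorem lt {f g : α → ℕ} (hf : PRec f) (hg : PRec g) : Deci (fun a => f a < g a) :=
  ⟨.lt hf hg, (Semi.le hg hf).of_iff fun _ => not_lt⟩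

theorem le {f g : α → ℕ} (hf : PRec f) (hg : PRec g) : Deci (fun a => f a ≤ g a) :=
  ⟨.le hf hg, (Semi.lt hg hf).of_iff fun _ => not_le⟩

theorem mem {f : α → β} {g : α → List β} (hf : PRec f) (hg : PRec g) :
    Deci (fun a => f a ∈ g a) := ⟨.mem hf hg, .not_mem hf hg⟩

theorem not {p : α → Prop} (hp : Deci p) : Deci (fun a => ¬ p a) :=
  ⟨hp.2, hp.1.of_iff fun _ => not_not⟩

theorem and {p q : α → Prop} (hp : Deci p) (hq : Deci q) : Deci (fun a => p a ∧ q a) :=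
  ⟨hp.1.and hq.1, (hp.2.or hq.2).of_iff fun _ => by tauto⟩

theorem or {p q : α → Prop} (hp : Deci p) (hq : Deci q) : Deci (fun a => p a ∨ q a) :=
  ⟨hp.1.or hq.1, (hp.2.and hq.2).of_iff fun _ => by tauto⟩

theorem imp {p q : α → Prop} (hp : Deci p) (hq : Deci q) : Deci (fun a => p a → q a) :=
  (hp.not.or hq).of_iff fun _ => by tauto

theorem iff {p q : α → Prop} (hp : Deci p) (hq : Deci q) : Deci (fun a => p a ↔ q a) :=
  ((hp.imp hq).and (hq.imp hp)).of_iff fun _ => by tauto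

theorem bex {p : α → β → Prop} {f : α → List β} (hp : Deci (fun x : α × β => p x.1 x.2))
    (hf : PRec f) : Deci (fun a => ∃ b ∈ f a, p a b) :=
  ⟨.bex hp.1 hf, (Semi.ball (p := fun a b => ¬ p a b) hp.2 hf).of_iff fun _ => by simp⟩

theorem ball {p : α → β → Prop} {f : α → List β} (hp : Deci (fun x : α × β => p x.1 x.2))
    (hf : PRec f) : Deci (fun a => ∀ b ∈ f a, p a b) :=
  ⟨.ball hp.1 hf, (Semi.bex (p := fun a b => ¬ p a b) hp.2 hf).of_iff fun _ => by simp⟩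

theorem ballLt {p : α → ℕ → Prop} {f : α → ℕ} (hp : Deci (fun x : α × ℕ => p x.1 x.2))
    (hf : PRec f) : Deci (fun a => ∀ b < f a, p a b) :=
  ⟨.ballLt hp.1 hf, (Semi.bexLt (p := fun a b => ¬ p a b) hp.2 hf).of_iff fun _ => by simp⟩

theorem sumElim {o : α → β ⊕ γ} {p : α → β → Prop} {q : α → γ → Prop} (ho : PRec o)
    (hp : Deci (fun x : α × β => p x.1 x.2)) (hq : Deci (fun x : α × γ => q x.1 x.2)) :
    Deci (fun a => Sum.elim (p a) (q a) (o a)) := by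
  have key : ∀ (p : α → β → Prop) (q : α → γ → Prop),
      Semi (fun x : α × β => p x.1 x.2) → Semi (fun x : α × γ => q x.1 x.2) →
      Semi (fun a => Sum.elim (p a) (q a) (o a)) := fun p q hp hq => by
    refine Semi.of_iff (.or (.ex (p := fun a b => o a = .inl b ∧ p a b)
      (.and (.eq (by fun_prop) (by fun_prop)) hp)) (.ex (p := fun a c => o a = .inr c ∧ q a c)
      (.and (.eq (by fun_prop) (by fun_prop)) hq))) fun a => ?_
    cases o a <;> simp
  refine ⟨key _ _ hp.1 hq.1, (key (fun a b => ¬ p a b) (fun a c => ¬ q a c) hp.2 hq.2).of_iff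
    fun a => ?_⟩
  beta_reduce
  cases o a <;> rfl

end Deci

end Decidable

/-! ### Primitive recursive coding of the syntax -/

def Role.equiv : Role ≃ ℕ ⊕ ℕ where
  toFun | .name P => .inl P | .inv P => .inr P
  invFun := Sum.elim .name .inv
  left_inv R := by cases R <;> rfl
  right_inv x := by cases x <;> rfl

instance : Primcodable Role := .ofEquiv _ Role.equiv

def Basic.equiv : Basic ≃ ℕ ⊕ Role where
  toFun | .name P => .inl P | .some P => .inr P
  invFun := Sum.elim .name .some
  left_inv R := by cases R <;> rfl
  right_inv x := by cases x <;> rfl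

instance : Primcodable Basic := .ofEquiv _ Basic.equiv

def TAssertion.equiv : TAssertion ≃ (Basic × Basic) ⊕ (Basic × Basic) ⊕ Role where
  toFun | .pos B B' => .inl (B, B') | .neg B B' => .inr (.inl (B, B')) | .funct R => .inr (.inr R)
  invFun := Sum.elim (fun p => .pos p.1 p.2) (Sum.elim (fun p => .neg p.1 p.2) .funct)
  left_inv R := by cases R <;> rfl
  right_inv x := by rcases x with x | x | x <;> rfl

instance : Primcodable TAssertion := .ofEquiv _ TAssertion.equiv

def Fact.equiv (τ : Type) : Fact τ ≃ (ℕ × τ) ⊕ (ℕ × τ × τ) where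
  toFun | .conc N t => .inl (N, t) | .role P t t' => .inr (P, t, t')
  invFun := Sum.elim (fun p => .conc p.1 p.2) (fun p => .role p.1 p.2.1 p.2.2)
  left_inv R := by cases R <;> rfl
  right_inv x := by rcases x with x | x <;> rfl

instance {τ : Type} [Primcodable τ] : Primcodable (Fact τ) := .ofEquiv _ (Fact.equiv τ)

def QTerm.equiv : QTerm ≃ ℕ ⊕ ℕ where
  toFun | .var P => .inl P | .const P => .inr P
  invFun := Sum.elim .var .const
  left_inv R := by cases R <;> rfl
  right_inv x := by cases x <;> rfl

instance : Primcodable QTerm := .ofEquiv _ QTerm.equiv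

def CQ.equiv : CQ ≃ List ℕ × List (Fact QTerm) where
  toFun q := (q.exVars, q.atoms)
  invFun p := ⟨p.1, p.2⟩
  left_inv _ := rfl
  right_inv _ := rfl

instance : Primcodable CQ := .ofEquiv _ CQ.equiv

def UCQ.equiv : UCQ ≃ List CQ where
  toFun q := q.disjuncts
  invFun p := ⟨p⟩
  left_inv _ := rfl
  right_inv _ := rfl

instance : Primcodable UCQ := .ofEquiv _ UCQ.equiv

def SCall.equiv : SCall ≃ ℕ × List ℕ where
  toFun q := (q.fn, q.args)
  invFun p := ⟨p.1, p.2⟩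
  left_inv _ := rfl
  right_inv _ := rfl

instance : Primcodable SCall := .ofEquiv _ SCall.equiv

def GTerm.equiv : GTerm ≃ ℕ ⊕ SCall where
  toFun | .val P => .inl P | .call P => .inr P
  invFun := Sum.elim .val .call
  left_inv R := by cases R <;> rfl
  right_inv x := by cases x <;> rfl

instance : Primcodable GTerm := .ofEquiv _ GTerm.equiv

def ETerm.equiv : ETerm ≃ ℕ ⊕ ℕ ⊕ ℕ × List ℕ where
  toFun | .var P => .inl P | .const P => .inr (.inl P) | .skolem f xs => .inr (.inr (f, xs))
  invFun := Sum.elim .var (Sum.elim .const fun p => .skolem p.1 p.2)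
  left_inv R := by cases R <;> rfl
  right_inv x := by rcases x with x | x | x <;> rfl

instance : Primcodable ETerm := .ofEquiv _ ETerm.equiv

section Coding

variable {α β σ τ υ : Type} [Primcodable α] [Primcodable β] [Primcodable σ] [Primcodable τ]
  [Primcodable υ]

@[fun_prop]
theorem PRec.equivRole {f : α → Role} (hf : PRec f) : PRec (fun a => Role.equiv (f a)) :=
  Primrec.of_equiv.comp hf

@[fun_prop]
theorem PRec.equivBasic {f : α → Basic} (hf : PRec f) : PRec (fun a => Basic.equiv (f a)) :=
  Primrec.of_equiv.comp hf

@[fun_prop]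
theorem PRec.equivTAssertion {f : α → TAssertion} (hf : PRec f) :
    PRec (fun a => TAssertion.equiv (f a)) :=
  Primrec.of_equiv.comp hf

@[fun_prop]
theorem PRec.equivFact {f : α → Fact τ} (hf : PRec f) : PRec (fun a => Fact.equiv τ (f a)) :=
  Primrec.of_equiv.comp hf

@[fun_prop]
theorem PRec.equivQTerm {f : α → QTerm} (hf : PRec f) : PRec (fun a => QTerm.equiv (f a)) :=
  Primrec.of_equiv.comp hf

@[fun_prop]
theorem PRec.equivGTerm {f : α → GTerm} (hf : PRec f) : PRec (fun a => GTerm.equiv (f a)) :=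
  Primrec.of_equiv.comp hf

@[fun_prop]
theorem PRec.equivETerm {f : α → ETerm} (hf : PRec f) : PRec (fun a => ETerm.equiv (f a)) :=
  Primrec.of_equiv.comp hf

@[fun_prop]
theorem PRec.exVars {f : α → CQ} (hf : PRec f) : PRec (fun a => (f a).exVars) :=
  (PRec.fst (f := CQ.equiv) Primrec.of_equiv).comp hf

@[fun_prop]
theorem PRec.atoms {f : α → CQ} (hf : PRec f) : PRec (fun a => (f a).atoms) :=
  (PRec.snd (f := CQ.equiv) Primrec.of_equiv).comp hf

@[fun_prop]
theorem PRec.disjuncts {f : α → UCQ} (hf : PRec f) : PRec (fun a => (f a).disjuncts) :=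
  PRec.comp (f := UCQ.equiv) Primrec.of_equiv hf

@[fun_prop]
theorem PRec.roleName {f : α → ℕ} (hf : PRec f) : PRec (fun a => Role.name (f a)) :=
  PRec.comp (f := Role.equiv.symm) Primrec.of_equiv_symm (.inl hf)

@[fun_prop]
theorem PRec.roleInv {f : α → ℕ} (hf : PRec f) : PRec (fun a => Role.inv (f a)) :=
  PRec.comp (f := Role.equiv.symm) Primrec.of_equiv_symm (.inr hf)

@[fun_prop]
theorem PRec.basicName {f : α → ℕ} (hf : PRec f) : PRec (fun a => Basic.name (f a)) :=
  PRec.comp (f := Basic.equiv.symm) Primrec.of_equiv_symm (.inl hf)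

@[fun_prop]
theorem PRec.basicSome {f : α → Role} (hf : PRec f) : PRec (fun a => Basic.some (f a)) :=
  PRec.comp (f := Basic.equiv.symm) Primrec.of_equiv_symm (.inr hf)

@[fun_prop]
theorem PRec.pos {f g : α → Basic} (hf : PRec f) (hg : PRec g) :
    PRec (fun a => TAssertion.pos (f a) (g a)) :=
  PRec.comp (f := TAssertion.equiv.symm) Primrec.of_equiv_symm (.inl (.pair hf hg))

@[fun_prop]
theorem PRec.conc {f : α → ℕ} {g : α → τ} (hf : PRec f) (hg : PRec g) :
    PRec (fun a => Fact.conc (f a) (g a)) :=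
  PRec.comp (f := (Fact.equiv τ).symm) Primrec.of_equiv_symm (.inl (.pair hf hg))

@[fun_prop]
theorem PRec.role {f : α → ℕ} {g h : α → τ} (hf : PRec f) (hg : PRec g) (hh : PRec h) :
    PRec (fun a => Fact.role (f a) (g a) (h a)) :=
  PRec.comp (f := (Fact.equiv τ).symm) Primrec.of_equiv_symm (.inr (.pair hf (.pair hg hh)))

@[fun_prop]
theorem PRec.scall {f : α → ℕ} {g : α → List ℕ} (hf : PRec f) (hg : PRec g) :
    PRec (fun a => SCall.mk (f a) (g a)) :=
  PRec.comp (f := SCall.equiv.symm) Primrec.of_equiv_symm (.pair hf hg)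

@[fun_prop]
theorem PRec.val {f : α → ℕ} (hf : PRec f) : PRec (fun a => GTerm.val (f a)) :=
  PRec.comp (f := GTerm.equiv.symm) Primrec.of_equiv_symm (.inl hf)

@[fun_prop]
theorem PRec.call {f : α → SCall} (hf : PRec f) : PRec (fun a => GTerm.call (f a)) :=
  PRec.comp (f := GTerm.equiv.symm) Primrec.of_equiv_symm (.inr hf)

@[fun_prop]
theorem PRec.flip {f : α → Role} (hf : PRec f) : PRec (fun a => (f a).flip) := by
  refine (?_ : PRec fun a => Sum.elim (fun P => Role.inv P) (fun P => Role.name P)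
    (Role.equiv (f a))).of_eq fun a => by cases f a <;> rfl
  exact PRec.sumCases (by fun_prop) (by fun_prop) (by fun_prop)

@[fun_prop]
theorem PRec.factMap {f : α → Fact τ} {h : α → τ → υ} (hf : PRec f)
    (hh : PRec (fun p : α × τ => h p.1 p.2)) : PRec (fun a => (f a).map (h a)) := by
  refine (?_ : PRec fun a => Sum.elim (fun p : ℕ × τ => Fact.conc p.1 (h a p.2))
    (fun p : ℕ × τ × τ => Fact.role p.1 (h a p.2.1) (h a p.2.2)) (Fact.equiv τ (f a))).of_eq
      fun a => by cases f a <;> rfl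
  have h1 : PRec fun p : α × ℕ × τ => h p.1 p.2.2 :=
    hh.comp (g := fun p : α × ℕ × τ => (p.1, p.2.2)) (by fun_prop)
  have h2 : PRec fun p : α × ℕ × τ × τ => h p.1 p.2.2.1 :=
    hh.comp (g := fun p : α × ℕ × τ × τ => (p.1, p.2.2.1)) (by fun_prop)
  have h3 : PRec fun p : α × ℕ × τ × τ => h p.1 p.2.2.2 :=
    hh.comp (g := fun p : α × ℕ × τ × τ => (p.1, p.2.2.2)) (by fun_prop)
  exact PRec.sumCases (f := fun a (p : ℕ × τ) => Fact.conc p.1 (h a p.2))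
    (g := fun a (p : ℕ × τ × τ) => Fact.role p.1 (h a p.2.1) (h a p.2.2)) (by fun_prop)
    (by fun_prop) (by fun_prop)

@[fun_prop]
theorem PRec.terms {f : α → Fact τ} (hf : PRec f) : PRec (fun a => (f a).terms) := by
  refine (?_ : PRec fun a => Sum.elim (fun p : ℕ × τ => [p.2])
    (fun p : ℕ × τ × τ => [p.2.1, p.2.2]) (Fact.equiv τ (f a))).of_eq
      fun a => by cases f a <;> rfl
  exact PRec.sumCases (f := fun a (p : ℕ × τ) => [p.2])
    (g := fun a (p : ℕ × τ × τ) => [p.2.1, p.2.2]) (by fun_prop)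
    (by fun_prop) (by fun_prop)

@[fun_prop]
theorem PRec.ground {f : α → List ℕ} {g : α → ETerm} (hf : PRec f) (hg : PRec g) :
    PRec (fun a => (g a).ground (fun x => (f a).getD x 0)) := by
  refine (?_ : PRec fun a => Sum.elim (fun x => GTerm.val ((f a).getD x 0))
    (Sum.elim (fun c => GTerm.val c) (fun p : ℕ × List ℕ =>
      GTerm.call ⟨p.1, p.2.map fun x => (f a).getD x 0⟩)) (ETerm.equiv (g a))).of_eq
      fun a => by cases g a <;> rfl
  refine PRec.sumCases (f := fun a x => GTerm.val ((f a).getD x 0))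
    (g := fun a => Sum.elim (fun c => GTerm.val c) (fun p : ℕ × List ℕ =>
      GTerm.call ⟨p.1, p.2.map fun x => (f a).getD x 0⟩)) (by fun_prop) (by fun_prop) ?_
  exact PRec.sumCases (α := α × (ℕ ⊕ ℕ × List ℕ)) (o := fun p => p.2)
    (f := fun _ c => GTerm.val c) (g := fun a (p : ℕ × List ℕ) =>
      GTerm.call ⟨p.1, p.2.map fun x => (f a.1).getD x 0⟩) (by fun_prop) (by fun_prop)
      (by fun_prop)

end Coding

end KABV
namespace KABV

/-! ### Deciding the canonical model -/

/-- The facts of a list. -/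
def factSet (A : List (Fact ℕ)) : Set (Fact ℕ) := {F | F ∈ A}

/-- The basic concepts that a fact may assert. -/
def factBasics (F : Fact ℕ) : List Basic :=
  Sum.elim (fun p => [.name p.1]) (fun p => [.some (.name p.1), .some (.inv p.1)])
    (Fact.equiv ℕ F)

/-- The role assertion `R(c,d)` as a fact. -/
def roleFact (R : Role) (c d : ℕ) : Fact ℕ :=
  Sum.elim (fun P => .role P c d) (fun P => .role P d c) (Role.equiv R)

theorem aRole_iff_roleFact {A : Set (Fact ℕ)} {R : Role} {c d : ℕ} :
    ARole A R c d ↔ roleFact R c d ∈ A := by cases R <;> rfl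

theorem ABasic.exists_fact {A : List (Fact ℕ)} {B : Basic} {c : ℕ} (h : ABasic (factSet A) B c) :
    ∃ F ∈ A, B ∈ factBasics F ∧ c ∈ F.terms := by
  cases B with
  | name N => exact ⟨_, h, by simp [factBasics, Fact.equiv], by simp [Fact.terms]⟩
  | some R =>
    obtain ⟨d, hd⟩ := h
    cases R <;> exact ⟨_, hd, by simp [factBasics, Fact.equiv], by simp [Fact.terms]⟩

/-- The facts that are true in the canonical model. -/
def CanFact (T : TBox) (A : Set (Fact ℕ)) (F : Fact (ℕ × List Role)) : Prop :=
  (canModel T A).SatFact F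

/-- `c` has an anonymous `R`-successor. -/
def AliveStart (T : TBox) (A : Set (Fact ℕ)) (c : ℕ) (R : Role) : Prop :=
  (∃ B, ABasic A B c ∧ Sub T B (.some R)) ∧ ¬ ABasic A (.some R) c

/-- Anonymous `R`-successors have anonymous `S`-successors. -/
def AliveLink (T : TBox) (R S : Role) : Prop := Sub T (.some R.flip) (.some S) ∧ S ≠ R.flip

/-- Only neighbouring letters interact, and the final position is the letter next to the constant.
The recursion on words thereby becomes a bounded quantification over positions. -/
theorem alive_iff {T : TBox} {A : Set (Fact ℕ)} {c : ℕ} {w : List Role} :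
    Alive T A c w ↔ ∀ i < w.length,
      (i + 1 = w.length ∧ AliveStart T A c (w.getD i (.name 0))) ∨
      (i + 1 < w.length ∧ AliveLink T (w.getD (i + 1) (.name 0)) (w.getD i (.name 0))) := by
  induction w with
  | nil => simp [Alive]
  | cons S w ih =>
    cases w with
    | nil => simp [Alive, AliveStart]
    | cons R w =>
      rw [Alive, ih]
      constructor
      · rintro ⟨h1, h2⟩ (_ | i) hi
        · exact .inr ⟨by simp, h2⟩
        · simpa using h1 i (by simpa using hi)
      · intro h
        refine ⟨fun i hi => ?_, ?_⟩
        · simpa using h (i + 1) (by simpa using hi)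
        · simpa [AliveLink] using h 0 (by simp)

section

variable {α β : Type} [Primcodable α] [Primcodable β]

@[fun_prop]
theorem PRec.factBasics {f : α → Fact ℕ} (hf : PRec f) : PRec (fun a => factBasics (f a)) :=
  PRec.sumCases (f := fun _ (p : ℕ × ℕ) => [Basic.name p.1])
    (g := fun _ (p : ℕ × ℕ × ℕ) => [Basic.some (.name p.1), .some (.inv p.1)])
    (by fun_prop) (by fun_prop) (by fun_prop)

@[fun_prop]
theorem PRec.roleFact {R : α → Role} {c d : α → ℕ} (hR : PRec R) (hc : PRec c) (hd : PRec d) :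
    PRec (fun a => roleFact (R a) (c a) (d a)) :=
  PRec.sumCases (f := fun a P => Fact.role P (c a) (d a))
    (g := fun a P => Fact.role P (d a) (c a))
    (by fun_prop) (by fun_prop) (by fun_prop)

theorem Semi.sub {T : α → TBox} {B B' : α → Basic} (hT : PRec T) (hB : PRec B) (hB' : PRec B') :
    Semi (fun a => Sub (T a) (B a) (B' a)) := by
  refine Semi.of_iff (Semi.derivable (R := fun a P x => x = B a ∨
    ∃ y ∈ P, TAssertion.pos y x ∈ T a) ?_ hB') fun a => ⟨fun h => ?_, fun h => ?_⟩
  · refine .or (.eq ?_ ?_) (.bex (.mem ?_ ?_) ?_) <;> fun_prop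
  · generalize B' a = C at h
    induction h with
    | refl => exact .intro [] _ (.inl rfl) (by simp)
    | tail _ h ih => exact .intro [_] _ (.inr ⟨_, List.mem_singleton_self _, h⟩) (by simpa using ih)
  · generalize B' a = C at h
    induction h with
    | intro P x h _ ih =>
      rcases h with rfl | ⟨y, hy, h⟩
      · exact .refl
      · exact (ih y hy).tail h

/-- Unreachability has a finite certificate, a set closed under the positive inclusions that
separates the two concepts. Hence subsumption is decidable and not merely semidecidable. -/
theorem not_sub_iff {T : TBox} {B B' : Basic} : ¬ Sub T B B' ↔
    ∃ S : List Basic, B ∈ S ∧ (∀ a ∈ T, Sum.elim (fun p => p.1 ∈ S → p.2 ∈ S)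
      (fun _ => True) (TAssertion.equiv a)) ∧ B' ∉ S := by
  classical
  constructor
  · intro h
    -- Everything reachable from `B` is `B` itself or a right-hand side of an inclusion, so the
    -- reachable concepts form a finite list.
    refine ⟨B :: ((T.flatMap fun a => Sum.elim (fun p => [p.2]) (fun _ => [])
      (TAssertion.equiv a)).filter fun C => Sub T B C), by simp, fun a ha => ?_, ?_⟩
    · cases a with
      | pos C C' =>
        intro hC
        have hC : Sub T B C := by
          rcases List.mem_cons.1 hC with hC | hC
          · rw [show C = B from hC]; exact .refl
          · exact of_decide_eq_true (List.mem_filter.1 hC).2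
        refine List.mem_cons_of_mem _ (List.mem_filter.2 ⟨?_, decide_eq_true (hC.tail ha)⟩)
        exact List.mem_flatMap.2 ⟨_, ha, by simp [TAssertion.equiv]⟩
      | neg C C' => trivial
      | funct R => trivial
    · intro hB
      rcases List.mem_cons.1 hB with rfl | hB
      · exact h .refl
      · exact h (of_decide_eq_true (List.mem_filter.1 hB).2)
  · rintro ⟨S, h1, h2, h3⟩ h
    refine h3 ?_
    clear h3
    induction h with
    | refl => exact h1
    | tail _ h ih => exact h2 _ h ih

theorem Deci.sub {T : α → TBox} {B B' : α → Basic} (hT : PRec T) (hB : PRec B) (hB' : PRec B') :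
    Deci (fun a => Sub (T a) (B a) (B' a)) := by
  refine ⟨.sub hT hB hB', Semi.of_iff ?_ fun a => not_sub_iff⟩
  refine .ex (.and (.mem (by fun_prop) (by fun_prop)) (.and (.ball ?_ (by fun_prop))
    (.not_mem (by fun_prop) (by fun_prop))))
  refine (Deci.sumElim (α := (α × List Basic) × TAssertion)
    (o := fun x => TAssertion.equiv x.2) (p := fun x p => p.1 ∈ x.1.2 → p.2 ∈ x.1.2)
    (q := fun _ _ => True) (by fun_prop) ?_ (.const _)).1
  exact .imp (.mem (by fun_prop) (by fun_prop)) (.mem (by fun_prop) (by fun_prop))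

theorem Deci.aRole {A : α → List (Fact ℕ)} {R : α → Role} {c d : α → ℕ} (hA : PRec A)
    (hR : PRec R) (hc : PRec c) (hd : PRec d) :
    Deci (fun a => ARole (factSet (A a)) (R a) (c a) (d a)) := by
  refine Deci.of_iff (Deci.mem (f := fun a => KABV.roleFact (R a) (c a) (d a)) (g := A) ?_ hA)
    fun a => aRole_iff_roleFact
  fun_prop

theorem Deci.aBasic {A : α → List (Fact ℕ)} {B : α → Basic} {c : α → ℕ} (hA : PRec A)
    (hB : PRec B) (hc : PRec c) : Deci (fun a => ABasic (factSet (A a)) (B a) (c a)) := by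
  refine Deci.of_iff (Deci.sumElim (o := fun a => Basic.equiv (B a))
    (p := fun a N => Fact.conc N (c a) ∈ A a)
    (q := fun a R => ∃ F ∈ A a, ∃ d ∈ F.terms, ARole (factSet (A a)) R (c a) d)
    (by fun_prop) (.mem (by fun_prop) (by fun_prop))
    (.bex (.bex (.aRole (by fun_prop) (by fun_prop) (by fun_prop) (by fun_prop)) (by fun_prop))
      (by fun_prop))) fun a => ?_
  cases B a with
  | name N => rfl
  | some R =>
    refine ⟨fun ⟨d, hd⟩ => ⟨roleFact R (c a) d, aRole_iff_roleFact.1 hd, d, ?_, hd⟩,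
      fun ⟨F, hF, d, hd, h⟩ => ⟨d, h⟩⟩
    cases R <;> simp [roleFact, Role.equiv, Fact.terms]

/-- The quantifier over all basic concepts is harmless: an asserted concept is one of the concepts
that some fact of the ABox may assert. -/
theorem Deci.hasStart {T : α → TBox} {A : α → List (Fact ℕ)} {B : α → Basic} {c : α → ℕ}
    (hT : PRec T) (hA : PRec A) (hB : PRec B) (hc : PRec c) :
    Deci (fun a => ∃ B₀, ABasic (factSet (A a)) B₀ (c a) ∧ Sub (T a) B₀ (B a)) := by
  refine Deci.of_iff (?_ : Deci fun a => ∃ F ∈ A a, ∃ B₀ ∈ KABV.factBasics F,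
    ABasic (factSet (A a)) B₀ (c a) ∧ Sub (T a) B₀ (B a)) fun a => ?_
  · refine .bex (.bex (.and (.aBasic ?_ ?_ ?_) (.sub ?_ ?_ ?_)) ?_) ?_ <;> fun_prop
  · constructor
    · rintro ⟨B₀, h, h'⟩
      obtain ⟨F, hF, hB, -⟩ := h.exists_fact
      exact ⟨F, hF, B₀, hB, h, h'⟩
    · rintro ⟨F, hF, B₀, -, h⟩
      exact ⟨B₀, h⟩

theorem Deci.alive {T : α → TBox} {A : α → List (Fact ℕ)} {c : α → ℕ} {w : α → List Role}
    (hT : PRec T) (hA : PRec A) (hc : PRec c) (hw : PRec w) :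
    Deci (fun a => Alive (T a) (factSet (A a)) (c a) (w a)) := by
  refine Deci.of_iff ?_ fun a => alive_iff
  refine .ballLt (.or (.and (.eq ?_ ?_) (.and (.hasStart ?_ ?_ ?_ ?_) (.not (.aBasic ?_ ?_ ?_))))
    (.and (.lt ?_ ?_) (.and (.sub ?_ ?_ ?_) (.not (.eq ?_ ?_))))) ?_ <;> fun_prop

theorem Deci.hasB {T : α → TBox} {A : α → List (Fact ℕ)} {x : α → ℕ × List Role} {B : α → Basic}
    (hT : PRec T) (hA : PRec A) (hx : PRec x) (hB : PRec B) :
    Deci (fun a => HasB (T a) (factSet (A a)) (x a) (B a)) := by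
  refine Deci.of_iff (?_ : Deci fun a => ((x a).2 = [] ∧
    ∃ B₀, ABasic (factSet (A a)) B₀ (x a).1 ∧ Sub (T a) B₀ (B a)) ∨
    ((x a).2 ≠ [] ∧ Alive (T a) (factSet (A a)) (x a).1 (x a).2 ∧
      Sub (T a) (.some (((x a).2).getD 0 (.name 0)).flip) (B a))) fun a => ?_
  · refine .or (.and (.eq ?_ ?_) (.hasStart ?_ ?_ ?_ ?_)) (.and (.not (.eq ?_ ?_))
      (.and (.alive ?_ ?_ ?_ ?_) (.sub ?_ ?_ ?_))) <;> fun_prop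
  · obtain ⟨c, _ | ⟨R, w⟩⟩ := x a <;> simp [HasB]

theorem Deci.canRole {T : α → TBox} {A : α → List (Fact ℕ)} {R : α → Role}
    {x y : α → ℕ × List Role} (hT : PRec T) (hA : PRec A) (hR : PRec R) (hx : PRec x)
    (hy : PRec y) : Deci (fun a => CanRole (T a) (factSet (A a)) (R a) (x a) (y a)) := by
  refine .or (.and (.eq ?_ ?_) (.and (.eq ?_ ?_) (.aRole ?_ ?_ ?_ ?_))) (.or (.and (.eq ?_ ?_)
    (.alive ?_ ?_ ?_ ?_)) (.and (.eq ?_ ?_) (.alive ?_ ?_ ?_ ?_))) <;> fun_prop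

theorem Deci.canFact {T : α → TBox} {A : α → List (Fact ℕ)} {F : α → Fact (ℕ × List Role)}
    (hT : PRec T) (hA : PRec A) (hF : PRec F) :
    Deci (fun a => CanFact (T a) (factSet (A a)) (F a)) := by
  refine Deci.of_iff (Deci.sumElim (o := fun a => Fact.equiv _ (F a))
    (p := fun a p => HasB (T a) (factSet (A a)) p.2 (.name p.1))
    (q := fun a p => CanRole (T a) (factSet (A a)) (.name p.1) p.2.1 p.2.2)
    (by fun_prop) (.hasB (by fun_prop) (by fun_prop) (by fun_prop) (by fun_prop))
    (.canRole (by fun_prop) (by fun_prop) (by fun_prop) (by fun_prop) (by fun_prop))) fun a => ?_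
  cases F a <;> rfl

end

end KABV
-- Skeletons of the anonymous part and bounded query matches.
namespace KABV

/-- The auxiliary object may be found by search: some valid one exists, and every valid one gives
the same answer, so both the predicate and its complement are semidecidable. It is used with
skeletons as auxiliary objects. -/
theorem Deci.of_witness {α β : Type} [Primcodable α] [Primcodable β] {p : α → Prop}
    {C q : α → β → Prop} (hC : Semi (fun x : α × β => C x.1 x.2))
    (hq : Deci (fun x : α × β => q x.1 x.2)) (hex : ∀ a, ∃ b, C a b)
    (h : ∀ a b, C a b → (p a ↔ q a b)) : Deci p := by
  constructor
  · refine (Semi.ex (p := fun a b => C a b ∧ q a b) (hC.and hq.1)).of_iff fun a => ?_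
    constructor
    · intro hp
      obtain ⟨b, hb⟩ := hex a
      exact ⟨b, hb, (h a b hb).1 hp⟩
    · rintro ⟨b, hb, hq⟩
      exact (h a b hb).2 hq
  · refine (Semi.ex (p := fun a b => C a b ∧ ¬ q a b) (hC.and hq.2)).of_iff fun a => ?_
    constructor
    · intro hp
      obtain ⟨b, hb⟩ := hex a
      exact ⟨b, hb, fun hq => hp ((h a b hb).2 hq)⟩
    · rintro ⟨b, hb, hq⟩ hp
      exact hq ((h a b hb).1 hp)

@[fun_prop]
theorem PRec.head? {α β : Type} [Primcodable α] [Primcodable β] {f : α → List β} (hf : PRec f) :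
    PRec (fun a => (f a).head?) := Primrec.list_head?.comp hf

theorem Fact.terms_map {τ υ : Type} (f : τ → υ) (F : Fact τ) : (F.map f).terms = F.terms.map f := by
  cases F <;> rfl

theorem Fact.map_congr {τ υ : Type} {f g : τ → υ} {F : Fact τ} (h : ∀ t ∈ F.terms, f t = g t) :
    F.map f = F.map g := by
  cases F <;> simp_all [Fact.map, Fact.terms]

theorem Fact.map_map {τ υ ω : Type} (f : τ → υ) (g : υ → ω) (F : Fact τ) :
    (F.map f).map g = F.map (fun t => g (f t)) := by
  cases F <;> rfl

/-- A finite description of the anonymous part of the canonical model: `D.1` contains the roles on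
right-hand sides, `D.2.1` the constants of the ABox, and `D.2.2` an alive word for every last
letter of an alive word. -/
def Skeleton (T : TBox) (A : List (Fact ℕ))
    (D : List Role × List ℕ × List (ℕ × List Role)) : Prop :=
  (∀ a ∈ T, Sum.elim (fun p => Sum.elim (fun _ => True) (fun R => R ∈ D.1) (Basic.equiv p.2))
    (fun _ => True) (TAssertion.equiv a)) ∧
  (∀ F ∈ A, ∀ c ∈ F.terms, c ∈ D.2.1) ∧
  (∀ x ∈ D.2.2, Alive T (factSet A) x.1 x.2) ∧
  (∀ c ∈ D.2.1, ∀ R ∈ D.1, Alive T (factSet A) c [R] → ∃ x ∈ D.2.2, x.2.head? = some R) ∧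
  (∀ x ∈ D.2.2, ∀ S ∈ D.1, Alive T (factSet A) x.1 (S :: x.2) → ∃ y ∈ D.2.2, y.2.head? = some S)

section Skeleton

variable {T : TBox} {A : List (Fact ℕ)} {Rs : List Role} {Cs : List ℕ} {W : List (ℕ × List Role)}

theorem mem_of_sub (hR : ∀ a ∈ T, Sum.elim (fun p => Sum.elim (fun _ => True) (fun R => R ∈ Rs)
    (Basic.equiv p.2)) (fun _ => True) (TAssertion.equiv a)) {B : Basic} {R : Role}
    (h : Sub T B (.some R)) (hB : B ≠ .some R) : R ∈ Rs := by
  rcases Relation.ReflTransGen.cases_tail h with h | ⟨B', -, h⟩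
  · exact absurd h.symm hB
  · exact hR _ h

/-- The exclusions in `Alive` rule out that a letter arises from a subsumption of length zero. A
letter therefore occurs on the right-hand side of some inclusion, and alive words use a finite
alphabet. -/
theorem Alive.roles_mem (hR : ∀ a ∈ T, Sum.elim (fun p => Sum.elim (fun _ => True)
    (fun R => R ∈ Rs) (Basic.equiv p.2)) (fun _ => True) (TAssertion.equiv a)) {c : ℕ}
    {w : List Role} (h : Alive T (factSet A) c w) : ∀ R ∈ w, R ∈ Rs := by
  induction w with
  | nil => simp
  | cons S w ih =>
    refine List.forall_mem_cons.2 ⟨?_, ih h.tail⟩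
    cases w with
    | nil =>
      obtain ⟨⟨B, h1, h2⟩, h3⟩ := h
      refine mem_of_sub hR h2 ?_
      rintro rfl
      exact h3 h1
    | cons R w =>
      refine mem_of_sub hR h.2.1 fun e => h.2.2 ?_
      injection e with e
      exact e.symm

theorem ABasic.mem_consts (hC : ∀ F ∈ A, ∀ c ∈ F.terms, c ∈ Cs) {B : Basic} {c : ℕ}
    (h : ABasic (factSet A) B c) : c ∈ Cs := by
  obtain ⟨F, hF, -, hc⟩ := h.exists_fact
  exact hC F hF c hc

theorem Alive.const_mem (hC : ∀ F ∈ A, ∀ c ∈ F.terms, c ∈ Cs) {c : ℕ} {R : Role} {w : List Role}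
    (h : Alive T (factSet A) c (R :: w)) : c ∈ Cs := by
  induction w generalizing R with
  | nil => exact h.1.elim fun B hB => hB.1.mem_consts hC
  | cons S w ih => exact ih h.tail

theorem HasB.const_mem (hC : ∀ F ∈ A, ∀ c ∈ F.terms, c ∈ Cs) {x : ℕ × List Role} {B : Basic}
    (h : HasB T (factSet A) x B) : x.1 ∈ Cs ∧ Alive T (factSet A) x.1 x.2 := by
  obtain ⟨c, _ | ⟨R, w⟩⟩ := x
  · exact ⟨h.elim fun B hB => hB.1.mem_consts hC, trivial⟩
  · exact ⟨h.1.const_mem hC, h.1⟩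

theorem exists_skeleton (T : TBox) (A : List (Fact ℕ)) : ∃ D, Skeleton T A D := by
  classical
  let Rs : List Role := T.flatMap fun a => Sum.elim (fun p => Sum.elim (fun _ => [])
    (fun R => [R]) (Basic.equiv p.2)) (fun _ => []) (TAssertion.equiv a)
  have hR : ∀ a ∈ T, Sum.elim (fun p => Sum.elim (fun _ => True) (fun R => R ∈ Rs)
      (Basic.equiv p.2)) (fun _ => True) (TAssertion.equiv a) := by
    intro a ha
    rcases a with ⟨B, N | R⟩ | _ | _
    · trivial
    · exact List.mem_flatMap.2 ⟨_, ha, by simp [TAssertion.equiv, Basic.equiv]⟩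
    · trivial
    · trivial
  -- Representatives are chosen nonconstructively; this is enough, because skeletons are only
  -- searched for and then checked.
  let f : Role → Option (ℕ × List Role) := fun R =>
    if h : ∃ x : ℕ × List Role, Alive T (factSet A) x.1 x.2 ∧ x.2.head? = some R then
      some h.choose else none
  have hf : ∀ (x : ℕ × List Role) (R : Role), Alive T (factSet A) x.1 x.2 →
      x.2.head? = some R → ∃ y ∈ Rs.filterMap f, y.2.head? = some R := by
    intro x R hx hR'
    have h : ∃ x : ℕ × List Role, Alive T (factSet A) x.1 x.2 ∧ x.2.head? = some R := ⟨x, hx, hR'⟩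
    refine ⟨h.choose, List.mem_filterMap.2 ⟨R, hx.roles_mem hR R (List.mem_of_mem_head? hR'), ?_⟩,
      h.choose_spec.2⟩
    simp only [f]
    rw [dif_pos h]
  refine ⟨(Rs, A.flatMap Fact.terms, Rs.filterMap f), hR,
    fun F hF c hc => List.mem_flatMap.2 ⟨F, hF, hc⟩, fun x hx => ?_,
    fun c _ R _ h => hf (c, [R]) R h rfl, fun x _ S _ h => hf (x.1, S :: x.2) S h rfl⟩
  obtain ⟨R, -, h⟩ := List.mem_filterMap.1 hx
  simp only [f] at h
  split_ifs at h with h'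
  obtain rfl := Option.some.inj h
  exact h'.choose_spec.1

/-- Induction on the word: by `alive_cons_cons_iff_of_head` a letter that continues an alive word
also continues the representative of its last letter, and the list of representatives is closed
under such continuations. -/
theorem Skeleton.covers {D} (h : Skeleton T A D) : Covers T (factSet A) D.2.2 := by
  obtain ⟨hR, hC, hW, hs, hl⟩ := h
  refine ⟨hW, fun c R w hw => ?_⟩
  induction w generalizing R with
  | nil => exact hs c (hw.const_mem hC) R (hw.roles_mem hR R (by simp)) hw
  | cons S w ih =>
    obtain ⟨x, hx, hxS⟩ := ih S hw.tail
    obtain ⟨d, v⟩ := x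
    obtain ⟨u, rfl⟩ : ∃ u, v = S :: u := by
      cases v <;> simp_all
    exact hl _ hx R (hw.roles_mem hR R (by simp))
      ((alive_cons_cons_iff_of_head hw.tail (hW _ hx)).1 hw)

/-- The concepts of an anonymous element are determined by its last letter, and a constant outside
the ABox has no concepts. The representatives and the constants of the ABox are therefore enough. -/
theorem Skeleton.noClash_iff {D} (h : Skeleton T A D) : NoClash T (factSet A) ↔
    ∀ a ∈ T, Sum.elim (fun _ => True) (Sum.elim (fun p => ∀ x ∈ D.2.2 ++ D.2.1.map fun c => (c, []),
      HasB T (factSet A) x p.1 → ¬ HasB T (factSet A) x p.2) fun _ => True)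
      (TAssertion.equiv a) := by
  constructor
  · intro hn a ha
    cases a with
    | pos _ _ => trivial
    | neg B B' => exact fun x _ => hn B B' ha x
    | funct _ => trivial
  · intro hn B B' hB x hx hx'
    have := hn _ hB
    obtain ⟨c, w⟩ := x
    cases w with
    | nil =>
      refine this (c, []) (List.mem_append_right _ (List.mem_map.2 ⟨c, ?_, rfl⟩)) hx hx'
      exact (hx.const_mem h.2.1).1
    | cons R w =>
      obtain ⟨⟨d, v⟩, hy, hyR⟩ := h.covers.2 c R w hx.1
      obtain ⟨u, rfl⟩ : ∃ u, v = R :: u := by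
        cases v <;> simp_all
      have hal := h.covers.1 _ hy
      exact this _ (List.mem_append_left _ hy) ⟨hal, hx.2⟩ ⟨hal, hx'.2⟩

end Skeleton

/-- The value of a query term in the canonical model. -/
def evalCan (v : ℕ → ℕ) (ex : List ℕ) (g : ℕ → ℕ × List Role) (t : QTerm) : ℕ × List Role :=
  Sum.elim (fun x => if x ∈ ex then g x else (v x, [])) (fun c => (c, [])) (QTerm.equiv t)

theorem sat_canModel_iff {T : TBox} {A : Set (Fact ℕ)} {v : ℕ → ℕ} {q : CQ} :
    q.Sat (canModel T A) (fun x => ((v x, []) : ℕ × List Role)) ↔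
      ∃ g, ∀ a ∈ q.atoms, CanFact T A (a.map (evalCan v q.exVars g)) := by
  constructor
  · rintro ⟨g, hg, h⟩
    refine ⟨g, fun a ha => ?_⟩
    have : ∀ t, evalCan v q.exVars g t = QTerm.eval (canModel T A) g t := by
      intro t
      cases t with
      | var x =>
        by_cases hx : x ∈ q.exVars
        · exact if_pos hx
        · exact (if_neg hx).trans (hg x hx).symm
      | const c => rfl
    rw [Fact.map_congr fun t _ => this t]
    exact h a ha
  · rintro ⟨g, h⟩
    refine ⟨fun x => if x ∈ q.exVars then g x else (v x, []), fun x hx => if_neg hx,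
      fun a ha => ?_⟩
    have : ∀ t, evalCan v q.exVars g t = QTerm.eval (canModel T A)
        (fun x => if x ∈ q.exVars then g x else (v x, [])) t := by
      intro t
      cases t <;> rfl
    have h' := h a ha
    rw [Fact.map_congr fun t _ => this t] at h'
    exact h'

/-- The elements of the canonical model down to depth `N`. -/
def boundedElems (Rs : List Role) (Cs : List ℕ) (N : ℕ) : List (ℕ × List Role) :=
  (0, []) :: Cs.flatMap fun c => (List.range (N + 1)).flatMap fun k =>
    (tuples Rs k).map fun w => (c, w)

theorem mem_boundedElems {Rs : List Role} {Cs : List ℕ} {N c : ℕ} {w : List Role} (hc : c ∈ Cs)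
    (hw : ∀ R ∈ w, R ∈ Rs) (hN : w.length ≤ N) : (c, w) ∈ boundedElems Rs Cs N := by
  refine List.mem_cons_of_mem _ (List.mem_flatMap.2 ⟨c, hc, List.mem_flatMap.2 ⟨w.length, ?_,
    List.mem_map.2 ⟨w, mem_tuples.2 ⟨rfl, hw⟩, rfl⟩⟩⟩)
  simpa using Nat.lt_succ_of_le hN

theorem satFact_terms {T : TBox} {A : List (Fact ℕ)} {Cs : List ℕ}
    (hC : ∀ F ∈ A, ∀ c ∈ F.terms, c ∈ Cs) {F : Fact (ℕ × List Role)}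
    (h : CanFact T (factSet A) F) :
    ∀ x ∈ F.terms, x.1 ∈ Cs ∧ Alive T (factSet A) x.1 x.2 := by
  intro x hx
  cases F with
  | conc N y =>
    obtain rfl : x = y := by simpa [Fact.terms] using hx
    exact HasB.const_mem hC (B := .name N) h
  | role P y z =>
    have h : CanRole T (factSet A) (.name P) y z := h
    rcases (by simpa [Fact.terms] using hx : x = y ∨ x = z) with rfl | rfl
    · exact HasB.const_mem hC ((hasB_some_iff _ _).2 ⟨_, h⟩)
    · exact HasB.const_mem hC ((hasB_some_iff _ _).2 ⟨_, (canRole_flip _ _ _).2 h⟩)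

theorem Fact.length_terms_le {τ : Type} (F : Fact τ) : F.terms.length ≤ 2 := by
  cases F <;> simp [Fact.terms]

/-- A match is relocated by `shrink`, with `X` the set of its values. As an atom has at most two
terms, `X` has at most twice as many elements as there are atoms. With representatives of length at
most `k` this is the depth allowed on the right-hand side. -/
theorem Skeleton.match_iff {T : TBox} {A : List (Fact ℕ)} {D} (h : Skeleton T A D) {v : ℕ → ℕ}
    {q : CQ} {n k : ℕ} (hn : ∀ x ∈ q.exVars, x < n) (hk : ∀ x ∈ D.2.2, x.2.length ≤ k) :
    (∃ g, ∀ a ∈ q.atoms, CanFact T (factSet A) (a.map (evalCan v q.exVars g))) ↔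
      ∃ l ∈ tuples (boundedElems D.1 D.2.1 (k + (q.atoms.length + q.atoms.length))) n,
        ∀ a ∈ q.atoms, CanFact T (factSet A)
          (a.map (evalCan v q.exVars fun x => l.getD x (0, []))) := by
  classical
  refine ⟨fun ⟨g, hg⟩ => ?_, fun ⟨l, _, hl⟩ => ⟨_, hl⟩⟩
  set ts : List QTerm := q.atoms.flatMap Fact.terms with hts
  set X : Finset (ℕ × List Role) := (ts.map (evalCan v q.exVars g)).toFinset with hX
  have hXcard : X.card ≤ q.atoms.length + q.atoms.length := by
    refine (List.toFinset_card_le _).trans ?_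
    rw [List.length_map, hts, List.length_flatMap]
    have : ∀ l : List (Fact QTerm), (l.map fun a => a.terms.length).sum ≤ l.length + l.length := by
      intro l
      induction l with
      | nil => simp
      | cons a l ih =>
        have := a.length_terms_le
        simp only [List.map_cons, List.sum_cons, List.length_cons]
        omega
    exact this _
  let rep : Role → ℕ × List Role := fun R =>
    if h : ∃ x ∈ D.2.2, x.2.head? = some R then h.choose else (0, [])
  have hrep : ∀ c R w, Alive T (factSet A) c (R :: w) → (rep R) ∈ D.2.2 ∧
      (rep R).2.head? = some R := by
    intro c R w hw
    have h' := h.covers.2 c R w hw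
    simp only [rep]
    rw [dif_pos h']
    exact h'.choose_spec
  have hrep' : ∀ c R w, Alive T (factSet A) c (R :: w) →
      Alive T (factSet A) (rep R).1 (rep R).2 ∧ (rep R).2.head? = some R := fun c R w hw =>
    ⟨h.covers.1 _ (hrep c R w hw).1, (hrep c R w hw).2⟩
  -- Variables that are not quantified or that occur in no atom are irrelevant. They receive the
  -- default `(0, [])`, which `boundedElems` contains for this purpose.
  let l := (List.range n).map fun x => if QTerm.var x ∈ ts ∧ x ∈ q.exVars then
    shrink X rep (g x).1 (g x).2 else (0, [])
  have heval : ∀ t ∈ ts, evalCan v q.exVars (fun x => l.getD x (0, [])) t =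
      shrink X rep (evalCan v q.exVars g t).1 (evalCan v q.exVars g t).2 := by
    intro t ht
    cases t with
    | var x =>
      simp only [evalCan, QTerm.equiv, Equiv.coe_fn_mk, Sum.elim_inl]
      split_ifs with hx
      · simp [l, List.getD_eq_getElem?_getD, hn x hx, ht, hx]
      · rfl
    | const c => rfl
  have hsat : ∀ a ∈ q.atoms, CanFact T (factSet A)
      (a.map (evalCan v q.exVars fun x => l.getD x (0, []))) := by
    intro a ha
    have hat : ∀ t ∈ a.terms, t ∈ ts := fun t ht => List.mem_flatMap.2 ⟨a, ha, ht⟩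
    have hmem : ∀ t ∈ a.terms, evalCan v q.exVars g t ∈ X := fun t ht =>
      List.mem_toFinset.2 (List.mem_map_of_mem (hat t ht))
    have h1 := hg a ha
    rw [Fact.map_congr fun t ht => heval t (hat t ht)]
    cases a with
    | conc N t => exact shrink_hasB hrep' h1
    | role P t t' =>
      exact shrink_canRole hrep' (hmem t (by simp [Fact.terms])) (hmem t' (by simp [Fact.terms])) h1
  refine ⟨l, mem_tuples.2 ⟨by simp [l], fun y hy => ?_⟩, hsat⟩
  obtain ⟨x, hx, rfl⟩ := List.mem_map.1 hy
  split_ifs with hxt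
  · obtain ⟨a, ha, hxa⟩ := List.mem_flatMap.1 hxt.1
    have h1 := satFact_terms h.2.1 (hsat a ha) _ (by
      rw [Fact.terms_map]; exact List.mem_map_of_mem hxa)
    have h2 := satFact_terms h.2.1 (hg a ha) _ (by
      rw [Fact.terms_map]; exact List.mem_map_of_mem hxa)
    rw [heval _ hxt.1] at h1
    have he : evalCan v q.exVars g (.var x) = g x := by
      simp [evalCan, QTerm.equiv, hxt.2]
    rw [he] at h1 h2
    refine mem_boundedElems h1.1 (h1.2.roles_mem h.1) ?_
    refine (length_shrink k _ _ (fun c R w hw => hk _ (hrep c R w hw).1) h2.2).trans ?_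
    have := Finset.card_filter_le X (fun y => y.2.length < (g x).2.length)
    omega
  · simp [boundedElems]

end KABV
-- Decision procedures for consistency and certain answers.
namespace KABV

section

variable {α β : Type} [Primcodable α] [Primcodable β]

theorem Semi.skeleton {T : α → TBox} {A : α → List (Fact ℕ)}
    {D : α → List Role × List ℕ × List (ℕ × List Role)} (hT : PRec T) (hA : PRec A) (hD : PRec D) :
    Semi (fun a => Skeleton (T a) (A a) (D a)) := by
  refine Deci.and (.ball (.sumElim (p := fun (x : α × TAssertion) (p : Basic × Basic) =>
    Sum.elim (fun _ => True) (fun R => R ∈ (D x.1).1) (Basic.equiv p.2)) (q := fun _ _ => True)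
      (by fun_prop) (.sumElim (p := fun _ _ => True)
        (q := fun (x : (α × TAssertion) × Basic × Basic) R => R ∈ (D x.1.1).1)
        (by fun_prop) (.const _) (.mem (by fun_prop) (by fun_prop))) (.const _)) (by fun_prop))
    ?_ |>.1
  repeat' with_reducible first
      | apply Deci.and | apply Deci.ball | apply Deci.bex | apply Deci.imp | apply Deci.alive
      | apply Deci.mem | apply Deci.eq
  all_goals fun_prop

theorem Deci.consistent {T : α → TBox} {A : α → List (Fact ℕ)} (hT : PRec T) (hA : PRec A) :
    Deci (fun a => Consistent (T a) (A a).toFinset) := by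
  have hset : ∀ A : List (Fact ℕ), ((A.toFinset : Finset (Fact ℕ)) : Set (Fact ℕ)) = factSet A :=
    fun A => by ext F; simp [factSet]
  refine Deci.of_iff (.and (.ball (p := fun a t => Sum.elim (fun _ => True) (Sum.elim
    (fun _ => True) (fun R => ∀ F ∈ A a, ∀ c ∈ F.terms, ∀ d ∈ F.terms, ∀ F' ∈ A a,
      ∀ d' ∈ F'.terms, ARole (factSet (A a)) R c d ∧ ARole (factSet (A a)) R c d' → d = d'))
        (TAssertion.equiv t)) (f := T) ?_ hT)
    (.of_witness (p := fun a => NoClash (T a) (factSet (A a)))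
      (C := fun a D => Skeleton (T a) (A a) D)
      (q := fun a D => ∀ t ∈ T a, Sum.elim (fun _ => True) (Sum.elim (fun p =>
        ∀ x ∈ D.2.2 ++ D.2.1.map fun c => (c, []), HasB (T a) (factSet (A a)) x p.1 →
          ¬ HasB (T a) (factSet (A a)) x p.2) fun _ => True)
      (TAssertion.equiv t)) (.skeleton (by fun_prop) (by fun_prop) (by fun_prop)) ?_
      (fun a => exists_skeleton _ _) (fun a D h => h.noClash_iff)))
    fun a => ?_
  · refine .sumElim (p := fun _ _ => True) (q := fun (x : α × TAssertion) (y : _ ⊕ _) =>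
      Sum.elim (fun _ => True) (fun R => ∀ F ∈ A x.1, ∀ c ∈ F.terms, ∀ d ∈ F.terms, ∀ F' ∈ A x.1,
        ∀ d' ∈ F'.terms, ARole (factSet (A x.1)) R c d ∧ ARole (factSet (A x.1)) R c d' → d = d') y)
      (by fun_prop) (.const _) ?_
    refine .sumElim (p := fun _ _ => True)
      (q := fun (x : (α × TAssertion) × ((Basic × Basic) ⊕ Role)) (R : Role) =>
        ∀ F ∈ A x.1.1, ∀ c ∈ F.terms, ∀ d ∈ F.terms, ∀ F' ∈ A x.1.1, ∀ d' ∈ F'.terms,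
          ARole (factSet (A x.1.1)) R c d ∧ ARole (factSet (A x.1.1)) R c d' → d = d')
      (by fun_prop) (.const _) ?_
    repeat' with_reducible first
        | apply Deci.and | apply Deci.ball | apply Deci.imp | apply Deci.aRole | apply Deci.eq
    all_goals fun_prop
  · refine .ball ?_ (by fun_prop)
    refine .sumElim (o := fun x => TAssertion.equiv x.2) (p := fun _ _ => True)
      (q := fun (x : (α × List Role × List ℕ × List (ℕ × List Role)) × TAssertion)
          (y : (Basic × Basic) ⊕ Role) =>
        Sum.elim (fun p => ∀ z ∈ x.1.2.2.2 ++ x.1.2.2.1.map fun c => (c, []),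
          HasB (T x.1.1) (factSet (A x.1.1)) z p.1 → ¬ HasB (T x.1.1) (factSet (A x.1.1)) z p.2)
          (fun _ => True) y) (by fun_prop) (.const _) ?_
    refine .sumElim (o := fun x => x.2) (q := fun _ _ => True)
      (p := fun (x : ((α × List Role × List ℕ × List (ℕ × List Role)) × TAssertion) ×
          ((Basic × Basic) ⊕ Role)) (p : Basic × Basic) =>
        ∀ z ∈ x.1.1.2.2.2 ++ x.1.1.2.2.1.map fun c => (c, []),
          HasB (T x.1.1.1) (factSet (A x.1.1.1)) z p.1 →
            ¬ HasB (T x.1.1.1) (factSet (A x.1.1.1)) z p.2) (by fun_prop) ?_ (.const _)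
    repeat' with_reducible first
        | apply Deci.ball | apply Deci.not | apply Deci.imp | apply Deci.hasB
    all_goals fun_prop
  · rw [consistent_iff, hset]
    refine and_congr_left fun _ => ⟨fun h t ht => ?_, fun h R hR c d d' hd hd' => ?_⟩
    · cases t with
      | pos _ _ => trivial
      | neg _ _ => trivial
      | funct R => exact fun F _ c _ d _ F' _ d' _ hd => h R ht c d d' hd.1 hd.2
    · have key : ∀ d, ARole (factSet (A a)) R c d → ∃ F ∈ A a, c ∈ F.terms ∧ d ∈ F.terms :=
        fun d hd => ⟨roleFact R c d, aRole_iff_roleFact.1 hd, by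
          cases R <;> simp [roleFact, Role.equiv, Fact.terms]⟩
      obtain ⟨F, hF, hc, hdF⟩ := key d hd
      obtain ⟨F', hF', -, hdF'⟩ := key d' hd'
      exact h _ hR F hF c hc d hdF F' hF' d' hdF' ⟨hd, hd'⟩

@[fun_prop]
theorem PRec.evalCan {v : α → List ℕ} {ex : α → List ℕ} {l : α → List (ℕ × List Role)}
    {t : α → QTerm} (hv : PRec v) (hex : PRec ex) (hl : PRec l) (ht : PRec t) :
    PRec (fun a => evalCan (fun x => (v a).getD x 0) (ex a) (fun x => (l a).getD x (0, []))
      (t a)) := by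
  refine PRec.sumCases (f := fun a x => if x ∈ ex a then (l a).getD x (0, []) else
    ((v a).getD x 0, [])) (g := fun a c => (c, [])) (by fun_prop) ?_ (by fun_prop)
  exact .ite (Semi.primrecPred_mem (by fun_prop) (by fun_prop)) (by fun_prop) (by fun_prop)

@[fun_prop]
theorem PRec.boundedElems {Rs : α → List Role} {Cs : α → List ℕ} {N : α → ℕ} (hR : PRec Rs)
    (hC : PRec Cs) (hN : PRec N) : PRec (fun a => boundedElems (Rs a) (Cs a) (N a)) := by
  unfold KABV.boundedElems
  fun_prop

/-- Truth of a union of conjunctive queries in the canonical model. -/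
def CanSat (T : TBox) (A : Set (Fact ℕ)) (v : ℕ → ℕ) (q : UCQ) : Prop :=
  ∃ d ∈ q.disjuncts, ∃ g, ∀ a ∈ d.atoms, CanFact T A (a.map (evalCan v d.exVars g))

theorem certain_iff_canSat {T : TBox} {A : ABox} (hc : Consistent T A) (v : ℕ → ℕ) (q : UCQ) :
    q.Certain T A v ↔ CanSat T A v q := by
  rw [certain_iff_canModel hc]
  simp only [sat_canModel_iff]
  rfl

/-- The witness for a disjunct consists of a skeleton, a strict bound for the quantified variables
and a bound for the depth of the representatives. Once these are given, only finitely many matches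
remain to be tried. -/
theorem Deci.canSat {T : α → TBox} {A : α → List (Fact ℕ)} {v : α → List ℕ} {q : α → UCQ}
    (hT : PRec T) (hA : PRec A) (hv : PRec v) (hq : PRec q) :
    Deci (fun a => CanSat (T a) (factSet (A a)) (fun x => (v a).getD x 0) (q a)) := by
  refine .bex (.of_witness (β := (List Role × List ℕ × List (ℕ × List Role)) × ℕ × ℕ)
    (C := fun x D => Skeleton (T x.1) (A x.1) D.1 ∧ (∀ y ∈ x.2.exVars, y < D.2.1) ∧
      ∀ y ∈ D.1.2.2, y.2.length ≤ D.2.2)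
    (q := fun x D => ∃ l ∈ tuples (boundedElems D.1.1 D.1.2.1
        (D.2.2 + (x.2.atoms.length + x.2.atoms.length))) D.2.1,
        ∀ a ∈ x.2.atoms, CanFact (T x.1) (factSet (A x.1))
          (a.map (KABV.evalCan (fun y => (v x.1).getD y 0) x.2.exVars fun y => l.getD y (0, []))))
    ?_ ?_ ?_ ?_) (by fun_prop)
  · repeat' with_reducible first
        | apply Semi.and | apply Semi.skeleton | apply Semi.ball | apply Semi.lt | apply Semi.le
    all_goals fun_prop
  · repeat' with_reducible first
        | apply Deci.bex | apply Deci.ball | apply Deci.canFact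
    all_goals fun_prop
  · rintro ⟨a, d⟩
    obtain ⟨D, hD⟩ := exists_skeleton (T a) (A a)
    refine ⟨(D, d.exVars.sum + 1, (D.2.2.map fun x => x.2.length).sum), hD,
      fun y hy => Nat.lt_succ_of_le (List.le_sum_of_mem hy), fun y hy => ?_⟩
    exact List.le_sum_of_mem (List.mem_map.2 ⟨y, hy, rfl⟩)
  · rintro ⟨a, d⟩ D ⟨h1, h2, h3⟩
    exact h1.match_iff h2 h3

end

/-! ### Deciding EQL queries -/

/-- The rules for the truth values `x.2.2` of the EQL queries coded by `x.2.1` under the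
assignments `x.1`. -/
def ECQRule (T : TBox) (A : List (Fact ℕ)) (P : List (List ℕ × ℕ × Bool))
    (x : List ℕ × ℕ × Bool) : Prop :=
  (∃ q : UCQ, x.2.1 = Nat.pair 0 q.code ∧
    (CanSat T (factSet A) (fun y => x.1.getD y 0) q ↔ x.2.2 = true)) ∨
  (∃ m, x.2.1 = Nat.pair 1 m ∧ (x.1, m, !x.2.2) ∈ P) ∨
  (∃ m₁ m₂ b₁ b₂, x.2.1 = Nat.pair 2 (Nat.pair m₁ m₂) ∧ (x.1, m₁, b₁) ∈ P ∧ (x.1, m₂, b₂) ∈ P ∧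
    x.2.2 = (b₁ && b₂)) ∨
  (∃ y m, x.2.1 = Nat.pair 3 (Nat.pair y m) ∧
    ((x.2.2 = true ∧ ∃ F ∈ A, ∃ d ∈ F.terms, (updList 0 x.1 y d, m, true) ∈ P) ∨
     (x.2.2 = false ∧ ∀ F ∈ A, ∀ d ∈ F.terms, (updList 0 x.1 y d, m, false) ∈ P)))

/-- The truth value `b` is derivable for the query coded by `n`. -/
def EvalECQ (T : TBox) (A : List (Fact ℕ)) (v : List ℕ) (n : ℕ) (b : Bool) : Prop :=
  Derivable (ECQRule T A) (v, n, b)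

end KABV
namespace KABV

/-! ### Injectivity and computability of the codes -/

theorem codeList_injective {α : Type} {f : α → ℕ} (hf : Function.Injective f) :
    Function.Injective (codeList f) := fun _ _ h =>
  (List.map_injective_iff.2 hf) (Encodable.encode_injective h)

theorem Role.code_injective : Function.Injective Role.code := by
  intro R S h
  cases R <;> cases S <;> simp_all [Role.code, Nat.pair_eq_pair]

theorem Basic.code_injective : Function.Injective Basic.code := by
  intro R S h
  cases R <;> cases S <;> simp_all [Basic.code, Nat.pair_eq_pair, Role.code_injective.eq_iff]

theorem TAssertion.code_injective : Function.Injective TAssertion.code := by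
  intro R S h
  cases R <;> cases S <;>
    simp_all [TAssertion.code, Nat.pair_eq_pair, Role.code_injective.eq_iff,
      Basic.code_injective.eq_iff]

theorem Fact.code_injective {τ : Type} {f : τ → ℕ} (hf : Function.Injective f) :
    Function.Injective (Fact.code f) := by
  intro F G h
  cases F <;> cases G <;> simp_all [Fact.code, Nat.pair_eq_pair, hf.eq_iff]

theorem QTerm.code_injective : Function.Injective QTerm.code := by
  intro R S h
  cases R <;> cases S <;> simp_all [QTerm.code, Nat.pair_eq_pair]

theorem ETerm.code_injective : Function.Injective ETerm.code := by
  intro R S h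
  cases R <;> cases S <;> simp_all [ETerm.code, Nat.pair_eq_pair,
    (codeList_injective Function.injective_id).eq_iff]

theorem CQ.code_injective : Function.Injective CQ.code := by
  rintro ⟨e, a⟩ ⟨e', a'⟩ h
  simp_all [CQ.code, Nat.pair_eq_pair, (codeList_injective Function.injective_id).eq_iff,
    (codeList_injective (Fact.code_injective QTerm.code_injective)).eq_iff]

theorem UCQ.code_injective : Function.Injective UCQ.code := by
  rintro ⟨d⟩ ⟨d'⟩ h
  simp_all [UCQ.code, (codeList_injective CQ.code_injective).eq_iff]

theorem ECQ.code_injective : Function.Injective ECQ.code := by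
  intro Q
  induction Q with
  | cert q =>
    intro Q' h
    cases Q' <;> simp_all [ECQ.code, Nat.pair_eq_pair, UCQ.code_injective.eq_iff]
  | neg Q ih =>
    intro Q' h
    cases Q' <;> simp [ECQ.code, Nat.pair_eq_pair] at h
    rw [ih h]
  | and Q₁ Q₂ ih₁ ih₂ =>
    intro Q' h
    cases Q' <;> simp [ECQ.code, Nat.pair_eq_pair] at h
    rw [ih₁ h.1, ih₂ h.2]
  | ex x Q ih =>
    intro Q' h
    cases Q' <;> simp [ECQ.code, Nat.pair_eq_pair] at h
    rw [h.1, ih h.2]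

section

variable {α β τ : Type} [Primcodable α] [Primcodable β] [Primcodable τ]

theorem PRec.codeList {f : α → List β} {c : β → ℕ} (hf : PRec f) (hc : PRec c) :
    PRec (fun a => codeList c (f a)) := by
  unfold KABV.codeList
  fun_prop

@[fun_prop]
theorem PRec.codeNatList {f : α → List ℕ} (hf : PRec f) : PRec (fun a =>
  KABV.codeList _root_.id (f a)) :=
  .codeList hf .id

theorem PRec.roleCode : PRec Role.code := by
  refine (?_ : PRec fun R => Sum.elim (Nat.pair 0) (Nat.pair 1) (Role.equiv R)).of_eq
    fun R => by cases R <;> rfl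
  exact PRec.sumCases (f := fun _ P => Nat.pair 0 P) (g := fun _ P => Nat.pair 1 P)
    (by fun_prop) (by fun_prop) (by fun_prop)

theorem PRec.basicCode : PRec Basic.code := by
  refine (?_ : PRec fun R => Sum.elim (Nat.pair 0) (fun R : Role => Nat.pair 1 R.code)
    (Basic.equiv R)).of_eq fun R => by cases R <;> rfl
  have := PRec.roleCode
  exact PRec.sumCases (f := fun _ P => Nat.pair 0 P) (g := fun _ (R : Role) => Nat.pair 1 R.code)
    (by fun_prop) (by fun_prop) (by fun_prop)

theorem PRec.tAssertionCode : PRec TAssertion.code := by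
  have := PRec.roleCode
  have := PRec.basicCode
  refine (?_ : PRec fun R => Sum.elim (fun p : Basic × Basic =>
    Nat.pair 0 (Nat.pair p.1.code p.2.code))
    (Sum.elim (fun p : Basic × Basic => Nat.pair 1 (Nat.pair p.1.code p.2.code))
      (fun R : Role => Nat.pair 2 R.code))
    (TAssertion.equiv R)).of_eq fun R => by cases R <;> rfl
  refine PRec.sumCases (f := fun _ (p : Basic × Basic) => Nat.pair 0 (Nat.pair p.1.code p.2.code))
    (g := fun _ => Sum.elim (fun p : Basic × Basic => Nat.pair 1 (Nat.pair p.1.code p.2.code))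
      (fun R : Role => Nat.pair 2 R.code)) (by fun_prop) (by fun_prop) ?_
  exact PRec.sumCases (α := TAssertion × _) (o := fun x => x.2) (f := fun _ (p : Basic × Basic)
    => Nat.pair 1 (Nat.pair p.1.code p.2.code))
    (g := fun _ (R : Role) => Nat.pair 2 R.code) (by fun_prop) (by fun_prop) (by fun_prop)

theorem PRec.factCode {c : τ → ℕ} (hc : PRec c) : PRec (Fact.code c) := by
  refine (?_ : PRec fun F => Sum.elim (fun p : ℕ × τ => Nat.pair 0 (Nat.pair p.1 (c p.2)))
    (fun p : ℕ × τ × τ => Nat.pair 1 (Nat.pair p.1 (Nat.pair (c p.2.1) (c p.2.2))))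
    (Fact.equiv τ F)).of_eq fun R => by cases R <;> rfl
  exact PRec.sumCases (f := fun _ (p : ℕ × τ) => Nat.pair 0 (Nat.pair p.1 (c p.2)))
    (g := fun _ (p : ℕ × τ × τ) => Nat.pair 1 (Nat.pair p.1 (Nat.pair (c p.2.1) (c p.2.2))))
    (by fun_prop) (by fun_prop) (by fun_prop)

theorem PRec.qtermCode : PRec QTerm.code := by
  refine (?_ : PRec fun R => Sum.elim (Nat.pair 0) (Nat.pair 1) (QTerm.equiv R)).of_eq
    fun R => by cases R <;> rfl
  exact PRec.sumCases (f := fun _ P => Nat.pair 0 P) (g := fun _ P => Nat.pair 1 P)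
    (by fun_prop) (by fun_prop) (by fun_prop)

theorem PRec.etermCode : PRec ETerm.code := by
  refine (?_ : PRec fun R => Sum.elim (fun x => Nat.pair 0 x)
    (Sum.elim (fun c => Nat.pair 1 c) (fun p : ℕ × List ℕ =>
      Nat.pair 2 (Nat.pair p.1 (KABV.codeList _root_.id p.2))))
    (ETerm.equiv R)).of_eq fun R => by cases R <;> rfl
  refine PRec.sumCases (f := fun _ x => Nat.pair 0 x) (g := fun _ => Sum.elim (fun c =>
    Nat.pair 1 c)
    (fun p : ℕ × List ℕ => Nat.pair 2 (Nat.pair p.1 (KABV.codeList _root_.id p.2))))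
      (by fun_prop) (by fun_prop) ?_
  exact PRec.sumCases (α := ETerm × _) (o := fun x => x.2) (f := fun _ c => Nat.pair 1 c)
    (g := fun _ (p : ℕ × List ℕ) => Nat.pair 2 (Nat.pair p.1 (KABV.codeList _root_.id p.2)))
    (by fun_prop) (by fun_prop) (by fun_prop)

theorem PRec.cqCode : PRec CQ.code := by
  have := PRec.codeList (f := CQ.atoms) (by fun_prop) (PRec.factCode PRec.qtermCode)
  unfold CQ.code
  fun_prop

@[fun_prop]
theorem PRec.ucqCode {f : α → UCQ} (hf : PRec f) : PRec (fun a => (f a).code) :=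
  PRec.codeList (f := fun a => (f a).disjuncts) (by fun_prop) PRec.cqCode

theorem Semi.evalECQ {T : α → TBox} {A : α → List (Fact ℕ)} {v : α → List ℕ} {n : α → ℕ}
    {b : α → Bool} (hT : PRec T) (hA : PRec A) (hv : PRec v) (hn : PRec n) (hb : PRec b) :
    Semi (fun a => EvalECQ (T a) (A a) (v a) (n a) (b a)) := by
  refine Semi.derivable (R := fun a P x => ECQRule (T a) (A a) P x) ?_ (by fun_prop)
  refine .or (.ex (.and (.eq ?_ ?_) (Deci.iff (.canSat ?_ ?_ ?_ ?_) (.eq ?_ ?_)).1)) ?_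
  any_goals fun_prop
  repeat' with_reducible first
    | apply Semi.or | apply Semi.and | apply Semi.ex | apply Semi.ball | apply Semi.eq
    | apply Semi.mem
  all_goals fun_prop

end

theorem mem_adom_toFinset {A : List (Fact ℕ)} {d : ℕ} :
    d ∈ adom A.toFinset ↔ ∃ F ∈ A, d ∈ F.terms := by simp [adom]

/-- Rules cannot have negated premises, so falsity is derived like truth: a negation flips the
value, and a false existential has one premise for each constant of the ABox. Consistency is needed
at the atoms, where certain answers are replaced by truth in the canonical model. -/
theorem evalECQ_iff {T : TBox} {A : List (Fact ℕ)} (hc : Consistent T A.toFinset) (Q : ECQ)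
    (v : List ℕ) (b : Bool) :
    EvalECQ T A v Q.code b ↔ (b = true ↔ Q.Holds T A.toFinset fun y => v.getD y 0) := by
  have hset : ((A.toFinset : Finset (Fact ℕ)) : Set (Fact ℕ)) = factSet A := by
    ext F; simp [factSet]
  induction Q generalizing v b with
  | cert q =>
    have hq : ECQ.Holds T A.toFinset (fun y => v.getD y 0) (.cert q) ↔
        CanSat T (factSet A) (fun y => v.getD y 0) q := by
      rw [← hset]
      exact certain_iff_canSat hc _ _
    rw [hq]
    constructor
    · rintro ⟨P, _, h, -⟩
      rcases h with ⟨q', h, h'⟩ | ⟨_, h, _⟩ | ⟨_, _, _, _, h, _⟩ | ⟨_, _, h, _⟩ <;>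
        simp [ECQ.code, Nat.pair_eq_pair] at h
      obtain rfl := UCQ.code_injective h
      exact h'.symm
    · intro h
      exact .intro [] _ (.inl ⟨q, rfl, h.symm⟩) (by simp)
  | neg Q ih =>
    constructor
    · rintro ⟨P, _, h, hP⟩
      rcases h with ⟨_, h, _⟩ | ⟨_, h, h'⟩ | ⟨_, _, _, _, h, _⟩ | ⟨_, _, h, _⟩ <;>
        simp [ECQ.code, Nat.pair_eq_pair] at h
      subst h
      have := (ih _ _).1 (hP _ h')
      simp only [ECQ.Holds, ← this]
      cases b <;> simp
    · intro h
      refine .intro [(v, Q.code, !b)] _ (.inr (.inl ⟨_, rfl, by simp⟩)) ?_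
      simp only [List.mem_singleton, forall_eq]
      refine (ih _ _).2 ?_
      simp only [ECQ.Holds] at h
      cases b <;> simp_all
  | and Q₁ Q₂ ih₁ ih₂ =>
    constructor
    · rintro ⟨P, _, h, hP⟩
      rcases h with ⟨_, h, _⟩ | ⟨_, h, h'⟩ | ⟨_, _, _, _, h, h1, h2, h3⟩ | ⟨_, _, h, _⟩ <;>
        simp [ECQ.code, Nat.pair_eq_pair] at h
      obtain ⟨rfl, rfl⟩ := h
      have e1 := (ih₁ _ _).1 (hP _ h1)
      have e2 := (ih₂ _ _).1 (hP _ h2)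
      simp only at h3
      rw [h3, Bool.and_eq_true, e1, e2]
      rfl
    · intro h
      classical
      refine .intro [(v, Q₁.code, decide (Q₁.Holds T A.toFinset fun y => v.getD y 0)),
        (v, Q₂.code, decide (Q₂.Holds T A.toFinset fun y => v.getD y 0))] _
        (.inr (.inr (.inl ⟨_, _, _, _, rfl, List.mem_cons_self,
          List.mem_cons_of_mem _ List.mem_cons_self, ?_⟩))) ?_
      · rw [Bool.eq_iff_iff, h]; simp [ECQ.Holds]
      · simp only [List.mem_cons, List.not_mem_nil, or_false, forall_eq_or_imp, forall_eq]
        exact ⟨(ih₁ _ _).2 (by simp), (ih₂ _ _).2 (by simp)⟩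
  | ex x Q ih =>
    have hex : ECQ.Holds T A.toFinset (fun y => v.getD y 0) (.ex x Q) ↔
        ∃ F ∈ A, ∃ d ∈ F.terms, EvalECQ T A (updList 0 v x d) Q.code true := by
      simp only [ECQ.Holds, mem_adom_toFinset, ih, getD_updList]
      constructor
      · rintro ⟨d, ⟨F, hF, hd⟩, h⟩
        exact ⟨F, hF, d, hd, by simpa using h⟩
      · rintro ⟨F, hF, d, hd, h⟩
        exact ⟨d, ⟨F, hF, hd⟩, by simpa using h⟩
    have hft : ∀ d, EvalECQ T A (updList 0 v x d) Q.code false ↔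
        ¬ EvalECQ T A (updList 0 v x d) Q.code true := by
      intro d
      refine (ih _ false).trans (Iff.trans ?_ (not_congr (ih _ true)).symm)
      simp
    rw [hex]
    constructor
    · rintro ⟨P, _, h, hP⟩
      rcases h with ⟨_, h, _⟩ | ⟨_, h, h'⟩ | ⟨_, _, _, _, h, h1, h2, h3⟩ | ⟨_, _, h, h'⟩ <;>
        simp [ECQ.code, Nat.pair_eq_pair] at h
      obtain ⟨rfl, rfl⟩ := h
      rcases h' with ⟨h1, F, hF, d, hd, h⟩ | ⟨h1, h⟩
      · exact iff_of_true h1 ⟨F, hF, d, hd, hP _ h⟩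
      · refine iff_of_false (by simpa using h1) ?_
        rintro ⟨F, hF, d, hd, h2⟩
        exact (hft d).1 (hP _ (h F hF d hd)) h2
    · intro h
      cases b with
      | true =>
        obtain ⟨F, hF, d, hd, h⟩ := h.1 rfl
        refine .intro [(updList 0 v x d, Q.code, true)] _ (.inr (.inr (.inr ⟨_, _, rfl,
          .inl ⟨rfl, F, hF, d, hd, by simp⟩⟩))) ?_
        intro y hy
        obtain rfl := List.mem_singleton.1 hy
        exact h
      | false =>
        refine .intro (A.flatMap fun F => F.terms.map fun d => (updList 0 v x d, Q.code, false)) _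
          (.inr (.inr (.inr ⟨_, _, rfl, .inr ⟨rfl, fun F hF d hd => ?_⟩⟩))) ?_
        · exact List.mem_flatMap.2 ⟨F, hF, List.mem_map.2 ⟨d, hd, rfl⟩⟩
        · intro y hy
          obtain ⟨F, hF, hy⟩ := List.mem_flatMap.1 hy
          obtain ⟨d, hd, rfl⟩ := List.mem_map.1 hy
          exact (hft d).2 fun h' => by simpa using h.2 ⟨F, hF, d, hd, h'⟩

end KABV
namespace KABV

/-! ## Dependence on free variables -/

theorem CQ.mem_fv {q : CQ} {x : ℕ} :
    x ∈ q.fv ↔ (∃ a ∈ q.atoms, QTerm.var x ∈ a.terms) ∧ x ∉ q.exVars := by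
  have : ∀ t : QTerm, x ∈ t.vars ↔ t = .var x := by
    intro t
    cases t <;> simp [QTerm.vars, eq_comm]
  simp [CQ.fv, this]

theorem UCQ.mem_fv {q : UCQ} {x : ℕ} : x ∈ q.fv ↔ ∃ d ∈ q.disjuncts, x ∈ d.fv := by
  simp [UCQ.fv]

theorem CQ.sat_congr {I : Interp} {q : CQ} {g g' : ℕ → I.Dom} (h : ∀ x ∈ q.fv, g x = g' x)
    (hs : q.Sat I g) : q.Sat I g' := by
  classical
  obtain ⟨f, hf, hsat⟩ := hs
  refine ⟨fun x => if x ∈ q.exVars then f x else g' x, fun x hx => if_neg hx, fun a ha => ?_⟩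
  rw [← Fact.map_congr (f := QTerm.eval I f)]
  · exact hsat a ha
  · intro t ht
    cases t with
    | var x =>
      simp only [QTerm.eval]
      split_ifs with hx
      · rfl
      · rw [hf x hx, h x (CQ.mem_fv.2 ⟨⟨a, ha, ht⟩, hx⟩)]
    | const c => rfl

theorem UCQ.certain_congr {T : TBox} {A : ABox} {q : UCQ} {v v' : ℕ → ℕ}
    (h : ∀ x ∈ q.fv, v x = v' x) (hq : q.Certain T A v) : q.Certain T A v' := fun I hI => by
  obtain ⟨d, hd, hs⟩ := hq I hI
  exact ⟨d, hd, CQ.sat_congr (fun x hx => by rw [h x (UCQ.mem_fv.2 ⟨d, hd, hx⟩)]) hs⟩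

theorem ECQ.holds_congr {T : TBox} {A : ABox} {Q : ECQ} {v v' : ℕ → ℕ}
    (h : ∀ x ∈ Q.fv, v x = v' x) : Q.Holds T A v ↔ Q.Holds T A v' := by
  induction Q generalizing v v' with
  | cert q =>
    exact ⟨UCQ.certain_congr h, UCQ.certain_congr fun x hx => (h x hx).symm⟩
  | neg Q ih => exact not_congr (ih h)
  | and Q₁ Q₂ ih₁ ih₂ =>
    exact and_congr (ih₁ fun x hx => h x (Finset.mem_union_left _ hx))
      (ih₂ fun x hx => h x (Finset.mem_union_right _ hx))
  | ex x Q ih =>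
    refine exists_congr fun d => and_congr_right fun _ => ih fun y hy => ?_
    by_cases hyx : y = x
    · simp [hyx]
    · simp [hyx, h y (Finset.mem_erase.2 ⟨hyx, hy⟩)]

/-! ## Equivariance under permutations of the constants -/

def SCall.map (f : ℕ → ℕ) (t : SCall) : SCall := ⟨t.fn, t.args.map f⟩

def GTerm.map (f : ℕ → ℕ) : GTerm → GTerm
  | .val c => .val (f c)
  | .call t => .call (t.map f)

/-- The renaming of an ABox. -/
def permA (π : Equiv.Perm ℕ) (A : ABox) : ABox := A.image (Fact.map π)

/-- The renaming of a state. -/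
def KState.perm (π : Equiv.Perm ℕ) (s : KState) : KState where
  abox := permA π s.abox
  smap t := (s.smap (t.map π.symm)).map π

theorem Fact.map_id' {τ : Type} {f : τ → τ} (hf : ∀ t, f t = t) (F : Fact τ) : F.map f = F := by
  cases F <;> simp [Fact.map, hf]

@[simp]
theorem SCall.map_symm_map (π : Equiv.Perm ℕ) (t : SCall) : (t.map π).map π.symm = t := by
  cases t; simp [SCall.map]

@[simp]
theorem SCall.map_map_symm (π : Equiv.Perm ℕ) (t : SCall) : (t.map π.symm).map π = t := by
  cases t; simp [SCall.map]

@[simp]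
theorem permA_symm_permA (π : Equiv.Perm ℕ) (A : ABox) : permA π.symm (permA π A) = A := by
  simp only [permA, Finset.image_image]
  rw [Finset.image_congr (g := id), Finset.image_id]
  intro F _
  simp only [Function.comp, Fact.map_map, id]
  exact Fact.map_id' (by simp) F

@[simp]
theorem KState.perm_symm_perm (π : Equiv.Perm ℕ) (s : KState) : (s.perm π).perm π.symm = s := by
  cases s
  simp [KState.perm, Function.comp_def]

@[simp]
theorem KState.perm_perm_symm (π : Equiv.Perm ℕ) (s : KState) : (s.perm π.symm).perm π = s :=
  KState.perm_symm_perm π.symm s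

theorem Fact.map_injective {τ υ : Type} {f : τ → υ} (hf : Function.Injective f) :
    Function.Injective (Fact.map f) := by
  intro F G h
  cases F <;> cases G <;> simp_all [Fact.map, hf.eq_iff]

theorem mem_permA {π : Equiv.Perm ℕ} {A : ABox} {F : Fact ℕ} :
    F.map π ∈ permA π A ↔ F ∈ A := by
  simp only [permA, Finset.mem_image]
  exact ⟨fun ⟨G, hG, h⟩ => Fact.map_injective π.injective h ▸ hG, fun h => ⟨F, h, rfl⟩⟩

theorem mem_adom_permA {π : Equiv.Perm ℕ} {A : ABox} {c : ℕ} :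
    π c ∈ adom (permA π A) ↔ c ∈ adom A := by
  constructor
  · rintro ⟨F, hF, hc⟩
    obtain ⟨G, hG, rfl⟩ := Finset.mem_image.1 hF
    rw [Fact.terms_map, List.mem_map] at hc
    obtain ⟨d, hd, h⟩ := hc
    exact ⟨G, hG, π.injective h ▸ hd⟩
  · rintro ⟨F, hF, hc⟩
    exact ⟨F.map π, mem_permA.2 hF, by rw [Fact.terms_map]; exact List.mem_map_of_mem hc⟩

/-- An interpretation with renamed constants. -/
def Interp.rename (I : Interp) (π : Equiv.Perm ℕ) : Interp where
  Dom := I.Dom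
  ind c := I.ind (π c)
  ind_injective _ _ h := π.injective (I.ind_injective h)
  conc := I.conc
  role := I.role

theorem Interp.rename_isModel {I : Interp} {π : Equiv.Perm ℕ} {T : TBox} {A : ABox}
    (h : I.IsModel T (permA π A)) : (I.rename π).IsModel T A := by
  refine ⟨fun a ha => ?_, fun F hF => ?_⟩
  · have hr : ∀ R x y, (I.rename π).roleExt R x y ↔ I.roleExt R x y := fun R x y => by
      cases R <;> rfl
    have hb : ∀ B x, (I.rename π).basicExt B x ↔ I.basicExt B x := fun B x => by
      cases B with
      | name N => rfl
      | some R => exact exists_congr fun y => hr R x y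
    have := h.1 a ha
    cases a with
    | pos B B' => exact fun x hx => (hb _ _).2 (this x ((hb _ _).1 hx))
    | neg B B' => exact fun x hx hx' => this x ((hb _ _).1 hx) ((hb _ _).1 hx')
    | funct R => exact fun x y z hy hz => this x y z ((hr _ _ _).1 hy) ((hr _ _ _).1 hz)
  · have := h.2 _ (mem_permA.2 hF)
    rw [Fact.map_map] at this
    cases F <;> exact this

theorem Consistent.permA {T : TBox} {A : ABox} (h : Consistent T A) (π : Equiv.Perm ℕ) :
    Consistent T (permA π A) := by
  obtain ⟨I, hI⟩ := h
  exact ⟨I.rename π.symm, Interp.rename_isModel (by simpa using hI)⟩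

/-- A model of the renamed ABox becomes a model of the original one when only the interpretation of
the constants is precomposed with the permutation. The query does not notice, because its own
constants are fixed. -/
theorem UCQ.Certain.permA {T : TBox} {A : ABox} {q : UCQ} {v : ℕ → ℕ} {π : Equiv.Perm ℕ}
    (hπ : ∀ c ∈ q.consts, π c = c) (h : q.Certain T A v) :
    q.Certain T (permA π A) (fun x => π (v x)) := by
  intro I hI
  obtain ⟨d, hd, g, hg, hs⟩ := h _ (Interp.rename_isModel hI)
  refine ⟨d, hd, g, hg, fun a ha => ?_⟩
  have := hs a ha
  have he : a.map (QTerm.eval I g) = a.map (QTerm.eval (I.rename π) g) := by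
    refine Fact.map_congr fun t ht => ?_
    cases t with
    | var x => rfl
    | const c =>
      refine congrArg I.ind (hπ c ?_).symm
      exact List.mem_flatMap.2 ⟨d, hd, List.mem_flatMap.2 ⟨a, ha, List.mem_flatMap.2 ⟨_, ht,
        by simp [QTerm.consts]⟩⟩⟩
  rw [he]
  cases a <;> exact this

theorem UCQ.certain_permA {T : TBox} {A : ABox} {q : UCQ} {v : ℕ → ℕ} {π : Equiv.Perm ℕ}
    (hπ : ∀ c ∈ q.consts, π c = c) :
    q.Certain T (permA π A) (fun x => π (v x)) ↔ q.Certain T A v := by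
  refine ⟨fun h => ?_, fun h => h.permA hπ⟩
  have := h.permA (π := π.symm) fun c hc => by rw [Equiv.symm_apply_eq, hπ c hc]
  simpa using this

theorem ECQ.holds_permA {T : TBox} {A : ABox} {Q : ECQ} {v : ℕ → ℕ} {π : Equiv.Perm ℕ}
    (hπ : ∀ c ∈ Q.consts, π c = c) :
    Q.Holds T (permA π A) (fun x => π (v x)) ↔ Q.Holds T A v := by
  induction Q generalizing v with
  | cert q => exact UCQ.certain_permA hπ
  | neg Q ih => exact not_congr (ih hπ)
  | and Q₁ Q₂ ih₁ ih₂ =>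
    exact and_congr (ih₁ fun c hc => hπ c (List.mem_append_left _ hc))
      (ih₂ fun c hc => hπ c (List.mem_append_right _ hc))
  | ex x Q ih =>
    have key : ∀ d, (Function.update (fun x => π (v x)) x (π d)) =
        fun y => π (Function.update v x d y) := by
      intro d
      funext y
      by_cases h : y = x <;> simp [h]
    constructor
    · rintro ⟨d, hd, h⟩
      refine ⟨π.symm d, ?_, ?_⟩
      · rw [← mem_adom_permA (π := π)]; simpa using hd
      · refine (ih hπ).1 ?_
        rw [← key]
        simpa using h
    · rintro ⟨d, hd, h⟩
      refine ⟨π d, mem_adom_permA.2 hd, ?_⟩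
      rw [key]
      exact (ih hπ).2 h

theorem Assigns.map {params σ : List ℕ} {v : ℕ → ℕ} (h : Assigns params σ v) (f : ℕ → ℕ) :
    Assigns params (σ.map f) (fun x => f (v x)) := by
  intro pc hpc
  rw [List.zip_map_right, List.mem_map] at hpc
  obtain ⟨⟨p, c⟩, hpc, rfl⟩ := hpc
  exact congrArg f (h _ hpc)

section

variable {C₀ : List ℕ} {K : KAB} {π : Equiv.Perm ℕ}

theorem KAB.Legal.mem_actions (hK : K.WellFormed C₀) {A : ABox} {α : Action} {σ : List ℕ}
    (h : K.Legal A α σ) : α ∈ K.actions := by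
  obtain ⟨-, -, r, hr, rfl, -⟩ := h
  exact hK.rule_action r hr

theorem KAB.Legal.permA (hK : K.WellFormed C₀) (hπ : ∀ c ∈ C₀, π c = c) {A : ABox} {α : Action}
    {σ : List ℕ} (h : K.Legal A α σ) : K.Legal (permA π A) α (σ.map π) := by
  obtain ⟨h1, h2, r, hr, hα, v, hv, hQ⟩ := h
  refine ⟨by simpa using h1, fun c hc => ?_, r, hr, hα, fun x => π (v x), hv.map π, ?_⟩
  · obtain ⟨d, hd, rfl⟩ := List.mem_map.1 hc
    exact mem_adom_permA.2 (h2 d hd)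
  · exact (ECQ.holds_permA fun c hc => hπ c (hK.rule_consts r hr c hc)).2 hQ

theorem ETerm.ground_perm {t : ETerm} (hπ : ∀ c ∈ t.consts, π c = c) (v : ℕ → ℕ) :
    t.ground (fun x => π (v x)) = (t.ground v).map π := by
  cases t with
  | var x => rfl
  | const c => exact congrArg GTerm.val (hπ c (by simp [ETerm.consts])).symm
  | skolem f xs => simp [ETerm.ground, GTerm.map, SCall.map]

theorem KAB.map_mem_doFacts (hK : K.WellFormed C₀) (hπ : ∀ c ∈ C₀, π c = c) {A : ABox}
    {α : Action} (hα : α ∈ K.actions) {σ : List ℕ} {F : Fact GTerm} (h : F ∈ K.doFacts A α σ) :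
    F.map (GTerm.map π) ∈ K.doFacts (permA π A) α (σ.map π) := by
  obtain ⟨e, he, v, hv, hx, hp, hn, E, hE, rfl⟩ := h
  have hw := hK.effects α hα e he
  refine ⟨e, he, fun x => π (v x), hv.map π, fun x h1 h2 => mem_adom_permA.2 (hx x h1 h2),
    (UCQ.certain_permA fun c hc => hπ c (hw.pos_consts c hc)).2 hp,
    (ECQ.holds_permA fun c hc => hπ c (hw.neg_consts c hc)).2 hn, E, hE, ?_⟩
  rw [Fact.map_map]
  exact Fact.map_congr fun t ht =>
    (ETerm.ground_perm (fun c hc => hπ c (hw.fact_consts E hE t ht c hc)) v).symm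

theorem GTerm.map_symm_map (π : Equiv.Perm ℕ) (t : GTerm) : (t.map π).map π.symm = t := by
  cases t <;> simp [GTerm.map]

theorem GTerm.map_map_symm (π : Equiv.Perm ℕ) (t : GTerm) : (t.map π.symm).map π = t :=
  GTerm.map_symm_map π.symm t

theorem KAB.mem_doFacts_permA (hK : K.WellFormed C₀) (hπ : ∀ c ∈ C₀, π c = c) {A : ABox}
    {α : Action} (hα : α ∈ K.actions) {σ : List ℕ} {F : Fact GTerm} :
    F.map (GTerm.map π) ∈ K.doFacts (permA π A) α (σ.map π) ↔ F ∈ K.doFacts A α σ := by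
  refine ⟨fun h => ?_, K.map_mem_doFacts hK hπ hα⟩
  have := K.map_mem_doFacts (π := π.symm) hK
    (fun c hc => by rw [Equiv.symm_apply_eq, hπ c hc]) hα h
  rw [Fact.map_map, Fact.map_id' (GTerm.map_symm_map π)] at this
  simpa using this

theorem KAB.mem_doCalls_permA (hK : K.WellFormed C₀) (hπ : ∀ c ∈ C₀, π c = c) {A : ABox}
    {α : Action} (hα : α ∈ K.actions) {σ : List ℕ} {t : SCall} :
    t.map π ∈ K.doCalls (permA π A) α (σ.map π) ↔ t ∈ K.doCalls A α σ := by
  have key : ∀ (π : Equiv.Perm ℕ) (_ : ∀ c ∈ C₀, π c = c) (A : ABox) (σ : List ℕ) (t : SCall),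
      t ∈ K.doCalls A α σ → t.map π ∈ K.doCalls (permA π A) α (σ.map π) := by
    rintro π hπ A σ t ⟨F, hF, ht⟩
    refine ⟨_, K.map_mem_doFacts hK hπ hα hF, ?_⟩
    rw [Fact.terms_map]
    exact List.mem_map.2 ⟨_, ht, rfl⟩
  refine ⟨fun h => ?_, key π hπ A σ t⟩
  have := key π.symm (fun c hc => by rw [Equiv.symm_apply_eq, hπ c hc]) _ _ _ h
  simpa using this

/-- The answers are conjugated: the renamed call receives the renamed answer. Fixing `C₀` is
required because the conditions and effects of the actions mention these constants. -/
theorem KAB.ExecVia.perm (hK : K.WellFormed C₀) (hπ : ∀ c ∈ C₀, π c = c) {s s' : KState}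
    {α : Action} {σ : List ℕ} {θ : SCall → ℕ} (h : K.ExecVia s α σ θ s') :
    K.ExecVia (s.perm π) α (σ.map π) (fun t => π (θ (t.map π.symm))) (s'.perm π) := by
  have hα := h.legal.mem_actions hK
  have hcall : ∀ t, t ∈ K.doCalls (permA π s.abox) α (σ.map π) ↔
      t.map π.symm ∈ K.doCalls s.abox α σ := fun t => by
    have := K.mem_doCalls_permA hK hπ hα (A := s.abox) (σ := σ) (t := t.map π.symm)
    rwa [SCall.map_map_symm] at this
  refine ⟨h.legal.permA hK hπ, fun t ht d hd => ?_, ?_, fun t ht => ?_, fun t ht => ?_⟩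
  · obtain ⟨e, he, rfl⟩ := Option.map_eq_some_iff.1 hd
    exact congrArg π (h.agree _ ((hcall t).1 ht) e he)
  · ext F
    simp only [KState.perm, permA, Finset.coe_image, Set.mem_image]
    rw [h.abox_eq]
    constructor
    · rintro ⟨_, ⟨G, hG, rfl⟩, rfl⟩
      refine ⟨_, K.map_mem_doFacts hK hπ hα hG, ?_⟩
      rw [Fact.map_map, Fact.map_map]
      refine Fact.map_congr fun t _ => ?_
      cases t <;> simp [GTerm.map, GTerm.eval]
    · rintro ⟨G, hG, rfl⟩
      obtain ⟨G, rfl⟩ : ∃ G', G = Fact.map (GTerm.map π) G' :=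
        ⟨Fact.map (GTerm.map π.symm) G, by
          rw [Fact.map_map, Fact.map_id' (GTerm.map_map_symm π)]⟩
      refine ⟨_, ⟨G, (K.mem_doFacts_permA hK hπ hα).1 hG, rfl⟩, ?_⟩
      rw [Fact.map_map, Fact.map_map]
      refine Fact.map_congr fun t _ => ?_
      cases t <;> simp [GTerm.map, GTerm.eval]
  · simp only [KState.perm]
    rw [h.smap_call _ ((hcall t).1 ht)]
    rfl
  · simp only [KState.perm]
    rw [h.smap_old _ fun h' => ht ((hcall t).2 h')]

theorem KAB.StepBy.perm (hK : K.WellFormed C₀) (hπ : ∀ c ∈ C₀, π c = c) {s s' : KState}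
    (h : K.StepBy K.Exec s s') : K.StepBy K.Exec (s.perm π) (s'.perm π) := by
  obtain ⟨α, hα, σ, ⟨θ, h⟩, hc⟩ := h
  exact ⟨α, hα, σ.map π, ⟨_, h.perm hK hπ⟩, hc.permA π⟩

end

end KABV
namespace KABV

/-! ## Extending finite injections to permutations -/

theorem exists_perm_eqOn {S : Set ℕ} (hS : S.Finite) {f : ℕ → ℕ} (hf : S.InjOn f) :
    ∃ π : Equiv.Perm ℕ, ∀ x ∈ S, π x = f x := by
  have := hS.to_subtype
  obtain ⟨n, ⟨e⟩⟩ := Finite.exists_equiv_fin S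
  -- The symmetric group acts `n`-transitively, so it carries the enumeration of `S` to its
  -- injective image.
  obtain ⟨g, hg⟩ := (Equiv.Perm.isMultiplyPretransitive ℕ n).exists_smul_eq
    ⟨fun i => (e.symm i : ℕ), fun i j h => e.symm.injective (Subtype.ext h)⟩
    ⟨fun i => f (e.symm i), fun i j h => e.symm.injective
      (Subtype.ext (hf (e.symm i).2 (e.symm j).2 h))⟩
  refine ⟨g, fun x hx => ?_⟩
  have h : g (e.symm (e ⟨x, hx⟩) : ℕ) = f (e.symm (e ⟨x, hx⟩)) :=
    DFunLike.congr_fun hg (e ⟨x, hx⟩)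
  rwa [e.symm_apply_apply] at h

/-- Two finite families with the same equality pattern differ by a permutation. -/
theorem exists_perm_comp {ι : Type} {I : Set ι} (hI : I.Finite) {f g : ι → ℕ}
    (h : ∀ i ∈ I, ∀ j ∈ I, f i = f j ↔ g i = g j) :
    ∃ π : Equiv.Perm ℕ, ∀ i ∈ I, π (f i) = g i := by
  classical
  -- The common equality pattern makes `g i` a function of the value `f i`, which is injective on
  -- the image of `I`.
  have hφ : ∀ n : ℕ, ∃ m, ∀ i ∈ I, f i = n → g i = m := by
    intro n
    by_cases hn : ∃ i ∈ I, f i = n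
    · obtain ⟨i, hi, rfl⟩ := hn
      exact ⟨g i, fun j hj hij => (h j hj i hi).1 hij⟩
    · exact ⟨0, fun i hi hin => absurd ⟨i, hi, hin⟩ hn⟩
  choose φ hφ using hφ
  obtain ⟨π, hπ⟩ := exists_perm_eqOn (hI.image f) (f := φ) (by
    rintro _ ⟨i, hi, rfl⟩ _ ⟨j, hj, rfl⟩ hij
    rw [← hφ _ i hi rfl, ← hφ _ j hj rfl] at hij
    exact (h i hi j hj).2 hij)
  exact ⟨π, fun i hi => by rw [hπ _ ⟨i, hi, rfl⟩, ← hφ _ i hi rfl]⟩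

theorem exists_perm_lt {V : Set ℕ} (hV : V.Finite) : ∃ π : Equiv.Perm ℕ, ∀ x ∈ V,
  π x < V.ncard := by
  classical
  have := hV.to_subtype
  let e := Finite.equivFinOfCardEq (α := V) (n := V.ncard) rfl
  obtain ⟨π, hπ⟩ := exists_perm_eqOn hV (f := fun x => if h : x ∈ V then e ⟨x, h⟩ else 0) (by
    intro x hx y hy hxy
    simp only [hx, hy, dif_pos, Fin.val_inj, e.injective.eq_iff, Subtype.mk.injEq] at hxy
    exact hxy)
  exact ⟨π, fun x hx => by rw [hπ x hx]; simp [hx]⟩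

/-! ## States over a given set of constants -/

def Fact.shape {τ : Type} (F : Fact τ) : Fact Unit := F.map fun _ => ()

theorem Fact.shape_map {τ υ : Type} (f : τ → υ) (F : Fact τ) : (F.map f).shape = F.shape := by
  cases F <;> rfl

/-- The fact of the given shape with the given terms. -/
def Fact.ofShape {τ : Type} (t u : τ) : Fact Unit → Fact τ
  | .conc N _ => .conc N t
  | .role P _ _ => .role P t u

theorem finite_setOf_shape {τ : Type} {Sh : Set (Fact Unit)} (hS : Sh.Finite) {U : Set τ}
    (hU : U.Finite) : {F : Fact τ | F.shape ∈ Sh ∧ ∀ t ∈ F.terms, t ∈ U}.Finite := by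
  refine (hS.biUnion fun S _ => hU.biUnion fun t _ => hU.biUnion fun u _ =>
    Set.finite_singleton (Fact.ofShape t u S)).subset ?_
  rintro F ⟨hF, ht⟩
  simp only [Set.mem_iUnion]
  refine ⟨_, hF, ?_⟩
  cases F with
  | conc N t => exact ⟨t, ht t (by simp [Fact.terms]), t, ht t (by simp [Fact.terms]), rfl⟩
  | role P t u => exact ⟨t, ht t (by simp [Fact.terms]), u, ht u (by simp [Fact.terms]), rfl⟩

theorem finite_lists {V : Set ℕ} (hV : V.Finite) (n : ℕ) :
    {l : List ℕ | l.length = n ∧ ∀ x ∈ l, x ∈ V}.Finite := by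
  refine (List.finite_toSet (tuples hV.toFinset.toList n)).subset fun l hl => ?_
  exact mem_tuples.2 ⟨hl.1, fun x hx => by simpa using hl.2 x hx⟩

/-- Variables and constants receive a dummy signature, which can only enlarge the finite set of
signatures. -/
def ETerm.sig : ETerm → ℕ × ℕ
  | .skolem f xs => (f, xs.length)
  | _ => (0, 0)

/-- The names and arities of the service calls that `K` can issue. -/
def KAB.sigs (K : KAB) : Set (ℕ × ℕ) :=
  {p | ∃ α ∈ K.actions, ∃ e ∈ α.effects, ∃ E ∈ e.facts, ∃ t ∈ E.terms, p = t.sig}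

/-- The shapes of the facts that can occur in the states of `K`. -/
def KAB.shapes (K : KAB) : Set (Fact Unit) :=
  {S | ∃ F ∈ K.abox, S = F.shape} ∪ {S | ∃ α ∈ K.actions, ∃ e ∈ α.effects, ∃ E ∈ e.facts,
    S = E.shape}

theorem KAB.finite_sigs (K : KAB) : K.sigs.Finite := by
  refine (List.finite_toSet (K.actions.flatMap fun α => α.effects.flatMap fun e =>
    e.facts.flatMap fun E => E.terms.map ETerm.sig)).subset ?_
  rintro _ ⟨α, hα, e, he, E, hE, t, ht, rfl⟩
  simp only [List.mem_flatMap, List.mem_map, Set.mem_ofPred_eq]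
  exact ⟨α, hα, e, he, E, hE, t, ht, rfl⟩

theorem KAB.finite_shapes (K : KAB) : K.shapes.Finite := by
  refine (List.finite_toSet (K.abox.map Fact.shape ++ K.actions.flatMap fun α =>
    α.effects.flatMap fun e => e.facts.map Fact.shape)).subset ?_
  rintro _ (⟨F, hF, rfl⟩ | ⟨α, hα, e, he, E, hE, rfl⟩)
  · exact List.mem_append_left _ (List.mem_map_of_mem hF)
  · refine List.mem_append_right _ ?_
    simp only [List.mem_flatMap, List.mem_map]
    exact ⟨α, hα, e, he, E, hE, rfl⟩

/-- All constants in the ABox and the service call map of `s` belong to `V`. -/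
structure KAB.Over (K : KAB) (V : Set ℕ) (s : KState) : Prop where
  shape : ∀ F ∈ s.abox, F.shape ∈ K.shapes
  adom : adom s.abox ⊆ V
  smap : ∀ t d, s.smap t = some d → (t.fn, t.args.length) ∈ K.sigs ∧ (∀ a ∈ t.args, a ∈ V) ∧ d ∈ V

theorem finite_calls {S : Set (ℕ × ℕ)} (hS : S.Finite) {V : Set ℕ} (hV : V.Finite) :
    {t : SCall | (t.fn, t.args.length) ∈ S ∧ ∀ a ∈ t.args, a ∈ V}.Finite := by
  refine (hS.biUnion (t := fun p => SCall.mk p.1 '' {l | l.length = p.2 ∧ ∀ x ∈ l, x ∈ V})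
    fun p _ => (finite_lists hV p.2).image _).subset ?_
  rintro ⟨f, l⟩ ⟨h1, h2⟩
  exact Set.mem_biUnion h1 ⟨l, ⟨rfl, h2⟩, rfl⟩

/-- A state is determined by its set of facts and the graph of its service call map, and both are
subsets of finite sets fixed by `K` and `V`. -/
theorem KAB.finite_over (K : KAB) {V : Set ℕ} (hV : V.Finite) : {s | K.Over V s}.Finite := by
  have h1 := (finite_setOf_shape (τ := ℕ) K.finite_shapes hV).powerset
  have h2 := ((finite_calls K.finite_sigs hV).prod hV).powerset
  refine (h1.prod h2).of_injOn (f := fun s : KState => ((s.abox : Set (Fact ℕ)),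
    {p : SCall × ℕ | s.smap p.1 = some p.2})) ?_ ?_
  · intro s hs
    refine ⟨fun F hF => ⟨hs.shape F hF, fun t ht => hs.adom ⟨F, hF, ht⟩⟩, fun p hp => ?_⟩
    obtain ⟨a, b, c⟩ := hs.smap _ _ hp
    exact ⟨⟨a, b⟩, c⟩
  · rintro ⟨A, m⟩ _ ⟨A', m'⟩ _ h
    have h1 : (A : Set (Fact ℕ)) = A' := congrArg Prod.fst h
    have h2 : {p : SCall × ℕ | m p.1 = some p.2} = {p : SCall × ℕ | m' p.1 = some p.2} :=
      congrArg Prod.snd h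
    obtain rfl := Finset.coe_injective h1
    congr
    funext t
    refine Option.ext fun d => ?_
    exact Set.ext_iff.1 h2 (t, d)

theorem KAB.Over.perm {K : KAB} {V W : Set ℕ} {s : KState} (h : K.Over V s) (π : Equiv.Perm ℕ)
    (hπ : ∀ x ∈ V, π x ∈ W) : K.Over W (s.perm π) := by
  refine ⟨fun F hF => ?_, fun c hc => ?_, fun t d hd => ?_⟩
  · obtain ⟨G, hG, rfl⟩ := Finset.mem_image.1 hF
    rw [Fact.shape_map]
    exact h.shape G hG
  · have := hπ (π.symm c) (h.adom (by
      rw [← mem_adom_permA (π := π)]; simpa [KState.perm] using hc))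
    simpa using this
  · obtain ⟨e, he, rfl⟩ := Option.map_eq_some_iff.1 hd
    obtain ⟨h1, h2, h3⟩ := h.smap _ _ he
    refine ⟨by simpa [SCall.map] using h1, fun a ha => ?_, hπ _ h3⟩
    have := hπ _ (h2 (π.symm a) (List.mem_map_of_mem ha))
    simpa using this

/-- There is a uniform bound for the number of states over any `b` constants. -/
theorem KAB.exists_card_over_le (K : KAB) (b : ℕ) :
    ∃ M, ∀ V : Set ℕ, V.Finite → V.ncard ≤ b → {s | K.Over V s}.ncard ≤ M := by
  refine ⟨{s | K.Over {c | c < b} s}.ncard, fun V hV hb => ?_⟩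
  -- Renaming `V` into an initial segment embeds the states over `V` into those over the first `b`
  -- constants, so one bound serves for all `V`.
  obtain ⟨π, hπ⟩ := exists_perm_lt hV
  refine Set.ncard_le_ncard_of_injOn (fun s => s.perm π)
    (fun s hs => hs.perm π fun x hx => (hπ x hx).trans_le hb) (fun s _ s' _ h => ?_)
    (K.finite_over (Set.finite_lt_nat b))
  have := congrArg (fun s => KState.perm π.symm s) h
  simpa using this

/-! ## The terms issued by an action -/

section

variable {C₀ : List ℕ} {K : KAB}

theorem Assigns.mem {params σ : List ℕ} (hl : σ.length = params.length) {v : ℕ → ℕ}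
    (h : Assigns params σ v) {x : ℕ} (hx : x ∈ params) : v x ∈ σ := by
  obtain ⟨i, hi, rfl⟩ := List.getElem_of_mem hx
  have : (params[i], σ[i]) ∈ params.zip σ := by
    rw [List.mem_iff_getElem]
    exact ⟨i, by simp [hl, hi], by simp⟩
  rw [h _ this]
  exact List.getElem_mem _

theorem KAB.exists_of_mem_doFacts (hK : K.WellFormed C₀) {A : ABox} {α : Action} {σ : List ℕ}
    (hl : K.Legal A α σ) {F : Fact GTerm} (hF : F ∈ K.doFacts A α σ) :
    ∃ e ∈ α.effects, ∃ E ∈ e.facts, ∃ v : ℕ → ℕ, F = E.map (ETerm.ground v) ∧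
      (∀ t ∈ E.terms, ∀ x ∈ t.vars, v x ∈ adom A) ∧ ∀ t ∈ E.terms, ∀ c ∈ t.consts, c ∈ C₀ := by
  obtain ⟨e, he, v, hv, hx, -, -, E, hE, rfl⟩ := hF
  have hw := hK.effects α (hl.mem_actions hK) e he
  refine ⟨e, he, E, hE, v, rfl, fun t ht x hxt => ?_, hw.fact_consts E hE⟩
  by_cases hp : x ∈ α.params
  · exact hl.2.1 _ (hv.mem hl.1 hp)
  · refine hx x ?_ hp
    have := hw.fact_vars E hE t ht x hxt
    simpa [hp] using this

theorem KAB.doFacts_shape (hK : K.WellFormed C₀) {A : ABox} {α : Action} {σ : List ℕ}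
    (hl : K.Legal A α σ) {F : Fact GTerm} (hF : F ∈ K.doFacts A α σ) : F.shape ∈ K.shapes := by
  obtain ⟨e, he, E, hE, v, rfl, -⟩ := K.exists_of_mem_doFacts hK hl hF
  exact Or.inr ⟨α, hl.mem_actions hK, e, he, E, hE, Fact.shape_map _ _⟩

theorem KAB.mem_of_val_mem_doTerms (hK : K.WellFormed C₀) {A : ABox} {α : Action} {σ : List ℕ}
    (hl : K.Legal A α σ) {c : ℕ} (hc : GTerm.val c ∈ K.doTerms A α σ) : c ∈ C₀ ∨ c ∈ adom A := by
  obtain ⟨F, hF, hc⟩ := hc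
  obtain ⟨e, he, E, hE, v, rfl, hv, hcs⟩ := K.exists_of_mem_doFacts hK hl hF
  rw [Fact.terms_map, List.mem_map] at hc
  obtain ⟨t, ht, h⟩ := hc
  cases t with
  | var x =>
    obtain rfl : v x = c := by simpa [ETerm.ground] using h
    exact Or.inr (hv _ ht x (by simp [ETerm.vars]))
  | const d =>
    obtain rfl : d = c := by simpa [ETerm.ground] using h
    exact Or.inl (hcs _ ht d (by simp [ETerm.consts]))
  | skolem f xs => simp [ETerm.ground] at h

theorem KAB.sig_of_mem_doCalls (hK : K.WellFormed C₀) {A : ABox} {α : Action} {σ : List ℕ}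
    (hl : K.Legal A α σ) {t : SCall} (ht : t ∈ K.doCalls A α σ) :
    (t.fn, t.args.length) ∈ K.sigs ∧ ∀ a ∈ t.args, a ∈ adom A := by
  obtain ⟨F, hF, ht⟩ := ht
  obtain ⟨e, he, E, hE, v, rfl, hv, -⟩ := K.exists_of_mem_doFacts hK hl hF
  rw [Fact.terms_map, List.mem_map] at ht
  obtain ⟨u, hu, h⟩ := ht
  cases u with
  | var x => simp [ETerm.ground] at h
  | const d => simp [ETerm.ground] at h
  | skolem f xs =>
    obtain rfl : _ = t := by simpa [ETerm.ground] using h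
    refine ⟨⟨α, hl.mem_actions hK, e, he, E, hE, _, hu, by simp [ETerm.sig]⟩, fun a ha => ?_⟩
    obtain ⟨x, hx, rfl⟩ := List.mem_map.1 ha
    exact hv _ hu x hx

theorem finite_adom (A : ABox) : (adom A).Finite := by
  have : adom A = ⋃ F ∈ (A : Set (Fact ℕ)), {c | c ∈ F.terms} := by
    ext c
    simp [adom]
  rw [this]
  exact A.finite_toSet.biUnion fun F _ => List.finite_toSet _

theorem KAB.finite_doTerms (hK : K.WellFormed C₀) {A : ABox} {α : Action} {σ : List ℕ}
    (hl : K.Legal A α σ) : (K.doTerms A α σ).Finite := by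
  refine (((List.finite_toSet C₀).union (finite_adom A)).image GTerm.val |>.union
    ((finite_calls K.finite_sigs (finite_adom A)).image GTerm.call)).subset fun t ht => ?_
  cases t with
  | val c => exact Or.inl ⟨c, K.mem_of_val_mem_doTerms hK hl ht, rfl⟩
  | call t => exact Or.inr ⟨t, K.sig_of_mem_doCalls hK hl ht, rfl⟩

theorem KAB.finite_doFacts (hK : K.WellFormed C₀) {A : ABox} {α : Action} {σ : List ℕ}
    (hl : K.Legal A α σ) : (K.doFacts A α σ).Finite :=
  (finite_setOf_shape K.finite_shapes (K.finite_doTerms hK hl)).subset fun F hF =>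
    ⟨K.doFacts_shape hK hl hF, fun _ ht => ⟨F, hF, ht⟩⟩

theorem KAB.finite_doCalls (hK : K.WellFormed C₀) {A : ABox} {α : Action} {σ : List ℕ}
    (hl : K.Legal A α σ) : (K.doCalls A α σ).Finite :=
  (K.finite_doTerms hK hl).preimage (f := GTerm.call) fun _ _ _ _ h => GTerm.call.inj h

/-! ## Invariants of execution -/

theorem KAB.ExecVia.smap_mono {s s' : KState} {α : Action} {σ : List ℕ} {θ : SCall → ℕ}
    (h : K.ExecVia s α σ θ s') {t : SCall} {d : ℕ} (ht : s.smap t = some d) :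
    s'.smap t = some d := by
  by_cases hc : t ∈ K.doCalls s.abox α σ
  · rw [h.smap_call t hc, h.agree t hc d ht]
  · rw [h.smap_old t hc, ht]

theorem KAB.ExecVia.mem_adom {s s' : KState} {α : Action} {σ : List ℕ} {θ : SCall → ℕ}
    (h : K.ExecVia s α σ θ s') {c : ℕ} :
    c ∈ adom s'.abox ↔ ∃ t ∈ K.doTerms s.abox α σ, t.eval θ = c := by
  have : ∀ F, F ∈ s'.abox ↔ ∃ G ∈ K.doFacts s.abox α σ, G.map (GTerm.eval θ) = F := fun F => by
    rw [← Finset.mem_coe, h.abox_eq]; rfl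
  constructor
  · rintro ⟨F, hF, hc⟩
    obtain ⟨G, hG, rfl⟩ := (this F).1 hF
    rw [Fact.terms_map, List.mem_map] at hc
    obtain ⟨t, ht, rfl⟩ := hc
    exact ⟨t, ⟨G, hG, ht⟩, rfl⟩
  · rintro ⟨t, ⟨G, hG, ht⟩, rfl⟩
    exact ⟨_, (this _).2 ⟨G, hG, rfl⟩, by rw [Fact.terms_map]; exact List.mem_map_of_mem ht⟩

theorem KAB.ExecVia.over (hK : K.WellFormed C₀) {s s' : KState} {α : Action} {σ : List ℕ}
    {θ : SCall → ℕ} (h : K.ExecVia s α σ θ s') {V : Set ℕ} (hs : K.Over V s)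
    (hs' : adom s'.abox ⊆ V) : K.Over V s' := by
  refine ⟨fun F hF => ?_, hs', fun t d hd => ?_⟩
  · rw [← Finset.mem_coe, h.abox_eq] at hF
    obtain ⟨G, hG, rfl⟩ := hF
    rw [Fact.shape_map]
    exact K.doFacts_shape hK h.legal hG
  · by_cases hc : t ∈ K.doCalls s.abox α σ
    · rw [h.smap_call t hc, Option.some_inj] at hd
      obtain ⟨h1, h2⟩ := K.sig_of_mem_doCalls hK h.legal hc
      exact ⟨h1, fun a ha => hs.adom (h2 a ha), hs' (h.mem_adom.2 ⟨_, hc, hd⟩)⟩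
    · rw [h.smap_old t hc] at hd
      exact hs.smap t d hd

/-- The distinguished constants and the values of the service calls issued so far. -/
def KState.known (C₀ : List ℕ) (s : KState) : Set ℕ := {c | c ∈ C₀ ∨ ∃ t, s.smap t = some c}

/-- The invariant of all states generated by `K`. -/
structure KState.Inv (C₀ : List ℕ) (s : KState) : Prop where
  adom_known : adom s.abox ⊆ s.known C₀
  finite_smap : {t | (s.smap t).isSome}.Finite
  args_known : ∀ t d, s.smap t = some d → ∀ a ∈ t.args, a ∈ s.known C₀

theorem KState.Inv.finite_known {s : KState} (h : s.Inv C₀) : (s.known C₀).Finite := by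
  refine ((List.finite_toSet C₀).union
    (h.finite_smap.image fun t => (s.smap t).getD 0)).subset ?_
  rintro c (hc | ⟨t, ht⟩)
  · exact Or.inl hc
  · exact Or.inr ⟨t, by simp [ht], by simp [ht]⟩

theorem KAB.ExecVia.known_mono {s s' : KState} {α : Action} {σ : List ℕ}
    {θ : SCall → ℕ} (h : K.ExecVia s α σ θ s') : s.known C₀ ⊆ s'.known C₀ := by
  rintro c (hc | ⟨t, ht⟩)
  · exact Or.inl hc
  · exact Or.inr ⟨t, h.smap_mono ht⟩

/-- The constants of the new ABox come from `C₀`, from the old active domain or from answers, and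
the answers are recorded at once. Arguments of new calls lie in the old active domain. -/
theorem KAB.ExecVia.inv (hK : K.WellFormed C₀) {s s' : KState} {α : Action} {σ : List ℕ}
    {θ : SCall → ℕ} (h : K.ExecVia s α σ θ s') (hs : s.Inv C₀) : s'.Inv C₀ := by
  refine ⟨fun c hc => ?_, (hs.finite_smap.union (K.finite_doCalls hK h.legal)).subset
    fun t ht => ?_, fun t d ht a ha => ?_⟩
  · obtain ⟨t, ht, rfl⟩ := h.mem_adom.1 hc
    cases t with
    | val c =>
      rcases K.mem_of_val_mem_doTerms hK h.legal ht with hc | hc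
      · exact Or.inl hc
      · exact h.known_mono (hs.adom_known hc)
    | call t => exact Or.inr ⟨t, h.smap_call t ht⟩
  · by_cases hc : t ∈ K.doCalls s.abox α σ
    · exact Or.inr hc
    · left
      have ht : (s'.smap t).isSome := ht
      rwa [h.smap_old t hc] at ht
  · refine h.known_mono ?_
    by_cases hc : t ∈ K.doCalls s.abox α σ
    · exact hs.adom_known ((K.sig_of_mem_doCalls hK h.legal hc).2 a ha)
    · rw [h.smap_old t hc] at ht
      exact hs.args_known t d ht a ha

theorem KAB.inv_initState (hK : K.WellFormed C₀) : K.initState.Inv C₀ := by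
  refine ⟨?_, by simp [initState], by simp [initState]⟩
  rintro c ⟨F, hF, hc⟩
  exact Or.inl (hK.abox_consts F (List.mem_toFinset.1 hF) c hc)

theorem KAB.Reach.inv (hK : K.WellFormed C₀) {s : KState} (h : K.Reach K.Exec s) : s.Inv C₀ := by
  induction h with
  | init => exact K.inv_initState hK
  | step _ hs ih =>
    obtain ⟨α, -, σ, ⟨θ, h⟩, -⟩ := hs
    exact h.inv hK ih

theorem KAB.Reach.mono {ex ex' : KState → Action → List ℕ → KState → Prop}
    (h : ∀ s α σ s', ex s α σ s' → ex' s α σ s') {s : KState} (hs : K.Reach ex s) :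
    K.Reach ex' s := by
  induction hs with
  | init => exact .init
  | step _ hs ih =>
    obtain ⟨α, hα, σ, he, hc⟩ := hs
    exact ih.step ⟨α, hα, σ, h _ _ _ _ he, hc⟩

end

end KABV
namespace KABV

/-! ## Shortest paths -/

/-- The points reachable from `a` in `n` steps. -/
def ReachIn {α : Type} (R : α → α → Prop) (a : α) (n : ℕ) : Set α :=
  {x | ∃ τ : ℕ → α, τ 0 = a ∧ (∀ i < n, R (τ i) (τ (i + 1))) ∧ τ n = x}

theorem ReachIn.step {α : Type} {R : α → α → Prop} {a x y : α} {n : ℕ} (h : x ∈ ReachIn R a n)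
    (hxy : R x y) : y ∈ ReachIn R a (n + 1) := by
  obtain ⟨τ, h0, hτ, rfl⟩ := h
  refine ⟨fun i => if i ≤ n then τ i else y, by simpa using h0, fun i hi => ?_, by simp⟩
  rcases Nat.lt_succ_iff_lt_or_eq.1 hi with hi | rfl
  · simpa [hi.le, Nat.succ_le_of_lt hi] using hτ i hi
  · simpa using hxy

/-- A path of minimal length repeats no point, since the loop between two equal points could be cut
out. -/
theorem ReachIn.exists_injOn {α : Type} {R : α → α → Prop} {a x : α} {n : ℕ}
    (h : x ∈ ReachIn R a n) : ∃ m, ∃ τ : ℕ → α, τ 0 = a ∧ (∀ i < m, R (τ i) (τ (i + 1))) ∧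
      τ m = x ∧ (Set.Iic m).InjOn τ := by
  classical
  have hex : ∃ n, x ∈ ReachIn R a n := ⟨n, h⟩
  obtain ⟨τ, h0, hτ, hx⟩ := Nat.find_spec hex
  set m := Nat.find hex with hm
  refine ⟨m, τ, h0, hτ, hx, ?_⟩
  have key : ∀ i j, i < j → j ≤ m → τ i ≠ τ j := by
    intro i j hij hj he
    -- The path with the segment from `i` to `j` removed has length `m - (j - i)` and contradicts
    -- minimality.
    refine Nat.find_min hex (m := m - (j - i)) (by omega)
      ⟨fun k => if k ≤ i then τ k else τ (k + (j - i)), by simpa using h0, fun k hk => ?_, ?_⟩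
    · rcases lt_trichotomy k i with h | rfl | h
      · simpa [h.le, Nat.succ_le_of_lt h] using hτ k (by omega)
      · have h1 := hτ j (by omega)
        rw [← he] at h1
        have h2 : k + 1 + (j - k) = j + 1 := by omega
        simpa [h2] using h1
      · have h1 := hτ (k + (j - i)) (by omega)
        have h2 : k + 1 + (j - i) = k + (j - i) + 1 := by omega
        simpa [h.not_ge, h2, show ¬ k + 1 ≤ i by omega] using h1
    · rcases hj.lt_or_eq with h | h
      · have h2 : m - (j - i) + (j - i) = m := by omega
        simp [show ¬ m - (j - i) ≤ i by omega, h2, hx]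
      · have h2 : m - (j - i) = i := by omega
        simp only [h2, le_refl, if_true]
        rw [he, h, hx]
  intro i hi j hj he
  rcases lt_trichotomy i j with h | h | h
  · exact absurd he (key i j h hj)
  · exact h
  · exact absurd he.symm (key j i h hi)

theorem ReachIn.finite {α : Type} {R : α → α → Prop} {a : α}
    (hR : ∀ n, ∀ x ∈ ReachIn R a n, {y | R x y}.Finite) (n : ℕ) : (ReachIn R a n).Finite := by
  induction n with
  | zero =>
    refine (Set.finite_singleton a).subset ?_
    rintro x ⟨τ, h0, -, rfl⟩
    exact h0
  | succ n ih =>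
    refine (ih.biUnion fun x hx => hR n x hx).subset ?_
    rintro x ⟨τ, h0, hτ, rfl⟩
    exact Set.mem_biUnion (x := τ n) ⟨τ, h0, fun i hi => hτ i (by omega), rfl⟩ (hτ n (by omega))

/-! ## Commitments realised by executions -/

instance {S : Set GTerm} [Finite S] : Finite (EqCommitment S) := by
  have : Finite (Setoid S) := Finite.of_injective (fun r : Setoid S => r.r) fun r r' h => by
    cases r; cases r'; cases h; rfl
  exact Finite.of_injective (fun H : EqCommitment S => H.cells) fun H H' h => by
    cases H; cases H'; cases h; rfl

/-- The commitment that identifies the terms with equal values. -/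
def EqCommitment.kernel (S : Set GTerm) (θ : SCall → ℕ) : EqCommitment S where
  cells := Setoid.ker fun x : S => x.1.eval θ
  val_unique x y c d hx hy h := by
    have h : x.1.eval θ = y.1.eval θ := h
    rwa [hx, hy] at h

theorem EqCommitment.kernel_iff {S : Set GTerm} {θ : SCall → ℕ} {x y : S} :
    (kernel S θ).cells x y ↔ x.1.eval θ = y.1.eval θ := Iff.rfl

/-- The terms in `S` without the calls that are not in `D`. -/
def freshTerms (S : Set GTerm) (D : Set SCall) : Set GTerm :=
  {x | x ∈ S ∧ ∀ t, x = .call t → t ∈ D}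

/-- A commitment settles the equalities among the calls in `D` and between these and the constants,
while equalities between constants do not depend on the answers. Calls outside `D` are
unconstrained, hence the restriction to `freshTerms`. -/
theorem EqCommitment.Respected.eval_eq_iff {S : Set GTerm} {H : EqCommitment S} {D : Set SCall}
    {θ θ' : SCall → ℕ} (h : H.Respected D θ) (h' : H.Respected D θ') {x y : GTerm}
    (hx : x ∈ freshTerms S D) (hy : y ∈ freshTerms S D) :
    x.eval θ = y.eval θ ↔ x.eval θ' = y.eval θ' := by
  obtain ⟨hxS, hx⟩ := hx
  obtain ⟨hyS, hy⟩ := hy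
  cases x with
  | val c =>
    cases y with
    | val d => rfl
    | call u =>
      simp only [GTerm.eval]
      rw [eq_comm, h.vals ⟨_, hyS⟩ ⟨_, hxS⟩ u c (hy u rfl) rfl rfl,
        ← h'.vals ⟨_, hyS⟩ ⟨_, hxS⟩ u c (hy u rfl) rfl rfl, eq_comm]
  | call t =>
    cases y with
    | val d =>
      exact (h.vals ⟨_, hxS⟩ ⟨_, hyS⟩ t d (hx t rfl) rfl rfl).trans
        (h'.vals ⟨_, hxS⟩ ⟨_, hyS⟩ t d (hx t rfl) rfl rfl).symm
    | call u =>
      exact (h.calls ⟨_, hxS⟩ ⟨_, hyS⟩ t u (hx t rfl) (hy u rfl) rfl rfl).trans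
        (h'.calls ⟨_, hxS⟩ ⟨_, hyS⟩ t u (hx t rfl) (hy u rfl) rfl rfl).symm

/-- Being respected is a property of the equality pattern alone. The canonical pruning may therefore
be defined by patterns, without reference to commitments. -/
theorem EqCommitment.Respected.of_eval_eq_iff {S : Set GTerm} {H : EqCommitment S} {D : Set SCall}
    {θ θ' : SCall → ℕ} (h : H.Respected D θ)
    (hp : ∀ x ∈ freshTerms S D, ∀ y ∈ freshTerms S D,
      x.eval θ = y.eval θ ↔ x.eval θ' = y.eval θ') : H.Respected D θ' := by
  refine ⟨fun x y t u ht hu hx hy => ?_, fun x y t d ht hx hy => ?_⟩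
  · rw [← h.calls x y t u ht hu hx hy]
    exact (hp (.call t) ⟨hx ▸ x.2, by simp [ht]⟩ (.call u) ⟨hy ▸ y.2, by simp [hu]⟩).symm
  · rw [← h.vals x y t d ht hx hy]
    exact (hp (.call t) ⟨hx ▸ x.2, by simp [ht]⟩ (.val d) ⟨hy ▸ y.2, by simp⟩).symm

/-- The answers recorded in the service call map of `s`. -/
def KState.answers (s : KState) (t : SCall) : ℕ := (s.smap t).getD 0

section

variable {C₀ : List ℕ} {K : KAB}

theorem KAB.ExecVia.agrees {s s' : KState} {α : Action} {σ : List ℕ} {θ : SCall → ℕ}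
    (h : K.ExecVia s α σ θ s') :
    (EqCommitment.kernel (K.commitBase C₀ s α σ) s'.answers).Agrees s.smap := by
  intro x y t d ht hx hy
  rw [EqCommitment.kernel_iff, hx, hy]
  simp [GTerm.eval, KState.answers, h.smap_mono ht]

/-- On the calls that are issued, the recorded answers are those of `θ`. Taking the kernel of the
recorded answers yields a commitment that depends on the successor only, as is needed for counting
successors. -/
theorem KAB.ExecVia.realises {s s' : KState} {α : Action} {σ : List ℕ} {θ : SCall → ℕ}
    (h : K.ExecVia s α σ θ s') :
    K.Realises C₀ s α σ (EqCommitment.kernel (K.commitBase C₀ s α σ) s'.answers) s' := by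
  have ha : ∀ t ∈ K.doCalls s.abox α σ, s'.answers t = θ t := fun t ht => by
    simp [KState.answers, h.smap_call t ht]
  refine ⟨θ, h, fun x y t u ht hu hx hy => ?_, fun x y t d ht hx hy => ?_⟩
  · rw [EqCommitment.kernel_iff, hx, hy]
    simp [GTerm.eval, ha t ht, ha u hu]
  · rw [EqCommitment.kernel_iff, hx, hy]
    simp [GTerm.eval, ha t ht]

theorem KAB.finite_commitBase (hK : K.WellFormed C₀) {s : KState} (hs : s.Inv C₀) {α : Action}
    {σ : List ℕ} (hl : K.Legal s.abox α σ) : (K.commitBase C₀ s α σ).Finite := by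
  refine ((((List.finite_toSet C₀).image GTerm.val).union ((finite_adom s.abox).image GTerm.val)
    |>.union ((hs.finite_smap.image GTerm.call).union (hs.finite_known.image GTerm.val))).union
    (K.finite_doTerms hK hl)).subset ?_
  rintro x (((⟨c, hc, rfl⟩ | ⟨c, hc, rfl⟩) | ⟨t, d, htd, rfl | rfl⟩) | hx)
  · exact Or.inl (Or.inl (Or.inl ⟨c, hc, rfl⟩))
  · exact Or.inl (Or.inl (Or.inr ⟨c, hc, rfl⟩))
  · exact Or.inl (Or.inr (Or.inl ⟨t, by simp [htd], rfl⟩))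
  · exact Or.inl (Or.inr (Or.inr ⟨d, Or.inr ⟨t, htd⟩, rfl⟩))
  · exact Or.inr hx

/-- The base is finite and so carries finitely many commitments. Sending a kept successor to the
commitment read off its recorded answers is injective by the uniqueness clause of a pruning. -/
theorem KAB.IsPExec.finite_setOf (hK : K.WellFormed C₀)
    {pe : KState → Action → List ℕ → KState → Prop} (hpe : K.IsPExec C₀ pe) {s : KState}
    (hs : s.Inv C₀) (α : Action) (σ : List ℕ) : {s' | pe s α σ s'}.Finite := by
  rcases Set.eq_empty_or_nonempty {s' | pe s α σ s'} with h | ⟨s₁, h⟩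
  · rw [h]; exact Set.finite_empty
  obtain ⟨θ₁, h₁⟩ := hpe.sub _ _ _ _ h
  have := (K.finite_commitBase hK hs h₁.legal).to_subtype
  refine Set.Finite.of_injOn (f := fun s' : KState =>
    EqCommitment.kernel (K.commitBase C₀ s α σ) s'.answers) (Set.mapsTo_univ _ _) ?_
    Set.finite_univ
  intro s' h' s'' h'' he
  obtain ⟨θ', hθ'⟩ := hpe.sub _ _ _ _ h'
  obtain ⟨θ'', hθ''⟩ := hpe.sub _ _ _ _ h''
  have he : EqCommitment.kernel (K.commitBase C₀ s α σ) s'.answers =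
    EqCommitment.kernel (K.commitBase C₀ s α σ) s''.answers := he
  refine (hpe.unique s α σ _ hθ'.agrees ⟨s', hθ'.realises⟩).unique ⟨h', hθ'.realises⟩ ⟨h'', ?_⟩
  rw [he]
  exact hθ''.realises

theorem KAB.IsPExec.finite_stepBy (hK : K.WellFormed C₀)
    {pe : KState → Action → List ℕ → KState → Prop} (hpe : K.IsPExec C₀ pe) {s : KState}
    (hs : s.Inv C₀) : {s' | K.StepBy pe s s'}.Finite := by
  refine ((List.finite_toSet K.actions).biUnion fun α _ =>
    (finite_lists (finite_adom s.abox) α.params.length).biUnion fun σ _ =>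
    hpe.finite_setOf hK hs α σ).subset ?_
  rintro s' ⟨α, hα, σ, h, -⟩
  obtain ⟨θ, hθ⟩ := hpe.sub _ _ _ _ h
  exact Set.mem_biUnion hα (Set.mem_biUnion ⟨hθ.legal.1, hθ.legal.2.1⟩ h)

theorem KAB.reach_of_mem_reachIn {ex : KState → Action → List ℕ → KState → Prop} {τ : ℕ → KState}
    (h0 : τ 0 = K.initState) {n : ℕ} (h : ∀ i < n, K.StepBy ex (τ i) (τ (i + 1))) {i : ℕ}
    (hi : i ≤ n) : K.Reach ex (τ i) := by
  induction i with
  | zero => rw [h0]; exact .init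
  | succ i ih => exact (ih (by omega)).step (h i hi)

/-- The states along a run are over the constants that occur in it. -/
theorem KAB.over_of_run (hK : K.WellFormed C₀) {τ : ℕ → KState} (h0 : τ 0 = K.initState) {n : ℕ}
    (h : ∀ i < n, K.StepBy K.Exec (τ i) (τ (i + 1))) {V : Set ℕ}
    (hV : ∀ i ≤ n, adom (τ i).abox ⊆ V) {i : ℕ} (hi : i ≤ n) : K.Over V (τ i) := by
  induction i with
  | zero =>
    refine ⟨fun F hF => ?_, hV 0 hi, fun t d ht => ?_⟩
    · rw [h0] at hF
      exact Or.inl ⟨F, List.mem_toFinset.1 hF, rfl⟩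
    · simp [h0, initState] at ht
  | succ i ih =>
    obtain ⟨α, -, σ, ⟨θ, hθ⟩, -⟩ := h i hi
    exact hθ.over hK (ih (by omega)) (hV _ hi)

/-- All states of a run lie over the constants that occur in it. There are at most `b` of these, so
at most `M` different states are available, and a run without repetitions has length below `M`. -/
theorem KAB.exists_length_lt_of_runBounded (hK : K.WellFormed C₀)
    (hb : K.standardTS.RunBounded) : ∃ M, ∀ n (τ : ℕ → KState), τ 0 = K.initState →
      (∀ i < n, K.StepBy K.Exec (τ i) (τ (i + 1))) → (Set.Iic n).InjOn τ → n < M := by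
  obtain ⟨b, hb⟩ := hb
  obtain ⟨M, hM⟩ := K.exists_card_over_le b
  refine ⟨M, fun n τ h0 hτ hinj => ?_⟩
  -- Runs are infinite sequences of which only a prefix counts, so the path is frozen after its last
  -- state.
  let ρ : ℕ → K.standardTS.State := fun i =>
    ⟨τ (min i n), K.reach_of_mem_reachIn h0 hτ (min_le_right i n)⟩
  have hρ : K.standardTS.IsRun ((n + 1 : ℕ) : ℕ∞) ρ := by
    have h0' : τ (min 0 n) = K.initState := by simpa using h0
    refine ⟨Subtype.ext h0', fun i hi => ?_⟩
    have hi : i < n := by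
      have := Nat.cast_lt.1 hi
      omega
    have : K.StepBy K.Exec (τ (min i n)) (τ (min (i + 1) n)) := by
      rw [min_eq_left hi.le, min_eq_left (Nat.succ_le_of_lt hi)]
      exact hτ i hi
    exact this
  have hVb := hb _ ρ hρ
  set V := ⋃ i : ℕ, ⋃ _ : (i : ℕ∞) < ((n + 1 : ℕ) : ℕ∞), adom (K.standardTS.abox (ρ i)) with hV
  have hfin : V.Finite := Set.encard_lt_top_iff.1 (hVb.trans (by simp))
  have hcard : V.ncard ≤ b := by
    rw [← hfin.cast_ncard_eq] at hVb
    exact (Nat.cast_lt.1 hVb).le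
  have hsub : ∀ i ≤ n, adom (τ i).abox ⊆ V := by
    intro i hi c hc
    refine Set.mem_iUnion.2 ⟨i, Set.mem_iUnion.2 ⟨Nat.cast_lt.2 (by omega), ?_⟩⟩
    have : adom (τ (min i n)).abox = adom (K.standardTS.abox (ρ i)) := rfl
    rw [← this, min_eq_left hi]
    exact hc
  have h1 : (τ '' Set.Iic n).ncard ≤ M := by
    refine (Set.ncard_le_ncard ?_ (K.finite_over hfin)).trans (hM V hfin hcard)
    rintro _ ⟨i, hi, rfl⟩
    exact K.over_of_run hK h0 hτ hsub hi
  rw [hinj.ncard_image, Set.ncard_eq_toFinset_card'] at h1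
  simp at h1
  omega

theorem KAB.Reach.exists_reachIn {ex : KState → Action → List ℕ → KState → Prop} {s : KState}
    (h : K.Reach ex s) : ∃ n, s ∈ ReachIn (K.StepBy ex) K.initState n := by
  induction h with
  | init => exact ⟨0, fun _ => K.initState, rfl, fun i hi => absurd hi (by omega), rfl⟩
  | step _ hs ih =>
    obtain ⟨n, hn⟩ := ih
    exact ⟨n + 1, ReachIn.step hn hs⟩

theorem KAB.StepBy.mono {ex ex' : KState → Action → List ℕ → KState → Prop}
    (h : ∀ s α σ s', ex s α σ s' → ex' s α σ s') {s s' : KState} (hs : K.StepBy ex s s') :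
    K.StepBy ex' s s' := by
  obtain ⟨α, hα, σ, he, hc⟩ := hs
  exact ⟨α, hα, σ, h _ _ _ _ he, hc⟩

/-- A state of the pruning is reached there without repetitions. The path is also one of the
standard system, so its length is below `M`, and by finite branching only finitely many states are
that close to the initial one. -/
theorem KAB.IsPExec.finite_state (hK : K.WellFormed C₀) (hb : K.standardTS.RunBounded)
    {pe : KState → Action → List ℕ → KState → Prop} (hpe : K.IsPExec C₀ pe) :
    Finite (K.generated pe).State := by
  obtain ⟨M, hM⟩ := K.exists_length_lt_of_runBounded hK hb
  have hfin := ReachIn.finite (R := K.StepBy pe) (a := K.initState) fun n x hx => by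
    obtain ⟨τ, h0, hτ, rfl⟩ := hx
    exact hpe.finite_stepBy hK
      (((K.reach_of_mem_reachIn h0 hτ le_rfl).mono hpe.sub).inv hK)
  have : {s | K.Reach pe s}.Finite := by
    refine ((Set.finite_lt_nat M).biUnion fun n _ => hfin n).subset fun s hs => ?_
    obtain ⟨n, hn⟩ := hs.exists_reachIn
    obtain ⟨m, τ, h0, hτ, hs, hinj⟩ := ReachIn.exists_injOn hn
    exact Set.mem_biUnion (hM m τ h0 (fun i hi => (hτ i hi).mono hpe.sub) hinj) ⟨τ, h0, hτ, hs⟩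
  exact this.to_subtype

end

end KABV
-- Isomorphism of successors with the same commitment, and bisimilarity.
namespace KABV

theorem KState.perm_perm (π ρ : Equiv.Perm ℕ) (s : KState) :
    (s.perm π).perm ρ = s.perm (π.trans ρ) := by
  cases s
  simp only [KState.perm, permA, Finset.image_image, Option.map_map, SCall.map, List.map_map]
  congr 1
  exact Finset.image_congr fun F _ => Fact.map_map _ _ F

theorem KState.perm_refl (s : KState) : s.perm (Equiv.refl ℕ) = s := by
  have := s.perm_symm_perm (Equiv.refl ℕ)
  rw [KState.perm_perm] at this
  simpa using this

theorem SCall.map_eq_self {f : ℕ → ℕ} {t : SCall} (h : ∀ a ∈ t.args, f a = a) : t.map f = t := by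
  cases t
  simp only [SCall.map, SCall.mk.injEq, true_and]
  exact (List.map_congr_left h).trans (List.map_id _)

section

variable {C₀ : List ℕ} {K : KAB}

/-- Arguments and values of recorded calls are known constants, so a permutation that fixes these
preserves the graph of the service call map pointwise. -/
theorem KState.Inv.smap_perm {s : KState} (hs : s.Inv C₀) {ρ : Equiv.Perm ℕ}
    (hρ : ∀ c ∈ s.known C₀, ρ c = c) (t : SCall) :
    (s.smap (t.map ρ.symm)).map ρ = s.smap t := by
  have key : ∀ d, s.smap t = some d ∨ s.smap (t.map ρ.symm) = some d → t.map ρ.symm = t := by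
    rintro d (hd | hd)
    · exact SCall.map_eq_self fun a ha => by
        rw [Equiv.symm_apply_eq, hρ a (hs.args_known t d hd a ha)]
    · rw [← SCall.map_eq_self (f := ρ) fun a ha => hρ a (hs.args_known _ d hd a ha),
        SCall.map_map_symm]
  cases h : s.smap t with
  | some d =>
    rw [key d (Or.inl h), h]
    exact congrArg some (hρ d (Or.inr ⟨t, h⟩))
  | none =>
    cases h' : s.smap (t.map ρ.symm) with
    | none => rfl
    | some d =>
      rw [key d (Or.inr h'), h] at h'
      exact absurd h' (by simp)

/-- Executions that realise the same commitment lead to isomorphic states. -/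
theorem KAB.ExecVia.exists_perm (hK : K.WellFormed C₀) {s s₁ s₂ : KState} (hs : s.Inv C₀)
    {α : Action} {σ : List ℕ} {θ₁ θ₂ : SCall → ℕ} (h₁ : K.ExecVia s α σ θ₁ s₁)
    (h₂ : K.ExecVia s α σ θ₂ s₂) {H : EqCommitment (K.commitBase C₀ s α σ)}
    (hr₁ : H.Respected (K.doCalls s.abox α σ) θ₁) (hr₂ : H.Respected (K.doCalls s.abox α σ) θ₂) :
    ∃ ρ : Equiv.Perm ℕ, (∀ c ∈ s.known C₀, ρ c = c) ∧ s₂ = s₁.perm ρ := by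
  -- The values of the fresh terms under both assignments have the same equality pattern. The
  -- constants of the base are among these terms and evaluate to themselves, hence the permutation
  -- fixes the known constants.
  obtain ⟨ρ, hρ⟩ := exists_perm_comp
    (I := freshTerms (K.commitBase C₀ s α σ) (K.doCalls s.abox α σ))
    (f := GTerm.eval θ₁) (g := GTerm.eval θ₂)
    ((K.finite_commitBase hK hs h₁.legal).subset fun x hx => hx.1)
    fun x hx y hy => hr₁.eval_eq_iff hr₂ hx hy
  have hfix : ∀ c ∈ s.known C₀, ρ c = c := by
    intro c hc
    refine hρ (.val c) ⟨?_, by simp⟩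
    rcases hc with hc | ⟨t, ht⟩
    · exact Or.inl (Or.inl (Or.inl ⟨c, hc, rfl⟩))
    · exact Or.inl (Or.inr ⟨t, c, ht, Or.inr rfl⟩)
  have hterm : ∀ t ∈ K.doTerms s.abox α σ, ρ (t.eval θ₁) = t.eval θ₂ := by
    intro t ht
    exact hρ t ⟨Or.inr ht, by rintro u rfl; exact ht⟩
  have hargs : ∀ t ∈ K.doCalls s.abox α σ, ∀ a ∈ t.args, ρ a = a := fun t ht a ha =>
    hfix a (hs.adom_known ((K.sig_of_mem_doCalls hK h₁.legal ht).2 a ha))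
  refine ⟨ρ, hfix, ?_⟩
  have hA : s₂.abox = (s₁.perm ρ).abox := by
    refine Finset.coe_injective ?_
    simp only [KState.perm, permA, Finset.coe_image]
    rw [h₁.abox_eq, h₂.abox_eq, Set.image_image]
    refine Set.image_congr fun F hF => ?_
    rw [Fact.map_map]
    exact Fact.map_congr fun t ht => (hterm t ⟨F, hF, ht⟩).symm
  have hm : s₂.smap = (s₁.perm ρ).smap := by
    funext t
    simp only [KState.perm]
    by_cases ht : t ∈ K.doCalls s.abox α σ
    · have : t.map ρ.symm = t := SCall.map_eq_self fun a ha => by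
        rw [Equiv.symm_apply_eq, hargs t ht a ha]
      rw [this, h₁.smap_call t ht, h₂.smap_call t ht]
      exact congrArg some (hterm (.call t) ht).symm
    · have : t.map ρ.symm ∉ K.doCalls s.abox α σ := fun h => ht (by
        rwa [← SCall.map_eq_self (hargs _ h), SCall.map_map_symm] at h)
      rw [h₂.smap_old t ht, h₁.smap_old _ this, hs.smap_perm hfix]
  cases s₂
  simp only at hA hm
  rw [hA, hm]

/-- For the commitment realised by a given execution the pruning keeps some successor, and
`KAB.ExecVia.exists_perm` compares it with the given one. -/
theorem KAB.IsPExec.exists_step (hK : K.WellFormed C₀)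
    {pe : KState → Action → List ℕ → KState → Prop} (hpe : K.IsPExec C₀ pe) {s s' : KState}
    (hs : s.Inv C₀) (h : K.StepBy K.Exec s s') :
    ∃ ρ : Equiv.Perm ℕ, K.StepBy pe s (s'.perm ρ) ∧ ∀ c ∈ s.known C₀, ρ c = c := by
  obtain ⟨α, hα, σ, ⟨θ, hθ⟩, hc⟩ := h
  obtain ⟨s'', ⟨hp, θ₂, h₂, hr₂⟩, -⟩ := hpe.unique s α σ _ hθ.agrees ⟨s', hθ.realises⟩
  obtain ⟨θ₁, h₁, hr₁⟩ := hθ.realises (C₀ := C₀)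
  obtain ⟨ρ, hρ, rfl⟩ := h₁.exists_perm hK hs h₂ hr₁ hr₂
  exact ⟨ρ, ⟨α, hα, σ, hp, hc.permA ρ⟩, hρ⟩

/-- `s₂` is the renaming of `s₁` by a permutation that fixes `C₀` and maps `p.1` to `p.2` for
all `p ∈ P`, where `p.1` is known in `s₁`. -/
def Renamed (C₀ : List ℕ) (P : Set (ℕ × ℕ)) (s₁ s₂ : KState) : Prop :=
  ∃ π : Equiv.Perm ℕ, (∀ c ∈ C₀, π c = c) ∧ s₂ = s₁.perm π ∧
    ∀ p ∈ P, p.1 ∈ s₁.known C₀ ∧ π p.1 = p.2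

theorem KAB.StepBy.known_mono {s s' : KState} (h : K.StepBy K.Exec s s') :
    s.known C₀ ⊆ s'.known C₀ := by
  obtain ⟨α, -, σ, ⟨θ, h⟩, -⟩ := h
  exact h.known_mono

theorem Renamed.forth (hK : K.WellFormed C₀) {P : Set (ℕ × ℕ)} {s₁ s₂ s₁' : KState}
    (h : Renamed C₀ P s₁ s₂) (hs : K.StepBy K.Exec s₁ s₁') :
    ∃ s₂', K.StepBy K.Exec s₂ s₂' ∧ Renamed C₀ P s₁' s₂' := by
  obtain ⟨π, hπ, rfl, hP⟩ := h
  exact ⟨_, hs.perm hK hπ, π, hπ, rfl, fun p hp => ⟨hs.known_mono (hP p hp).1, (hP p hp).2⟩⟩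

/-- The step is pulled back along `π`, replaced by the kept successor, and `π` is corrected by the
inverse of `ρ`. As `ρ` fixes what is known in `s₁`, the pairs in `P` survive the correction. -/
theorem Renamed.back (hK : K.WellFormed C₀) {pe : KState → Action → List ℕ → KState → Prop}
    (hpe : K.IsPExec C₀ pe) {P : Set (ℕ × ℕ)} {s₁ s₂ s₂' : KState} (hi : s₁.Inv C₀)
    (h : Renamed C₀ P s₁ s₂) (hs : K.StepBy K.Exec s₂ s₂') :
    ∃ s₁', K.StepBy pe s₁ s₁' ∧ Renamed C₀ P s₁' s₂' := by
  obtain ⟨π, hπ, rfl, hP⟩ := h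
  have h1 := hs.perm (π := π.symm) hK fun c hc => by rw [Equiv.symm_apply_eq, hπ c hc]
  rw [KState.perm_symm_perm] at h1
  obtain ⟨ρ, h2, hρ⟩ := hpe.exists_step hK hi h1
  refine ⟨_, h2, ρ.symm.trans π, fun c hc => ?_, ?_, fun p hp => ⟨?_, ?_⟩⟩
  · have : ρ.symm c = c := by rw [Equiv.symm_apply_eq, hρ c (Or.inl hc)]
    simp [this, hπ c hc]
  · rw [← KState.perm_perm, KState.perm_symm_perm, KState.perm_perm_symm]
  · exact (h2.mono hpe.sub).known_mono (hP p hp).1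
  · have : ρ.symm p.1 = p.1 := by rw [Equiv.symm_apply_eq, hρ _ (hP p hp).1]
    simp [this, (hP p hp).2]

/-! ## The history-preserving bisimulation -/

open Classical in
/-- The restriction of a permutation to a set. -/
noncomputable def permOn (π : Equiv.Perm ℕ) (S : Set ℕ) : ℕ ≃. ℕ where
  toFun a := if a ∈ S then some (π a) else none
  invFun b := if π.symm b ∈ S then some (π.symm b) else none
  inv a b := by
    simp only [Option.ite_none_right_eq_some, Option.some_inj]
    constructor
    · rintro ⟨h, rfl⟩
      exact ⟨h, by simp⟩
    · rintro ⟨h, rfl⟩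
      exact ⟨by simpa using h, by simp⟩

open Classical in
theorem permOn_eq_some {π : Equiv.Perm ℕ} {S : Set ℕ} {a b : ℕ} :
    permOn π S a = some b ↔ a ∈ S ∧ π a = b := by
  change (if a ∈ S then some (π a) else none) = some b ↔ _
  simp

theorem permOn_symm_eq_some {π : Equiv.Perm ℕ} {S : Set ℕ} {a b : ℕ} :
    (permOn π S).symm b = some a ↔ a ∈ S ∧ π a = b := by
  rw [← permOn_eq_some]
  exact PEquiv.mem_iff_mem _

/-- The partial bijections are permutations restricted to the known constants. After a step the
permutation may change elsewhere, but it agrees with the old one on the old known constants, and the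
known set only grows, so the restriction is extended. -/
theorem KAB.IsPExec.hpBisimilar (hK : K.WellFormed C₀)
    {pe : KState → Action → List ℕ → KState → Prop} (hpe : K.IsPExec C₀ pe) :
    HPBisimilar C₀ (K.generated pe) K.standardTS := by
  have hinv : ∀ s : (K.generated pe).State, s.1.Inv C₀ := fun s => (s.2.mono hpe.sub).inv hK
  refine ⟨fun s₁ h s₂ => ∃ π : Equiv.Perm ℕ, (∀ c ∈ C₀, π c = c) ∧ s₂.1 = s₁.1.perm π ∧
    h = permOn π (s₁.1.known C₀), ⟨?_, ?_, ?_⟩, permOn (Equiv.refl ℕ) (K.initState.known C₀),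
    Equiv.refl ℕ, fun _ _ => rfl, (KState.perm_refl _).symm, rfl⟩
  · rintro s₁ _ ⟨_, _⟩ ⟨π, hπ, rfl, rfl⟩
    refine ⟨fun c hc => permOn_eq_some.2 ⟨Or.inl hc, hπ c hc⟩, fun c hc => ?_, fun c hc => ?_,
      fun N c d h => ?_, fun P c d c' d' h h' => ?_⟩
    · rw [permOn_eq_some.2 ⟨(hinv s₁).adom_known hc, rfl⟩]
      rfl
    · have : π.symm c ∈ adom s₁.1.abox := by
        rw [← mem_adom_permA (π := π), Equiv.apply_symm_apply]
        exact hc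
      rw [permOn_symm_eq_some.2 ⟨(hinv s₁).adom_known this, π.apply_symm_apply c⟩]
      rfl
    · obtain ⟨-, rfl⟩ := permOn_eq_some.1 h
      exact (mem_permA (π := π) (F := .conc N c)).symm
    · obtain ⟨-, rfl⟩ := permOn_eq_some.1 h
      obtain ⟨-, rfl⟩ := permOn_eq_some.1 h'
      exact (mem_permA (π := π) (F := .role P c c')).symm
  · rintro s₁ _ ⟨_, r₂⟩ ⟨π, hπ, rfl, rfl⟩ s₁' h
    have h1 : K.StepBy K.Exec s₁.1 s₁'.1 := h.mono hpe.sub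
    have h2 := h1.perm hK hπ
    refine ⟨⟨_, r₂.step h2⟩, h2, permOn π (s₁'.1.known C₀), ?_, π, hπ, rfl, rfl⟩
    intro a b hab
    obtain ⟨ha, hb⟩ := permOn_eq_some.1 hab
    exact permOn_eq_some.2 ⟨h1.known_mono ha, hb⟩
  · rintro s₁ _ s₂ ⟨π, hπ, hs, rfl⟩ s₂' h
    -- Taking for `P` the whole graph of `π` on the known constants makes the new bijection extend
    -- the old one.
    obtain ⟨t, ht, ρ, hρ, h2, hP⟩ := Renamed.back hK hpe (hinv s₁)
      (P := {p | p.1 ∈ s₁.1.known C₀ ∧ π p.1 = p.2}) ⟨π, hπ, hs, fun p hp => hp⟩ h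
    refine ⟨⟨t, s₁.2.step ht⟩, ht, permOn ρ (t.known C₀), ?_, ρ, hρ, h2, rfl⟩
    intro a b hab
    exact permOn_eq_some.2 (hP (a, b) (permOn_eq_some.1 hab))

end

end KABV
namespace KABV

/-! ## Invariance of the μ-calculus -/

/-- Negation exchanges the polarities, so monotonicity and antitonicity have to be proved together.
-/
theorem MuForm.ext_mono_aux {Υ : TS} {Z : ℕ} (Φ : MuForm) :
    ∀ {b : Bool}, Polarity Z b Φ → ∀ (v : ℕ → ℕ) {V V' : ℕ → Set Υ.State},
      (∀ Y, Y ≠ Z → V Y = V' Y) → V Z ⊆ V' Z →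
      (b = true → Φ.ext Υ v V ⊆ Φ.ext Υ v V') ∧ (b = false → Φ.ext Υ v V' ⊆ Φ.ext Υ v V) := by
  induction Φ with
  | query Q => exact fun _ _ _ _ _ _ => ⟨fun _ => subset_rfl, fun _ => subset_rfl⟩
  | neg Φ ih =>
    intro b hb v V V' h h'
    obtain ⟨h1, h2⟩ := ih hb v h h'
    exact ⟨fun e => Set.compl_subset_compl.2 (h2 (by simp [e])),
      fun e => Set.compl_subset_compl.2 (h1 (by simp [e]))⟩
  | and Φ Ψ ih ih' =>
    intro b hb v V V' h h'
    obtain ⟨h1, h2⟩ := ih hb.1 v h h'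
    obtain ⟨h3, h4⟩ := ih' hb.2 v h h'
    exact ⟨fun e => Set.inter_subset_inter (h1 e) (h3 e),
      fun e => Set.inter_subset_inter (h2 e) (h4 e)⟩
  | ex x Φ ih =>
    intro b hb v V V' h h'
    exact ⟨fun e s ⟨d, hd, hs⟩ => ⟨d, hd, (ih hb _ h h').1 e hs⟩,
      fun e s ⟨d, hd, hs⟩ => ⟨d, hd, (ih hb _ h h').2 e hs⟩⟩
  | dia Φ ih =>
    intro b hb v V V' h h'
    exact ⟨fun e s ⟨d, hd, hs⟩ => ⟨d, hd, (ih hb _ h h').1 e hs⟩,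
      fun e s ⟨d, hd, hs⟩ => ⟨d, hd, (ih hb _ h h').2 e hs⟩⟩
  | pvar Y =>
    intro b hb v V V' h h'
    by_cases hY : Y = Z
    · subst hY
      exact ⟨fun _ => h', fun e => absurd (hb rfl) (by simp [e])⟩
    · exact ⟨fun _ => (h Y hY).subset, fun _ => (h Y hY).symm.subset⟩
  | mu Y Φ ih =>
    intro b hb v V V' h h'
    rcases eq_or_ne Y Z with rfl | hY
    · have : ∀ S, Function.update V Y S = Function.update V' Y S := fun S => by
        funext X
        by_cases hX : X = Y
        · simp [hX]
        · simp [hX, h X hX]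
      simp [ext, this]
    · have key := fun S => ih (hb.resolve_left hY) v (V := Function.update V Y S)
        (V' := Function.update V' Y S) (fun X hX => by
          by_cases hXY : X = Y
          · simp [hXY]
          · simp [hXY, h X hX]) (by simpa [hY.symm] using h')
      exact ⟨fun e => Set.sInter_subset_sInter fun S hS => ((key S).1 e).trans hS,
        fun e => Set.sInter_subset_sInter fun S hS => ((key S).2 e).trans hS⟩

theorem MuForm.ext_mono {Υ : TS} {Z : ℕ} {Φ : MuForm} (hΦ : Polarity Z true Φ) (v : ℕ → ℕ)
    (V : ℕ → Set Υ.State) : Monotone fun S => Φ.ext Υ v (Function.update V Z S) :=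
  fun S S' h => (MuForm.ext_mono_aux Φ hΦ v (V := Function.update V Z S)
    (V' := Function.update V Z S') (fun Y hY => by simp [hY]) (by simpa using h)).1 rfl

/-- The sets `S₁` and `S₂` are not separated by the relation `R`. -/
def Compat {α β : Type} (R : α → β → Prop) (S₁ : Set α) (S₂ : Set β) : Prop :=
  ∀ a b, R a b → (a ∈ S₁ ↔ b ∈ S₂)

/-- The relation need not preserve the stages of both iterations in step, so the fixpoints are
compared directly. The points whose whole `R`-connected component lies in the fixpoints form a
compatible pair of sets. Its image is compatible again and contained in the fixpoints, hence in the
pair; so the pair consists of prefixpoints and equals the pair of least fixpoints. -/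
theorem compat_lfp {α β : Type} {R : α → β → Prop} {f : Set α → Set α} {g : Set β → Set β}
    (hf : Monotone f) (hg : Monotone g) (h : ∀ S₁ S₂, Compat R S₁ S₂ → Compat R (f S₁) (g S₂)) :
    Compat R (⋂₀ {S | f S ⊆ S}) (⋂₀ {S | g S ⊆ S}) := by
  set L₁ := ⋂₀ {S | f S ⊆ S} with hL₁
  set L₂ := ⋂₀ {S | g S ⊆ S} with hL₂
  have hf' : f L₁ ⊆ L₁ := fun a ha S hS => hS (hf (Set.sInter_subset_of_mem hS) ha)
  have hg' : g L₂ ⊆ L₂ := fun a ha S hS => hS (hg (Set.sInter_subset_of_mem hS) ha)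
  let r : α ⊕ β → α ⊕ β → Prop := fun x y => ∃ a b, x = .inl a ∧ y = .inr b ∧ R a b
  let mem (S₁ : Set α) (S₂ : Set β) : α ⊕ β → Prop := Sum.elim (· ∈ S₁) (· ∈ S₂)
  have hsat : ∀ S₁ S₂, Compat R S₁ S₂ → ∀ x y, Relation.EqvGen r x y →
      (mem S₁ S₂ x ↔ mem S₁ S₂ y) := by
    intro S₁ S₂ hS x y hxy
    induction hxy with
    | rel x y h =>
      obtain ⟨a, b, rfl, rfl, hab⟩ := h
      exact hS a b hab
    | refl x => rfl
    | symm x y _ ih => exact ih.symm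
    | trans x y z _ _ ih ih' => exact ih.trans ih'
  -- A point is kept only if every point connected to it by a zigzag of `R`, on either side, belongs
  -- to the respective fixpoint.
  let X₁ : Set α := {a | ∀ y, Relation.EqvGen r (.inl a) y → mem L₁ L₂ y}
  let X₂ : Set β := {b | ∀ y, Relation.EqvGen r (.inr b) y → mem L₁ L₂ y}
  have hX : Compat R X₁ X₂ := by
    intro a b hab
    have hr : Relation.EqvGen r (.inl a) (.inr b) := .rel _ _ ⟨a, b, rfl, rfl, hab⟩
    exact ⟨fun ha y hy => ha y (hr.trans _ _ _ hy),
      fun hb y hy => hb y ((hr.symm _ _).trans _ _ _ hy)⟩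
  have hX₁ : X₁ ⊆ L₁ := fun a ha => ha (.inl a) (.refl _)
  have hX₂ : X₂ ⊆ L₂ := fun b hb => hb (.inr b) (.refl _)
  have hle : ∀ y, mem (f X₁) (g X₂) y → mem L₁ L₂ y := by
    rintro (a | b) hy
    · exact hf' (hf hX₁ hy)
    · exact hg' (hg hX₂ hy)
  have h1 : L₁ ⊆ X₁ := Set.sInter_subset_of_mem fun a ha y hy =>
    hle y ((hsat _ _ (h _ _ hX) _ _ hy).1 ha)
  have h2 : L₂ ⊆ X₂ := Set.sInter_subset_of_mem fun b hb y hy =>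
    hle y ((hsat _ _ (h _ _ hX) _ _ hy).1 hb)
  rwa [h1.antisymm hX₁, h2.antisymm hX₂]

section

variable {C₀ : List ℕ} {K : KAB}

theorem Renamed.mono {P P' : Set (ℕ × ℕ)} (hP : P ⊆ P') {s₁ s₂ : KState}
    (h : Renamed C₀ P' s₁ s₂) : Renamed C₀ P s₁ s₂ := by
  obtain ⟨π, h1, h2, h3⟩ := h
  exact ⟨π, h1, h2, fun p hp => h3 p (hP hp)⟩

theorem Renamed.holds_iff {P : Set (ℕ × ℕ)} {s₁ s₂ : KState} (h : Renamed C₀ P s₁ s₂) {T : TBox}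
    {Q : ECQ} (hQ : ∀ c ∈ Q.consts, c ∈ C₀) {v₁ v₂ : ℕ → ℕ}
    (hv : ∀ x ∈ Q.fv, (v₁ x, v₂ x) ∈ P) : Q.Holds T s₁.abox v₁ ↔ Q.Holds T s₂.abox v₂ := by
  obtain ⟨π, h1, rfl, h3⟩ := h
  rw [← ECQ.holds_permA (π := π) fun c hc => h1 c (hQ c hc)]
  exact ECQ.holds_congr fun x hx => (h3 _ (hv x hx)).2

theorem Renamed.insert {P : Set (ℕ × ℕ)} {s₁ s₂ : KState} (h : Renamed C₀ P s₁ s₂)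
    (hi : s₁.Inv C₀) {d : ℕ} (hd : d ∈ adom s₁.abox) :
    ∃ e ∈ adom s₂.abox, Renamed C₀ (insert (d, e) P) s₁ s₂ := by
  obtain ⟨π, h1, rfl, h3⟩ := h
  refine ⟨π d, mem_adom_permA.2 hd, π, h1, rfl, ?_⟩
  rintro p (rfl | hp)
  · exact ⟨hi.adom_known hd, rfl⟩
  · exact h3 p hp

theorem Renamed.insert' {P : Set (ℕ × ℕ)} {s₁ s₂ : KState} (h : Renamed C₀ P s₁ s₂)
    (hi : s₁.Inv C₀) {e : ℕ} (he : e ∈ adom s₂.abox) :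
    ∃ d ∈ adom s₁.abox, Renamed C₀ (Insert.insert (d, e) P) s₁ s₂ := by
  obtain ⟨π, h1, rfl, h3⟩ := h
  have hd : π.symm e ∈ adom s₁.abox := by
    rw [← mem_adom_permA (π := π), Equiv.apply_symm_apply]
    exact he
  refine ⟨π.symm e, hd, π, h1, rfl, ?_⟩
  rintro p (rfl | hp)
  · exact ⟨hi.adom_known hd, by simp⟩
  · exact h3 p hp

/-- The set `P` records the pairs of constants held by the free variables. Such constants may leave
the active domain but remain known, so later steps preserve them. A quantifier enlarges `P`, which
shrinks the relation and keeps the assumption on predicate variables; at a fixpoint `P` is constant.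
-/
theorem KAB.IsPExec.compat_ext (hK : K.WellFormed C₀)
    {pe : KState → Action → List ℕ → KState → Prop} (hpe : K.IsPExec C₀ pe) (Φ : MuForm) :
    Φ.SynMonotone → (∀ c ∈ Φ.consts, c ∈ C₀) → ∀ (P : Set (ℕ × ℕ)) (v₁ v₂ : ℕ → ℕ),
      (∀ x ∈ Φ.fv, (v₁ x, v₂ x) ∈ P) → ∀ (V₁ : ℕ → Set (K.generated pe).State)
      (V₂ : ℕ → Set K.standardTS.State),
      (∀ Z ∈ Φ.fpv, Compat (fun s₁ s₂ => Renamed C₀ P s₁.1 s₂.1) (V₁ Z) (V₂ Z)) →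
      Compat (fun s₁ s₂ => Renamed C₀ P s₁.1 s₂.1) (Φ.ext (K.generated pe) v₁ V₁)
        (Φ.ext K.standardTS v₂ V₂) := by
  have hinv : ∀ s : (K.generated pe).State, s.1.Inv C₀ := fun s => (s.2.mono hpe.sub).inv hK
  induction Φ with
  | query Q => exact fun _ hc P v₁ v₂ hv V₁ V₂ _ s₁ s₂ h => h.holds_iff hc hv
  | neg Φ ih =>
    exact fun hm hc P v₁ v₂ hv V₁ V₂ hV s₁ s₂ h =>
      not_congr (ih hm hc P v₁ v₂ hv V₁ V₂ hV s₁ s₂ h)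
  | and Φ Ψ ih ih' =>
    exact fun hm hc P v₁ v₂ hv V₁ V₂ hV s₁ s₂ h => and_congr
      (ih hm.1 (fun c h => hc c (List.mem_append_left _ h)) P v₁ v₂
        (fun x h => hv x (Finset.mem_union_left _ h)) V₁ V₂
        (fun Z h => hV Z (Finset.mem_union_left _ h)) s₁ s₂ h)
      (ih' hm.2 (fun c h => hc c (List.mem_append_right _ h)) P v₁ v₂
        (fun x h => hv x (Finset.mem_union_right _ h)) V₁ V₂
        (fun Z h => hV Z (Finset.mem_union_right _ h)) s₁ s₂ h)
  | ex x Φ ih =>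
    intro hm hc P v₁ v₂ hv V₁ V₂ hV s₁ s₂ h
    have key : ∀ d e, Renamed C₀ (insert (d, e) P) s₁.1 s₂.1 →
        (s₁ ∈ Φ.ext (K.generated pe) (Function.update v₁ x d) V₁ ↔
          s₂ ∈ Φ.ext K.standardTS (Function.update v₂ x e) V₂) := by
      intro d e h
      refine ih hm hc _ _ _ (fun y hy => ?_) V₁ V₂ (fun Z hZ t₁ t₂ ht => hV Z hZ t₁ t₂
        (ht.mono (Set.subset_insert _ _))) s₁ s₂ h
      by_cases hyx : y = x
      · simp [hyx]
      · simpa [hyx] using Or.inr (hv y (Finset.mem_erase.2 ⟨hyx, hy⟩))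
    constructor
    · rintro ⟨d, hd, hs⟩
      obtain ⟨e, he, h'⟩ := h.insert (hinv s₁) hd
      exact ⟨e, he, (key d e h').1 hs⟩
    · rintro ⟨e, he, hs⟩
      obtain ⟨d, hd, h'⟩ := h.insert' (hinv s₁) he
      exact ⟨d, hd, (key d e h').2 hs⟩
  | dia Φ ih =>
    intro hm hc P v₁ v₂ hv V₁ V₂ hV s₁ s₂ h
    constructor
    · rintro ⟨s₁', hs, hs'⟩
      obtain ⟨t, ht, h'⟩ := h.forth hK (StepBy.mono hpe.sub hs)
      exact ⟨⟨t, s₂.2.step ht⟩, ht, (ih hm hc P v₁ v₂ hv V₁ V₂ hV s₁' ⟨t, s₂.2.step ht⟩ h').1 hs'⟩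
    · rintro ⟨s₂', hs, hs'⟩
      obtain ⟨t, ht, h'⟩ := h.back hK hpe (hinv s₁) hs
      exact ⟨⟨t, s₁.2.step ht⟩, ht, (ih hm hc P v₁ v₂ hv V₁ V₂ hV ⟨t, s₁.2.step ht⟩ s₂' h').2 hs'⟩
  | pvar Z => exact fun _ _ P v₁ v₂ _ V₁ V₂ hV => hV Z (by simp [MuForm.fpv])
  | mu Z Φ ih =>
    intro hm hc P v₁ v₂ hv V₁ V₂ hV
    refine compat_lfp (MuForm.ext_mono hm.1 v₁ V₁) (MuForm.ext_mono hm.1 v₂ V₂)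
      fun S₁ S₂ hS => ih hm.2 hc P v₁ v₂ hv _ _ fun Y hY => ?_
    by_cases hYZ : Y = Z
    · subst hYZ
      simpa using hS
    · simpa [hYZ] using hV Y (Finset.mem_erase.2 ⟨hYZ, hY⟩)

theorem KAB.IsPExec.models_iff (hK : K.WellFormed C₀)
    {pe : KState → Action → List ℕ → KState → Prop} (hpe : K.IsPExec C₀ pe) {Φ : MuForm}
    (hΦ : Φ.IsSentence C₀) : (K.generated pe).Models Φ ↔ K.standardTS.Models Φ := by
  refine hpe.compat_ext hK Φ hΦ.monotone hΦ.consts_mem ∅ _ _ ?_ _ _ ?_ _ _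
    ⟨Equiv.refl ℕ, fun _ _ => rfl, (KState.perm_refl _).symm, by simp⟩
  · simp [hΦ.closed]
  · simp [hΦ.pclosed]

end

end KABV
namespace KABV

/-! ## A canonical pruning -/

/-- The terms of the commitment base of `ασ` on which the answers to its calls matter. -/
def KAB.newTerms (C₀ : List ℕ) (K : KAB) (s : KState) (α : Action) (σ : List ℕ) : Set GTerm :=
  freshTerms (K.commitBase C₀ s α σ) (K.doCalls s.abox α σ)

/-- `θ` and `θ'` lead to the same equalities between the terms in `S`. -/
def SamePattern (S : Set GTerm) (θ θ' : SCall → ℕ) : Prop :=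
  ∀ x ∈ S, ∀ y ∈ S, x.eval θ = y.eval θ ↔ x.eval θ' = y.eval θ'

theorem SamePattern.symm {S : Set GTerm} {θ θ' : SCall → ℕ} (h : SamePattern S θ θ') :
    SamePattern S θ' θ := fun x hx y hy => (h x hx y hy).symm

theorem SamePattern.trans {S : Set GTerm} {θ θ' θ'' : SCall → ℕ} (h : SamePattern S θ θ')
    (h' : SamePattern S θ' θ'') : SamePattern S θ θ'' :=
  fun x hx y hy => (h x hx y hy).trans (h' x hx y hy)

theorem GTerm.eval_congr {θ θ' : SCall → ℕ} {x : GTerm} (h : ∀ t, x = .call t → θ t = θ' t) :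
    x.eval θ = x.eval θ' := by
  cases x with
  | val c => rfl
  | call t => exact h t rfl

theorem samePattern_of_eqOn {S : Set GTerm} {D : Set SCall} {θ θ' : SCall → ℕ}
    (h : ∀ t ∈ D, θ t = θ' t) : SamePattern (freshTerms S D) θ θ' := fun x hx y hy => by
  rw [GTerm.eval_congr fun t ht => h t (hx.2 t ht), GTerm.eval_congr fun t ht => h t (hy.2 t ht)]

section

variable {C₀ : List ℕ} {K : KAB} {s s' s'' : KState} {α : Action} {σ : List ℕ} {θ θ' : SCall → ℕ}

theorem KAB.ExecVia.answers_eq (h : K.ExecVia s α σ θ s') {t : SCall}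
    (ht : t ∈ K.doCalls s.abox α σ) : s'.answers t = θ t := by
  simp [KState.answers, h.smap_call t ht]

theorem KAB.ExecVia.samePattern (h : K.ExecVia s α σ θ s') :
    SamePattern (K.newTerms C₀ s α σ) s'.answers θ :=
  samePattern_of_eqOn fun _ ht => h.answers_eq ht

/-- A selection of one successor for each equality pattern is a pruning. -/
theorem KAB.isPExec_of_pattern {pe : KState → Action → List ℕ → KState → Prop}
    (hsub : ∀ s α σ s', pe s α σ s' → K.Exec s α σ s')
    (hex : ∀ s α σ s', K.Exec s α σ s' →
      ∃ s'', pe s α σ s'' ∧ SamePattern (K.newTerms C₀ s α σ) s'.answers s''.answers)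
    (huniq : ∀ s α σ s' s'', pe s α σ s' → pe s α σ s'' →
      SamePattern (K.newTerms C₀ s α σ) s'.answers s''.answers → s' = s'') :
    K.IsPExec C₀ pe := by
  refine ⟨hsub, fun s α σ H hH ⟨s', θ, h, hr⟩ => ?_⟩
  obtain ⟨s'', hp, hs⟩ := hex s α σ s' ⟨θ, h⟩
  obtain ⟨θ', h'⟩ := hsub _ _ _ _ hp
  refine ⟨s'', ⟨hp, θ', h', hr.of_eval_eq_iff
    ((h.samePattern.symm.trans hs).trans h'.samePattern)⟩, fun t ⟨hpt, θt, ht, hrt⟩ => ?_⟩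
  refine huniq s α σ t s'' hpt hp ((ht.samePattern.trans ?_).trans hs)
  exact SamePattern.trans (fun x hx y hy => hrt.eval_eq_iff hr hx hy) h.samePattern.symm

theorem KAB.ExecVia.unique (h : K.ExecVia s α σ θ s') (h' : K.ExecVia s α σ θ' s'')
    (he : ∀ t ∈ K.doCalls s.abox α σ, θ t = θ' t) : s' = s'' := by
  have hA : s'.abox = s''.abox := by
    refine Finset.coe_injective ?_
    rw [h.abox_eq, h'.abox_eq]
    exact Set.image_congr fun F hF => Fact.map_congr fun t ht =>
      GTerm.eval_congr fun u hu => he u ⟨F, hF, hu ▸ ht⟩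
  have hm : s'.smap = s''.smap := by
    funext t
    by_cases ht : t ∈ K.doCalls s.abox α σ
    · rw [h.smap_call t ht, h'.smap_call t ht, he t ht]
    · rw [h.smap_old t ht, h'.smap_old t ht]
  cases s'
  cases s''
  simp only at hA hm
  rw [hA, hm]

theorem KAB.exists_execVia (hK : K.WellFormed C₀) (hl : K.Legal s.abox α σ)
    (ha : ∀ t ∈ K.doCalls s.abox α σ, ∀ d, s.smap t = some d → θ t = d) :
    ∃ s', K.ExecVia s α σ θ s' := by
  classical
  refine ⟨⟨(K.finite_doFacts hK hl).toFinset.image (Fact.map (GTerm.eval θ)),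
    fun t => if t ∈ K.doCalls s.abox α σ then some (θ t) else s.smap t⟩, hl, ha, ?_, ?_, ?_⟩
  · simp
  · intro t ht
    simp [ht]
  · intro t ht
    simp [ht]

/-- The constants of the commitment base in a state. -/
def KState.base (C₀ : List ℕ) (s : KState) : Set ℕ :=
  {c | c ∈ C₀ ∨ c ∈ adom s.abox ∨ ∃ t, s.smap t = some c}

theorem KState.finite_base (h : {t | (s.smap t).isSome}.Finite) : (s.base C₀).Finite := by
  refine ((List.finite_toSet C₀).union ((finite_adom s.abox).union
    (h.image fun t => (s.smap t).getD 0))).subset ?_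
  rintro c (hc | hc | ⟨t, ht⟩)
  · exact Or.inl hc
  · exact Or.inr (Or.inl hc)
  · exact Or.inr (Or.inr ⟨t, by simp [ht], by simp [ht]⟩)

theorem KAB.val_mem_newTerms (hK : K.WellFormed C₀) (hl : K.Legal s.abox α σ) {c : ℕ} :
    GTerm.val c ∈ K.newTerms C₀ s α σ ↔ c ∈ s.base C₀ := by
  constructor
  · rintro ⟨((⟨d, hd, h⟩ | ⟨d, hd, h⟩) | ⟨t, d, ht, h | h⟩) | h, -⟩
    · exact Or.inl (GTerm.val.inj h ▸ hd)
    · exact Or.inr (Or.inl (GTerm.val.inj h ▸ hd))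
    · simp at h
    · exact Or.inr (Or.inr ⟨t, GTerm.val.inj h ▸ ht⟩)
    · rcases K.mem_of_val_mem_doTerms hK hl h with h | h
      · exact Or.inl h
      · exact Or.inr (Or.inl h)
  · rintro (h | h | ⟨t, ht⟩)
    · exact ⟨Or.inl (Or.inl (Or.inl ⟨c, h, rfl⟩)), by simp⟩
    · exact ⟨Or.inl (Or.inl (Or.inr ⟨c, h, rfl⟩)), by simp⟩
    · exact ⟨Or.inl (Or.inr ⟨t, c, ht, Or.inr rfl⟩), by simp⟩

theorem KAB.call_mem_newTerms {t : SCall} :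
    GTerm.call t ∈ K.newTerms C₀ s α σ ↔ t ∈ K.doCalls s.abox α σ :=
  ⟨fun h => h.2 t rfl, fun h => ⟨Or.inr h, by rintro u hu; cases hu; exact h⟩⟩

theorem KAB.samePattern_iff (hK : K.WellFormed C₀) (hl : K.Legal s.abox α σ) :
    SamePattern (K.newTerms C₀ s α σ) θ θ' ↔
      (∀ t ∈ K.doCalls s.abox α σ, ∀ c ∈ s.base C₀, θ t = c ↔ θ' t = c) ∧
      ∀ t ∈ K.doCalls s.abox α σ, ∀ u ∈ K.doCalls s.abox α σ, θ t = θ u ↔ θ' t = θ' u := by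
  constructor
  · exact fun h => ⟨fun t ht c hc => h (.call t) (K.call_mem_newTerms.2 ht) (.val c)
      ((K.val_mem_newTerms hK hl).2 hc), fun t ht u hu => h (.call t) (K.call_mem_newTerms.2 ht)
      (.call u) (K.call_mem_newTerms.2 hu)⟩
  · rintro ⟨h1, h2⟩ x hx y hy
    cases x with
    | val c =>
      cases y with
      | val d => rfl
      | call u =>
        have := h1 u (K.call_mem_newTerms.1 hy) c ((K.val_mem_newTerms hK hl).1 hx)
        simp only [GTerm.eval]
        rw [eq_comm, this, eq_comm]
    | call t =>
      cases y with
      | val d => exact h1 t (K.call_mem_newTerms.1 hx) d ((K.val_mem_newTerms hK hl).1 hy)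
      | call u => exact h2 t (K.call_mem_newTerms.1 hx) u (K.call_mem_newTerms.1 hy)

/-- `M` is the least strict upper bound of `X`. -/
def IsSup (X : Set ℕ) (M : ℕ) : Prop := (∀ x ∈ X, x < M) ∧ (M = 0 ∨ ∃ x ∈ X, x + 1 = M)

theorem IsSup.unique {X : Set ℕ} {M M' : ℕ} (h : IsSup X M) (h' : IsSup X M') : M = M' := by
  have key : ∀ {M M' : ℕ}, IsSup X M → IsSup X M' → M ≤ M' := by
    rintro M M' ⟨-, rfl | ⟨x, hx, rfl⟩⟩ h'
    · exact Nat.zero_le _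
    · exact h'.1 x hx
  exact (key h h').antisymm (key h' h)

theorem exists_isSup {X : Set ℕ} (hX : X.Finite) : ∃ M, IsSup X M := by
  rcases X.eq_empty_or_nonempty with rfl | h
  · exact ⟨0, by simp [IsSup]⟩
  · obtain ⟨a, ha, hmax⟩ := hX.exists_maximal h
    refine ⟨a + 1, fun x hx => Nat.lt_succ_of_le ?_, Or.inr ⟨a, ha, rfl⟩⟩
    by_contra hlt
    exact hlt (hmax hx (by omega))

/-- Fresh answers are determined by the least call in their class. -/
def CanonAnswers (X : Set ℕ) (M : ℕ) (D : Set SCall) (θ : SCall → ℕ) : Prop :=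
  ∀ t ∈ D, θ t ∈ X ∨ ∃ u ∈ D, θ u = θ t ∧ θ t = M + Encodable.encode u ∧
    ∀ u' ∈ D, θ u' = θ t → Encodable.encode u ≤ Encodable.encode u'

open Classical in
theorem CanonAnswers.exists_of {X : Set ℕ} {M : ℕ} (hM : ∀ x ∈ X, x < M) (D : Set SCall)
    (θ : SCall → ℕ) : ∃ θ', CanonAnswers X M D θ' ∧
      (∀ t ∈ D, ∀ c ∈ X, θ t = c ↔ θ' t = c) ∧ ∀ t ∈ D, ∀ u ∈ D, θ t = θ u ↔ θ' t = θ' u := by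
  let C (t : SCall) : Set ℕ := {n | ∃ u ∈ D, θ u = θ t ∧ n = Encodable.encode u}
  -- Answers outside `X` become at least `M` and so stay outside, and different classes receive
  -- different values because their least calls are different.
  let θ' (t : SCall) : ℕ := if θ t ∈ X then θ t else M + sInf (C t)
  have hC : ∀ t ∈ D, ∃ u ∈ D, θ u = θ t ∧ sInf (C t) = Encodable.encode u := fun t ht =>
    Nat.sInf_mem (s := C t) ⟨_, t, ht, rfl, rfl⟩
  have hX : ∀ t ∈ D, ∀ c ∈ X, θ t = c ↔ θ' t = c := by
    intro t ht c hc
    by_cases h : θ t ∈ X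
    · simp [θ', h]
    · have h1 : θ t ≠ c := fun e => h (e ▸ hc)
      have h2 : θ' t ≠ c := by
        have := hM c hc
        simp only [θ', if_neg h]
        omega
      exact iff_of_false h1 h2
  have hD : ∀ t ∈ D, ∀ u ∈ D, θ t = θ u ↔ θ' t = θ' u := by
    intro t ht u hu
    by_cases h : θ t ∈ X
    · have h1 := hX u hu _ h
      have h2 : θ' t = θ t := by simp [θ', h]
      rw [h2, eq_comm, h1, eq_comm]
    · by_cases h' : θ u ∈ X
      · have h1 := hX t ht _ h'
        have h2 : θ' u = θ u := by simp [θ', h']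
        rw [h2, h1]
      · constructor
        · intro e
          have : C t = C u := by simp only [C, e]
          simp [θ', h, h', this]
        · intro e
          have e : sInf (C t) = sInf (C u) := by simpa [θ', h, h'] using e
          obtain ⟨a, -, ha, ha'⟩ := hC t ht
          obtain ⟨b, -, hb, hb'⟩ := hC u hu
          rw [ha', hb', Encodable.encode_inj] at e
          rw [← ha, ← hb, e]
  refine ⟨θ', fun t ht => ?_, hX, hD⟩
  by_cases h : θ t ∈ X
  · exact Or.inl (by simp [θ', h])
  · right
    obtain ⟨u, hu, hut, hc⟩ := hC t ht
    refine ⟨u, hu, (hD u hu t ht).1 hut, by simp [θ', h, hc], fun u' hu' he => ?_⟩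
    rw [← hc]
    exact Nat.sInf_le ⟨u', hu', (hD u' hu' t ht).2 he, rfl⟩

/-- The pattern determines which answers lie in `X`, and which ones; every other class has the same
members under both assignments, hence the same least code and the same value. -/
theorem CanonAnswers.eqOn {X : Set ℕ} {M : ℕ} {D : Set SCall} {θ θ' : SCall → ℕ}
    (h : CanonAnswers X M D θ) (h' : CanonAnswers X M D θ')
    (hX : ∀ t ∈ D, ∀ c ∈ X, θ t = c ↔ θ' t = c)
    (hD : ∀ t ∈ D, ∀ u ∈ D, θ t = θ u ↔ θ' t = θ' u) : ∀ t ∈ D, θ t = θ' t := by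
  intro t ht
  rcases h t ht with h1 | ⟨u, hu, hut, he, hmin⟩
  · exact ((hX t ht _ h1).1 rfl).symm
  · rcases h' t ht with h2 | ⟨u', hu', hut', he', hmin'⟩
    · exact (hX t ht _ h2).2 rfl
    · have a := hmin u' hu' ((hD u' hu' t ht).2 hut')
      have b := hmin' u hu ((hD u hu t ht).1 hut)
      rw [he, he', a.antisymm b]

/-- The executions with canonical answers; in states with infinitely many recorded calls, one
execution is chosen for each equality pattern. -/
def KAB.canonExec (C₀ : List ℕ) (K : KAB) (s : KState) (α : Action) (σ : List ℕ) (s' : KState) :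
    Prop :=
  ({t | (s.smap t).isSome}.Finite ∧ ∃ θ M, K.ExecVia s α σ θ s' ∧ IsSup (s.base C₀) M ∧
    CanonAnswers (s.base C₀) M (K.doCalls s.abox α σ) θ) ∨
  (¬ {t | (s.smap t).isSome}.Finite ∧ ∃ h : ∃ s'', K.Exec s α σ s'' ∧
    SamePattern (K.newTerms C₀ s α σ) s'.answers s''.answers, s' = h.choose)

/-- A pruning must be defined at all states, including unreachable ones that record infinitely many
calls. There the base may be unbounded and no fresh number above it need exist; such states are
served by an arbitrary choice. -/
theorem KAB.isPExec_canonExec (hK : K.WellFormed C₀) : K.IsPExec C₀ (K.canonExec C₀) := by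
  refine K.isPExec_of_pattern ?_ ?_ ?_
  · rintro s α σ s' (⟨-, θ, M, h, -⟩ | ⟨-, h, he⟩)
    · exact ⟨θ, h⟩
    · have := h.choose_spec.1
      rwa [← he] at this
  · rintro s α σ s' ⟨θ, h⟩
    by_cases hf : {t | (s.smap t).isSome}.Finite
    · obtain ⟨M, hM⟩ := exists_isSup (KState.finite_base (C₀ := C₀) hf)
      obtain ⟨θ', hc, hX, hD⟩ := CanonAnswers.exists_of hM.1 (K.doCalls s.abox α σ) θ
      obtain ⟨s'', h''⟩ := K.exists_execVia hK (s := s) (α := α) (σ := σ) (θ := θ') h.legal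
        fun t ht d hd => (hX t ht d (Or.inr (Or.inr ⟨t, hd⟩))).1 (h.agree t ht d hd)
      exact ⟨s'', Or.inl ⟨hf, θ', M, h'', hM, hc⟩, (h.samePattern.trans
        ((K.samePattern_iff hK h.legal).2 ⟨hX, hD⟩)).trans h''.samePattern.symm⟩
    · have hex : ∃ s'', K.Exec s α σ s'' ∧
          SamePattern (K.newTerms C₀ s α σ) s'.answers s''.answers :=
        ⟨s', ⟨θ, h⟩, fun _ _ _ _ => Iff.rfl⟩
      have hspec := hex.choose_spec
      have hex' : ∃ s'', K.Exec s α σ s'' ∧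
          SamePattern (K.newTerms C₀ s α σ) hex.choose.answers s''.answers :=
        ⟨s', ⟨θ, h⟩, hspec.2.symm⟩
      refine ⟨hex.choose, Or.inr ⟨hf, hex', ?_⟩, hspec.2⟩
      -- A choice depends only on the predicate chosen from, and equal patterns yield equal
      -- predicates by transitivity.
      congr 1
      funext t
      exact propext (and_congr_right fun _ => ⟨fun h => hspec.2.symm.trans h, fun h =>
        hspec.2.trans h⟩)
  · rintro s α σ s' s'' (⟨hf, θ, M, h, hM, hc⟩ | ⟨hf, h, he⟩) (⟨hf', θ', M', h', hM', hc'⟩ |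
      ⟨hf', h', he'⟩) hp
    · obtain rfl := hM.unique hM'
      obtain ⟨hX, hD⟩ := (K.samePattern_iff hK h.legal).1
        ((h.samePattern.symm.trans hp).trans h'.samePattern)
      exact h.unique h' (hc.eqOn hc' hX hD)
    · exact absurd hf hf'
    · exact absurd hf' hf
    · rw [he, he']
      congr 1
      funext t
      exact propext (and_congr_right fun _ => ⟨fun h => hp.symm.trans h, fun h => hp.trans h⟩)

end

end KABV
namespace KABV

/-! ## Finite representations of states and executions -/

/-- Effects, actions, rules and knowledge and action bases with EQL queries given by their codes. -/
abbrev RawEffect := UCQ × ℕ × List (Fact ETerm)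

abbrev RawAction := List ℕ × List RawEffect

abbrev RawRule := ℕ × RawAction

abbrev RawKAB := TBox × List (Fact ℕ) × List RawAction × List RawRule

/-- Queries of the recursive type `ECQ` are left as codes. The remaining data are built from
numbers, sums, products and lists, so their primitive recursive encodings come for free, and
`ECQRule` works on codes. -/
def Effect.raw (e : Effect) : RawEffect := (e.qpos, e.qneg.code, e.facts)

def Action.raw (α : Action) : RawAction := (α.params, α.effects.map Effect.raw)

def Rule.raw (r : Rule) : RawRule := (r.cond.code, r.act.raw)

def KAB.raw (K : KAB) : RawKAB :=
  (K.tbox, K.abox, K.actions.map Action.raw, K.process.map Rule.raw)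

theorem Effect.raw_injective : Function.Injective Effect.raw := by
  rintro ⟨q, Q, E⟩ ⟨q', Q', E'⟩ h
  simp only [Effect.raw, Prod.mk.injEq] at h
  obtain ⟨rfl, h, rfl⟩ := h
  rw [ECQ.code_injective h]

theorem Action.raw_injective : Function.Injective Action.raw := by
  rintro ⟨p, e⟩ ⟨p', e'⟩ h
  simp only [Action.raw, Prod.mk.injEq] at h
  obtain ⟨rfl, h⟩ := h
  rw [Effect.raw_injective.list_map h]

/-- The pairs of corresponding entries of two lists. -/
def zipL {β : Type} (d : β) (xs : List β) (ys : List ℕ) : List (β × ℕ) :=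
  (List.range xs.length).map fun i => (xs.getD i d, ys.getD i 0)

/-- `zipL` accesses entries by position, which makes it visibly primitive recursive. On lists of
equal length nothing is lost. -/
theorem zipL_eq {β : Type} {d : β} {xs : List β} {ys : List ℕ} (h : ys.length = xs.length) :
    zipL d xs ys = xs.zip ys := by
  refine List.ext_getElem (by simp [zipL, h]) fun i h1 h2 => ?_
  simp only [zipL, List.length_map, List.length_range] at h1
  simp [zipL, h1, h]

theorem mem_of_lookup {β : Type} [DecidableEq β] {ps : List (β × ℕ)} {x : β} {c : ℕ}
    (h : ps.lookup x = some c) : (x, c) ∈ ps := by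
  induction ps with
  | nil => simp at h
  | cons p ps ih =>
    obtain ⟨y, d⟩ := p
    rw [List.lookup_cons] at h
    by_cases hxy : x = y
    · subst hxy
      simp at h
      simp [h]
    · have : (x == y) = false := by simpa using hxy
      rw [this] at h
      exact List.mem_cons_of_mem _ (ih h)

theorem lookup_isSome {β : Type} [DecidableEq β] {ps : List (β × ℕ)} {x : β}
    (h : x ∈ ps.map Prod.fst) : ∃ c, ps.lookup x = some c := by
  induction ps with
  | nil => simp at h
  | cons p ps ih =>
    obtain ⟨y, d⟩ := p
    rw [List.lookup_cons]
    by_cases hxy : x = y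
    · exact ⟨d, by simp [hxy]⟩
    · have : (x == y) = false := by simpa using hxy
      rw [this]
      exact ih (by simpa [hxy] using h)

theorem lookup_eq_of_nodup {β : Type} [DecidableEq β] {ps : List (β × ℕ)}
    (hn : (ps.map Prod.fst).Nodup) {x : β} {c : ℕ} (h : (x, c) ∈ ps) : ps.lookup x = some c := by
  obtain ⟨d, hd⟩ := lookup_isSome (List.mem_map.2 ⟨_, h, rfl⟩)
  rw [hd]
  have := List.inj_on_of_nodup_map hn h (mem_of_lookup hd) rfl
  simpa using (Prod.mk.inj this).2.symm

theorem snd_of_mem_zip_map {β : Type} {l : List β} {f : β → ℕ} {p : β × ℕ}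
    (h : p ∈ l.zip (l.map f)) : p.2 = f p.1 := by
  induction l with
  | nil => simp at h
  | cons x l ih =>
    rw [List.map_cons, List.zip_cons_cons, List.mem_cons] at h
    rcases h with rfl | h
    · rfl
    · exact ih h

/-- The first value that the list of pairs assigns to `x`. -/
def look {β : Type} [DecidableEq β] (ps : List (β × ℕ)) (x : β) : ℕ := (ps.lookup x).getD 0

theorem look_eq {β : Type} [DecidableEq β] {ps : List (β × ℕ)} {f : β → ℕ}
    (hf : ∀ p ∈ ps, p.2 = f p.1) {x : β} (hx : x ∈ ps.map Prod.fst) : look ps x = f x := by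
  obtain ⟨c, hc⟩ := lookup_isSome hx
  rw [look, hc]
  exact hf _ (mem_of_lookup hc)

theorem look_mem {β : Type} [DecidableEq β] {ps : List (β × ℕ)} {x : β}
    (hx : x ∈ ps.map Prod.fst) : (x, look ps x) ∈ ps := by
  obtain ⟨c, hc⟩ := lookup_isSome hx
  rw [look, hc]
  exact mem_of_lookup hc

/-- A valuation, given by its list of values, that follows a list of pairs. -/
def valOf (ps : List (ℕ × ℕ)) : List ℕ := ps.foldr (fun p l => updList 0 l p.1 p.2) []

theorem getD_valOf (ps : List (ℕ × ℕ)) : (fun x => (valOf ps).getD x 0) = look ps := by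
  induction ps with
  | nil => funext x; simp [valOf, look]
  | cons p ps ih =>
    rw [valOf, List.foldr_cons, getD_updList]
    rw [valOf] at ih
    rw [ih]
    funext x
    obtain ⟨y, d⟩ := p
    by_cases hxy : x = y
    · simp [hxy, look]
    · have : (x == y) = false := by simpa using hxy
      simp [look, List.lookup_cons, hxy, this]

def adomL (A : List (Fact ℕ)) : List ℕ := A.flatMap Fact.terms

theorem mem_adomL {A : List (Fact ℕ)} {c : ℕ} : c ∈ adomL A ↔ c ∈ adom A.toFinset := by
  simp [adomL, mem_adom_toFinset]

/-- The free variables of a union of conjunctive queries. -/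
def UCQ.fvL (q : UCQ) : List ℕ :=
  q.disjuncts.flatMap fun d => d.atoms.flatMap fun a => a.terms.flatMap fun t =>
    Sum.elim (fun x => if x ∈ d.exVars then [] else [x]) (fun _ => []) (QTerm.equiv t)

theorem UCQ.mem_fvL {q : UCQ} {x : ℕ} : x ∈ q.fvL ↔ x ∈ q.fv := by
  simp only [UCQ.fvL, UCQ.mem_fv, CQ.mem_fv, List.mem_flatMap]
  refine exists_congr fun d => and_congr_right fun _ => ?_
  constructor
  · rintro ⟨a, ha, t, ht, h⟩
    cases t with
    | var y =>
      simp only [QTerm.equiv, Equiv.coe_fn_mk, Sum.elim_inl] at h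
      split_ifs at h with hy
      · simp at h
      · obtain rfl := List.mem_singleton.1 h
        exact ⟨⟨a, ha, ht⟩, hy⟩
    | const c => simp [QTerm.equiv] at h
  · rintro ⟨⟨a, ha, ht⟩, hx⟩
    exact ⟨a, ha, _, ht, by simp [QTerm.equiv, hx]⟩

/-- The code of the condition of an effect. -/
def RawEffect.query (e : RawEffect) : ℕ := Nat.pair 2 (Nat.pair (Nat.pair 0 e.1.code) e.2.1)

theorem Effect.query_raw (e : Effect) : e.raw.query = (ECQ.and (.cert e.qpos) e.qneg).code := rfl

/-- The valuations that are relevant for an effect under actual parameters `σ`. -/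
def RawEffect.vals (A : List (Fact ℕ)) (params σ : List ℕ) (e : RawEffect) : List (List ℕ) :=
  (tuples (adomL A) e.1.fvL.length).map fun τ =>
    valOf (zipL 0 params σ ++ zipL 0 e.1.fvL τ)

section

variable {C₀ : List ℕ} {K : KAB} {A : List (Fact ℕ)} {α : Action} {σ : List ℕ}

theorem assigns_look (hn : α.params.Nodup) (hl : σ.length = α.params.length)
    (ps : List (ℕ × ℕ)) : Assigns α.params σ (look (α.params.zip σ ++ ps)) := by
  rintro ⟨x, c⟩ h
  have h1 : ((α.params.zip σ).map Prod.fst) = α.params := List.map_fst_zip hl.ge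
  have h2 := lookup_eq_of_nodup (by rwa [h1]) h
  simp [look, List.lookup_append, h2]

theorem Assigns.eq_of_mem_zip {v : ℕ → ℕ} (h : Assigns α.params σ v) :
    ∀ p ∈ α.params.zip σ, p.2 = v p.1 := fun p hp => (h p hp).symm

/-- By well-formedness an effect reads its valuation only at parameters and at free variables of
`qpos`. The former are given by `σ` and the latter range over the active domain, so finitely many
valuations suffice. -/
theorem KAB.mem_doFacts_iff (hK : K.WellFormed C₀) (hα : α ∈ K.actions)
    (hl : σ.length = α.params.length) (hσ : ∀ c ∈ σ, c ∈ adom A.toFinset) {F : Fact GTerm} :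
    F ∈ K.doFacts A.toFinset α σ ↔ ∃ e ∈ α.effects, ∃ v ∈ e.raw.vals A α.params σ,
      (ECQ.and (.cert e.qpos) e.qneg).Holds K.tbox A.toFinset (fun x => v.getD x 0) ∧
      ∃ E ∈ e.facts, F = E.map (ETerm.ground fun x => v.getD x 0) := by
  refine exists_congr fun e => and_congr_right fun he => ?_
  have hw := hK.effects α hα e he
  have hfst : (α.params.zip σ).map Prod.fst = α.params := List.map_fst_zip hl.ge
  constructor
  · rintro ⟨v, hv, hx, hp, hn, E, hE, rfl⟩
    have hvx : ∀ x ∈ e.qpos.fvL, v x ∈ adomL A := by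
      intro x hxq
      rw [mem_adomL]
      by_cases h : x ∈ α.params
      · exact hσ _ (hv.mem hl h)
      · exact hx x (UCQ.mem_fvL.1 hxq) h
    -- Parameters come first and so take precedence in lookups. For a variable that is also free in
    -- `qpos` both entries agree with `v`.
    set ps := α.params.zip σ ++ e.qpos.fvL.zip (e.qpos.fvL.map v) with hps
    have hlook : ∀ x ∈ e.qpos.fv ∪ α.params.toFinset, look ps x = v x := by
      intro x hx
      refine look_eq (fun p hp => ?_) ?_
      · rcases List.mem_append.1 hp with hp | hp
        · exact hv.eq_of_mem_zip p hp
        · exact snd_of_mem_zip_map hp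
      · rw [hps, List.map_append, hfst, List.map_fst_zip (by simp)]
        simpa [UCQ.mem_fvL, or_comm] using hx
    refine ⟨valOf ps, ?_, ?_⟩
    · refine List.mem_map.2 ⟨e.qpos.fvL.map v, mem_tuples.2 ⟨by simp [Effect.raw], ?_⟩, ?_⟩
      · simpa using hvx
      · simp only [Effect.raw, hps]
        rw [zipL_eq hl, zipL_eq (by simp)]
    · rw [getD_valOf]
      refine ⟨(ECQ.holds_congr fun x hx => ?_).2 ⟨hp, hn⟩, E, hE,
        Fact.map_congr fun t ht => ?_⟩
      · refine hlook x ?_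
        rcases Finset.mem_union.1 hx with hx | hx
        · exact Finset.mem_union_left _ hx
        · exact hw.neg_vars hx
      · have := fun x hx => (hlook x (hw.fact_vars E hE t ht x hx)).symm
        cases t with
        | var x => exact congrArg GTerm.val (this x (by simp [ETerm.vars]))
        | const c => rfl
        | skolem f xs =>
          simp only [ETerm.ground, GTerm.call.injEq, SCall.mk.injEq, true_and]
          exact List.map_congr_left this
  · rintro ⟨v, hv, hq, hE⟩
    obtain ⟨τ, hτ, rfl⟩ := List.mem_map.1 hv
    obtain ⟨hτl, hτ⟩ := mem_tuples.1 hτ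
    have hτl : τ.length = e.qpos.fvL.length := hτl
    change ECQ.Holds _ _ (fun x => (valOf (zipL 0 α.params σ ++ zipL 0 e.qpos.fvL τ)).getD x 0) _
      at hq
    change ∃ E ∈ e.facts, F = E.map (ETerm.ground fun x =>
      (valOf (zipL 0 α.params σ ++ zipL 0 e.qpos.fvL τ)).getD x 0) at hE
    rw [getD_valOf, zipL_eq hl, zipL_eq hτl] at hq hE
    refine ⟨_, assigns_look (hK.params_nodup α hα) hl _, fun x hx hxp => ?_, hq.1, hq.2, hE⟩
    have h1 := look_mem (ps := α.params.zip σ ++ e.qpos.fvL.zip τ) (x := x) (by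
      rw [List.map_append, hfst, List.map_fst_zip hτl.ge]
      exact List.mem_append_right _ (UCQ.mem_fvL.2 hx))
    rcases List.mem_append.1 h1 with h | h
    · exact absurd (List.of_mem_zip h).1 hxp
    · exact mem_adomL.1 (hτ _ (List.of_mem_zip h).2)

/-! ### Evaluating the effects of an action -/

/-- `ασ` is legal, or not legal, depending on `b`. -/
def LegalL (T : TBox) (rules : List RawRule) (A : List (Fact ℕ)) (α : RawAction) (σ : List ℕ)
    (b : Bool) : Prop :=
  (b = true ∧ ∃ r ∈ rules, r.2 = α ∧ EvalECQ T A (valOf (zipL 0 α.1 σ)) r.1 true) ∨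
  (b = false ∧ ∀ r ∈ rules, r.2 ≠ α ∨ EvalECQ T A (valOf (zipL 0 α.1 σ)) r.1 false)

theorem KAB.legalL_iff (hK : K.WellFormed C₀) (hA : Consistent K.tbox A.toFinset)
    (hα : α ∈ K.actions) (hl : σ.length = α.params.length) (hσ : ∀ c ∈ σ, c ∈ adom A.toFinset)
    (b : Bool) :
    LegalL K.tbox (K.process.map Rule.raw) A α.raw σ b ↔
      (b = true ↔ K.Legal A.toFinset α σ) := by
  have key : ∀ r ∈ K.process, r.raw.2 = α.raw → ∀ b,
      EvalECQ K.tbox A (valOf (zipL 0 α.raw.1 σ)) r.raw.1 b ↔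
        (b = true ↔ ∃ v, Assigns α.params σ v ∧ r.cond.Holds K.tbox A.toFinset v) := by
    intro r hr hrα b
    have hrα : r.act = α := Action.raw_injective hrα
    refine (evalECQ_iff hA _ _ _).trans (iff_congr Iff.rfl ?_)
    have hv : (fun y => (valOf (zipL 0 α.raw.1 σ)).getD y 0) = look (α.params.zip σ) := by
      rw [getD_valOf, ← zipL_eq hl]
      rfl
    have has := assigns_look (hK.params_nodup α hα) hl []
    rw [List.append_nil] at has
    rw [hv]
    refine ⟨fun h => ⟨_, has, h⟩, fun ⟨v, hv, h⟩ => (ECQ.holds_congr fun x hx => ?_).1 h⟩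
    refine (look_eq hv.eq_of_mem_zip ?_).symm
    rw [List.map_fst_zip hl.ge]
    rw [hK.rule_vars r hr, hrα] at hx
    simpa using hx
  have hlegal : K.Legal A.toFinset α σ ↔ ∃ r ∈ K.process, r.act = α ∧
      ∃ v, Assigns α.params σ v ∧ r.cond.Holds K.tbox A.toFinset v :=
    ⟨fun h => h.2.2, fun h => ⟨hl, hσ, h⟩⟩
  have hraw : ∀ r : Rule, r.raw.2 = α.raw ↔ r.act = α := fun r => Action.raw_injective.eq_iff
  rw [hlegal]
  cases b with
  | true =>
    simp only [LegalL, true_and, List.mem_map, exists_exists_and_eq_and, reduceCtorEq, false_and,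
      or_false, true_iff]
    refine exists_congr fun r => and_congr_right fun hr => ?_
    rw [← hraw]
    exact and_congr_right fun h => by simpa using key r hr h true
  | false =>
    simp only [LegalL, reduceCtorEq, false_and, List.mem_map, forall_exists_index, and_imp,
      forall_apply_eq_imp_iff₂, true_and, false_or, false_iff, not_exists, not_and]
    refine forall₂_congr fun r hr => ?_
    rw [ne_eq, ← imp_iff_not_or, ← hraw]
    refine forall_congr' fun h => ?_
    have := key r hr h false
    simpa using this

/-- `DF` consists of the facts that the effects of `ασ` produce. -/
def DoL (T : TBox) (A : List (Fact ℕ)) (α : RawAction) (σ : List ℕ) (DF : List (Fact GTerm)) :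
    Prop :=
  (∀ F ∈ DF, ∃ e ∈ α.2, ∃ v ∈ e.vals A α.1 σ, EvalECQ T A v e.query true ∧
    ∃ E ∈ e.2.2, F = E.map (ETerm.ground fun x => v.getD x 0)) ∧
  ∀ e ∈ α.2, ∀ v ∈ e.vals A α.1 σ, EvalECQ T A v e.query false ∨
    ∀ E ∈ e.2.2, E.map (ETerm.ground fun x => v.getD x 0) ∈ DF

/-- `DoL` determines the set of facts exactly while using evaluations only positively: a fact must
be produced by a true condition, and a valuation whose facts are not all listed must make the
condition false. -/
theorem KAB.doL_iff (hK : K.WellFormed C₀) (hA : Consistent K.tbox A.toFinset)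
    (hα : α ∈ K.actions) (hl : σ.length = α.params.length) (hσ : ∀ c ∈ σ, c ∈ adom A.toFinset)
    {DF : List (Fact GTerm)} :
    DoL K.tbox A α.raw σ DF ↔ ∀ F, F ∈ DF ↔ F ∈ K.doFacts A.toFinset α σ := by
  have hq : ∀ (e : Effect) v b, EvalECQ K.tbox A v e.raw.query b ↔ (b = true ↔
      (ECQ.and (.cert e.qpos) e.qneg).Holds K.tbox A.toFinset (fun x => v.getD x 0)) :=
    fun e v b => by
      rw [e.query_raw]
      exact evalECQ_iff hA _ _ _
  have h1 : (∀ F ∈ DF, ∃ e ∈ α.raw.2, ∃ v ∈ e.vals A α.raw.1 σ, EvalECQ K.tbox A v e.query true ∧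
      ∃ E ∈ e.2.2, F = E.map (ETerm.ground fun x => v.getD x 0)) ↔
      ∀ F ∈ DF, F ∈ K.doFacts A.toFinset α σ := by
    refine forall₂_congr fun F _ => ?_
    rw [K.mem_doFacts_iff hK hα hl hσ]
    simp only [Action.raw, List.mem_map, exists_exists_and_eq_and]
    refine exists_congr fun e => and_congr_right fun _ => exists_congr fun v =>
      and_congr_right fun _ => ?_
    rw [hq]
    simp [Effect.raw]
  have h2 : (∀ e ∈ α.raw.2, ∀ v ∈ e.vals A α.raw.1 σ, EvalECQ K.tbox A v e.query false ∨
      ∀ E ∈ e.2.2, E.map (ETerm.ground fun x => v.getD x 0) ∈ DF) ↔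
      ∀ F ∈ K.doFacts A.toFinset α σ, F ∈ DF := by
    simp only [K.mem_doFacts_iff hK hα hl hσ]
    simp only [Action.raw, List.mem_map, forall_exists_index, and_imp, forall_apply_eq_imp_iff₂, hq]
    constructor
    · rintro h F e he v hv hh E hE rfl
      rcases h e he v hv with h | h
      · simp only [Bool.false_eq_true, false_iff] at h
        exact absurd hh h
      · exact h E hE
    · intro h e he v hv
      by_cases hh : (ECQ.and (.cert e.qpos) e.qneg).Holds K.tbox A.toFinset (fun x => v.getD x 0)
      · exact Or.inr fun E hE => h _ e he v hv hh E hE rfl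
      · exact Or.inl (by simpa using hh)
  rw [DoL, h1, h2]
  exact ⟨fun h F => ⟨h.1 F, h.2 F⟩, fun h => ⟨fun F => (h F).1, fun F => (h F).2⟩⟩

end

end KABV
-- Represented states, their canonical successors and finite presentations of transition systems.
namespace KABV

/-- Finite representations of states. -/
abbrev RawState := List (Fact ℕ) × List (SCall × ℕ)

structure RawState.Rep (r : RawState) (s : KState) : Prop where
  abox : s.abox = r.1.toFinset
  smap : ∀ t d, s.smap t = some d ↔ (t, d) ∈ r.2

/-- Lists represent states up to order and repetition. Equality of the represented states is thereby
turned into a decidable condition on lists. -/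
def SameL (r r' : RawState) : Prop :=
  ((∀ F ∈ r.1, F ∈ r'.1) ∧ ∀ F ∈ r'.1, F ∈ r.1) ∧ (∀ p ∈ r.2, p ∈ r'.2) ∧ ∀ p ∈ r'.2, p ∈ r.2

theorem RawState.Rep.finite {r : RawState} {s : KState} (h : r.Rep s) :
    {t | (s.smap t).isSome}.Finite := by
  refine (List.finite_toSet (r.2.map Prod.fst)).subset fun t ht => ?_
  obtain ⟨d, hd⟩ := Option.isSome_iff_exists.1 ht
  exact List.mem_map.2 ⟨_, (h.smap t d).1 hd, rfl⟩

theorem exists_rep {s : KState} (h : {t | (s.smap t).isSome}.Finite) : ∃ r : RawState, r.Rep s := by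
  refine ⟨(s.abox.toList, h.toFinset.toList.map fun t => (t, (s.smap t).getD 0)), by simp,
    fun t d => ?_⟩
  simp only [List.mem_map, Finset.mem_toList, Set.Finite.mem_toFinset, Set.mem_ofPred_eq,
    Prod.mk.injEq]
  constructor
  · intro ht
    exact ⟨t, by simp [ht], rfl, by simp [ht]⟩
  · rintro ⟨u, hu, rfl, rfl⟩
    obtain ⟨d, hd⟩ := Option.isSome_iff_exists.1 hu
    simp [hd]

theorem RawState.Rep.sameL_iff {r r' : RawState} {s s' : KState} (h : r.Rep s) (h' : r'.Rep s') :
    SameL r r' ↔ s = s' := by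
  constructor
  · rintro ⟨⟨h1, h2⟩, h3, h4⟩
    have hA : s.abox = s'.abox := by
      rw [h.abox, h'.abox]
      ext F
      simpa using ⟨h1 F, h2 F⟩
    have hm : s.smap = s'.smap := by
      funext t
      refine Option.ext fun d => ?_
      rw [h.smap, h'.smap]
      exact ⟨h3 _, h4 _⟩
    cases s
    cases s'
    simp only at hA hm
    rw [hA, hm]
  · rintro rfl
    have h1 : ∀ F, F ∈ r.1 ↔ F ∈ r'.1 := fun F => by
      rw [← List.mem_toFinset, ← h.abox, h'.abox, List.mem_toFinset]
    have h2 : ∀ p, p ∈ r.2 ↔ p ∈ r'.2 := fun p => by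
      rw [← h.smap, h'.smap]
    exact ⟨⟨fun F => (h1 F).1, fun F => (h1 F).2⟩, fun p => (h2 p).1, fun p => (h2 p).2⟩

theorem RawState.Rep.of_sameL {r r' : RawState} {s : KState} (h : r.Rep s) (h' : SameL r r') :
    r'.Rep s := by
  obtain ⟨⟨h1, h2⟩, h3, h4⟩ := h'
  refine ⟨?_, fun t d => (h.smap t d).trans ⟨h3 _, h4 _⟩⟩
  rw [h.abox]
  ext F
  simpa using ⟨h1 F, h2 F⟩

def baseL (C₀ : List ℕ) (r : RawState) : List ℕ := C₀ ++ adomL r.1 ++ r.2.map Prod.snd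

theorem RawState.Rep.mem_baseL {C₀ : List ℕ} {r : RawState} {s : KState} (h : r.Rep s) {c : ℕ} :
    c ∈ baseL C₀ r ↔ c ∈ s.base C₀ := by
  simp only [baseL, List.mem_append, mem_adomL, ← h.abox, List.mem_map, or_assoc]
  refine or_congr Iff.rfl (or_congr Iff.rfl ?_)
  constructor
  · rintro ⟨⟨t, d⟩, hp, rfl⟩
    exact ⟨t, (h.smap t _).2 hp⟩
  · rintro ⟨t, ht⟩
    exact ⟨_, (h.smap t c).1 ht, rfl⟩

def callsL (DF : List (Fact GTerm)) : List SCall :=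
  DF.flatMap fun F => F.terms.flatMap fun t =>
    Sum.elim (fun _ => []) (fun c => [c]) (GTerm.equiv t)

theorem mem_callsL {DF : List (Fact GTerm)} {t : SCall} :
    t ∈ callsL DF ↔ ∃ F ∈ DF, GTerm.call t ∈ F.terms := by
  simp only [callsL, List.mem_flatMap]
  refine exists_congr fun F => and_congr_right fun _ => ?_
  constructor
  · rintro ⟨u, hu, h⟩
    cases u with
    | val c => simp [GTerm.equiv] at h
    | call c =>
      have : t = c := by simpa [GTerm.equiv] using h
      exact this ▸ hu
  · intro h
    exact ⟨_, h, by simp [GTerm.equiv]⟩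

def IsSupL (X : List ℕ) (M : ℕ) : Prop := (∀ x ∈ X, x < M) ∧ (M = 0 ∨ ∃ x ∈ X, x + 1 = M)

/-- The answers `θ` agree with the recorded ones and are canonical. -/
def AnswersL (C₀ : List ℕ) (r : RawState) (DF : List (Fact GTerm)) (M : ℕ)
    (θ : List (SCall × ℕ)) : Prop :=
  (∀ t ∈ callsL DF, ∀ p ∈ r.2, p.1 = t → look θ t = p.2) ∧
  ∀ t ∈ callsL DF, look θ t ∈ baseL C₀ r ∨ ∃ u ∈ callsL DF, look θ u = look θ t ∧
    look θ t = M + Encodable.encode u ∧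
    ∀ u' ∈ callsL DF, look θ u' = look θ t → Encodable.encode u ≤ Encodable.encode u'

/-- The relevant answers to the calls in `DF`. -/
def thetas (C₀ : List ℕ) (r : RawState) (DF : List (Fact GTerm)) (M : ℕ) :
    List (List (SCall × ℕ)) :=
  (tuples (baseL C₀ r ++ (callsL DF).map fun t => M + Encodable.encode t)
    (callsL DF).length).map fun vs => zipL ⟨0, []⟩ (callsL DF) vs

/-- The state that results from the facts `DF` and the answers `θ`. -/
def nextL (r : RawState) (DF : List (Fact GTerm)) (θ : List (SCall × ℕ)) : RawState :=
  (DF.map fun F => F.map (GTerm.eval (look θ)), ((callsL DF).map fun t => (t, look θ t)) ++ r.2)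

/-- `r'` represents a canonical successor of `r`. -/
def EdgeL (C₀ : List ℕ) (K : RawKAB) (r r' : RawState) : Prop :=
  ∃ α ∈ K.2.2.1, ∃ σ ∈ tuples (adomL r.1) α.1.length, LegalL K.1 K.2.2.2 r.1 α σ true ∧
    ∃ DF, DoL K.1 r.1 α σ DF ∧ ∃ M, IsSupL (baseL C₀ r) M ∧ ∃ θ ∈ thetas C₀ r DF M,
      AnswersL C₀ r DF M θ ∧ SameL (nextL r DF θ) r' ∧ Consistent K.1 r'.1.toFinset

/-- All canonical successors of `r` are represented in `R`. -/
def ClosedL (C₀ : List ℕ) (K : RawKAB) (r : RawState) (R : List RawState) : Prop :=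
  ∀ α ∈ K.2.2.1, ∀ σ ∈ tuples (adomL r.1) α.1.length, LegalL K.1 K.2.2.2 r.1 α σ false ∨
    ∃ DF, DoL K.1 r.1 α σ DF ∧ ∃ M, IsSupL (baseL C₀ r) M ∧ ∀ θ ∈ thetas C₀ r DF M,
      ¬ AnswersL C₀ r DF M θ ∨ ¬ Consistent K.1 (nextL r DF θ).1.toFinset ∨
        ∃ r' ∈ R, SameL (nextL r DF θ) r'

section

variable {C₀ : List ℕ} {K : KAB} {r r' : RawState} {s s' : KState} {α : Action} {σ : List ℕ}
  {DF : List (Fact GTerm)} {M : ℕ} {θ : List (SCall × ℕ)}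

theorem RawState.Rep.isSupL_iff (h : r.Rep s) : IsSupL (baseL C₀ r) M ↔ IsSup (s.base C₀) M := by
  simp only [IsSupL, IsSup, h.mem_baseL]

theorem mem_callsL_iff (hDF : ∀ F, F ∈ DF ↔ F ∈ K.doFacts s.abox α σ) {t : SCall} :
    t ∈ callsL DF ↔ t ∈ K.doCalls s.abox α σ := by
  rw [mem_callsL]
  exact exists_congr fun F => and_congr_left fun _ => hDF F

theorem RawState.Rep.answersL_iff (h : r.Rep s) (hDF : ∀ F, F ∈ DF ↔ F ∈ K.doFacts s.abox α σ) :
    AnswersL C₀ r DF M θ ↔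
      (∀ t ∈ K.doCalls s.abox α σ, ∀ d, s.smap t = some d → look θ t = d) ∧
      CanonAnswers (s.base C₀) M (K.doCalls s.abox α σ) (look θ) := by
  simp only [AnswersL, CanonAnswers, h.mem_baseL, mem_callsL_iff hDF, h.smap]
  refine and_congr_left fun _ => forall₂_congr fun t _ => ?_
  exact ⟨fun h d hd => h _ hd rfl, fun h p hp hpt => h _ (hpt ▸ hp)⟩

theorem RawState.Rep.nextL_iff (h : r.Rep s) (hl : K.Legal s.abox α σ)
    (hDF : ∀ F, F ∈ DF ↔ F ∈ K.doFacts s.abox α σ)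
    (ha : ∀ t ∈ K.doCalls s.abox α σ, ∀ d, s.smap t = some d → look θ t = d) :
    (nextL r DF θ).Rep s' ↔ K.ExecVia s α σ (look θ) s' := by
  have h1 : s'.abox = (nextL r DF θ).1.toFinset ↔
      (s'.abox : Set (Fact ℕ)) = Fact.map (GTerm.eval (look θ)) '' K.doFacts s.abox α σ := by
    rw [← Finset.coe_inj]
    have : ((nextL r DF θ).1.toFinset : Set (Fact ℕ)) =
        Fact.map (GTerm.eval (look θ)) '' K.doFacts s.abox α σ := by
      ext F
      simp [nextL, hDF]
    rw [this]
  have h2 : ∀ t d, (t, d) ∈ (nextL r DF θ).2 ↔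
      (t ∈ K.doCalls s.abox α σ ∧ look θ t = d) ∨ s.smap t = some d := by
    intro t d
    simp only [nextL, List.mem_append, List.mem_map, mem_callsL_iff hDF, h.smap]
    refine or_congr_left ⟨?_, fun ⟨ht, hd⟩ => ⟨t, ht, by rw [hd]⟩⟩
    rintro ⟨u, hu, he⟩
    obtain ⟨rfl, rfl⟩ := Prod.mk.inj he
    exact ⟨hu, rfl⟩
  constructor
  · intro hr
    have h3 := fun t d => (hr.smap t d).trans (h2 t d)
    refine ⟨hl, ha, h1.1 hr.abox, fun t ht => (h3 _ _).2 (Or.inl ⟨ht, rfl⟩), fun t ht => ?_⟩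
    exact Option.ext fun d => (h3 t d).trans (by simp [ht])
  · intro hx
    refine ⟨h1.2 hx.abox_eq, fun t d => ?_⟩
    rw [h2]
    by_cases ht : t ∈ K.doCalls s.abox α σ
    · rw [hx.smap_call t ht, Option.some_inj]
      exact ⟨fun e => Or.inl ⟨ht, e⟩, fun e => e.elim (fun e => e.2) (ha t ht d)⟩
    · rw [hx.smap_old t ht]
      simp [ht]

theorem KAB.ExecVia.congr {θ θ' : SCall → ℕ} (h : K.ExecVia s α σ θ s')
    (he : ∀ t ∈ K.doCalls s.abox α σ, θ t = θ' t) : K.ExecVia s α σ θ' s' := by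
  refine ⟨h.legal, fun t ht d hd => he t ht ▸ h.agree t ht d hd, ?_,
    fun t ht => he t ht ▸ h.smap_call t ht, h.smap_old⟩
  rw [h.abox_eq]
  exact Set.image_congr fun F hF => Fact.map_congr fun t ht =>
    GTerm.eval_congr fun u hu => he u ⟨F, hF, hu ▸ ht⟩

/-- Only the answers to issued calls matter, and canonical ones lie in the base or have the form `M`
plus the code of an issued call; the finite list `thetas` contains them all. A represented state
records finitely many calls, so the branch of `canonExec` that uses choice does not arise. -/
theorem RawState.Rep.canonExec_iff (h : r.Rep s) (hl : K.Legal s.abox α σ)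
    (hDF : ∀ F, F ∈ DF ↔ F ∈ K.doFacts s.abox α σ) (hM : IsSup (s.base C₀) M) :
    K.canonExec C₀ s α σ s' ↔
      ∃ θ ∈ thetas C₀ r DF M, AnswersL C₀ r DF M θ ∧ (nextL r DF θ).Rep s' := by
  constructor
  · rintro (⟨-, θ, M', hx, hM', hc⟩ | ⟨hf, -⟩)
    · obtain rfl := hM.unique hM'
      set L := callsL DF with hL
      have hz : zipL ⟨0, []⟩ L (L.map θ) = L.zip (L.map θ) := zipL_eq (by simp)
      have hlook : ∀ t ∈ K.doCalls s.abox α σ, look (zipL ⟨0, []⟩ L (L.map θ)) t = θ t := by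
        intro t ht
        rw [hz]
        refine look_eq (fun p hp => snd_of_mem_zip_map hp) ?_
        rw [List.map_fst_zip (by simp)]
        exact (mem_callsL_iff hDF).2 ht
      have ha : ∀ t ∈ K.doCalls s.abox α σ, ∀ d, s.smap t = some d →
          look (zipL ⟨0, []⟩ L (L.map θ)) t = d := fun t ht d hd => by
        rw [hlook t ht]
        exact hx.agree t ht d hd
      refine ⟨zipL ⟨0, []⟩ L (L.map θ), List.mem_map.2 ⟨L.map θ, mem_tuples.2 ⟨by simp [hL], ?_⟩,
        rfl⟩, (h.answersL_iff hDF).2 ⟨ha, fun t ht => ?_⟩, (h.nextL_iff hl hDF ha).2 ?_⟩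
      · intro x hxm
        obtain ⟨t, ht, rfl⟩ := List.mem_map.1 hxm
        rcases hc t ((mem_callsL_iff hDF).1 ht) with h1 | ⟨u, hu, -, h1, -⟩
        · exact List.mem_append_left _ (h.mem_baseL.2 h1)
        · exact List.mem_append_right _ (List.mem_map.2 ⟨u, (mem_callsL_iff hDF).2 hu, h1.symm⟩)
      · rw [hlook t ht]
        refine (hc t ht).imp id ?_
        rintro ⟨u, hu, h1, h2, h3⟩
        refine ⟨u, hu, by rw [hlook u hu, h1], h2, fun u' hu' he => h3 u' hu' ?_⟩
        rwa [hlook u' hu'] at he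
      · exact hx.congr fun t ht => (hlook t ht).symm
    · exact absurd h.finite hf
  · rintro ⟨θ, -, ha, hr⟩
    obtain ⟨ha, hc⟩ := (h.answersL_iff hDF).1 ha
    exact Or.inl ⟨h.finite, _, M, (h.nextL_iff hl hDF ha).1 hr, hM, hc⟩

theorem KAB.canonExec_legal (h : K.canonExec C₀ s α σ s') : K.Legal s.abox α σ := by
  rcases h with ⟨-, θ, M, h, -⟩ | ⟨-, h, -⟩
  · exact h.legal
  · obtain ⟨⟨θ, h⟩, -⟩ := h.choose_spec
    exact h.legal

theorem mem_tuples_adomL :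
    σ ∈ tuples (adomL r.1) α.params.length ↔
      σ.length = α.params.length ∧ ∀ c ∈ σ, c ∈ adom r.1.toFinset := by
  simp only [mem_tuples, mem_adomL]

theorem RawState.Rep.edgeL_iff (hK : K.WellFormed C₀) (h : r.Rep s) (h' : r'.Rep s')
    (hc : Consistent K.tbox s.abox) :
    EdgeL C₀ K.raw r r' ↔ K.StepBy (K.canonExec C₀) s s' := by
  have hc' : Consistent K.tbox r.1.toFinset := h.abox ▸ hc
  constructor
  · rintro ⟨_, hm, σ, hσ, hl, DF, hDF, M, hM, θ, hθ, ha, hs, hcons⟩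
    obtain ⟨α, hα, rfl⟩ := List.mem_map.1 hm
    obtain ⟨h1, h2⟩ := mem_tuples_adomL.1 hσ
    have hl := ((K.legalL_iff hK hc' hα h1 h2 true).1 hl).1 rfl
    rw [← h.abox] at hl
    have hDF := (K.doL_iff hK hc' hα h1 h2).1 hDF
    rw [← h.abox] at hDF
    refine ⟨α, hα, σ, (h.canonExec_iff hl hDF (h.isSupL_iff.1 hM)).2 ⟨θ, hθ, ha,
      h'.of_sameL ⟨⟨hs.1.2, hs.1.1⟩, hs.2.2, hs.2.1⟩⟩, ?_⟩
    rw [h'.abox]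
    exact hcons
  · rintro ⟨α, hα, σ, hx, hcons⟩
    have hl := K.canonExec_legal hx
    obtain ⟨h1, h2⟩ : σ.length = α.params.length ∧ ∀ c ∈ σ, c ∈ adom r.1.toFinset :=
      ⟨hl.1, h.abox ▸ hl.2.1⟩
    have hfin := K.finite_doFacts hK hl
    have hDF : ∀ F, F ∈ hfin.toFinset.toList ↔ F ∈ K.doFacts s.abox α σ := by simp
    obtain ⟨M, hM⟩ := exists_isSup (KState.finite_base (C₀ := C₀) h.finite)
    obtain ⟨θ, hθ, ha, hr⟩ := (h.canonExec_iff hl hDF hM).1 hx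
    refine ⟨_, List.mem_map_of_mem hα, σ, mem_tuples_adomL.2 ⟨h1, h2⟩, ?_, _, ?_, M,
      h.isSupL_iff.2 hM, θ, hθ, ha, (hr.sameL_iff h').2 rfl, h'.abox ▸ hcons⟩
    · refine (K.legalL_iff hK hc' hα h1 h2 true).2 ⟨fun _ => ?_, fun _ => rfl⟩
      rw [← h.abox]
      exact hl
    · refine (K.doL_iff hK hc' hα h1 h2).2 ?_
      rw [← h.abox]
      exact hDF

/-- A universal statement about successors becomes semidecidable because the candidates are finite
in number and each failure has positive evidence: illegality by evaluation to false, and wrong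
answers or inconsistency by decidability. -/
theorem RawState.Rep.closedL_iff (hK : K.WellFormed C₀) (h : r.Rep s)
    (hc : Consistent K.tbox s.abox) {R : List RawState} :
    ClosedL C₀ K.raw r R ↔ ∀ s', K.StepBy (K.canonExec C₀) s s' → ∃ r' ∈ R, r'.Rep s' := by
  have hc' : Consistent K.tbox r.1.toFinset := h.abox ▸ hc
  constructor
  · rintro hcl s' ⟨α, hα, σ, hx, hcons⟩
    have hl := K.canonExec_legal hx
    obtain ⟨h1, h2⟩ : σ.length = α.params.length ∧ ∀ c ∈ σ, c ∈ adom r.1.toFinset :=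
      ⟨hl.1, h.abox ▸ hl.2.1⟩
    rcases hcl _ (List.mem_map_of_mem hα) σ (mem_tuples_adomL.2 ⟨h1, h2⟩) with
      hl' | ⟨DF, hDF, M, hM, hall⟩
    · have := (K.legalL_iff hK hc' hα h1 h2 false).1 hl'
      rw [← h.abox] at this
      exact absurd (this.2 hl) (by simp)
    · have hDF := (K.doL_iff hK hc' hα h1 h2).1 hDF
      rw [← h.abox] at hDF
      obtain ⟨θ, hθ, ha, hr⟩ := (h.canonExec_iff hl hDF (h.isSupL_iff.1 hM)).1 hx
      rcases hall θ hθ with h3 | h3 | ⟨r', hr', h3⟩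
      · exact absurd ha h3
      · rw [← hr.abox] at h3
        exact absurd hcons h3
      · exact ⟨r', hr', hr.of_sameL h3⟩
  · intro hall _ hm σ hσ
    obtain ⟨α, hα, rfl⟩ := List.mem_map.1 hm
    obtain ⟨h1, h2⟩ := mem_tuples_adomL.1 hσ
    by_cases hl : K.Legal s.abox α σ
    · right
      have hfin := K.finite_doFacts hK hl
      have hDF : ∀ F, F ∈ hfin.toFinset.toList ↔ F ∈ K.doFacts s.abox α σ := by simp
      obtain ⟨M, hM⟩ := exists_isSup (KState.finite_base (C₀ := C₀) h.finite)
      refine ⟨_, (K.doL_iff hK hc' hα h1 h2).2 (by rw [← h.abox]; exact hDF), M,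
        h.isSupL_iff.2 hM, fun θ hθ => ?_⟩
      by_cases ha : AnswersL C₀ r hfin.toFinset.toList M θ
      · by_cases hcons : Consistent K.raw.1 (nextL r hfin.toFinset.toList θ).1.toFinset
        · right; right
          obtain ⟨s', hx⟩ := K.exists_execVia hK hl ((h.answersL_iff hDF).1 ha).1
          have hr := (h.nextL_iff hl hDF ((h.answersL_iff hDF).1 ha).1).2 hx
          obtain ⟨r', hr', h'⟩ := hall s' ⟨α, hα, σ,
            (h.canonExec_iff hl hDF hM).2 ⟨θ, hθ, ha, hr⟩, by rw [hr.abox]; exact hcons⟩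
          exact ⟨r', hr', (hr.sameL_iff h').2 rfl⟩
        · exact Or.inr (Or.inl hcons)
      · exact Or.inl ha
    · left
      refine (K.legalL_iff hK hc' hα h1 h2 false).2 ?_
      rw [← h.abox]
      simpa using hl

/-! ### Finite state spaces -/

/-- A numbered list of represented states with their distances from the initial state, and a list
of edges; the first component is the number of the last state. -/
abbrev RawTS := ℕ × List (RawState × ℕ) × List (ℕ × ℕ)

def RawTS.st (w : RawTS) (i : ℕ) : RawState := (w.2.1.getD i (([], []), 0)).1

def RawTS.rank (w : RawTS) (i : ℕ) : ℕ := (w.2.1.getD i (([], []), 0)).2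

def RawTS.succs (w : RawTS) (i : ℕ) : List RawState :=
  w.2.2.flatMap fun p => if p.1 = i then [w.st p.2] else []

theorem RawTS.mem_succs {w : RawTS} {i : ℕ} {r : RawState} :
    r ∈ w.succs i ↔ ∃ j, (i, j) ∈ w.2.2 ∧ w.st j = r := by
  simp only [succs, List.mem_flatMap]
  constructor
  · rintro ⟨⟨i', j⟩, hp, h⟩
    split_ifs at h with hi
    · obtain rfl : i' = i := hi
      exact ⟨j, hp, (List.mem_singleton.1 h).symm⟩
    · simp at h
  · rintro ⟨j, hp, rfl⟩
    exact ⟨_, hp, by simp⟩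

/-- `w` represents the transition system generated by the canonical executions. -/
structure RawTS.Correct (C₀ : List ℕ) (K : RawKAB) (w : RawTS) : Prop where
  init : SameL (w.st 0) (K.2.1, [])
  reach : ∀ i < w.1 + 1, i = 0 ∨ ∃ p ∈ w.2.2, p.2 = i ∧ w.rank p.1 < w.rank i
  distinct : ∀ i < w.1 + 1, ∀ j < w.1 + 1, i = j ∨ ¬ SameL (w.st i) (w.st j)
  edge : ∀ p ∈ w.2.2, (p.1 < w.1 + 1 ∧ p.2 < w.1 + 1) ∧ EdgeL C₀ K (w.st p.1) (w.st p.2)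
  closed : ∀ i < w.1 + 1, ClosedL C₀ K (w.st i) (w.succs i)

theorem KAB.rep_init : RawState.Rep (K.abox, []) K.initState := ⟨rfl, by simp [initState]⟩

theorem KAB.Reach.consistent (hK : K.WellFormed C₀)
    {ex : KState → Action → List ℕ → KState → Prop} (h : K.Reach ex s) :
    Consistent K.tbox s.abox := by
  cases h with
  | init => exact hK.consistent
  | step _ h =>
    obtain ⟨-, -, -, -, h⟩ := h
    exact h

/-- Decreasing ranks lead every listed entry back to the initial one, so each entry represents a
reachable state; distinctness makes this correspondence injective. Closure under successors makes it
surjective. -/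
theorem RawTS.Correct.exists_equiv (hK : K.WellFormed C₀) {w : RawTS} (hw : w.Correct C₀ K.raw) :
    ∃ ι : (K.generated (K.canonExec C₀)).State ≃ Fin (w.1 + 1),
      ι (K.generated (K.canonExec C₀)).init = 0 ∧
      (∀ s s', (K.generated (K.canonExec C₀)).Step s s' ↔ ((ι s).val, (ι s').val) ∈ w.2.2) ∧
      ∀ s, (w.st (ι s)).Rep s.1 := by
  have h0 : (w.st 0).Rep K.initState :=
    K.rep_init.of_sameL ⟨⟨hw.init.1.2, hw.init.1.1⟩, hw.init.2.2, hw.init.2.1⟩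
  have hex : ∀ n, ∀ i < w.1 + 1, w.rank i = n →
      ∃ s : (K.generated (K.canonExec C₀)).State, (w.st i).Rep s.1 := by
    intro n
    -- An entry is not known to represent any state until an entry of smaller rank with an edge to
    -- it does; the edge condition then produces the state.
    induction n using Nat.strong_induction_on with
    | _ n ih =>
      intro i hi hn
      rcases hw.reach i hi with rfl | ⟨⟨j, i'⟩, hp, rfl, hr⟩
      · exact ⟨⟨_, .init⟩, h0⟩
      · obtain ⟨⟨hj, -⟩, he⟩ := hw.edge _ hp
        obtain ⟨s, hs⟩ := ih _ (hn ▸ hr) j hj rfl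
        have hc := s.2.consistent hK
        have he' := he
        obtain ⟨_, hm, σ, hσ, hl, DF, hDF, M, hM, θ, hθ, ha, hsame, hcons⟩ := he'
        obtain ⟨α, hα, rfl⟩ := List.mem_map.1 hm
        have hc' : Consistent K.tbox (w.st j).1.toFinset := hs.abox ▸ hc
        obtain ⟨h1, h2⟩ := mem_tuples_adomL.1 hσ
        have hl := ((K.legalL_iff hK hc' hα h1 h2 true).1 hl).1 rfl
        have hDF := (K.doL_iff hK hc' hα h1 h2).1 hDF
        rw [← hs.abox] at hl hDF
        have ha := ((hs.answersL_iff hDF).1 ha).1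
        obtain ⟨s', hx⟩ := K.exists_execVia hK hl ha
        have hs' := ((hs.nextL_iff hl hDF ha).2 hx).of_sameL hsame
        exact ⟨⟨s', s.2.step ((hs.edgeL_iff hK hs' hc).1 he)⟩, hs'⟩
  have hex : ∀ i : Fin (w.1 + 1), ∃ s : (K.generated (K.canonExec C₀)).State,
      (w.st i).Rep s.1 := fun i => hex _ i i.2 rfl
  choose φ hφ using hex
  have hinj : Function.Injective φ := by
    intro i j hij
    have := (hφ i).sameL_iff (hφ j)
    rcases hw.distinct i i.2 j j.2 with h | h
    · exact Fin.ext h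
    · exact absurd (this.2 (by rw [hij])) h
  have hstep : ∀ i (s' : KState), K.StepBy (K.canonExec C₀) (φ i).1 s' →
      ∃ j : Fin (w.1 + 1), (i.val, j.val) ∈ w.2.2 ∧ (φ j).1 = s' := by
    intro i s' h
    obtain ⟨r', hr', hrep⟩ := ((hφ i).closedL_iff hK ((φ i).2.consistent hK)).1
      (hw.closed i i.2) s' h
    obtain ⟨j, hp, rfl⟩ := RawTS.mem_succs.1 hr'
    exact ⟨⟨j, (hw.edge _ hp).1.2⟩, hp, ((hφ _).sameL_iff hrep).1
      ⟨⟨fun _ => id, fun _ => id⟩, fun _ => id, fun _ => id⟩⟩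
  have hφ0 : φ 0 = (K.generated (K.canonExec C₀)).init :=
    Subtype.ext (((hφ 0).sameL_iff h0).1
      ⟨⟨fun _ => id, fun _ => id⟩, fun _ => id, fun _ => id⟩)
  have hsurj : Function.Surjective φ := by
    rintro ⟨s, hs⟩
    induction hs with
    | init => exact ⟨0, hφ0⟩
    | step hs h ih =>
      obtain ⟨i, hi⟩ := ih
      obtain ⟨j, -, hj⟩ := hstep i _ (by rw [hi]; exact h)
      exact ⟨j, Subtype.ext hj⟩
  let e := Equiv.ofBijective φ ⟨hinj, hsurj⟩
  have hrep : ∀ s, (w.st (e.symm s)).Rep s.1 := fun s => by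
    have := hφ (e.symm s)
    rwa [show φ (e.symm s) = s from e.apply_symm_apply s] at this
  refine ⟨e.symm, e.symm_apply_eq.2 hφ0.symm, fun s s' => ⟨fun h => ?_, fun h => ?_⟩, hrep⟩
  · have hs : φ (e.symm s) = s := e.apply_symm_apply s
    obtain ⟨j, hj, hj'⟩ := hstep (e.symm s) s'.1 (by rw [hs]; exact h)
    have : e.symm s' = j := e.symm_apply_eq.2 (Subtype.ext hj'.symm)
    rwa [this]
  · exact ((hrep s).edgeL_iff hK (hrep s') (s.2.consistent hK)).1 (hw.edge _ h).2

theorem KAB.exists_rawTS (hK : K.WellFormed C₀)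
    [Finite (K.generated (K.canonExec C₀)).State] : ∃ w : RawTS, w.Correct C₀ K.raw := by
  classical
  set Υ := K.generated (K.canonExec C₀) with hΥ
  have hinv : ∀ s : Υ.State, s.1.Inv C₀ := fun s =>
    (s.2.mono (K.isPExec_canonExec hK).sub).inv hK
  obtain ⟨n, ⟨e₀⟩⟩ := Finite.exists_equiv_fin Υ.State
  obtain ⟨n, rfl⟩ : ∃ m, n = m + 1 := ⟨n - 1, by have := (e₀ Υ.init).pos; omega⟩
  -- The transposition gives the initial state the number `0`.
  let e := e₀.trans (Equiv.swap (e₀ Υ.init) 0)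
  have he0 : e Υ.init = 0 := by simp [e]
  have hrep : ∀ s : Υ.State, ∃ r : RawState, r.Rep s.1 := fun s => exists_rep (hinv s).finite_smap
  choose rep hrep using hrep
  have hdist : ∀ s : Υ.State, ∃ k, s.1 ∈ ReachIn (K.StepBy (K.canonExec C₀)) K.initState k :=
    fun s => s.2.exists_reachIn
  -- The distance from the initial state serves as rank: the predecessor on a shortest path is
  -- strictly closer.
  let dist (s : Υ.State) : ℕ := Nat.find (hdist s)
  let w : RawTS := (n, List.ofFn fun i => (rep (e.symm i), dist (e.symm i)),
    ((Finset.univ : Finset (Fin (n + 1) × Fin (n + 1))).filter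
      fun p => Υ.Step (e.symm p.1) (e.symm p.2)).toList.map fun p => (p.1.val, p.2.val))
  have hget : ∀ i : Fin (n + 1), w.2.1.getD i (([], []), 0) =
      (rep (e.symm i), dist (e.symm i)) := fun i => by
    rw [List.getD_eq_getElem _ _ (by rw [List.length_ofFn]; exact i.2), List.getElem_ofFn]
  have hst : ∀ i : Fin (n + 1), w.st i = rep (e.symm i) := fun i => by rw [RawTS.st, hget]
  have hrank : ∀ i : Fin (n + 1), w.rank i = dist (e.symm i) := fun i => by rw [RawTS.rank, hget]
  have hedge : ∀ i j : Fin (n + 1), (i.val, j.val) ∈ w.2.2 ↔ Υ.Step (e.symm i) (e.symm j) := by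
    intro i j
    simp [w, ← Fin.ext_iff]
  have hedge' : ∀ p ∈ w.2.2, ∃ i j : Fin (n + 1), p = (i.val, j.val) := by
    intro p hp
    obtain ⟨⟨i, j⟩, -, rfl⟩ := List.mem_map.1 hp
    exact ⟨i, j, rfl⟩
  have hst' : ∀ s, w.st (e s) = rep s := fun s => by rw [hst]; simp
  refine ⟨w, ?_, fun i hi => ?_, fun i hi j hj => ?_, fun p hp => ?_, fun i hi => ?_⟩
  · have h1 : w.st 0 = rep Υ.init := by
      rw [← hst', he0]
      rfl
    rw [h1]
    exact ((hrep _).sameL_iff K.rep_init).2 rfl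
  · lift i to Fin (n + 1) using hi
    by_cases h0 : i = 0
    · left
      rw [h0]
      rfl
    right
    have hs := Nat.find_spec (hdist (e.symm i))
    obtain ⟨τ, h1, hτ, h2⟩ := hs
    have hpos : dist (e.symm i) ≠ 0 := by
      intro hz
      have hz' : Nat.find (hdist (e.symm i)) = 0 := hz
      rw [hz', h1] at h2
      have : Υ.init = e.symm i := Subtype.ext h2
      exact h0 (by rw [← he0, this]; simp)
    obtain ⟨k, hk⟩ := Nat.exists_eq_succ_of_ne_zero hpos
    have hk' : Nat.find (hdist (e.symm i)) = k + 1 := hk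
    rw [hk'] at hτ h2
    let t : Υ.State := ⟨τ k, K.reach_of_mem_reachIn h1 hτ (Nat.le_succ k)⟩
    have ht : Υ.Step t (e.symm i) := by
      have := hτ k (Nat.lt_succ_self k)
      rw [h2] at this
      exact this
    refine ⟨((e t).val, i.val), (hedge _ _).2 (by simpa using ht), rfl, ?_⟩
    rw [hrank, hrank, hk]
    refine Nat.lt_succ_of_le (Nat.find_min' _ ⟨τ, h1, fun i hi => hτ i (by omega), ?_⟩)
    rw [e.symm_apply_apply]
  · lift i to Fin (n + 1) using hi
    lift j to Fin (n + 1) using hj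
    by_cases hij : i = j
    · exact Or.inl (by rw [hij])
    · right
      rw [hst, hst, (hrep _).sameL_iff (hrep _)]
      exact fun h => hij (e.symm.injective (Subtype.ext h))
  · obtain ⟨i, j, rfl⟩ := hedge' p hp
    refine ⟨⟨i.2, j.2⟩, ?_⟩
    simp only
    rw [hst, hst, (hrep _).edgeL_iff hK (hrep _) ((e.symm i).2.consistent hK)]
    exact (hedge i j).1 hp
  · lift i to Fin (n + 1) using hi
    rw [hst, (hrep _).closedL_iff hK ((e.symm i).2.consistent hK)]
    intro s' h
    let t : Υ.State := ⟨s', (e.symm i).2.step h⟩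
    refine ⟨rep t, RawTS.mem_succs.2 ⟨e t, (hedge _ _).2 ?_, hst' t⟩, hrep t⟩
    rw [e.symm_apply_apply]
    exact h

end

end KABV
namespace KABV

/-! ### Checking representations of transition systems -/

section

variable {α : Type} [Primcodable α]

theorem Deci.semi {p : α → Prop} (h : Deci p) : Semi p := h.1

theorem Deci.semi_not {p : α → Prop} (h : Deci p) : Semi (fun a => ¬ p a) := h.2

@[fun_prop]
theorem PRec.zipL {β : Type} [Primcodable β] (d : β) {xs : α → List β} {ys : α → List ℕ}
    (hx : PRec xs) (hy : PRec ys) : PRec (fun a => zipL d (xs a) (ys a)) := by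
  unfold KABV.zipL
  fun_prop

@[fun_prop]
theorem PRec.look {β : Type} [Primcodable β] [DecidableEq β] {ps : α → List (β × ℕ)} {x : α → β}
    (hp : PRec ps) (hx : PRec x) : PRec (fun a => look (ps a) (x a)) :=
  Primrec.option_getD.comp (Primrec.listLookup.comp hx hp) (Primrec.const 0)

@[fun_prop]
theorem PRec.valOf {ps : α → List (ℕ × ℕ)} (hp : PRec ps) : PRec (fun a => valOf (ps a)) :=
  PRec.foldr (h := fun _ (p : ℕ × ℕ) l => KABV.updList 0 l p.1 p.2) hp (by fun_prop) (by fun_prop)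

@[fun_prop]
theorem PRec.adomL {A : α → List (Fact ℕ)} (hA : PRec A) : PRec (fun a => adomL (A a)) := by
  unfold KABV.adomL
  fun_prop

@[fun_prop]
theorem PRec.fvL {q : α → UCQ} (hq : PRec q) : PRec (fun a => (q a).fvL) := by
  unfold UCQ.fvL
  refine .flatMap (by fun_prop) (.flatMap (by fun_prop) (.flatMap (by fun_prop) ?_))
  refine PRec.sumCases (α := ((α × CQ) × Fact QTerm) × QTerm)
    (f := fun p x => if x ∈ p.1.1.2.exVars then [] else [x])
    (g := fun _ _ => []) (by fun_prop) ?_ (by fun_prop)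
  exact .ite (Semi.primrecPred_mem (by fun_prop) (by fun_prop)) (by fun_prop) (by fun_prop)

@[fun_prop]
theorem PRec.effectQuery {e : α → RawEffect} (he : PRec e) :
    PRec (fun a => RawEffect.query (e a)) := by
  unfold RawEffect.query
  fun_prop

@[fun_prop]
theorem PRec.effectVals {A : α → List (Fact ℕ)} {p σ : α → List ℕ} {e : α → RawEffect}
    (hA : PRec A) (hp : PRec p) (hσ : PRec σ) (he : PRec e) :
    PRec (fun a => RawEffect.vals (A a) (p a) (σ a) (e a)) := by
  unfold RawEffect.vals
  fun_prop

@[fun_prop]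
theorem PRec.baseL {C : α → List ℕ} {r : α → RawState} (hC : PRec C) (hr : PRec r) :
    PRec (fun a => baseL (C a) (r a)) := by
  unfold KABV.baseL
  fun_prop

@[fun_prop]
theorem PRec.callsL {DF : α → List (Fact GTerm)} (hD : PRec DF) :
    PRec (fun a => callsL (DF a)) := by
  unfold KABV.callsL
  refine .flatMap (by fun_prop) (.flatMap (by fun_prop) ?_)
  exact PRec.sumCases (f := fun _ _ => []) (g := fun _ c => [c]) (by fun_prop) (by fun_prop)
    (by fun_prop)

@[fun_prop]
theorem PRec.thetas {C : α → List ℕ} {r : α → RawState} {DF : α → List (Fact GTerm)} {M : α → ℕ}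
    (hC : PRec C) (hr : PRec r) (hD : PRec DF) (hM : PRec M) :
    PRec (fun a => thetas (C a) (r a) (DF a) (M a)) := by
  unfold KABV.thetas
  fun_prop

@[fun_prop]
theorem PRec.evalLook {θ : α → List (SCall × ℕ)} {t : α → GTerm} (hθ : PRec θ) (ht : PRec t) :
    PRec (fun a => (t a).eval (KABV.look (θ a))) := by
  refine (PRec.sumCases (o := fun a => GTerm.equiv (t a)) (f := fun _ c => c)
    (g := fun a u => KABV.look (θ a) u) (by fun_prop) (by fun_prop) (by fun_prop)).of_eq
    fun a => ?_
  cases t a <;> rfl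

@[fun_prop]
theorem PRec.nextL {r : α → RawState} {DF : α → List (Fact GTerm)} {θ : α → List (SCall × ℕ)}
    (hr : PRec r) (hD : PRec DF) (hθ : PRec θ) : PRec (fun a => nextL (r a) (DF a) (θ a)) := by
  unfold KABV.nextL
  fun_prop

@[fun_prop]
theorem PRec.st {w : α → RawTS} {i : α → ℕ} (hw : PRec w) (hi : PRec i) :
    PRec (fun a => (w a).st (i a)) := by
  unfold RawTS.st
  fun_prop

@[fun_prop]
theorem PRec.rank {w : α → RawTS} {i : α → ℕ} (hw : PRec w) (hi : PRec i) :
    PRec (fun a => (w a).rank (i a)) := by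
  unfold RawTS.rank
  fun_prop

@[fun_prop]
theorem PRec.succs {w : α → RawTS} {i : α → ℕ} (hw : PRec w) (hi : PRec i) :
    PRec (fun a => (w a).succs (i a)) := by
  unfold RawTS.succs
  fun_prop

theorem Deci.sameL {r r' : α → RawState} (hr : PRec r) (hr' : PRec r') :
    Deci (fun a => SameL (r a) (r' a)) := by
  unfold SameL
  repeat' with_reducible first
      | apply Deci.and | apply Deci.ball | apply Deci.mem
  all_goals fun_prop

theorem Deci.isSupL {X : α → List ℕ} {M : α → ℕ} (hX : PRec X) (hM : PRec M) :
    Deci (fun a => IsSupL (X a) (M a)) := by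
  unfold IsSupL
  repeat' with_reducible first
      | apply Deci.and | apply Deci.or | apply Deci.ball | apply Deci.bex | apply Deci.lt
      | apply Deci.eq
  all_goals fun_prop

theorem Deci.answersL {C : α → List ℕ} {r : α → RawState} {DF : α → List (Fact GTerm)} {M : α → ℕ}
    {θ : α → List (SCall × ℕ)} (hC : PRec C) (hr : PRec r) (hD : PRec DF) (hM : PRec M)
    (hθ : PRec θ) : Deci (fun a => AnswersL (C a) (r a) (DF a) (M a) (θ a)) := by
  unfold AnswersL
  repeat' with_reducible first
      | apply Deci.and | apply Deci.or | apply Deci.ball | apply Deci.bex | apply Deci.imp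
      | apply Deci.lt | apply Deci.le | apply Deci.eq | apply Deci.mem
  all_goals fun_prop

theorem Semi.legalL {T : α → TBox} {R : α → List RawRule} {A : α → List (Fact ℕ)}
    {β : α → RawAction} {σ : α → List ℕ} {b : α → Bool} (hT : PRec T) (hR : PRec R) (hA : PRec A)
    (hβ : PRec β) (hσ : PRec σ) (hb : PRec b) :
    Semi (fun a => LegalL (T a) (R a) (A a) (β a) (σ a) (b a)) := by
  unfold LegalL
  repeat' with_reducible first
      | apply Semi.and | apply Semi.or | apply Semi.ball | apply Semi.bex | apply Semi.evalECQ
      | apply Semi.eq | apply Semi.ne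
  all_goals fun_prop

theorem Semi.doL {T : α → TBox} {A : α → List (Fact ℕ)} {β : α → RawAction} {σ : α → List ℕ}
    {DF : α → List (Fact GTerm)} (hT : PRec T) (hA : PRec A) (hβ : PRec β) (hσ : PRec σ)
    (hD : PRec DF) : Semi (fun a => DoL (T a) (A a) (β a) (σ a) (DF a)) := by
  unfold DoL
  repeat' with_reducible first
      | apply Semi.and | apply Semi.or | apply Semi.ball | apply Semi.bex | apply Semi.evalECQ
      | apply Semi.eq | apply Semi.mem
  all_goals fun_prop

theorem Semi.edgeL {C : α → List ℕ} {K : α → RawKAB} {r r' : α → RawState} (hC : PRec C)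
    (hK : PRec K) (hr : PRec r) (hr' : PRec r') :
    Semi (fun a => EdgeL (C a) (K a) (r a) (r' a)) := by
  unfold EdgeL
  repeat' with_reducible first
    | apply Semi.and | apply Semi.bex | apply Semi.ex | apply Semi.legalL | apply Semi.doL
    | apply Deci.isSupL | apply Deci.answersL | apply Deci.sameL
    | apply Deci.consistent
    | apply Deci.semi_not | apply Deci.semi
  all_goals fun_prop

theorem Semi.closedL {C : α → List ℕ} {K : α → RawKAB} {r : α → RawState} {R : α → List RawState}
    (hC : PRec C) (hK : PRec K) (hr : PRec r) (hR : PRec R) :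
    Semi (fun a => ClosedL (C a) (K a) (r a) (R a)) := by
  unfold ClosedL
  repeat' with_reducible first
    | apply Semi.and | apply Semi.or | apply Semi.ball | apply Semi.bex | apply Semi.ex
    | apply Semi.legalL | apply Semi.doL
    | apply Deci.isSupL | apply Deci.answersL | apply Deci.sameL
    | apply Deci.consistent
    | apply Deci.semi_not | apply Deci.semi
  all_goals fun_prop

theorem Semi.correct {C : α → List ℕ} {K : α → RawKAB} {w : α → RawTS} (hC : PRec C)
    (hK : PRec K) (hw : PRec w) : Semi (fun a => (w a).Correct (C a) (K a)) := by
  refine Semi.of_iff (p := fun a => SameL ((w a).st 0) ((K a).2.1, []) ∧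
    (∀ i < (w a).1 + 1, i = 0 ∨ ∃ p ∈ (w a).2.2, p.2 = i ∧ (w a).rank p.1 < (w a).rank i) ∧
    (∀ i < (w a).1 + 1, ∀ j < (w a).1 + 1, i = j ∨ ¬ SameL ((w a).st i) ((w a).st j)) ∧
    (∀ p ∈ (w a).2.2, (p.1 < (w a).1 + 1 ∧ p.2 < (w a).1 + 1) ∧
      EdgeL (C a) (K a) ((w a).st p.1) ((w a).st p.2)) ∧
    (∀ i < (w a).1 + 1, ClosedL (C a) (K a) ((w a).st i) ((w a).succs i))) ?_ fun a =>
    ⟨fun h => ⟨h.1, h.2, h.3, h.4, h.5⟩, fun h => ⟨h.1, h.2.1, h.2.2.1, h.2.2.2.1, h.2.2.2.2⟩⟩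
  repeat' with_reducible first
    | apply Semi.and | apply Semi.or | apply Semi.ball | apply Semi.ballLt | apply Semi.bex
    | apply Semi.edgeL | apply Semi.closedL | apply Semi.eq | apply Semi.lt
    | apply Deci.sameL
    | apply Deci.semi_not | apply Deci.semi
  all_goals fun_prop

end

end KABV
namespace KABV

/-! ## Propositional translation -/

/-- Propositions: instances of EQL queries (given by their codes), and membership of a constant in
the active domain. -/
def propQuery (n : ℕ) (l : List ℕ) : ℕ :=
  Encodable.encode (Sum.inl (n, l) : (ℕ × List ℕ) ⊕ ℕ)

def propAdom (d : ℕ) : ℕ := Encodable.encode (Sum.inr d : (ℕ × List ℕ) ⊕ ℕ)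

theorem propQuery_inj {n n' : ℕ} {l l' : List ℕ} :
    propQuery n l = propQuery n' l' ↔ n = n' ∧ l = l' := by
  simp only [propQuery, Encodable.encode_inj, Sum.inl.injEq, Prod.mk.injEq]

theorem propAdom_inj {d d' : ℕ} : propAdom d = propAdom d' ↔ d = d' := by
  simp only [propAdom, Encodable.encode_inj, Sum.inr.injEq]

theorem propQuery_ne_propAdom {n d : ℕ} {l : List ℕ} : propQuery n l ≠ propAdom d := by
  simp only [propQuery, propAdom, ne_eq, Encodable.encode_inj, reduceCtorEq, not_false_iff]

namespace PropMu

/-- The syntax has no truth constants. Every set is a prefixpoint of the identity, so the least one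
is empty. -/
protected def false : PropMu := .mu 0 (.pvar 0)

protected def or (φ ψ : PropMu) : PropMu := .neg (.and (.neg φ) (.neg ψ))

theorem ext_false {F : FinFrame} {L : List (ℕ × ℕ)} {V : ℕ → Set F.State} :
    PropMu.false.ext F L V = ∅ := by
  refine Set.eq_empty_of_subset_empty fun i hi => ?_
  exact hi ∅ (by simp [ext])

theorem ext_or {F : FinFrame} {L : List (ℕ × ℕ)} {V : ℕ → Set F.State} {φ ψ : PropMu} :
    (φ.or ψ).ext F L V = φ.ext F L V ∪ ψ.ext F L V := by
  simp [PropMu.or, ext, Set.compl_inter]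

/-- The disjunction of a list of formulae. -/
def disj (l : List PropMu) : PropMu := l.foldr PropMu.or PropMu.false

theorem mem_ext_disj {F : FinFrame} {L : List (ℕ × ℕ)} {V : ℕ → Set F.State} {l : List PropMu}
    {i : F.State} : i ∈ (disj l).ext F L V ↔ ∃ φ ∈ l, i ∈ φ.ext F L V := by
  induction l with
  | nil => simp [disj, ext_false]
  | cons φ l ih =>
    have : disj (φ :: l) = φ.or (disj l) := rfl
    simp [this, ext_or, ih]

theorem fpv_disj {l : List PropMu} {s : Finset ℕ} (h : ∀ φ ∈ l, φ.fpv ⊆ s) : (disj l).fpv ⊆ s := by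
  induction l with
  | nil => simp [disj, PropMu.false, fpv]
  | cons φ l ih =>
    exact Finset.union_subset (h φ (by simp)) (ih fun ψ hψ => h ψ (by simp [hψ]))

theorem polarity_disj {l : List PropMu} {Z : ℕ} {b : Bool} (h : ∀ φ ∈ l, φ.Polarity Z b) :
    (disj l).Polarity Z b := by
  induction l with
  | nil =>
    by_cases hZ : 0 = Z
    · exact Or.inl hZ
    · exact Or.inr fun e => absurd e hZ
  | cons φ l ih =>
    have h1 := h φ (by simp)
    have h2 := ih fun ψ hψ => h ψ (by simp [hψ])
    have : disj (φ :: l) = φ.or (disj l) := rfl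
    simpa [this, PropMu.or, Polarity] using ⟨h1, h2⟩

theorem synMonotone_disj {l : List PropMu} (h : ∀ φ ∈ l, φ.SynMonotone) :
    (disj l).SynMonotone := by
  induction l with
  | nil => exact ⟨fun _ => rfl, trivial⟩
  | cons φ l ih => exact ⟨h φ (by simp), ih fun ψ hψ => h ψ (by simp [hψ])⟩

end PropMu

namespace MuForm

/-- The propositional translation under a valuation of the individual variables, where quantifiers
are expanded over the constants in `Ds`. -/
def toProp (Ds : List ℕ) : MuForm → List ℕ → PropMu
  | query Q, l => .atom (propQuery Q.code l)
  | neg Φ, l => .neg (toProp Ds Φ l)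
  | and Φ Ψ, l => .and (toProp Ds Φ l) (toProp Ds Ψ l)
  | ex x Φ, l => .disj (Ds.map fun d => .and (.atom (propAdom d)) (toProp Ds Φ (updList 0 l x d)))
  | dia Φ, l => .dia (toProp Ds Φ l)
  | pvar Z, _ => .pvar Z
  | mu Z Φ, l => .mu Z (toProp Ds Φ l)

/-- The propositions in the translation. -/
def props (Ds : List ℕ) : MuForm → List ℕ → List ℕ
  | query Q, l => [propQuery Q.code l]
  | neg Φ, l => props Ds Φ l
  | and Φ Ψ, l => props Ds Φ l ++ props Ds Ψ l
  | ex x Φ, l => Ds.flatMap fun d => propAdom d :: props Ds Φ (updList 0 l x d)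
  | dia Φ, l => props Ds Φ l
  | pvar _, _ => []
  | mu _ Φ, l => props Ds Φ l

variable {Ds : List ℕ}

theorem fpv_toProp (Φ : MuForm) (l : List ℕ) : (Φ.toProp Ds l).fpv ⊆ Φ.fpv := by
  induction Φ generalizing l with
  | query Q => exact subset_rfl
  | neg Φ ih => exact ih l
  | and Φ Ψ ih ih' => exact Finset.union_subset_union (ih l) (ih' l)
  | ex x Φ ih =>
    refine PropMu.fpv_disj fun φ hφ => ?_
    obtain ⟨d, -, rfl⟩ := List.mem_map.1 hφ
    exact Finset.union_subset (Finset.empty_subset _) (ih _)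
  | dia Φ ih => exact ih l
  | pvar Z => exact subset_rfl
  | mu Z Φ ih => exact Finset.erase_subset_erase _ (ih l)

theorem polarity_toProp (Φ : MuForm) {Z : ℕ} {b : Bool} (h : Φ.Polarity Z b) (l : List ℕ) :
    (Φ.toProp Ds l).Polarity Z b := by
  induction Φ generalizing l b with
  | query Q => cases b <;> trivial
  | neg Φ ih => exact ih h l
  | and Φ Ψ ih ih' => exact ⟨ih h.1 l, ih' h.2 l⟩
  | ex x Φ ih =>
    refine PropMu.polarity_disj fun φ hφ => ?_
    obtain ⟨d, -, rfl⟩ := List.mem_map.1 hφ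
    exact ⟨by cases b <;> trivial, ih h _⟩
  | dia Φ ih => exact ih h l
  | pvar Y => exact h
  | mu Y Φ ih => exact h.imp id fun h => ih h l

theorem synMonotone_toProp (Φ : MuForm) (h : Φ.SynMonotone) (l : List ℕ) :
    (Φ.toProp Ds l).SynMonotone := by
  induction Φ generalizing l with
  | query Q => trivial
  | neg Φ ih => exact ih h l
  | and Φ Ψ ih ih' => exact ⟨ih h.1 l, ih' h.2 l⟩
  | ex x Φ ih =>
    refine PropMu.synMonotone_disj fun φ hφ => ?_
    obtain ⟨d, -, rfl⟩ := List.mem_map.1 hφ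
    exact ⟨trivial, ih h _⟩
  | dia Φ ih => exact ih h l
  | pvar Y => trivial
  | mu Y Φ ih => exact ⟨polarity_toProp Φ h.1 l, ih h.2 l⟩

theorem isSentence_toProp {C₀ : List ℕ} {Φ : MuForm} (h : Φ.IsSentence C₀) (l : List ℕ) :
    (Φ.toProp Ds l).IsSentence :=
  ⟨Finset.subset_empty.1 (h.pclosed ▸ fpv_toProp Φ l), synMonotone_toProp Φ h.monotone l⟩

theorem ext_toProp {Υ : TS} {F : FinFrame} {L : List (ℕ × ℕ)} (ι : Υ.State ≃ F.State)
    (hstep : ∀ s s', Υ.Step s s' ↔ F.Step (ι s) (ι s'))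
    (hD : ∀ s, ∀ d ∈ adom (Υ.abox s), d ∈ Ds) {Ps : List ℕ}
    (hLq : ∀ s (Q : ECQ) l, propQuery Q.code l ∈ Ps → (((ι s).val, propQuery Q.code l) ∈ L ↔
      Q.Holds Υ.tbox (Υ.abox s) fun x => l.getD x 0))
    (hLd : ∀ s d, propAdom d ∈ Ps → (((ι s).val, propAdom d) ∈ L ↔ d ∈ adom (Υ.abox s)))
    (Φ : MuForm) (l : List ℕ) (hP : ∀ p ∈ Φ.props Ds l, p ∈ Ps) (V : ℕ → Set F.State) :
    Φ.ext Υ (fun x => l.getD x 0) (fun Z => ι ⁻¹' V Z) = ι ⁻¹' (Φ.toProp Ds l).ext F L V := by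
  induction Φ generalizing l V with
  | query Q =>
    ext s
    exact (hLq s Q l (hP _ (by simp [props]))).symm
  | neg Φ ih => exact congrArg compl (ih l hP V)
  | and Φ Ψ ih ih' =>
    exact congrArg₂ (· ∩ ·) (ih l (fun p hp => hP p (List.mem_append_left _ hp)) V)
      (ih' l (fun p hp => hP p (List.mem_append_right _ hp)) V)
  | ex x Φ ih =>
    have hmem : ∀ d ∈ Ds, ∀ p ∈ propAdom d :: Φ.props Ds (updList 0 l x d), p ∈ Ps :=
      fun d hd p hp => hP p (List.mem_flatMap.2 ⟨d, hd, hp⟩)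
    have key : ∀ d ∈ Ds, ∀ s, (s ∈ Φ.ext Υ (Function.update (fun x => l.getD x 0) x d)
        (fun Z => ι ⁻¹' V Z) ↔ ι s ∈ (Φ.toProp Ds (updList 0 l x d)).ext F L V) := by
      intro d hd s
      rw [← getD_updList, ih _ (fun p hp => hmem d hd p (List.mem_cons_of_mem _ hp)) V]
      rfl
    ext s
    simp only [Set.mem_preimage, toProp, PropMu.mem_ext_disj, List.mem_map,
      exists_exists_and_eq_and]
    constructor
    · rintro ⟨d, hd, h⟩
      exact ⟨d, hD s d hd, (hLd s d (hmem d (hD s d hd) _ (by simp))).2 hd,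
        (key d (hD s d hd) s).1 h⟩
    · rintro ⟨d, hd, h1, h2⟩
      exact ⟨d, (hLd s d (hmem d hd _ (by simp))).1 h1, (key d hd s).2 h2⟩
  | dia Φ ih =>
    ext s
    simp only [ext, ih l hP V, toProp, PropMu.ext, Set.mem_preimage, Set.mem_ofPred_eq, hstep]
    constructor
    · rintro ⟨t, h1, h2⟩
      exact ⟨ι t, h1, h2⟩
    · rintro ⟨j, h1, h2⟩
      exact ⟨ι.symm j, by simpa using h1, by simpa using h2⟩
  | pvar Z => rfl
  | mu Z Φ ih =>
    have key : ∀ S : Set F.State,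
        Φ.ext Υ (fun x => l.getD x 0) (Function.update (fun Z => ι ⁻¹' V Z) Z (ι ⁻¹' S)) =
          ι ⁻¹' (Φ.toProp Ds l).ext F L (Function.update V Z S) := by
      intro S
      rw [← ih l hP]
      congr 1
      funext Y
      by_cases hY : Y = Z
      · subst hY
        simp
      · simp [hY]
    ext s
    constructor
    · intro hs S hS
      exact hs (ι ⁻¹' S) ((key S).subset.trans (Set.preimage_mono hS))
    · intro hs S hS
      -- Every set of states is a preimage under the bijection, so both intersections range over
      -- corresponding prefixpoints.
      have h1 : ι ⁻¹' (ι.symm ⁻¹' S) = S := by ext; simp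
      have := hs (ι.symm ⁻¹' S) (by
        have h2 := key (ι.symm ⁻¹' S)
        rw [h1] at h2
        have hS : Φ.ext Υ (fun x => l.getD x 0) (Function.update (fun Z => ι ⁻¹' V Z) Z S) ⊆ S := hS
        rw [h2] at hS
        intro i hi
        exact hS (by simpa using hi))
      simpa using this

end MuForm

/-! ### Computing the translation -/

def orCode (m n : ℕ) : ℕ := Nat.pair 1 (Nat.pair 2 (Nat.pair (Nat.pair 1 m) (Nat.pair 1 n)))

/-- The rules for translating the formula with code `x.2.1` under the valuation `x.1` into the
formula with code `x.2.2.1` and the list of propositions `x.2.2.2`. -/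
def ToPropRule (Ds : List ℕ) (P : List (List ℕ × ℕ × ℕ × List ℕ))
    (x : List ℕ × ℕ × ℕ × List ℕ) : Prop :=
  (∃ q, x.2.1 = Nat.pair 0 q ∧ x.2.2 = (Nat.pair 0 (propQuery q x.1), [propQuery q x.1])) ∨
  (∃ m n, x.2.1 = Nat.pair 1 m ∧ x.2.2.1 = Nat.pair 1 n ∧ (x.1, m, n, x.2.2.2) ∈ P) ∨
  (∃ m m' n n' p p', x.2.1 = Nat.pair 2 (Nat.pair m m') ∧
    x.2.2 = (Nat.pair 2 (Nat.pair n n'), p ++ p') ∧ (x.1, m, n, p) ∈ P ∧ (x.1, m', n', p') ∈ P) ∨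
  (∃ (y m : ℕ) (B : List (ℕ × ℕ × List ℕ)), x.2.1 = Nat.pair 3 (Nat.pair y m) ∧
    B.map (fun t => t.1) = Ds ∧ (∀ t ∈ B, (updList 0 x.1 y t.1, m, t.2) ∈ P) ∧
    x.2.2 = (B.foldr (fun t n => orCode (Nat.pair 2 (Nat.pair (Nat.pair 0 (propAdom t.1)) t.2.1)) n)
        PropMu.false.code, B.flatMap fun t => propAdom t.1 :: t.2.2)) ∨
  (∃ m n, x.2.1 = Nat.pair 4 m ∧ x.2.2.1 = Nat.pair 3 n ∧ (x.1, m, n, x.2.2.2) ∈ P) ∨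
  (∃ z, x.2.1 = Nat.pair 5 z ∧ x.2.2 = (Nat.pair 4 z, [])) ∨
  (∃ z m n, x.2.1 = Nat.pair 6 (Nat.pair z m) ∧ x.2.2.1 = Nat.pair 5 (Nat.pair z n) ∧
    (x.1, m, n, x.2.2.2) ∈ P)

theorem code_disj (l : List PropMu) :
    (PropMu.disj l).code = l.foldr (fun φ n => orCode φ.code n) PropMu.false.code := by
  induction l with
  | nil => rfl
  | cons φ l ih =>
    rw [List.foldr_cons, ← ih]
    rfl

/-- The leading tag of a code selects exactly one rule, and the premises determine the conclusion,
so the derivable output is unique and equals the translation. -/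
theorem toPropRule_iff {Ds : List ℕ} (Φ : MuForm) (l : List ℕ) (y : ℕ × List ℕ) :
    Derivable (ToPropRule Ds) (l, Φ.code, y) ↔ y = ((Φ.toProp Ds l).code, Φ.props Ds l) := by
  induction Φ generalizing l y with
  | query Q =>
    constructor
    · rintro ⟨P, _, h, -⟩
      rcases h with ⟨_, h, h'⟩ | ⟨_, _, h, _⟩ | ⟨_, _, _, _, _, _, h, _⟩ | ⟨_, _, _, h, _⟩ |
        ⟨_, _, h, _⟩ | ⟨_, h, _⟩ | ⟨_, _, _, h, _⟩ <;>
        simp only [MuForm.code, Nat.pair_eq_pair, false_and, true_and, zero_ne_one,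
          OfNat.zero_ne_ofNat] at h
      subst h
      exact h'
    · rintro rfl
      exact .intro [] _ (.inl ⟨_, rfl, rfl⟩) (by simp)
  | neg Φ ih =>
    constructor
    · rintro ⟨P, _, h, hP⟩
      rcases h with ⟨_, h, h'⟩ | ⟨_, _, h, h'⟩ | ⟨_, _, _, _, _, _, h, _⟩ | ⟨_, _, _, h, _⟩ |
        ⟨_, _, h, _⟩ | ⟨_, h, _⟩ | ⟨_, _, _, h, _⟩ <;> simp [MuForm.code, Nat.pair_eq_pair] at h
      subst h
      obtain ⟨h1, h2⟩ := h'
      obtain ⟨a, b⟩ := y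
      have := (ih _ _).1 (hP _ h2)
      simp only [Prod.mk.injEq] at this h1 ⊢
      rw [h1, this.1, this.2]
      exact ⟨rfl, rfl⟩
    · rintro rfl
      refine .intro [(l, Φ.code, (Φ.toProp Ds l).code, Φ.props Ds l)] _
        (.inr (.inl ⟨_, _, rfl, rfl, by simp [MuForm.props]⟩)) ?_
      intro z hz
      obtain rfl := List.mem_singleton.1 hz
      exact (ih _ _).2 rfl
  | and Φ Ψ ih ih' =>
    constructor
    · rintro ⟨P, _, h, hP⟩
      rcases h with ⟨_, h, h'⟩ | ⟨_, _, h, h'⟩ | ⟨_, _, _, _, _, _, h, h'⟩ | ⟨_, _, _, h, _⟩ |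
        ⟨_, _, h, _⟩ | ⟨_, h, _⟩ | ⟨_, _, _, h, _⟩ <;> simp [MuForm.code, Nat.pair_eq_pair] at h
      obtain ⟨rfl, rfl⟩ := h
      obtain ⟨h1, h2, h3⟩ := h'
      have e := (ih _ _).1 (hP _ h2)
      have e' := (ih' _ _).1 (hP _ h3)
      simp only [Prod.mk.injEq] at e e'
      obtain ⟨rfl, rfl⟩ := e
      obtain ⟨rfl, rfl⟩ := e'
      exact h1
    · rintro rfl
      refine .intro [(l, Φ.code, (Φ.toProp Ds l).code, Φ.props Ds l),
        (l, Ψ.code, (Ψ.toProp Ds l).code, Ψ.props Ds l)] _ (.inr (.inr (.inl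
          ⟨_, _, _, _, _, _, rfl, rfl, List.mem_cons_self,
            List.mem_cons_of_mem _ List.mem_cons_self⟩))) ?_
      simp only [List.mem_cons, List.not_mem_nil, or_false, forall_eq_or_imp, forall_eq]
      exact ⟨(ih _ _).2 rfl, (ih' _ _).2 rfl⟩
  | ex x Φ ih =>
    constructor
    · rintro ⟨P, _, h, hP⟩
      rcases h with ⟨_, h, h'⟩ | ⟨_, _, h, h'⟩ | ⟨_, _, _, _, _, _, h, h'⟩ | ⟨_, _, B, h, h'⟩ |
        ⟨_, _, h, _⟩ | ⟨_, h, _⟩ | ⟨_, _, _, h, _⟩ <;> simp [MuForm.code, Nat.pair_eq_pair] at h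
      obtain ⟨rfl, rfl⟩ := h
      obtain ⟨rfl, h2, h3⟩ := h'
      -- The first components of `B` are prescribed and the premises fix the rest, so the table of
      -- instances is forced.
      have hB : B = (B.map fun t => t.1).map fun d => (d, (Φ.toProp (B.map fun t => t.1)
          (updList 0 l x d)).code, Φ.props (B.map fun t => t.1) (updList 0 l x d)) := by
        rw [List.map_map]
        refine (List.map_id _).symm.trans (List.map_congr_left fun t ht => ?_)
        exact Prod.ext rfl ((ih _ _).1 (hP _ (h2 t ht)))
      simp only at h3
      rw [h3]
      generalize B.map (fun t => t.1) = Ds at hB ⊢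
      subst hB
      simp only [MuForm.toProp, MuForm.props, code_disj, List.foldr_map, List.flatMap_map,
        PropMu.code]
    · rintro rfl
      refine .intro (Ds.map fun d => (updList 0 l x d, Φ.code,
        (Φ.toProp Ds (updList 0 l x d)).code, Φ.props Ds (updList 0 l x d))) _
        (.inr (.inr (.inr (.inl ⟨x, Φ.code, Ds.map fun d => (d,
          (Φ.toProp Ds (updList 0 l x d)).code, Φ.props Ds (updList 0 l x d)), rfl, ?_, ?_, ?_⟩))))
          ?_
      · exact (List.map_map ..).trans (List.map_id Ds)
      · intro t ht
        obtain ⟨d, hd, rfl⟩ := List.mem_map.1 ht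
        exact List.mem_map.2 ⟨d, hd, rfl⟩
      · simp only [MuForm.toProp, MuForm.props, code_disj, List.foldr_map, List.flatMap_map,
          PropMu.code]
      · intro z hz
        obtain ⟨d, hd, rfl⟩ := List.mem_map.1 hz
        exact (ih _ _).2 rfl
  | dia Φ ih =>
    constructor
    · rintro ⟨P, _, h, hP⟩
      rcases h with ⟨_, h, h'⟩ | ⟨_, _, h, h'⟩ | ⟨_, _, _, _, _, _, h, _⟩ | ⟨_, _, _, h, _⟩ |
        ⟨_, _, h, h'⟩ | ⟨_, h, _⟩ | ⟨_, _, _, h, _⟩ <;> simp [MuForm.code, Nat.pair_eq_pair] at h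
      subst h
      obtain ⟨h1, h2⟩ := h'
      obtain ⟨a, b⟩ := y
      have := (ih _ _).1 (hP _ h2)
      simp only [Prod.mk.injEq] at this h1 ⊢
      rw [h1, this.1, this.2]
      exact ⟨rfl, rfl⟩
    · rintro rfl
      refine .intro [(l, Φ.code, (Φ.toProp Ds l).code, Φ.props Ds l)] _
        (.inr (.inr (.inr (.inr (.inl ⟨_, _, rfl, rfl, by simp [MuForm.props]⟩))))) ?_
      intro z hz
      obtain rfl := List.mem_singleton.1 hz
      exact (ih _ _).2 rfl
  | pvar Z =>
    constructor
    · rintro ⟨P, _, h, -⟩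
      rcases h with ⟨_, h, h'⟩ | ⟨_, _, h, _⟩ | ⟨_, _, _, _, _, _, h, _⟩ | ⟨_, _, _, h, _⟩ |
        ⟨_, _, h, _⟩ | ⟨_, h, h'⟩ | ⟨_, _, _, h, _⟩ <;> simp [MuForm.code, Nat.pair_eq_pair] at h
      subst h
      exact h'
    · rintro rfl
      exact .intro [] _ (.inr (.inr (.inr (.inr (.inr (.inl ⟨_, rfl, rfl⟩)))))) (by simp)
  | mu Z Φ ih =>
    constructor
    · rintro ⟨P, _, h, hP⟩
      rcases h with ⟨_, h, h'⟩ | ⟨_, _, h, h'⟩ | ⟨_, _, _, _, _, _, h, _⟩ | ⟨_, _, _, h, _⟩ |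
        ⟨_, _, h, _⟩ | ⟨_, h, _⟩ | ⟨_, _, _, h, h'⟩ <;> simp [MuForm.code, Nat.pair_eq_pair] at h
      obtain ⟨rfl, rfl⟩ := h
      obtain ⟨h1, h2⟩ := h'
      obtain ⟨a, b⟩ := y
      have := (ih _ _).1 (hP _ h2)
      simp only [Prod.mk.injEq] at this h1 ⊢
      rw [h1, this.1, this.2]
      exact ⟨rfl, rfl⟩
    · rintro rfl
      refine .intro [(l, Φ.code, (Φ.toProp Ds l).code, Φ.props Ds l)] _
        (.inr (.inr (.inr (.inr (.inr (.inr ⟨_, _, _, rfl, rfl, by simp [MuForm.props]⟩)))))) ?_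
      intro z hz
      obtain rfl := List.mem_singleton.1 hz
      exact (ih _ _).2 rfl

section

variable {α : Type} [Primcodable α]

@[fun_prop]
theorem PRec.propQuery {n : α → ℕ} {l : α → List ℕ} (hn : PRec n) (hl : PRec l) :
    PRec (fun a => propQuery (n a) (l a)) :=
  PRec.encode (.inl (.pair hn hl))

@[fun_prop]
theorem PRec.propAdom {d : α → ℕ} (hd : PRec d) : PRec (fun a => propAdom (d a)) :=
  PRec.encode (.inr hd)

@[fun_prop]
theorem PRec.orCode {m n : α → ℕ} (hm : PRec m) (hn : PRec n) :
    PRec (fun a => orCode (m a) (n a)) := by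
  unfold KABV.orCode
  fun_prop

theorem Semi.toProp {Ds l : α → List ℕ} {n : α → ℕ} {y : α → ℕ × List ℕ} (hD : PRec Ds)
    (hl : PRec l) (hn : PRec n) (hy : PRec y) :
    Semi (fun a => Derivable (ToPropRule (Ds a)) (l a, n a, y a)) := by
  refine Semi.derivable (R := fun a P x => ToPropRule (Ds a) P x) ?_ (by fun_prop)
  have hfold : ∀ {γ : Type} [Primcodable γ] {f : γ → List (ℕ × ℕ × List ℕ)}, PRec f →
      PRec fun a => (f a).foldr (fun t n => KABV.orCode (Nat.pair 2 (Nat.pair (Nat.pair 0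
        (KABV.propAdom t.1)) t.2.1)) n) PropMu.false.code := fun hf =>
    PRec.foldr (h := fun _ (t : ℕ × ℕ × List ℕ) n => KABV.orCode (Nat.pair 2 (Nat.pair
      (Nat.pair 0 (KABV.propAdom t.1)) t.2.1)) n) hf (.const _) (by fun_prop)
  unfold ToPropRule
  repeat' with_reducible first
    | apply Semi.or | apply Semi.and | apply Semi.ex | apply Semi.ball | apply Semi.eq
    | apply Semi.mem
  all_goals fun_prop

end

end KABV
namespace KABV

/-! ## Finite-state model checking -/

/-- The set of states given by the list of its truth values. -/
def toSet (F : FinFrame) (S : List Bool) : Set F.State := {i | S.getD i false = true}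

/-- The rules for computing the extension `x.2.2` of the formula with code `x.2.1`, where the list
`x.1` contains the values of the predicate variables. -/
def ExtRule (M : (ℕ × List (ℕ × ℕ)) × List (ℕ × ℕ)) (P : List (List (List Bool) × ℕ × List Bool))
    (x : List (List Bool) × ℕ × List Bool) : Prop :=
  x.2.2.length = M.1.1 + 1 ∧
  ((∃ p, x.2.1 = Nat.pair 0 p ∧ ∀ i < M.1.1 + 1, (x.2.2.getD i false = true ↔ (i, p) ∈ M.2)) ∨
  (∃ m S, x.2.1 = Nat.pair 1 m ∧ (x.1, m, S) ∈ P ∧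
    ∀ i < M.1.1 + 1, (x.2.2.getD i false = true ↔ ¬ S.getD i false = true)) ∨
  (∃ m m' S S', x.2.1 = Nat.pair 2 (Nat.pair m m') ∧ (x.1, m, S) ∈ P ∧ (x.1, m', S') ∈ P ∧
    ∀ i < M.1.1 + 1, (x.2.2.getD i false = true ↔ S.getD i false = true ∧ S'.getD i false = true)) ∨
  (∃ m S, x.2.1 = Nat.pair 3 m ∧ (x.1, m, S) ∈ P ∧
    ∀ i < M.1.1 + 1, (x.2.2.getD i false = true ↔
      ∃ e ∈ M.1.2, e.1 = i ∧ e.2 < M.1.1 + 1 ∧ S.getD e.2 false = true)) ∨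
  (∃ z, x.2.1 = Nat.pair 4 z ∧
    ∀ i < M.1.1 + 1, (x.2.2.getD i false = true ↔ (x.1.getD z []).getD i false = true)) ∨
  (∃ (z m : ℕ) (B : List (List Bool × List Bool)), x.2.1 = Nat.pair 5 (Nat.pair z m) ∧
    B.map (fun t => t.1) = tuples [false, true] (M.1.1 + 1) ∧
    (∀ t ∈ B, (updList [] x.1 z t.1, m, t.2) ∈ P) ∧
    ∀ i < M.1.1 + 1, (x.2.2.getD i false = true ↔ ∀ t ∈ B,
      (∀ j < M.1.1 + 1, t.2.getD j false = true → t.1.getD j false = true) →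
        t.1.getD i false = true)))

theorem exists_toSet (F : FinFrame) (X : Set F.State) :
    ∃ S : List Bool, S.length = F.last + 1 ∧ toSet F S = X := by
  classical
  refine ⟨List.ofFn fun i : Fin (F.last + 1) => decide (i ∈ X), by simp, ?_⟩
  ext i
  have hi : i.val < (List.ofFn fun i : Fin (F.last + 1) => decide (i ∈ X)).length := by
    rw [List.length_ofFn]
    exact i.2
  simp only [toSet, Set.mem_ofPred_eq]
  rw [List.getD_eq_getElem _ _ hi, List.getElem_ofFn]
  simp

theorem toSet_eq_iff {F : FinFrame} {S : List Bool} {X : Set F.State} {p : ℕ → Prop}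
    (h : ∀ i : F.State, p i ↔ i ∈ X) :
    (∀ i < F.last + 1, (S.getD i false = true ↔ p i)) ↔ toSet F S = X := by
  constructor
  · intro hS
    ext i
    exact (hS i i.2).trans (h i)
  · rintro rfl i hi
    exact (h ⟨i, hi⟩).symm

theorem toSet_getD_updList {env : List (List Bool)} {F : FinFrame} (z : ℕ) (S : List Bool) :
    (fun y => toSet F ((updList [] env z S).getD y [])) =
      Function.update (fun y => toSet F (env.getD y [])) z (toSet F S) := by
  funext y
  have := congrFun (getD_updList [] env z S) y
  rw [this]
  by_cases hy : y = z
  · subst hy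
    simp
  · simp [hy]

/-- A fixpoint is computed literally as the intersection of all prefixpoints, by tabulating the body
on every Boolean list of the right length. No monotonicity is needed, so the statement covers
formulae that are not well-formed. The length condition ensures that different lists stand for
different sets. -/
theorem extRule_iff (F : FinFrame) (L : List (ℕ × ℕ)) (φ : PropMu) (env : List (List Bool))
    (S : List Bool) :
    Derivable (ExtRule ((F.last, F.edges), L)) (env, φ.code, S) ↔
      S.length = F.last + 1 ∧ toSet F S = φ.ext F L fun z => toSet F (env.getD z []) := by
  induction φ generalizing env S with
  | atom p =>
    have key : (∀ i < F.last + 1, (S.getD i false = true ↔ (i, p) ∈ L)) ↔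
        toSet F S = (PropMu.atom p).ext F L fun z => toSet F (env.getD z []) :=
      toSet_eq_iff fun i => Iff.rfl
    rw [← key]
    constructor
    · rintro ⟨P, _, ⟨hl, h⟩, hP⟩
      rcases h with ⟨_, h, h'⟩ | ⟨_, _, h, _⟩ | ⟨_, _, _, _, h, _⟩ | ⟨_, _, h, _⟩ | ⟨_, h, _⟩ |
        ⟨_, _, _, h, _⟩ <;> simp [PropMu.code, Nat.pair_eq_pair] at h
      subst h
      exact ⟨hl, h'⟩
    · exact fun h => .intro [] _ ⟨h.1, .inl ⟨_, rfl, h.2⟩⟩ (by simp)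
  | neg φ ih =>
    have key : ∀ S', toSet F S' = φ.ext F L (fun z => toSet F (env.getD z [])) →
        ((∀ i < F.last + 1, (S.getD i false = true ↔ ¬ S'.getD i false = true)) ↔
        toSet F S = (PropMu.neg φ).ext F L fun z => toSet F (env.getD z [])) := fun S' hS' =>
      toSet_eq_iff fun i => by
        rw [PropMu.ext, ← hS']
        rfl
    constructor
    · rintro ⟨P, _, ⟨hl, h⟩, hP⟩
      rcases h with ⟨_, h, h'⟩ | ⟨_, _, h, h', h2⟩ | ⟨_, _, _, _, h, _⟩ | ⟨_, _, h, _⟩ | ⟨_, h, _⟩ |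
        ⟨_, _, _, h, _⟩ <;> simp [PropMu.code, Nat.pair_eq_pair] at h
      subst h
      exact ⟨hl, (key _ ((ih _ _).1 (hP _ h')).2).1 h2⟩
    · rintro ⟨hl, h⟩
      obtain ⟨S', h1, h2⟩ := exists_toSet F (φ.ext F L fun z => toSet F (env.getD z []))
      refine .intro [(env, φ.code, S')] _ ⟨hl, .inr (.inl ⟨_, S', rfl, List.mem_cons_self,
        (key S' h2).2 h⟩)⟩ fun y hy => ?_
      obtain rfl := List.mem_singleton.1 hy
      exact (ih _ _).2 ⟨h1, h2⟩
  | and φ ψ ih ih' =>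
    have key : ∀ S' S'', toSet F S' = φ.ext F L (fun z => toSet F (env.getD z [])) →
        toSet F S'' = ψ.ext F L (fun z => toSet F (env.getD z [])) →
        ((∀ i < F.last + 1, (S.getD i false = true ↔
          S'.getD i false = true ∧ S''.getD i false = true)) ↔
        toSet F S = (PropMu.and φ ψ).ext F L fun z => toSet F (env.getD z [])) :=
      fun S' S'' hS' hS'' => toSet_eq_iff fun i => by
        rw [PropMu.ext, ← hS', ← hS'']
        rfl
    constructor
    · rintro ⟨P, _, ⟨hl, h⟩, hP⟩
      rcases h with ⟨_, h, h'⟩ | ⟨_, _, h, h', h2⟩ | ⟨_, _, _, _, h, h1, h2, h3⟩ | ⟨_, _, h, _⟩ |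
        ⟨_, h, _⟩ | ⟨_, _, _, h, _⟩ <;> simp [PropMu.code, Nat.pair_eq_pair] at h
      obtain ⟨rfl, rfl⟩ := h
      exact ⟨hl, (key _ _ ((ih _ _).1 (hP _ h1)).2 ((ih' _ _).1 (hP _ h2)).2).1 h3⟩
    · rintro ⟨hl, h⟩
      obtain ⟨S', h1, h2⟩ := exists_toSet F (φ.ext F L fun z => toSet F (env.getD z []))
      obtain ⟨S'', h3, h4⟩ := exists_toSet F (ψ.ext F L fun z => toSet F (env.getD z []))
      refine .intro [(env, φ.code, S'), (env, ψ.code, S'')] _ ⟨hl, .inr (.inr (.inl ⟨_, _, S', S'',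
        rfl, List.mem_cons_self, List.mem_cons_of_mem _ List.mem_cons_self,
        (key S' S'' h2 h4).2 h⟩))⟩ ?_
      simp only [List.mem_cons, List.not_mem_nil, or_false, forall_eq_or_imp, forall_eq]
      exact ⟨(ih _ _).2 ⟨h1, h2⟩, (ih' _ _).2 ⟨h3, h4⟩⟩
  | dia φ ih =>
    -- An edge list may mention numbers that are not states; the bound on `e.2` discards such
    -- targets.
    have key : ∀ S', toSet F S' = φ.ext F L (fun z => toSet F (env.getD z [])) →
        ((∀ i < F.last + 1, (S.getD i false = true ↔
          ∃ e ∈ F.edges, e.1 = i ∧ e.2 < F.last + 1 ∧ S'.getD e.2 false = true)) ↔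
        toSet F S = (PropMu.dia φ).ext F L fun z => toSet F (env.getD z [])) := fun S' hS' =>
      toSet_eq_iff fun i => by
        rw [PropMu.ext, ← hS']
        constructor
        · rintro ⟨⟨_, j⟩, he, rfl, hj, h⟩
          exact ⟨⟨j, hj⟩, he, h⟩
        · rintro ⟨j, he, h⟩
          exact ⟨_, he, rfl, j.2, h⟩
    constructor
    · rintro ⟨P, _, ⟨hl, h⟩, hP⟩
      rcases h with ⟨_, h, h'⟩ | ⟨_, _, h, h', h2⟩ | ⟨_, _, _, _, h, _⟩ | ⟨_, _, h, h', h2⟩ |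
        ⟨_, h, _⟩ | ⟨_, _, _, h, _⟩ <;> simp [PropMu.code, Nat.pair_eq_pair] at h
      subst h
      exact ⟨hl, (key _ ((ih _ _).1 (hP _ h')).2).1 h2⟩
    · rintro ⟨hl, h⟩
      obtain ⟨S', h1, h2⟩ := exists_toSet F (φ.ext F L fun z => toSet F (env.getD z []))
      refine .intro [(env, φ.code, S')] _ ⟨hl, .inr (.inr (.inr (.inl ⟨_, S', rfl,
        List.mem_cons_self, (key S' h2).2 h⟩)))⟩ fun y hy => ?_
      obtain rfl := List.mem_singleton.1 hy
      exact (ih _ _).2 ⟨h1, h2⟩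
  | pvar Z =>
    have key : (∀ i < F.last + 1, (S.getD i false = true ↔ (env.getD Z []).getD i false = true)) ↔
        toSet F S = (PropMu.pvar Z).ext F L fun z => toSet F (env.getD z []) :=
      toSet_eq_iff fun i => Iff.rfl
    rw [← key]
    constructor
    · rintro ⟨P, _, ⟨hl, h⟩, hP⟩
      rcases h with ⟨_, h, h'⟩ | ⟨_, _, h, h', h2⟩ | ⟨_, _, _, _, h, _⟩ | ⟨_, _, h, h', h2⟩ |
        ⟨_, h, h'⟩ | ⟨_, _, _, h, _⟩ <;> simp [PropMu.code, Nat.pair_eq_pair] at h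
      subst h
      exact ⟨hl, h'⟩
    · exact fun h => .intro [] _ ⟨h.1, .inr (.inr (.inr (.inr (.inl ⟨_, rfl, h.2⟩))))⟩ (by simp)
  | mu Z φ ih =>
    have key : ∀ B : List (List Bool × List Bool),
        B.map (fun t => t.1) = tuples [false, true] (F.last + 1) →
        (∀ t ∈ B, toSet F t.2 = φ.ext F L fun z => toSet F ((updList [] env Z t.1).getD z [])) →
        ((∀ i < F.last + 1, (S.getD i false = true ↔ ∀ t ∈ B,
          (∀ j < F.last + 1, t.2.getD j false = true → t.1.getD j false = true) →
            t.1.getD i false = true)) ↔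
        toSet F S = (PropMu.mu Z φ).ext F L fun z => toSet F (env.getD z [])) := by
      intro B hB hB'
      refine toSet_eq_iff (p := fun i => ∀ t ∈ B,
          (∀ j < F.last + 1, t.2.getD j false = true → t.1.getD j false = true) →
            t.1.getD i false = true) fun i => ?_
      have hsub : ∀ t ∈ B, ((∀ j < F.last + 1, t.2.getD j false = true → t.1.getD j false = true) ↔
          φ.ext F L (Function.update (fun z => toSet F (env.getD z [])) Z (toSet F t.1)) ⊆
            toSet F t.1) := by
        intro t ht
        rw [← toSet_getD_updList, ← hB' t ht]
        exact ⟨fun h j hj => h j j.2 hj, fun h j hj hj' => h (a := ⟨j, hj⟩) hj'⟩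
      constructor
      · intro h X hX
        obtain ⟨T, h1, rfl⟩ := exists_toSet F X
        have hT : T ∈ B.map fun t => t.1 := by
          rw [hB]
          exact mem_tuples.2 ⟨h1, fun b _ => by cases b <;> simp⟩
        obtain ⟨t, ht, rfl⟩ := List.mem_map.1 hT
        exact h t ht ((hsub t ht).2 hX)
      · intro h t ht hsub'
        exact h _ ((hsub t ht).1 hsub')
    constructor
    · rintro ⟨P, _, ⟨hl, h⟩, hP⟩
      rcases h with ⟨_, h, h'⟩ | ⟨_, _, h, h', h2⟩ | ⟨_, _, _, _, h, _⟩ | ⟨_, _, h, h', h2⟩ |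
        ⟨_, h, h'⟩ | ⟨_, _, B, h, h1, h2, h3⟩ <;> simp [PropMu.code, Nat.pair_eq_pair] at h
      obtain ⟨rfl, rfl⟩ := h
      exact ⟨hl, (key B h1 fun t ht => ((ih _ _).1 (hP _ (h2 t ht))).2).1 h3⟩
    · rintro ⟨hl, h⟩
      -- The table pairs every candidate set with the value of the body on it, which the induction
      -- hypothesis derives.
      choose g hg1 hg2 using fun T : List Bool => exists_toSet F
        (φ.ext F L fun z => toSet F ((updList [] env Z T).getD z []))
      let B := (tuples [false, true] (F.last + 1)).map fun T => (T, g T)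
      have hB : B.map (fun t => t.1) = tuples [false, true] (F.last + 1) :=
        (List.map_map ..).trans (List.map_id _)
      refine .intro (B.map fun t => (updList [] env Z t.1, φ.code, t.2)) _
        ⟨hl, .inr (.inr (.inr (.inr (.inr ⟨Z, φ.code, B, rfl, hB, fun t ht =>
          List.mem_map_of_mem (f := fun t => (updList [] env Z t.1, φ.code, t.2)) ht,
          (key B hB fun t ht => ?_).2 h⟩))))⟩ fun y hy => ?_
      · obtain ⟨T, -, rfl⟩ := List.mem_map.1 ht
        exact hg2 T
      · obtain ⟨t, ht, rfl⟩ := List.mem_map.1 hy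
        obtain ⟨T, -, rfl⟩ := List.mem_map.1 ht
        exact (ih _ _).2 ⟨hg1 T, hg2 T⟩

theorem Semi.extRule {α : Type} [Primcodable α] {M : α → (ℕ × List (ℕ × ℕ)) × List (ℕ × ℕ)}
    {x : α → List (List Bool) × ℕ × List Bool} (hM : PRec M) (hx : PRec x) :
    Semi (fun a => Derivable (ExtRule (M a)) (x a)) := by
  refine Semi.derivable (R := fun a P x => ExtRule (M a) P x) ?_ hx
  unfold ExtRule
  repeat' with_reducible first
    | apply Semi.or | apply Semi.and | apply Semi.ex | apply Semi.eq | apply Semi.mem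
    | apply Semi.ballLt | apply Semi.ball | apply Deci.iff | apply Deci.and | apply Deci.not
    | apply Deci.ball | apply Deci.bex | apply Deci.imp | apply Deci.ballLt | apply Deci.eq
    | apply Deci.lt | apply Deci.mem | apply Deci.semi
  all_goals fun_prop

/-- Truth of a closed formula in a state is decidable. -/
theorem holdsAt_iff_derivable (F : FinFrame) (L : List (ℕ × ℕ)) (φ : PropMu) (i : F.State)
    (b : Bool) :
    (∃ S : List Bool, Derivable (ExtRule ((F.last, F.edges), L)) ([], φ.code, S) ∧
      (b = true ↔ S.getD i false = true)) ↔ (b = true ↔ F.HoldsAt L i φ) := by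
  have hext : (φ.ext F L fun z => toSet F (([] : List (List Bool)).getD z [])) =
      φ.ext F L fun _ => ∅ := by
    congr 1
    funext z
    ext i
    simp [toSet]
  simp only [extRule_iff, hext]
  constructor
  · rintro ⟨S, ⟨-, hS⟩, h⟩
    rw [h, FinFrame.HoldsAt, ← hS]
    rfl
  · intro h
    obtain ⟨S, h1, h2⟩ := exists_toSet F (φ.ext F L fun _ => ∅)
    refine ⟨S, ⟨h1, h2⟩, ?_⟩
    rw [h, FinFrame.HoldsAt, ← h2]
    rfl

end KABV
namespace KABV

/-! ## Closing queries -/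

/-- Substitution of constants for variables. -/
def QTerm.subst (ρ : ℕ → Option ℕ) : QTerm → QTerm
  | var x => (ρ x).elim (var x) const
  | const c => const c

def CQ.subst (ρ : ℕ → Option ℕ) (q : CQ) : CQ :=
  ⟨q.exVars, q.atoms.map (Fact.map (QTerm.subst fun x => if x ∈ q.exVars then none else ρ x))⟩

def UCQ.subst (ρ : ℕ → Option ℕ) (q : UCQ) : UCQ := ⟨q.disjuncts.map (CQ.subst ρ)⟩

def ECQ.subst : (ℕ → Option ℕ) → ECQ → ECQ
  | ρ, cert q => cert (q.subst ρ)
  | ρ, neg Q => neg (Q.subst ρ)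
  | ρ, and Q₁ Q₂ => and (Q₁.subst ρ) (Q₂.subst ρ)
  | ρ, ex x Q => ex x (Q.subst (Function.update ρ x none))

theorem Fact.mem_terms_map {τ υ : Type} {f : τ → υ} {F : Fact τ} {t : υ} :
    t ∈ (F.map f).terms ↔ ∃ s ∈ F.terms, f s = t := by
  cases F <;> simp [Fact.map, Fact.terms, eq_comm]

theorem CQ.eq_none_of_mem_fv_subst {ρ : ℕ → Option ℕ} {q : CQ} {x : ℕ} (h : x ∈ (q.subst ρ).fv) :
    ρ x = none := by
  obtain ⟨⟨a, ha, hx⟩, hex⟩ := CQ.mem_fv.1 h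
  obtain ⟨b, -, rfl⟩ := List.mem_map.1 ha
  obtain ⟨t, -, ht⟩ := Fact.mem_terms_map.1 hx
  change x ∉ q.exVars at hex
  cases t with
  | const c => simp [QTerm.subst] at ht
  | var y =>
    simp only [QTerm.subst] at ht
    by_cases hy : y ∈ q.exVars
    · rw [if_pos hy] at ht
      obtain rfl : y = x := by simpa using ht
      exact absurd hy hex
    · rw [if_neg hy] at ht
      cases hr : ρ y with
      | none =>
        rw [hr] at ht
        obtain rfl : y = x := by simpa using ht
        exact hr
      | some c => simp [hr] at ht

theorem ECQ.eq_none_of_mem_fv_subst {ρ : ℕ → Option ℕ} {Q : ECQ} {x : ℕ}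
    (h : x ∈ (Q.subst ρ).fv) : ρ x = none := by
  induction Q generalizing ρ with
  | cert q =>
    obtain ⟨d, hd, hx⟩ := UCQ.mem_fv.1 h
    obtain ⟨d, -, rfl⟩ := List.mem_map.1 hd
    exact CQ.eq_none_of_mem_fv_subst hx
  | neg Q ih => exact ih h
  | and Q₁ Q₂ ih₁ ih₂ => exact (Finset.mem_union.1 h).elim ih₁ ih₂
  | ex y Q ih =>
    obtain ⟨hxy, hx⟩ := Finset.mem_erase.1 h
    simpa [hxy] using ih hx

theorem ECQ.fv_subst_eq_empty {ρ : ℕ → ℕ} {Q : ECQ} : (Q.subst fun x => some (ρ x)).fv = ∅ :=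
  Finset.eq_empty_of_forall_notMem fun _ hx => by simpa using eq_none_of_mem_fv_subst hx

theorem CQ.sat_subst {I : Interp} {ρ : ℕ → Option ℕ} {g : ℕ → I.Dom} {q : CQ} :
    (q.subst ρ).Sat I g ↔ q.Sat I fun x => (ρ x).elim (g x) I.ind := by
  have key : ∀ f f' : ℕ → I.Dom, (∀ x, f' x = if x ∈ q.exVars then f x else
      (ρ x).elim (f x) I.ind) → ((∀ a ∈ (q.subst ρ).atoms, I.SatFact (a.map (QTerm.eval I f))) ↔
        ∀ a ∈ q.atoms, I.SatFact (a.map (QTerm.eval I f'))) := by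
    intro f f' hf
    have ht : ∀ t : QTerm, QTerm.eval I f (t.subst fun x => if x ∈ q.exVars then none else ρ x) =
        QTerm.eval I f' t := by
      rintro (x | c)
      · simp only [QTerm.subst, QTerm.eval, hf]
        split_ifs
        · rfl
        · cases ρ x <;> rfl
      · rfl
    simp only [CQ.subst, List.forall_mem_map]
    refine forall₂_congr fun a _ => ?_
    cases a <;> simp only [Fact.map, ht]
  constructor
  · rintro ⟨f, hf, h⟩
    refine ⟨fun x => if x ∈ q.exVars then f x else (ρ x).elim (f x) I.ind, fun x hx => ?_,
      (key f _ fun _ => rfl).1 h⟩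
    simp only [if_neg hx, hf x hx]
  · rintro ⟨f, hf, h⟩
    refine ⟨fun x => if x ∈ q.exVars then f x else g x, fun x hx => if_neg hx,
      (key _ f fun x => ?_).2 h⟩
    by_cases hx : x ∈ q.exVars
    · simp [hx]
    · simp [hx, hf x hx]

theorem ECQ.holds_subst {T : TBox} {A : ABox} {Q : ECQ} {ρ : ℕ → Option ℕ} {v : ℕ → ℕ} :
    (Q.subst ρ).Holds T A v ↔ Q.Holds T A fun x => (ρ x).getD (v x) := by
  induction Q generalizing ρ v with
  | cert q =>
    refine forall₂_congr fun I _ => ?_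
    simp only [UCQ.subst, List.mem_map, exists_exists_and_eq_and, CQ.sat_subst]
    refine exists_congr fun d => and_congr_right fun _ => Eq.to_iff (congrArg
      (fun u => CQ.Sat I u d) ?_)
    funext x
    cases ρ x <;> rfl
  | neg Q ih => exact not_congr ih
  | and Q₁ Q₂ ih₁ ih₂ => exact and_congr ih₁ ih₂
  | ex x Q ih =>
    refine exists_congr fun d => and_congr_right fun _ => ih.trans (Eq.to_iff (congrArg
      (fun u => Q.Holds T A u) ?_))
    funext y
    by_cases hy : y = x
    · subst hy
      simp
    · simp [hy]

/-- The conjunctive queries saying that `d` occurs in a fact with the predicate of a given one. -/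
def Fact.touch {τ : Type} (d : ℕ) : Fact τ → List CQ
  | conc N _ => [⟨[], [conc N (.const d)]⟩]
  | role P _ _ => [⟨[0], [role P (.const d) (.var 0)]⟩, ⟨[0], [role P (.var 0) (.const d)]⟩]

/-- The query saying that `d` occurs in a fact with a predicate from `Fs`. -/
def UCQ.inAdom (d : ℕ) (Fs : List (Fact ℕ)) : UCQ := ⟨Fs.flatMap (Fact.touch d)⟩

theorem UCQ.fv_inAdom (d : ℕ) (Fs : List (Fact ℕ)) : (inAdom d Fs).fv = ∅ := by
  refine Finset.eq_empty_of_forall_notMem fun x hx => ?_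
  obtain ⟨q, hq, hx⟩ := UCQ.mem_fv.1 hx
  obtain ⟨F, -, hF⟩ := List.mem_flatMap.1 hq
  obtain ⟨⟨a, ha, hxa⟩, hex⟩ := CQ.mem_fv.1 hx
  cases F with
  | conc N c =>
    obtain rfl := List.mem_singleton.1 hF
    obtain rfl := List.mem_singleton.1 ha
    simp [Fact.terms] at hxa
  | role P c c' =>
    simp only [Fact.touch, List.mem_cons, List.not_mem_nil, or_false] at hF
    rcases hF with rfl | rfl <;> obtain rfl := List.mem_singleton.1 ha <;>
      simp [Fact.terms] at hxa hex <;> exact hex hxa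

theorem mem_adom_of_aRole {A : ABox} {R : Role} {c d : ℕ} (h : ARole (A : Set (Fact ℕ)) R c d) :
    c ∈ adom A := by
  cases R with
  | name P => exact ⟨_, h, by simp [Fact.terms]⟩
  | inv P => exact ⟨_, h, by simp [Fact.terms]⟩

theorem mem_adom_of_aBasic {A : ABox} {B : Basic} {c : ℕ} (h : ABasic (A : Set (Fact ℕ)) B c) :
    c ∈ adom A := by
  cases B with
  | name N => exact ⟨_, h, by simp [Fact.terms]⟩
  | some R =>
    obtain ⟨d, h⟩ := h
    exact mem_adom_of_aRole h

theorem mem_adom_of_canRole {T : TBox} {A : ABox} {R : Role} {c : ℕ} {y : ℕ × List Role}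
    (h : CanRole T (A : Set (Fact ℕ)) R (c, []) y) : c ∈ adom A := by
  rcases h with ⟨-, -, h⟩ | ⟨rfl, h⟩ | ⟨h, -⟩
  · exact mem_adom_of_aRole h
  · obtain ⟨⟨B, h, -⟩, -⟩ := h
    exact mem_adom_of_aBasic h
  · simp at h

/-- Membership in the active domain becomes a certain answer: inclusions start from asserted
concepts, so a constant that takes part in a concept or role of the canonical model occurs in the
ABox. Conversely an occurrence is matched by its own fact, whose predicate is listed because the
fact lies in `Fs`. -/
theorem UCQ.certain_inAdom {T : TBox} {A : ABox} (hc : Consistent T A) {Fs : List (Fact ℕ)}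
    (hA : ∀ F ∈ A, F ∈ Fs) (d : ℕ) (v : ℕ → ℕ) :
    (inAdom d Fs).Certain T A v ↔ d ∈ adom A := by
  constructor
  · rw [certain_iff_canModel hc]
    rintro ⟨q, hq, g, hg, hs⟩
    obtain ⟨F, -, hF⟩ := List.mem_flatMap.1 hq
    cases F with
    | conc N c =>
      obtain rfl := List.mem_singleton.1 hF
      obtain ⟨B, hB, -⟩ := hs _ (List.mem_singleton_self _)
      exact mem_adom_of_aBasic hB
    | role P c c' =>
      simp only [Fact.touch, List.mem_cons, List.not_mem_nil, or_false] at hF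
      rcases hF with rfl | rfl
      · exact mem_adom_of_canRole (hs _ (List.mem_singleton_self _))
      · exact mem_adom_of_canRole ((canRole_flip (.name P)
          _ _).2 (hs _ (List.mem_singleton_self _)))
  · rintro ⟨F, hF, hd⟩ I hI
    have hsat := hI.2 F hF
    cases F with
    | conc N c =>
      obtain rfl : d = c := by simpa [Fact.terms] using hd
      refine ⟨_, List.mem_flatMap.2 ⟨_, hA _ hF, List.mem_singleton_self _⟩, fun x => I.ind (v x),
        fun _ _ => rfl, fun a ha => ?_⟩
      obtain rfl := List.mem_singleton.1 ha
      exact hsat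
    | role P c c' =>
      have hd : d = c ∨ d = c' := by simpa [Fact.terms] using hd
      rcases hd with rfl | rfl
      · refine ⟨_, List.mem_flatMap.2 ⟨_, hA _ hF, List.mem_cons_self⟩,
          Function.update (fun x => I.ind (v x)) 0 (I.ind c'),
          fun x hx => Function.update_of_ne (by simpa using hx) _ _, fun a ha => ?_⟩
        obtain rfl := List.mem_singleton.1 ha
        simpa [Fact.map, QTerm.eval] using hsat
      · refine ⟨_, List.mem_flatMap.2 ⟨_, hA _ hF, List.mem_cons_of_mem _ List.mem_cons_self⟩,
          Function.update (fun x => I.ind (v x)) 0 (I.ind c),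
          fun x hx => Function.update_of_ne (by simpa using hx) _ _, fun a ha => ?_⟩
        obtain rfl := List.mem_singleton.1 ha
        simpa [Fact.map, QTerm.eval] using hsat

/-! ## Labellings -/

/-- The truth of a proposition of the translation. -/
def PropTrue (T : TBox) (A : ABox) (p : ℕ) : Prop :=
  (∃ (Q : ECQ) (l : List ℕ), p = propQuery Q.code l ∧ Q.Holds T A fun x => l.getD x 0) ∨
  ∃ d, p = propAdom d ∧ d ∈ adom A

theorem propTrue_propQuery {T : TBox} {A : ABox} {Q : ECQ} {l : List ℕ} :
    PropTrue T A (propQuery Q.code l) ↔ Q.Holds T A fun x => l.getD x 0 := by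
  constructor
  · rintro (⟨Q', l', h, h'⟩ | ⟨d, h, -⟩)
    · obtain ⟨e, rfl⟩ := propQuery_inj.1 h
      rwa [ECQ.code_injective e]
    · exact absurd h propQuery_ne_propAdom
  · exact fun h => .inl ⟨Q, l, rfl, h⟩

theorem propTrue_propAdom {T : TBox} {A : ABox} {d : ℕ} :
    PropTrue T A (propAdom d) ↔ d ∈ adom A := by
  constructor
  · rintro (⟨Q', l', h, -⟩ | ⟨d', h, h'⟩)
    · exact absurd h.symm propQuery_ne_propAdom
    · rwa [propAdom_inj.1 h]
  · exact fun h => .inr ⟨d, rfl, h⟩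

theorem holds_cert_nil {T : TBox} {A : ABox} (hc : Consistent T A) (v : ℕ → ℕ) :
    ¬ (ECQ.cert ⟨[]⟩).Holds T A v := by
  obtain ⟨I, hI⟩ := hc
  intro h
  obtain ⟨d, hd, -⟩ := h I hI
  simp at hd

/-- A query instance is closed by substituting the constants for its variables, and membership in
the active domain is expressed by `UCQ.inAdom`. Other numbers get the empty union, which is never
certain over a consistent knowledge base. -/
theorem exists_closed_query {T : TBox} (Fs : List (Fact ℕ)) (p : ℕ) :
    ∃ Q : ECQ, Q.fv = ∅ ∧ ∀ A : ABox, Consistent T A → (∀ F ∈ A, F ∈ Fs) →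
      (Q.Holds T A (fun _ => 0) ↔ PropTrue T A p) := by
  by_cases h1 : ∃ (Q : ECQ) (l : List ℕ), p = propQuery Q.code l
  · obtain ⟨Q, l, rfl⟩ := h1
    exact ⟨Q.subst fun x => some (l.getD x 0), ECQ.fv_subst_eq_empty, fun A _ _ =>
      ECQ.holds_subst.trans propTrue_propQuery.symm⟩
  by_cases h2 : ∃ d, p = propAdom d
  · obtain ⟨d, rfl⟩ := h2
    exact ⟨.cert (.inAdom d Fs), UCQ.fv_inAdom d Fs, fun A hc hA =>
      (UCQ.certain_inAdom hc hA d _).trans propTrue_propAdom.symm⟩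
  refine ⟨.cert ⟨[]⟩, rfl, fun A hc _ => iff_of_false (holds_cert_nil hc _) ?_⟩
  rintro (⟨Q, l, rfl, -⟩ | ⟨d, rfl, -⟩)
  · exact h1 ⟨Q, l, rfl⟩
  · exact h2 ⟨d, rfl⟩

theorem exists_queries {T : TBox} (Fs : List (Fact ℕ)) (ps : List ℕ) :
    ∃ qs : List ECQ, (∀ Q ∈ qs, Q.fv = ∅) ∧
      ∀ A : ABox, Consistent T A → (∀ F ∈ A, F ∈ Fs) → ∀ p,
        ((∃ Q, qs[p]? = some Q ∧ Q.Holds T A fun _ => 0) ↔ p ∈ ps ∧ PropTrue T A p) := by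
  choose f hf hT using exists_closed_query (T := T) Fs
  -- The list is indexed by the propositions themselves, and `ps.sum + 1` exceeds all of them.
  -- Positions outside `ps` hold the query that is never true.
  refine ⟨(List.range (ps.sum + 1)).map fun p => if p ∈ ps then f p else .cert ⟨[]⟩, ?_, ?_⟩
  · intro Q hQ
    obtain ⟨p, -, rfl⟩ := List.mem_map.1 hQ
    split_ifs
    · exact hf p
    · rfl
  · intro A hc hA p
    constructor
    · rintro ⟨Q, hQ, h⟩
      simp only [List.getElem?_map, Option.map_eq_some_iff] at hQ
      obtain ⟨p', hp', rfl⟩ := hQ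
      obtain ⟨-, rfl⟩ : _ ∧ p = p' := by simpa [List.getElem?_eq_some_iff] using hp'
      split_ifs at h with hp
      · exact ⟨hp, (hT p A hc hA).1 h⟩
      · exact absurd h (holds_cert_nil hc _)
    · rintro ⟨hp, h⟩
      have : p < ps.sum + 1 := Nat.lt_succ_of_le (List.le_sum_of_mem hp)
      exact ⟨f p, by simp [this, hp], (hT p A hc hA).2 h⟩

theorem MuForm.mem_props {Ds : List ℕ} (Φ : MuForm) {l : List ℕ} {p : ℕ}
    (h : p ∈ Φ.props Ds l) :
    (∃ (Q : ECQ) (l' : List ℕ), p = propQuery Q.code l') ∨ ∃ d, p = propAdom d := by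
  induction Φ generalizing l with
  | query Q => exact .inl ⟨Q, l, List.mem_singleton.1 h⟩
  | neg Φ ih => exact ih h
  | and Φ Ψ ih ih' => exact (List.mem_append.1 h).elim ih ih'
  | ex x Φ ih =>
    obtain ⟨d, -, h⟩ := List.mem_flatMap.1 h
    rcases List.mem_cons.1 h with h | h
    · exact .inr ⟨d, h⟩
    · exact ih h
  | dia Φ ih => exact ih h
  | pvar Z => simp [props] at h
  | mu Z Φ ih => exact ih h

/-- The evaluation of a proposition. -/
def PropVal (T : TBox) (A : List (Fact ℕ)) (p : ℕ) (b : Bool) : Prop :=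
  (∃ n l, p = propQuery n l ∧ EvalECQ T A l n b) ∨ ∃ d, p = propAdom d ∧ (b = true ↔ d ∈ adomL A)

theorem propVal_iff {T : TBox} {A : List (Fact ℕ)} (hc : Consistent T A.toFinset) {p : ℕ}
    (hp : (∃ (Q : ECQ) (l : List ℕ), p = propQuery Q.code l) ∨ ∃ d, p = propAdom d) {b : Bool} :
    PropVal T A p b ↔ (b = true ↔ PropTrue T A.toFinset p) := by
  rcases hp with ⟨Q, l, rfl⟩ | ⟨d, rfl⟩
  · rw [propTrue_propQuery, ← evalECQ_iff hc]
    constructor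
    · rintro (⟨n, l', h, h'⟩ | ⟨d, h, -⟩)
      · obtain ⟨rfl, rfl⟩ := propQuery_inj.1 h
        exact h'
      · exact absurd h propQuery_ne_propAdom
    · exact fun h => .inl ⟨_, _, rfl, h⟩
  · rw [propTrue_propAdom, ← mem_adomL]
    constructor
    · rintro (⟨n, l', h, -⟩ | ⟨d', h, h'⟩)
      · exact absurd h.symm propQuery_ne_propAdom
      · rwa [propAdom_inj.1 h]
    · exact fun h => .inr ⟨_, rfl, h⟩

theorem Semi.propVal {α : Type} [Primcodable α] {T : α → TBox} {A : α → List (Fact ℕ)}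
    {p : α → ℕ} {b : α → Bool} (hT : PRec T) (hA : PRec A) (hp : PRec p) (hb : PRec b) :
    Semi fun a => PropVal (T a) (A a) (p a) (b a) := by
  unfold PropVal
  repeat' with_reducible first
    | apply Semi.or | apply Semi.and | apply Semi.ex | apply Semi.evalECQ | apply Semi.eq
    | apply Deci.iff | apply Deci.mem | apply Deci.eq | apply Deci.semi
  all_goals fun_prop

/-- `L` is the labelling of the states in `w` with the true propositions among `ps`. -/
def LabelOK (T : TBox) (w : RawTS) (ps : List ℕ) (L : List (ℕ × ℕ)) : Prop :=
  (∀ x ∈ L, (x.1 < w.1 + 1 ∧ x.2 ∈ ps) ∧ PropVal T (w.st x.1).1 x.2 true) ∧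
  ∀ i < w.1 + 1, ∀ p ∈ ps, (i, p) ∈ L ∨ PropVal T (w.st i).1 p false

theorem Semi.labelOK {α : Type} [Primcodable α] {T : α → TBox} {w : α → RawTS}
    {ps : α → List ℕ} {L : α → List (ℕ × ℕ)} (hT : PRec T) (hw : PRec w) (hp : PRec ps)
    (hL : PRec L) : Semi fun a => LabelOK (T a) (w a) (ps a) (L a) := by
  unfold LabelOK
  repeat' with_reducible first
    | apply Semi.or | apply Semi.and | apply Semi.ball | apply Semi.ballLt | apply Semi.propVal
    | apply Semi.lt | apply Semi.mem
  all_goals fun_prop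

theorem LabelOK.mem_iff {T : TBox} {w : RawTS} {ps : List ℕ} {L : List (ℕ × ℕ)}
    (hL : LabelOK T w ps L)
    (hps : ∀ p ∈ ps, (∃ (Q : ECQ) (l : List ℕ), p = propQuery Q.code l) ∨ ∃ d, p = propAdom d)
    {i : ℕ} (hi : i < w.1 + 1) (hc : Consistent T (w.st i).1.toFinset) {p : ℕ} :
    (i, p) ∈ L ↔ p ∈ ps ∧ PropTrue T (w.st i).1.toFinset p := by
  constructor
  · intro h
    obtain ⟨⟨-, hp⟩, hv⟩ := hL.1 _ h
    exact ⟨hp, ((propVal_iff hc (hps p hp)).1 hv).1 rfl⟩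
  · rintro ⟨hp, ht⟩
    refine (hL.2 i hi p hp).resolve_right fun h => ?_
    exact Bool.false_ne_true (((propVal_iff hc (hps p hp)).1 h).2 ht)

theorem exists_labelOK {T : TBox} {w : RawTS} {ps : List ℕ}
    (hps : ∀ p ∈ ps, (∃ (Q : ECQ) (l : List ℕ), p = propQuery Q.code l) ∨ ∃ d, p = propAdom d)
    (hc : ∀ i < w.1 + 1, Consistent T (w.st i).1.toFinset) : ∃ L, LabelOK T w ps L := by
  classical
  refine ⟨((List.range (w.1 + 1)).product ps).filter fun x => PropTrue T (w.st x.1).1.toFinset x.2,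
    ?_, ?_⟩
  · intro x hx
    simp only [List.mem_filter, decide_eq_true_eq] at hx
    obtain ⟨hx, ht⟩ := hx
    obtain ⟨h1, h2⟩ := List.pair_mem_product.1 hx
    have h1 := List.mem_range.1 h1
    exact ⟨⟨h1, h2⟩, (propVal_iff (hc _ h1) (hps _ h2)).2 (iff_of_true rfl ht)⟩
  · intro i hi p hp
    by_cases ht : PropTrue T (w.st i).1.toFinset p
    · left
      simp only [List.mem_filter, List.pair_mem_product, List.mem_range, decide_eq_true_eq]
      exact ⟨⟨hi, hp⟩, ht⟩
    · exact .inr ((propVal_iff (hc _ hi) (hps _ hp)).2 (iff_of_false Bool.false_ne_true ht))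

end KABV
namespace KABV

/-! ## The reduction -/

def RawEffect.code (e : RawEffect) : ℕ :=
  Nat.pair e.1.code (Nat.pair e.2.1 (codeList (Fact.code ETerm.code) e.2.2))

def RawAction.code (α : RawAction) : ℕ := Nat.pair (codeList id α.1) (codeList RawEffect.code α.2)

def RawRule.code (r : RawRule) : ℕ := Nat.pair r.1 (RawAction.code r.2)

def RawKAB.code (K : RawKAB) : ℕ :=
  Nat.pair (codeList TAssertion.code K.1) (Nat.pair (codeList (Fact.code id) K.2.1)
    (Nat.pair (codeList RawAction.code K.2.2.1) (codeList RawRule.code K.2.2.2)))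

theorem RawEffect.code_injective : Function.Injective RawEffect.code := by
  rintro ⟨q, n, E⟩ ⟨q', n', E'⟩ h
  simp only [code, Nat.pair_eq_pair] at h
  obtain ⟨h1, rfl, h2⟩ := h
  rw [UCQ.code_injective h1, codeList_injective (Fact.code_injective ETerm.code_injective) h2]

theorem RawAction.code_injective : Function.Injective RawAction.code := by
  rintro ⟨p, e⟩ ⟨p', e'⟩ h
  simp only [code, Nat.pair_eq_pair] at h
  rw [codeList_injective Function.injective_id h.1, codeList_injective RawEffect.code_injective h.2]

theorem RawRule.code_injective : Function.Injective RawRule.code := by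
  rintro ⟨p, e⟩ ⟨p', e'⟩ h
  simp only [code, Nat.pair_eq_pair] at h
  rw [h.1, RawAction.code_injective h.2]

theorem RawKAB.code_injective : Function.Injective RawKAB.code := by
  rintro ⟨T, A, G, P⟩ ⟨T', A', G', P'⟩ h
  simp only [code, Nat.pair_eq_pair] at h
  rw [codeList_injective TAssertion.code_injective h.1,
    codeList_injective (Fact.code_injective Function.injective_id) h.2.1,
    codeList_injective RawAction.code_injective h.2.2.1,
    codeList_injective RawRule.code_injective h.2.2.2]

theorem Action.code_raw (α : Action) : RawAction.code α.raw = α.code := by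
  simp only [RawAction.code, Action.raw, Action.code, codeList, List.map_map]
  rfl

theorem Rule.code_raw (r : Rule) : RawRule.code r.raw = r.code :=
  congrArg (Nat.pair r.cond.code) r.act.code_raw

theorem KAB.code_raw (K : KAB) : RawKAB.code K.raw = K.code := by
  have h1 : RawAction.code ∘ Action.raw = Action.code := funext Action.code_raw
  have h2 : RawRule.code ∘ Rule.raw = Rule.code := funext Rule.code_raw
  simp only [RawKAB.code, KAB.raw, KAB.code, codeList, List.map_map, h1, h2]

theorem PRec.rawEffectCode : PRec RawEffect.code := by
  have h := PRec.codeList (α := RawEffect) (f := fun e => e.2.2) (by fun_prop)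
    (PRec.factCode PRec.etermCode)
  unfold RawEffect.code
  fun_prop

theorem PRec.rawActionCode : PRec RawAction.code := by
  have h := PRec.codeList (α := RawAction) (f := fun e => e.2) (by fun_prop) PRec.rawEffectCode
  unfold RawAction.code
  fun_prop

theorem PRec.rawRuleCode : PRec RawRule.code :=
  .natPair (.fst .id) (.comp PRec.rawActionCode (.snd .id))

theorem PRec.rawKABCode : PRec RawKAB.code := by
  have h1 := PRec.codeList (α := RawKAB) (f := fun K => K.1) (by fun_prop) PRec.tAssertionCode
  have h2 := PRec.codeList (α := RawKAB) (f := fun K => K.2.1) (by fun_prop) (PRec.factCode .id)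
  have h3 := PRec.codeList (α := RawKAB) (f := fun K => K.2.2.1) (by fun_prop) PRec.rawActionCode
  have h4 := PRec.codeList (α := RawKAB) (f := fun K => K.2.2.2) (by fun_prop) PRec.rawRuleCode
  exact .natPair h1 (.natPair h2 (.natPair h3 h4))

/-- The constants in the active domains of the states. -/
def RawTS.consts (w : RawTS) : List ℕ :=
  (List.range (w.1 + 1)).flatMap fun i => adomL (w.st i).1

theorem RawTS.mem_consts {w : RawTS} {i : ℕ} (hi : i < w.1 + 1) {d : ℕ}
    (hd : d ∈ adom (w.st i).1.toFinset) : d ∈ w.consts :=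
  List.mem_flatMap.2 ⟨i, List.mem_range.2 hi, mem_adomL.2 hd⟩

@[fun_prop]
theorem PRec.consts {α : Type} [Primcodable α] {w : α → RawTS} (hw : PRec w) :
    PRec fun a => (w a).consts := by
  unfold RawTS.consts
  exact .flatMap (by fun_prop) (by fun_prop)

/-- Codes are inverted by searching for a preimage; since they are injective, the one that is found
is the original. -/
theorem exists_decode : ∃ f : ℕ →. (List ℕ × RawKAB) × ℕ, Partrec f ∧
    ∀ (C₀ : List ℕ) (K : KAB) (Φ : MuForm),
      ((C₀, K.raw), Φ.code) ∈ f (codeVerification C₀ K Φ) := by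
  have hC := PRec.rawKABCode
  have hS : Semi fun x : ℕ × (List ℕ × RawKAB) × ℕ =>
      x.1 = Nat.pair (codeList id x.2.1.1) (Nat.pair (RawKAB.code x.2.1.2) x.2.2) :=
    .eq (by fun_prop) (.natPair (by fun_prop) (.natPair (.comp hC (by fun_prop)) (by fun_prop)))
  obtain ⟨f, hf, hs, hd⟩ := Semi.exists_partrec (p := fun (n : ℕ) (x : (List ℕ × RawKAB) × ℕ) =>
    n = Nat.pair (codeList id x.1.1) (Nat.pair (RawKAB.code x.1.2) x.2)) hS
  refine ⟨f, hf, fun C₀ K Φ => ?_⟩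
  have hdom := hd (codeVerification C₀ K Φ) ((C₀, K.raw), Φ.code) (by
    simp only [codeVerification, KAB.code_raw])
  obtain ⟨⟨⟨C, R⟩, n⟩, hx⟩ := Part.dom_iff_mem.1 hdom
  have := hs _ _ hx
  simp only [codeVerification, ← KAB.code_raw, Nat.pair_eq_pair] at this
  obtain ⟨h1, h2, rfl⟩ := this
  obtain rfl := codeList_injective Function.injective_id h1
  obtain rfl := RawKAB.code_injective h2
  exact hx

/-- Correctness of a presentation is semidecidable, so an unbounded search finds one as soon as one
exists. Finiteness of the canonical pruning guarantees this, and no bound has to be supplied. -/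
theorem exists_construct : ∃ f : List ℕ × RawKAB →. RawTS, Partrec f ∧
    ∀ (C₀ : List ℕ) (K : KAB), K.WellFormed C₀ →
      Finite (K.generated (K.canonExec C₀)).State →
        ∃ w ∈ f (C₀, K.raw), w.Correct C₀ K.raw := by
  obtain ⟨f, hf, hs, hd⟩ := Semi.exists_partrec (p := fun (x : List ℕ × RawKAB) (w : RawTS) =>
    w.Correct x.1 x.2) (Semi.correct (by fun_prop) (by fun_prop) (by fun_prop))
  refine ⟨f, hf, fun C₀ K hK _ => ?_⟩
  obtain ⟨w, hw⟩ := K.exists_rawTS hK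
  obtain ⟨w', hw'⟩ := Part.dom_iff_mem.1 (hd (C₀, K.raw) w hw)
  exact ⟨w', hw', hs _ _ hw'⟩

/-- Consistency of all states makes each proposition evaluate to true or to false, so a labelling
that passes the check exists. The code of the formula and the list of propositions in the result are
forced by `toPropRule_iff`. -/
theorem exists_label : ∃ f : ((List ℕ × RawKAB) × ℕ) × RawTS →. ℕ × List (ℕ × ℕ), Partrec f ∧
    ∀ (C₀ : List ℕ) (K : KAB) (Φ : MuForm) (w : RawTS),
      (∀ i < w.1 + 1, Consistent K.tbox (w.st i).1.toFinset) →
        ∃ L, ((Φ.toProp w.consts []).code, L) ∈ f (((C₀, K.raw), Φ.code), w) ∧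
          LabelOK K.tbox w (Φ.props w.consts []) L := by
  have hS : Semi fun x : (((List ℕ × RawKAB) × ℕ) × RawTS) × ℕ × List (ℕ × ℕ) =>
      ∃ ps : List ℕ, Derivable (ToPropRule x.1.2.consts) ([], x.1.1.2, x.2.1, ps) ∧
        LabelOK x.1.1.1.2.1 x.1.2 ps x.2.2 := by
    refine .ex (.and (.toProp ?_ ?_ ?_ ?_) (.labelOK ?_ ?_ ?_ ?_))
    all_goals fun_prop
  obtain ⟨f, hf, hs, hd⟩ := Semi.exists_partrec
    (p := fun (a : ((List ℕ × RawKAB) × ℕ) × RawTS) (y : ℕ × List (ℕ × ℕ)) =>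
      ∃ ps : List ℕ, Derivable (ToPropRule a.2.consts) ([], a.1.2, y.1, ps) ∧
        LabelOK a.1.1.2.1 a.2 ps y.2) hS
  refine ⟨f, hf, fun C₀ K Φ w hc => ?_⟩
  obtain ⟨L, hL⟩ := exists_labelOK (T := K.tbox) (w := w) (fun p => Φ.mem_props (Ds := w.consts)
    (l := []) (p := p)) hc
  obtain ⟨⟨m, L'⟩, hy⟩ := Part.dom_iff_mem.1 (hd (((C₀, K.raw), Φ.code), w)
    ((Φ.toProp w.consts []).code, L) ⟨_, (toPropRule_iff Φ [] _).2 rfl, hL⟩)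
  obtain ⟨ps, h1, h2⟩ := hs _ _ hy
  have := (toPropRule_iff Φ [] _).1 h1
  simp only [Prod.mk.injEq] at this
  obtain ⟨rfl, rfl⟩ := this
  exact ⟨L', hy, h2⟩

theorem exists_modelCheck : ∃ f : RawTS × ℕ × List (ℕ × ℕ) →. Bool, Partrec f ∧
    ∀ (w : RawTS) (φ : PropMu) (L : List (ℕ × ℕ)), ∃ b ∈ f (w, φ.code, L),
      (b = true ↔ FinFrame.HoldsAt ⟨w.1, w.2.2⟩ L 0 φ) := by
  have hS : Semi fun x : (RawTS × ℕ × List (ℕ × ℕ)) × Bool =>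
      ∃ S : List Bool, Derivable (ExtRule ((x.1.1.1, x.1.1.2.2), x.1.2.2)) ([], x.1.2.1, S) ∧
        (x.2 = true ↔ S.getD 0 false = true) := by
    refine .ex (.and (.extRule ?_ ?_) (Deci.semi (.iff (.eq ?_ ?_) (.eq ?_ ?_))))
    all_goals fun_prop
  obtain ⟨f, hf, hs, hd⟩ := Semi.exists_partrec
    (p := fun (a : RawTS × ℕ × List (ℕ × ℕ)) (b : Bool) =>
      ∃ S : List Bool, Derivable (ExtRule ((a.1.1, a.1.2.2), a.2.2)) ([], a.2.1, S) ∧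
        (b = true ↔ S.getD 0 false = true)) hS
  refine ⟨f, hf, fun w φ L => ?_⟩
  have key := holdsAt_iff_derivable ⟨w.1, w.2.2⟩ L φ 0
  classical
  obtain ⟨b, hb⟩ := Part.dom_iff_mem.1 (hd (w, φ.code, L)
    (decide (FinFrame.HoldsAt ⟨w.1, w.2.2⟩ L 0 φ)) ((key _).2 (by simp)))
  exact ⟨b, hb, (key b).1 (hs _ _ hb)⟩

/-- Verification is computably translated to finite-state model checking on a frame that does not
depend on the formula. -/
theorem exists_translation : ∃ f : ℕ →. RawTS × ℕ × List (ℕ × ℕ), Partrec f ∧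
    ∀ (C₀ : List ℕ) (K : KAB), K.WellFormed C₀ →
      Finite (K.generated (K.canonExec C₀)).State → ∃ w : RawTS, w.Correct C₀ K.raw ∧
        ∀ Φ : MuForm, ∃ L,
          (w, (Φ.toProp w.consts []).code, L) ∈ f (codeVerification C₀ K Φ) ∧
            LabelOK K.tbox w (Φ.props w.consts []) L := by
  obtain ⟨f, hf, hfs⟩ := exists_decode
  obtain ⟨g, hg, hgs⟩ := exists_construct
  obtain ⟨h, hh, hhs⟩ := exists_label
  -- The search `g` sees only `C₀` and the knowledge and action base; the formula enters later,
  -- through `h`. This is why one presentation serves for all formulae.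
  refine ⟨fun n => (f n).bind fun x => (g x.1).bind fun w => (h (x, w)).map fun y => (w, y),
    ?_, fun C₀ K hK hfin => ?_⟩
  · refine hf.bind (Partrec.bind (g := fun (a : ℕ × (List ℕ × RawKAB) × ℕ) w =>
      (h (a.2, w)).map fun y => (w, y)) (hg.comp (Computable.fst.comp Computable.snd)) ?_)
    refine Partrec.map (g := fun (a : (ℕ × (List ℕ × RawKAB) × ℕ) × RawTS)
      (y : ℕ × List (ℕ × ℕ)) => (a.2, y))
      (hh.comp ((Computable.snd.comp Computable.fst).pair Computable.snd)) ?_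
    exact (Computable.snd.comp Computable.fst).pair Computable.snd
  · obtain ⟨w, hwg, hw⟩ := hgs C₀ K hK hfin
    refine ⟨w, hw, fun Φ => ?_⟩
    obtain ⟨ι, -, -, hrep⟩ := hw.exists_equiv hK
    obtain ⟨L, hLh, hL⟩ := hhs C₀ K Φ w fun i hi => by
      have := (ι.symm ⟨i, hi⟩).2.consistent hK
      have hr := hrep (ι.symm ⟨i, hi⟩)
      rw [Equiv.apply_symm_apply] at hr
      rwa [hr.abox] at this
    refine ⟨L, Part.mem_bind_iff.2 ⟨_, hfs C₀ K Φ, Part.mem_bind_iff.2 ⟨w, hwg, ?_⟩⟩, hL⟩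
    exact (Part.mem_map_iff _).2 ⟨_, hLh, rfl⟩

theorem RawTS.Correct.exists_frame {C₀ : List ℕ} {K : KAB} (hK : K.WellFormed C₀) {w : RawTS}
    (hw : w.Correct C₀ K.raw) :
    ∃ ι : (K.generated (K.canonExec C₀)).State ≃ FinFrame.State ⟨w.1, w.2.2⟩,
      ι (K.generated (K.canonExec C₀)).init = 0 ∧
      (∀ s s', (K.generated (K.canonExec C₀)).Step s s' ↔
        FinFrame.Step ⟨w.1, w.2.2⟩ (ι s) (ι s')) ∧
      ∀ (Φ : MuForm) (L : List (ℕ × ℕ)), LabelOK K.tbox w (Φ.props w.consts []) L →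
        (∃ qs : List ECQ, (∀ Q ∈ qs, Q.fv = ∅) ∧ ∀ s p, ((ι s).val, p) ∈ L ↔
          ∃ Q, qs[p]? = some Q ∧
            Q.Holds K.tbox ((K.generated (K.canonExec C₀)).abox s) fun _ => 0) ∧
        ∀ s, (K.generated (K.canonExec C₀)).HoldsAt s Φ ↔
          FinFrame.HoldsAt ⟨w.1, w.2.2⟩ L (ι s) (Φ.toProp w.consts []) := by
  obtain ⟨ι, h0, hstep, hrep⟩ := hw.exists_equiv hK
  refine ⟨ι, h0, hstep, fun Φ L hL => ?_⟩
  have hmem : ∀ (s : (K.generated (K.canonExec C₀)).State) p, ((ι s).val, p) ∈ L ↔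
      p ∈ Φ.props w.consts [] ∧ PropTrue K.tbox s.1.abox p := by
    intro s p
    have hc := s.2.consistent hK
    rw [(hrep s).abox] at hc ⊢
    exact hL.mem_iff (fun p => Φ.mem_props) (ι s).2 hc
  constructor
  · obtain ⟨qs, hqs, hq⟩ := exists_queries (T := K.tbox)
      ((List.range (w.1 + 1)).flatMap fun i => (w.st i).1) (Φ.props w.consts [])
    refine ⟨qs, hqs, fun s p => (hmem s p).trans (hq _ (s.2.consistent hK) (fun F hF => ?_) p).symm⟩
    refine List.mem_flatMap.2 ⟨ι s, List.mem_range.2 (ι s).2, ?_⟩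
    rw [(hrep s).abox] at hF
    exact List.mem_toFinset.1 hF
  · intro s
    have := Φ.ext_toProp (F := ⟨w.1, w.2.2⟩) (L := L) ι hstep (Ds := w.consts)
      (fun s d hd => RawTS.mem_consts (ι s).2 (by rw [← (hrep s).abox]; exact hd))
      (Ps := Φ.props w.consts []) (fun s Q l hp => by
        rw [hmem, propTrue_propQuery]
        exact and_iff_right hp)
      (fun s d hp => by
        rw [hmem, propTrue_propAdom]
        exact and_iff_right hp) [] (fun _ => id) fun _ => ∅
    exact Set.ext_iff.1 this s

/-- The code of the model checking problem for a frame, a code of a formula, and a labelling. -/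
def RawTS.problemCode (y : RawTS × ℕ × List (ℕ × ℕ)) : ℕ :=
  Nat.pair (Nat.pair y.1.1 (codeList codePair y.1.2.2))
    (Nat.pair (codeList codePair y.2.2) y.2.1)

theorem RawTS.problemCode_eq (w : RawTS) (φ : PropMu) (L : List (ℕ × ℕ)) :
    RawTS.problemCode (w, φ.code, L) = codeModelChecking ⟨w.1, w.2.2⟩ L φ := rfl

theorem RawTS.computable_problemCode : Computable RawTS.problemCode := by
  have hp : PRec codePair := .natPair (.fst .id) (.snd .id)
  have h1 := PRec.codeList (α := RawTS × ℕ × List (ℕ × ℕ)) (f := fun y => y.1.2.2)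
    (by fun_prop) hp
  have h2 := PRec.codeList (α := RawTS × ℕ × List (ℕ × ℕ)) (f := fun y => y.2.2)
    (by fun_prop) hp
  exact Primrec.to_comp (PRec.natPair (.natPair (by fun_prop) h1) (.natPair h2 (by fun_prop)))

end KABV
-- Assembly of the decision procedure and the reduction.
theorem theorem1 :
    ∃ (dec : ℕ →. Bool) (red : ℕ →. ℕ), Partrec dec ∧ Partrec red ∧
      ∀ (C₀ : List ℕ) (K : KAB), K.WellFormed C₀ → K.standardTS.RunBounded →
        -- the decision procedure
        (∀ Φ : MuForm, Φ.IsSentence C₀ →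
          ∃ b ∈ dec (codeVerification C₀ K Φ), b = true ↔ K.standardTS.Models Φ) ∧
        -- all prunings are finite-state and faithful
        (∀ pe, K.IsPExec C₀ pe →
          Finite (K.generated pe).State ∧
          HPBisimilar C₀ (K.generated pe) K.standardTS ∧
          ∀ Φ : MuForm, Φ.IsSentence C₀ →
            ((K.generated pe).Models Φ ↔ K.standardTS.Models Φ)) ∧
        -- the reduction, by way of one pruning that does not depend on the formula
        ∃ pe, K.IsPExec C₀ pe ∧
          ∃ (F : FinFrame) (ι : (K.generated pe).State ≃ F.State),
            ι (K.generated pe).init = 0 ∧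
            (∀ s s', (K.generated pe).Step s s' ↔ F.Step (ι s) (ι s')) ∧
            ∀ Φ : MuForm, Φ.IsSentence C₀ →
              ∃ (L : List (ℕ × ℕ)) (φ : PropMu) (qs : List ECQ),
                codeModelChecking F L φ ∈ red (codeVerification C₀ K Φ) ∧
                φ.IsSentence ∧
                (∀ Q ∈ qs, Q.fv = ∅) ∧
                -- proposition `p` is the truth of the `p`-th closed query
                (∀ s p, ((ι s).val, p) ∈ L ↔
                  ∃ Q, qs[p]? = some Q ∧ Q.Holds K.tbox ((K.generated pe).abox s) (fun _ => 0)) ∧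
                (∀ s, (K.generated pe).HoldsAt s Φ ↔ F.HoldsAt L (ι s) φ) ∧
                (K.standardTS.Models Φ ↔ F.HoldsAt L 0 φ) := by
  obtain ⟨f, hf, hfs⟩ := exists_translation
  obtain ⟨g, hg, hgs⟩ := exists_modelCheck
  -- Both functions share the translation `f`: the decision procedure follows it by model checking,
  -- the reduction by merely coding the resulting problem.
  refine ⟨fun n => (f n).bind g, fun n => (f n).map RawTS.problemCode,
    hf.bind (hg.comp Computable.snd), hf.map (RawTS.computable_problemCode.comp Computable.snd),
    fun C₀ K hK hb => ?_⟩
  have hpe := K.isPExec_canonExec hK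
  have hfin := hpe.finite_state hK hb
  obtain ⟨w, hw, hΦ⟩ := hfs C₀ K hK hfin
  obtain ⟨ι, h0, hstep, hι⟩ := hw.exists_frame hK
  have hmodels : ∀ (Φ : MuForm), Φ.IsSentence C₀ → ∀ L,
      LabelOK K.tbox w (Φ.props w.consts []) L →
        (K.standardTS.Models Φ ↔
          FinFrame.HoldsAt ⟨w.1, w.2.2⟩ L 0 (Φ.toProp w.consts [])) := by
    intro Φ hs L hL
    rw [← hpe.models_iff hK hs, ← h0]
    exact (hι Φ L hL).2 _
  refine ⟨fun Φ hs => ?_, fun pe hpe => ⟨hpe.finite_state hK hb, hpe.hpBisimilar hK,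
    fun Φ hs => hpe.models_iff hK hs⟩, _, hpe, ⟨w.1, w.2.2⟩, ι, h0, hstep, fun Φ hs => ?_⟩
  · obtain ⟨L, hmem, hL⟩ := hΦ Φ
    obtain ⟨b, hb, hbt⟩ := hgs w (Φ.toProp w.consts []) L
    exact ⟨b, Part.mem_bind_iff.2 ⟨_, hmem, hb⟩, hbt.trans (hmodels Φ hs L hL).symm⟩
  · obtain ⟨L, hmem, hL⟩ := hΦ Φ
    obtain ⟨⟨qs, hqs, hq⟩, hholds⟩ := hι Φ L hL
    exact ⟨L, Φ.toProp w.consts [], qs, (Part.mem_map_iff _).2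
      ⟨_, hmem, RawTS.problemCode_eq w _ L⟩,
      MuForm.isSentence_toProp hs [], hqs, hq, hholds, hmodels Φ hs L hL⟩
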